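/- Let $n=d-2\ge 0$ and $u_1\le u_2\le 0$. Indices $a,b,i,j$ run over $1,\dots,n$ and are summed when repeated. **I. Gravitational background.** Let $H_{ab}(u)$ be a symmetric $C^2$ matrix function vanishing for $u\notin[u_1,u_2]$, and consider the sandwich plane wave $ds^2=2\,du\,dv-H_{ab}(u)x^ax^b\,du^2-dx_a\,dx^a$. There are unique matrix solutions $E^{\mp}$ (with entries $E^a{}_i$) of $\ddot E=HE$, with $\dot E^{T}E$ symmetric, such that $E^{\mp}\to 1$ as $u\to\mp\infty$, and $E^-(u)=u\,b+c$ for $u>u_2$, where $c=E^-(0)$ and $b=\dot E^-(0)$. A value $u$ is called regular for $E$ if $\det E(u)\neq0$. For $E=E^\mp$ there are functions $F^{ij}_\mp$ with $\dot F=\gamma^{-1}$ at all regular $u$, where $\gamma=E^TE$, and with $F^{ij}_-=u\,\delta^{ij}$ for $u<u_1$, $F^{ij}_+=u\,\delta^{ij}$ for $u>u_2$. For any such $F_\mp$ put, with $E^i{}_a$ the inverse of $E^a{}_i$, $$\sigma_{ab}=\dot E^i{}_aE_{bi},\quad \Omega=|\det\gamma^{-1}|^{1/4},\quad \phi_k=\tfrac{k_0}{2}\sigma_{ab}x^ax^b+k_iE^i{}_ax^a+k_0v+\tfrac{k_ik_j}{2k_0}F^{ij},\quad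 \Phi_k=\Omega e^{i\phi_k},$$ and, with $\mathcal R^a=du\,\delta^{ab}\partial_b+dx^a\partial_v$ acting on tensors by covariant derivatives, $A=\frac{1}{ik_0}\epsilon_a\mathcal R^a\Phi_k$ and $h=\frac1{(ik_0)^2}\epsilon_a\mathcal R^a(\epsilon_b\mathcal R^b\Phi_k)$ for constant $\epsilon\in\mathbb C^n$. The superscripts $-$ (in) and $+$ (out) denote the use of $(E^-,F_-)$ and $(E^+,F_+)$. *Solutions.* For $k_0\ne0$ and at all points with $u$ regular: $d\phi_k$ is null and $\Box\Phi_k=0$; $A_\mu=\varepsilon_\mu\Phi_k$ with $\varepsilon_\mu dX^\mu=\epsilon^a(\frac{k_j}{k_0}E^j{}_a+\sigma_{ab}x^b)du+\epsilon_adx^a$, $\varepsilon\cdot d\phi_k=0$, $A_v=0$, $\nabla_\mu A^\mu=\partial_\mu A^\mu=0$, $\nabla^2A_\mu=0$ and $\nabla^\mu F_{\mu\nu}=0$. If moreover $H_{aa}=0$ (vacuum) and $\epsilon_a\epsilon_a=0$, then $h_{\mu\nu}dX^\mu dX^\nu=\big((\varepsilon\cdot dX)^2-\frac{i}{k_0}\epsilon_a\epsilon_b\sigma^{ab}du^2\big)\Phi_k$,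 $h_{v\mu}=h_{\mu v}=0$, $h^\mu_\mu=0$, $\nabla_\mu h^\mu_\sigma=0$ and $\nabla^2h_{\mu\nu}-2R^\rho{}_{\mu\nu\sigma}h_\rho{}^\sigma=0$. The in (out) modes of each spin equal the corresponding Minkowski momentum eigenstates for $u<u_1$ ($u>u_2$). *Inner products.* On the slices $u=\mathrm{const}$ let $$\langle\Phi_1|\Phi_2\rangle=i\!\int\!(\Phi_1\partial_v\bar\Phi_2-\bar\Phi_2\partial_v\Phi_1)\,dv\,d^nx,\qquad \langle A_1|A_2\rangle=-i\!\int\!(A_1^\mu\bar F_{2\,v\mu}-\bar A_2^\mu F_{1\,v\mu})\,dv\,d^nx,$$ $$\langle h_1|h_2\rangle=i\!\int\!(h_1^{\mu\sigma}\partial_v\bar h_{2\,\mu\sigma}-\bar h_2^{\mu\sigma}\partial_vh_{1\,\mu\sigma})\,dv\,d^nx .$$ All relations below between momentum eigenstates are understood after smearing with smooth functions of the momenta $(k_0,k_i)$ and $(l_0,l_i)$ compactly supported in $k_0,l_0>0$; the integrals for the resulting wave packets then converge absolutely. For gravitons assume $H_{aa}=0$ and null polarisations. Let $w=1,\ \epsilon_1\cdot\bar\epsilon_2,\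 (\epsilon_1\cdot\bar\epsilon_2)^2$ for spin $0,1,2$, and write $\Phi$ for the field of any of these spins. Then: 1. at every $u$ regular for $E^-$, $\langle\Phi^-_1|\Phi^-_2\rangle=w\,2k_0(2\pi)^{n+1}\delta(k_0-l_0)\delta^{n}(k_i-l_i)$, and likewise for out modes at every $u$ regular for $E^+$; 2. at every $u$ regular for both, $\langle\Phi_1^+|\bar\Phi_2^-\rangle=0$; 3. $\langle\Phi^+_1|\Phi^-_2\rangle$ takes the same value at $u$ and $u'$ if the closed interval between them is regular for $E^-$ and $E^+$; 4. if $c$ is invertible, then at $u=0$ $$\langle\Phi^+_1|\Phi^-_2\rangle=w\,2k_0\,2\pi\delta(k_0-l_0)\,e^{-is_l}\,\Omega^-(0)\int d^nx\,\exp\!\Big[i\big((k_a-l_ic^i{}_a)x^a-\tfrac{l_0}{2}\sigma^-_{ab}(0)x^ax^b\big)\Big],\qquad s_l=\tfrac{l_il_j}{2l_0}F_-^{ij}(0),$$ with $c^i{}_a$ the inverse of $c$; if $b$ is invertible too, this equals $$w\,2k_0\,2\pi\delta(k_0-l_0)\Big(\frac{2\pi}{l_0}\Big)^{n/2}\frac{e^{-\frac{i\pi}{4}\operatorname{sgn}\sigma^-(0)}\,e^{-i(s_l+r_{k,l})}}{\sqrt{|\det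 b|}},\qquad r_{k,l}=\frac{1}{2l_0}(k_a-l_ic^i{}_a)(c\,b^{-1})^{ab}(k_b-l_jc^j{}_b),$$ where $\sigma^-(0)=-b\,c^{-1}$ and $\operatorname{sgn}$ is the signature (number of positive minus number of negative eigenvalues); 5. if $c$ is invertible, the scattering is unitary: there is a unitary operator $S$ of $L^2(\{k_0>0\},(2\pi)^{n+1}2k_0\,dk_0\,d^nk)$ onto itself, the same for all three spins, such that the wave packets at $u=0$ with momentum profiles $f,g$ satisfy $\langle\Phi_f^+|\Phi_g^-\rangle=w\int f\,\overline{Sg}\;(2\pi)^{n+1}2k_0\,dk_0\,d^nk$. **II. Gauge theory background.** Let $\mathfrak h$ be a finite-dimensional real vector space (a Cartan subalgebra), $e:\mathfrak h\to\mathbb R$ linear (the charge or root), $\mathsf F_a:\mathbb R\to\mathfrak h$ of class $C^1$, vanishing for $u\notin[u_1,u_2]$. On Minkowski space consider the background $\mathsf A=x^a\mathsf F_a(u)\,du$, with $D_\mu=\partial_\mu-ie\mathsf A_\mu$. Let $\mathsf A_a^\mp$ satisfy $\dot{\mathsf A}^\mp_a=\mathsf F_a$ and vanish in the past/future respectively,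 let $f_\mp(u)=\int^u|k+e\mathsf A^\mp|^2ds$ be normalised to $u|k|^2$ in the past/future, and put $\tilde\phi_k=k_0v+(k_a+e\mathsf A_a)x^a+\frac{f(u)}{2k_0}$, $\Phi=e^{i\tilde\phi_k}$ and $a=\frac1{ik_0}\tilde\epsilon_a\mathcal R^a\Phi$, $\tilde\epsilon\in\mathbb C^n$ constant. Then for $k_0\neq0$: $D_\mu D^\mu\Phi=0$, and the momentum $\mathsf K=-ie^{-i\tilde\phi_k}De^{i\tilde\phi_k}$ is null; $a=\tilde\varepsilon\,\Phi$ with $\tilde\varepsilon=\tilde\epsilon_a(dx^a+\frac1{k_0}(k^a+e\mathsf A^a)du)$, $\mathsf K\cdot\tilde\varepsilon=0$, $a_v=0$, $D_\mu a^\mu=\partial_\mu a^\mu=0$ and $D_\mu(D^\mu a_\nu-D_\nu a^\mu)+ie\,a^\mu(\partial_\mu\mathsf A_\nu-\partial_\nu\mathsf A_\mu)=0$; the in (out) modes equal the Minkowski momentum eigenstates for $u<u_1$ ($u>u_2$). With the scalar inner product above and $\langle a_1|a_2\rangle=-i\int(a_1^\mu\bar f_{2\,v\mu}-\bar a_2^\mu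 f_{1\,v\mu})\,dv\,d^nx$, $f_{\mu\nu}=D_\mu a_\nu-D_\nu a_\mu$, and with $w=1$ for scalars and $w=\tilde\epsilon_1\cdot\bar{\tilde\epsilon}_2$ for gluons, in the same smeared sense and at every $u$: $$\langle\Phi^\mp_1|\Phi^\mp_2\rangle=w\,2k_0(2\pi)^{n+1}\delta(k_0-l_0)\delta^n(k_a-l_a),\qquad\langle\Phi^+_1|\bar\Phi^-_2\rangle=0,$$ $$\langle\Phi^+_1|\Phi^-_2\rangle=w\,2k_0(2\pi)^{n+1}\delta(k_0-l_0)\,\delta^n(k_a-l_a-c_a)\,e^{-i\tilde s_l},\qquad c_a=e\mathsf A^-_a(0),\quad\tilde s_l=\frac{f_-(0)}{2l_0}\ (f_-\text{ formed with }l),$$ and $\langle\Phi^+_f|\Phi^-_g\rangle=w\int f\,\overline{Sg}\;(2\pi)^{n+1}2k_0\,dk_0\,d^nk$ with a unitary $S$ as in I.5 (depending on the background), the same for both spins and all $u$. -/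

import Mathlib

open MeasureTheory Filter Topology
open scoped Matrix ContDiff ComplexConjugate

noncomputable section

namespace PlaneWave

variable {n : ℕ}

/-! ### Coordinates `(u, v, x¹, …, xⁿ)`, `n = d - 2`, and tensor calculus -/

/-- Coordinate labels of a spacetime of dimension `d = n + 2`. -/
abbrev Idx (n : ℕ) := Fin 2 ⊕ Fin n

/-- Spacetime points in global Brinkmann coordinates. -/
abbrev Pt (n : ℕ) := Idx n → ℝ

/-- Constant momenta `(k₀, k₁, …, kₙ)`. -/
abbrev Mom (n : ℕ) := ℝ × (Fin n → ℝ)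

/-- The label of the coordinate `u`. -/
abbrev iu : Idx n := Sum.inl 0

/-- The label of the coordinate `v`. -/
abbrev iv : Idx n := Sum.inl 1

/-- The point with coordinates `(u, v, x)`. -/
def pt (u v : ℝ) (x : Fin n → ℝ) : Pt n := Sum.elim ![u, v] x

/-- The transverse coordinates of a point. -/
def trans (X : Pt n) : Fin n → ℝ := fun a => X (Sum.inr a)

/-- Partial derivative in the coordinate direction `μ`. -/
def pd {V : Type*} [NormedAddCommGroup V] [NormedSpace ℝ V] (μ : Idx n) (f : Pt n → V)
    (X : Pt n) : V :=
  deriv (fun t : ℝ => f (Function.update X μ t)) (X μ)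

/-- The quadratic form `M_ab x^a x^b`. -/
def quad (M : Matrix (Fin n) (Fin n) ℝ) (x : Fin n → ℝ) : ℝ := ∑ a, ∑ b, M a b * x a * x b

/-- The plane wave metric `2 du dv - H_ab(u) x^a x^b du² - dx_a dx^a`; `H = 0` is Minkowski. -/
def metric (H : ℝ → Matrix (Fin n) (Fin n) ℝ) (X : Pt n) : Matrix (Idx n) (Idx n) ℝ :=
  Matrix.fromBlocks !![-quad (H (X iu)) (trans X), 1; 1, 0] 0 0 (-1)

/-- The inverse metric `g^{μν}`. -/
def invMetric (H : ℝ → Matrix (Fin n) (Fin n) ℝ) (X : Pt n) : Matrix (Idx n) (Idx n) ℝ :=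
  (metric H X)⁻¹

/-- Christoffel symbols `Γ^l_{μν}` of the Levi-Civita connection. -/
def christoffel (H : ℝ → Matrix (Fin n) (Fin n) ℝ) (l μ ν : Idx n) (X : Pt n) : ℝ :=
  (1 / 2) * ∑ ρ, invMetric H X l ρ *
    (pd μ (fun Y => metric H Y ρ ν) X + pd ν (fun Y => metric H Y ρ μ) X
      - pd ρ (fun Y => metric H Y μ ν) X)

/-- The curvature `R^ρ_{σμν} = ∂_μ Γ^ρ_{νσ} - ∂_ν Γ^ρ_{μσ} + Γ^ρ_{μl} Γ^l_{νσ} - Γ^ρ_{νl} Γ^l_{μσ}`;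
its only independent components are `R^a_{ubu} = -H_ab`. -/
def riemann (H : ℝ → Matrix (Fin n) (Fin n) ℝ) (ρ σ μ ν : Idx n) (X : Pt n) : ℝ :=
  pd μ (christoffel H ρ ν σ) X - pd ν (christoffel H ρ μ σ) X
    + ∑ l, (christoffel H ρ μ l X * christoffel H l ν σ X
      - christoffel H ρ ν l X * christoffel H l μ σ X)

/-- Covariant derivative `∇_μ A_α` of a (complex) covector field. -/
def cov1 (H : ℝ → Matrix (Fin n) (Fin n) ℝ) (A : Idx n → Pt n → ℂ) (μ α : Idx n)
    (X : Pt n) : ℂ :=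
  pd μ (A α) X - ∑ l, (christoffel H l μ α X : ℂ) * A l X

/-- Covariant derivative `∇_μ h_{αβ}`. -/
def cov2 (H : ℝ → Matrix (Fin n) (Fin n) ℝ) (h : Idx n → Idx n → Pt n → ℂ) (μ α β : Idx n)
    (X : Pt n) : ℂ :=
  pd μ (h α β) X - ∑ l, ((christoffel H l μ α X : ℂ) * h l β X
    + (christoffel H l μ β X : ℂ) * h α l X)

/-- Covariant derivative `∇_μ T_{αβδ}`. -/
def cov3 (H : ℝ → Matrix (Fin n) (Fin n) ℝ) (T : Idx n → Idx n → Idx n → Pt n → ℂ)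
    (μ α β δ : Idx n) (X : Pt n) : ℂ :=
  pd μ (T α β δ) X - ∑ l, ((christoffel H l μ α X : ℂ) * T l β δ X
    + (christoffel H l μ β X : ℂ) * T α l δ X + (christoffel H l μ δ X : ℂ) * T α β l X)

/-- The field strength `∂_μ A_ν - ∂_ν A_μ`. -/
def fieldStrength (A : Idx n → Pt n → ℂ) (μ ν : Idx n) (X : Pt n) : ℂ :=
  pd μ (A ν) X - pd ν (A μ) X

/-- The scalar wave operator `|g|^{-1/2} ∂_μ (|g|^{1/2} g^{μν} ∂_ν Φ)`. -/
def waveOp (H : ℝ → Matrix (Fin n) (Fin n) ℝ) (Φ : Pt n → ℂ) (X : Pt n) : ℂ :=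
  ((Real.sqrt |(metric H X).det| : ℝ) : ℂ)⁻¹ *
    ∑ μ, pd μ (fun Y => ((Real.sqrt |(metric H Y).det| : ℝ) : ℂ) *
      ∑ ν, (invMetric H Y μ ν : ℂ) * pd ν Φ Y) X

/-! ### Vielbeins, Rosen metric, deformation tensor -/

/-- Entrywise derivative of a matrix function. -/
def matDeriv (E : ℝ → Matrix (Fin n) (Fin n) ℝ) (u : ℝ) : Matrix (Fin n) (Fin n) ℝ :=
  Matrix.of fun a i => deriv (fun s => E s a i) u

/-- A vielbein `E^a_i(u)`: a matrix of solutions of `Ë_{ai} = H_ab E^b_i` such that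
`Ė^a_i E_{aj}` is symmetric in `i, j`. It may be singular at some `u`. -/
structure IsVielbein (H E : ℝ → Matrix (Fin n) (Fin n) ℝ) : Prop where
  hasDeriv : ∀ u a i, HasDerivAt (fun s => E s a i) (matDeriv E u a i) u
  ode : ∀ u a i, HasDerivAt (fun s => matDeriv E s a i) ((H u * E u) a i) u
  symm : ∀ u, ((matDeriv E u)ᵀ * E u).IsSymm

/-- The in-vielbein `E^-`, trivial in the past. -/
def IsInVielbein (H E : ℝ → Matrix (Fin n) (Fin n) ℝ) : Prop :=
  IsVielbein H E ∧ ∀ a i, Tendsto (fun u => E u a i) atBot (𝓝 ((1 : Matrix (Fin n) (Fin n) ℝ) a i))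

/-- The out-vielbein `E^+`, trivial in the future. -/
def IsOutVielbein (H E : ℝ → Matrix (Fin n) (Fin n) ℝ) : Prop :=
  IsVielbein H E ∧ ∀ a i, Tendsto (fun u => E u a i) atTop (𝓝 ((1 : Matrix (Fin n) (Fin n) ℝ) a i))

/-- `u` is not a caustic: the Rosen coordinates of the vielbein `E` are regular at `u`. -/
def Regular (E : ℝ → Matrix (Fin n) (Fin n) ℝ) (u : ℝ) : Prop := (E u).det ≠ 0

/-- The transverse Rosen metric `γ_ij = E^a_i E_{aj}`. -/
def rosen (E : ℝ → Matrix (Fin n) (Fin n) ℝ) (u : ℝ) : Matrix (Fin n) (Fin n) ℝ := (E u)ᵀ * E u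

/-- `F^{ij} = ∫^u γ^{ij}(s) ds`: an antiderivative of `γ^{ij}` off the caustics, with the constant of
integration fixed by `F^{ij}(u) = u δ^{ij}` in the asymptotic region `R`. -/
structure IsRosenIntegral (E F : ℝ → Matrix (Fin n) (Fin n) ℝ) (R : Set ℝ) : Prop where
  hasDeriv : ∀ u, Regular E u → ∀ i j, HasDerivAt (fun s => F s i j) ((rosen E u)⁻¹ i j) u
  asymptotic : ∀ u ∈ R, F u = u • (1 : Matrix (Fin n) (Fin n) ℝ)

/-- The deformation tensor `σ_ab = Ė^i_a E_{bi}`, with `E^i_a` the inverse of `E^a_i`. -/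
def shear (E : ℝ → Matrix (Fin n) (Fin n) ℝ) (u : ℝ) : Matrix (Fin n) (Fin n) ℝ :=
  Matrix.of fun a b => ∑ i, matDeriv (fun s => (E s)⁻¹) u i a * E u b i

/-- `Ω = |γ^{-1}|^{1/4} = |E|^{-1/2}`. -/
def Omega (E : ℝ → Matrix (Fin n) (Fin n) ℝ) (u : ℝ) : ℝ := |(rosen E u)⁻¹.det| ^ (1 / 4 : ℝ)

/-! ### Momentum eigenstates on the gravitational background -/

/-- The solution `φ_k` of the Hamilton–Jacobi equation. -/
def phase (E F : ℝ → Matrix (Fin n) (Fin n) ℝ) (k : Mom n) (X : Pt n) : ℝ :=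
  k.1 / 2 * quad (shear E (X iu)) (trans X)
    + ∑ i, ∑ a, k.2 i * (E (X iu))⁻¹ i a * X (Sum.inr a)
    + k.1 * X iv + quad (F (X iu)) k.2 / (2 * k.1)

/-- The scalar mode `Φ = Ω e^{i φ_k}`. -/
def scalarMode (E F : ℝ → Matrix (Fin n) (Fin n) ℝ) (k : Mom n) (X : Pt n) : ℂ :=
  (Omega E (X iu) : ℂ) * Complex.exp (Complex.I * (phase E F k X : ℂ))

/-- The spin raising operator `ε_a R^a`, `R^a = du δ^{ab} ∂_b + dx^a ∂_v`, on scalars. -/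
def raise1 (ε : Fin n → ℂ) (Φ : Pt n → ℂ) (μ : Idx n) (X : Pt n) : ℂ :=
  match μ with
  | Sum.inl j => if j = 0 then ∑ a, ε a * pd (Sum.inr a) Φ X else 0
  | Sum.inr a => ε a * pd iv Φ X

/-- The spin raising operator `ε_a R^a` on covector fields, acting by covariant derivatives. -/
def raise2 (H : ℝ → Matrix (Fin n) (Fin n) ℝ) (ε : Fin n → ℂ) (A : Idx n → Pt n → ℂ)
    (μ ν : Idx n) (X : Pt n) : ℂ :=
  match μ with
  | Sum.inl j => if j = 0 then ∑ a, ε a * cov1 H A (Sum.inr a) ν X else 0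
  | Sum.inr a => ε a * cov1 H A iv ν X

/-- The gauge field mode `A = (i k₀)^{-1} ε_a R^a Φ`. -/
def gaugeMode (E F : ℝ → Matrix (Fin n) (Fin n) ℝ) (ε : Fin n → ℂ) (k : Mom n) (μ : Idx n)
    (X : Pt n) : ℂ :=
  (Complex.I * k.1)⁻¹ * raise1 ε (scalarMode E F k) μ X

/-- The graviton mode `h = (i k₀)^{-2} ε_a R^a (ε_b R^b Φ)`. -/
def gravitonMode (H E F : ℝ → Matrix (Fin n) (Fin n) ℝ) (ε : Fin n → ℂ) (k : Mom n)
    (μ ν : Idx n) (X : Pt n) : ℂ :=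
  (Complex.I * k.1)⁻¹ * raise2 H ε (gaugeMode E F ε k) μ ν X

/-- The curved polarisation `ε_μ dX^μ = ε^a (k_j E^j_a / k₀ + σ_ab x^b) du + ε_a dx^a`. -/
def pol (E : ℝ → Matrix (Fin n) (Fin n) ℝ) (ε : Fin n → ℂ) (k : Mom n) (μ : Idx n)
    (X : Pt n) : ℂ :=
  match μ with
  | Sum.inl j => if j = 0 then
      ∑ a, ε a * (((∑ i, k.2 i * (E (X iu))⁻¹ i a) / k.1
        + ∑ b, shear E (X iu) a b * X (Sum.inr b) : ℝ) : ℂ) else 0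
  | Sum.inr a => ε a

/-- The tail `- (i / k₀) ε_a ε_b σ^{ab} du²` of the graviton. -/
def tail (E : ℝ → Matrix (Fin n) (Fin n) ℝ) (ε : Fin n → ℂ) (k : Mom n) (μ ν : Idx n)
    (X : Pt n) : ℂ :=
  if μ = iu ∧ ν = iu then
    -(Complex.I / k.1) * ∑ a, ∑ b, ε a * ε b * (shear E (X iu) a b : ℂ) else 0

/-- The linear field equations and gauge conditions satisfied by the modes of spin 0, 1, 2 built from
`E` and `F`, away from the caustics of `E`, together with the closed forms of the modes. -/
structure GravModesSolve (H E F : ℝ → Matrix (Fin n) (Fin n) ℝ) : Prop where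
  /-- `φ_k` solves the Hamilton–Jacobi equation: `K = dφ_k` is null. -/
  hamiltonJacobi : ∀ k : Mom n, k.1 ≠ 0 → ∀ X : Pt n, Regular E (X iu) →
    ∑ μ, ∑ ν, invMetric H X μ ν * pd μ (phase E F k) X * pd ν (phase E F k) X = 0
  scalar_wave : ∀ k : Mom n, k.1 ≠ 0 → ∀ X : Pt n, Regular E (X iu) →
    waveOp H (scalarMode E F k) X = 0
  gauge_closed : ∀ (ε : Fin n → ℂ) (k : Mom n), k.1 ≠ 0 → ∀ X : Pt n, Regular E (X iu) → ∀ μ,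
    gaugeMode E F ε k μ X = pol E ε k μ X * scalarMode E F k X
  gauge_onshell : ∀ (ε : Fin n → ℂ) (k : Mom n), k.1 ≠ 0 → ∀ X : Pt n, Regular E (X iu) →
    ∑ μ, ∑ ν, (invMetric H X μ ν : ℂ) * pol E ε k μ X * ((pd ν (phase E F k) X : ℝ) : ℂ) = 0
  gauge_lightcone : ∀ (ε : Fin n → ℂ) (k : Mom n), k.1 ≠ 0 → ∀ X : Pt n, Regular E (X iu) →
    gaugeMode E F ε k iv X = 0
  gauge_lorenz : ∀ (ε : Fin n → ℂ) (k : Mom n), k.1 ≠ 0 → ∀ X : Pt n, Regular E (X iu) →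
    ∑ μ, ∑ ν, (invMetric H X μ ν : ℂ) * cov1 H (gaugeMode E F ε k) μ ν X = 0
  gauge_divergence : ∀ (ε : Fin n → ℂ) (k : Mom n), k.1 ≠ 0 → ∀ X : Pt n, Regular E (X iu) →
    ∑ μ, pd μ (fun Y => ∑ ν, (invMetric H Y μ ν : ℂ) * gaugeMode E F ε k ν Y) X = 0
  gauge_wave : ∀ (ε : Fin n → ℂ) (k : Mom n), k.1 ≠ 0 → ∀ X : Pt n, Regular E (X iu) → ∀ μ,
    ∑ α, ∑ β, (invMetric H X α β : ℂ) * cov2 H (cov1 H (gaugeMode E F ε k)) α β μ X = 0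
  gauge_maxwell : ∀ (ε : Fin n → ℂ) (k : Mom n), k.1 ≠ 0 → ∀ X : Pt n, Regular E (X iu) → ∀ μ,
    ∑ α, ∑ β, (invMetric H X α β : ℂ) *
      cov2 H (fieldStrength (gaugeMode E F ε k)) α β μ X = 0
  /-- Gravitons: null polarisation on a vacuum background. -/
  graviton_closed : (∀ u, (H u).trace = 0) → ∀ (ε : Fin n → ℂ), ∑ a, ε a * ε a = 0 →
    ∀ k : Mom n, k.1 ≠ 0 → ∀ X : Pt n, Regular E (X iu) → ∀ μ ν,
    gravitonMode H E F ε k μ ν X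
      = (pol E ε k μ X * pol E ε k ν X + tail E ε k μ ν X) * scalarMode E F k X
  graviton_lightcone : (∀ u, (H u).trace = 0) → ∀ (ε : Fin n → ℂ), ∑ a, ε a * ε a = 0 →
    ∀ k : Mom n, k.1 ≠ 0 → ∀ X : Pt n, Regular E (X iu) → ∀ μ,
    gravitonMode H E F ε k iv μ X = 0 ∧ gravitonMode H E F ε k μ iv X = 0
  graviton_traceless : (∀ u, (H u).trace = 0) → ∀ (ε : Fin n → ℂ), ∑ a, ε a * ε a = 0 →
    ∀ k : Mom n, k.1 ≠ 0 → ∀ X : Pt n, Regular E (X iu) →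
    ∑ μ, ∑ ν, (invMetric H X μ ν : ℂ) * gravitonMode H E F ε k μ ν X = 0
  graviton_transverse : (∀ u, (H u).trace = 0) → ∀ (ε : Fin n → ℂ), ∑ a, ε a * ε a = 0 →
    ∀ k : Mom n, k.1 ≠ 0 → ∀ X : Pt n, Regular E (X iu) → ∀ σ,
    ∑ μ, ∑ ν, (invMetric H X μ ν : ℂ) * cov2 H (gravitonMode H E F ε k) μ ν σ X = 0
  /-- The linearised Einstein equation `∇_α ∇^α h_{μν} - 2 R^ρ_{μνσ} h_ρ^σ = 0`. -/
  graviton_einstein : (∀ u, (H u).trace = 0) → ∀ (ε : Fin n → ℂ), ∑ a, ε a * ε a = 0 →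
    ∀ k : Mom n, k.1 ≠ 0 → ∀ X : Pt n, Regular E (X iu) → ∀ μ ν,
    ∑ α, ∑ β, (invMetric H X α β : ℂ) * cov3 H (cov2 H (gravitonMode H E F ε k)) α β μ ν X
      - 2 * ∑ ρ, ∑ σ, ∑ τ, (riemann H ρ μ ν σ X : ℂ) * (invMetric H X σ τ : ℂ)
          * gravitonMode H E F ε k ρ τ X = 0

/-- The Minkowski phase `k·X = k₀ v + k_a x^a + u k_a k_a / (2 k₀)` of an on-shell momentum. -/
def flatPhase (k : Mom n) (X : Pt n) : ℝ :=
  k.1 * X iv + ∑ a, k.2 a * X (Sum.inr a) + X iu * (∑ a, k.2 a ^ 2) / (2 * k.1)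

/-- The Minkowski plane wave `e^{i k·X}`. -/
def flatWave (k : Mom n) (X : Pt n) : ℂ := Complex.exp (Complex.I * (flatPhase k X : ℂ))

/-- The Minkowski polarisation `ε_a (dx^a + (k_a / k₀) du)`. -/
def flatPol (ε : Fin n → ℂ) (k : Mom n) (μ : Idx n) : ℂ :=
  match μ with
  | Sum.inl j => if j = 0 then ∑ a, ε a * ((k.2 a / k.1 : ℝ) : ℂ) else 0
  | Sum.inr a => ε a

/-- In the asymptotic region `u ∈ R` the modes are Minkowski momentum eigenstates. -/
structure GravModesFlat (H E F : ℝ → Matrix (Fin n) (Fin n) ℝ) (R : Set ℝ) : Prop where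
  scalar : ∀ k : Mom n, k.1 ≠ 0 → ∀ X : Pt n, X iu ∈ R → scalarMode E F k X = flatWave k X
  gauge : ∀ (ε : Fin n → ℂ) (k : Mom n), k.1 ≠ 0 → ∀ X : Pt n, X iu ∈ R → ∀ μ,
    gaugeMode E F ε k μ X = flatPol ε k μ * flatWave k X
  graviton : ∀ (ε : Fin n → ℂ) (k : Mom n), k.1 ≠ 0 → ∀ X : Pt n, X iu ∈ R → ∀ μ ν,
    gravitonMode H E F ε k μ ν X = flatPol ε k μ * flatPol ε k ν * flatWave k X

/-! ### Wave packets and symplectic inner products on the slices `u = const` -/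

/-- Smearing functions in momentum space: smooth, compactly supported in `k₀ > 0`
(positive frequency). -/
structure IsTest (f : Mom n → ℂ) : Prop where
  smooth : ContDiff ℝ ∞ f
  compact : HasCompactSupport f
  positive : ∀ k ∈ tsupport f, 0 < k.1

/-- The wave packet `∫ f(k) Φ_k dk` of a family of modes. -/
def packet (f : Mom n → ℂ) (M : Mom n → Pt n → ℂ) (X : Pt n) : ℂ := ∫ k, f k * M k X

/-- Wave packets of covector modes. -/
def packet1 (f : Mom n → ℂ) (M : Mom n → Idx n → Pt n → ℂ) (μ : Idx n) (X : Pt n) : ℂ :=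
  packet f (fun k => M k μ) X

/-- Wave packets of symmetric tensor modes. -/
def packet2 (f : Mom n → ℂ) (M : Mom n → Idx n → Idx n → Pt n → ℂ) (μ ν : Idx n)
    (X : Pt n) : ℂ :=
  packet f (fun k => M k μ ν) X

/-- Complex conjugate fields. -/
def conj0 (Φ : Pt n → ℂ) (X : Pt n) : ℂ := conj (Φ X)

/-- Complex conjugate covector fields. -/
def conj1 (A : Idx n → Pt n → ℂ) (μ : Idx n) (X : Pt n) : ℂ := conj (A μ X)

/-- Complex conjugate tensor fields. -/
def conj2 (h : Idx n → Idx n → Pt n → ℂ) (μ ν : Idx n) (X : Pt n) : ℂ := conj (h μ ν X)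

/-- Integrand over `(v, x)` of `⟨Φ₁|Φ₂⟩ = i ∫_{Σ_u} (Φ₁ ∂_v Φ̄₂ - Φ̄₂ ∂_v Φ₁) dv dx`. -/
def scalarDensity (Φ₁ Φ₂ : Pt n → ℂ) (u : ℝ) (p : ℝ × (Fin n → ℝ)) : ℂ :=
  let X := pt u p.1 p.2;
  Complex.I * (Φ₁ X * pd iv (conj0 Φ₂) X - conj (Φ₂ X) * pd iv Φ₁ X)

/-- Raise the index of a covector. -/
def up1 (H : ℝ → Matrix (Fin n) (Fin n) ℝ) (A : Idx n → Pt n → ℂ) (μ : Idx n) (X : Pt n) : ℂ :=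
  ∑ ν, (invMetric H X μ ν : ℂ) * A ν X

/-- Raise both indices of a tensor. -/
def up2 (H : ℝ → Matrix (Fin n) (Fin n) ℝ) (h : Idx n → Idx n → Pt n → ℂ) (μ σ : Idx n)
    (X : Pt n) : ℂ :=
  ∑ ν, ∑ τ, (invMetric H X μ ν : ℂ) * (invMetric H X σ τ : ℂ) * h ν τ X

/-- Integrand of `⟨A₁|A₂⟩ = -i ∫_{Σ_u} (A₁^μ F̄₂_{vμ} - Ā₂^μ F₁_{vμ}) dv dx`, the symplectic form of
`-¼ F²`; with the signature `(+,-,…,-)` the overall sign makes it positive on positive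
frequencies. -/
def gaugeDensity (H : ℝ → Matrix (Fin n) (Fin n) ℝ) (A₁ A₂ : Idx n → Pt n → ℂ) (u : ℝ)
    (p : ℝ × (Fin n → ℝ)) : ℂ :=
  let X := pt u p.1 p.2;
  -Complex.I * ∑ μ, (up1 H A₁ μ X * conj (fieldStrength A₂ iv μ X)
    - conj (up1 H A₂ μ X) * fieldStrength A₁ iv μ X)

/-- Integrand of `⟨h₁|h₂⟩ = i ∫_{Σ_u} (h₁^{μσ} ∂_v h̄₂_{μσ} - h̄₂^{μσ} ∂_v h₁_{μσ}) dv dx`. -/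
def gravitonDensity (H : ℝ → Matrix (Fin n) (Fin n) ℝ) (h₁ h₂ : Idx n → Idx n → Pt n → ℂ) (u : ℝ)
    (p : ℝ × (Fin n → ℝ)) : ℂ :=
  let X := pt u p.1 p.2;
  Complex.I * ∑ μ, ∑ σ, (up2 H h₁ μ σ X * pd iv (conj2 h₂ μ σ) X
    - conj (up2 H h₂ μ σ X) * pd iv (h₁ μ σ) X)

/-- The pairing `∫∫ f(k) ḡ(l) 2k₀ (2π)^{n+1} δ(k₀ - l₀) δⁿ(k - l) dk dl`. -/
def deltaPairing (f g : Mom n → ℂ) : ℂ :=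
  (2 * Real.pi : ℂ) ^ (n + 1) * ∫ k : Mom n, 2 * (k.1 : ℂ) * f k * conj (g k)

/-- The one-particle measure `(2π)^{n+1} 2k₀ dk₀ dk` on `k₀ > 0`. -/
def oneParticle (n : ℕ) : Measure (Mom n) :=
  (volume.restrict {k : Mom n | 0 < k.1}).withDensity
    (fun k => ENNReal.ofReal ((2 * Real.pi) ^ (n + 1) * (2 * k.1)))

/-- The smeared form of the slice relations. The four functions are the integrands, as functions of
two smearing functions, of the slice `u` and of the point of the slice, of `⟨Φ₁⁻|Φ₂⁻⟩`, `⟨Φ₁⁺|Φ₂⁺⟩`,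
`⟨Φ₁⁺|Φ₂⁻⟩`, `⟨Φ₁⁺|Φ̄₂⁻⟩`; `w` is the contraction of the polarisations; `regIn`, `regOut` say at which
`u` the in and out modes are defined. -/
structure SliceRelations (w : ℂ) (regIn regOut : ℝ → Prop)
    (inIn outOut outIn outInBar : (Mom n → ℂ) → (Mom n → ℂ) → ℝ → ℝ × (Fin n → ℝ) → ℂ) :
    Prop where
  in_in : ∀ f g, IsTest f → IsTest g → ∀ u, regIn u →
    Integrable (inIn f g u) ∧ ∫ p, inIn f g u p = w * deltaPairing f g
  out_out : ∀ f g, IsTest f → IsTest g → ∀ u, regOut u →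
    Integrable (outOut f g u) ∧ ∫ p, outOut f g u p = w * deltaPairing f g
  no_creation : ∀ f g, IsTest f → IsTest g → ∀ u, regIn u → regOut u →
    Integrable (outInBar f g u) ∧ ∫ p, outInBar f g u p = 0
  out_in_integrable : ∀ f g, IsTest f → IsTest g → ∀ u, regIn u → regOut u →
    Integrable (outIn f g u)
  out_in_conserved : ∀ f g, IsTest f → IsTest g → ∀ u u',
    (∀ s ∈ Set.uIcc u u', regIn s ∧ regOut s) →
    ∫ p, outIn f g u p = ∫ p, outIn f g u' p

/-- The in–out overlap at the slice `u` is the matrix element `w ⟨f| S g⟩` of the operator `S` on the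
one-particle space of positive frequency momentum wave functions. -/
def ScattersBy (S : Lp ℂ 2 (oneParticle n) ≃ₗᵢ[ℂ] Lp ℂ 2 (oneParticle n)) (w : ℂ) (u : ℝ)
    (outIn : (Mom n → ℂ) → (Mom n → ℂ) → ℝ → ℝ × (Fin n → ℝ) → ℂ) : Prop :=
  ∀ f g, IsTest f → IsTest g → ∀ F G : Lp ℂ 2 (oneParticle n),
    F =ᵐ[oneParticle n] f → G =ᵐ[oneParticle n] g →
    ∫ p, outIn f g u p = w * inner ℂ (S G) F

/-! ### The in–out overlaps on the gravitational background -/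

/-- `k_a - l_i c^i_a`, where `c = E^-(0)` and `c^i_a` is its inverse. -/
def momShift (Em : ℝ → Matrix (Fin n) (Fin n) ℝ) (k l : Fin n → ℝ) (a : Fin n) : ℝ :=
  k a - ∑ i, l i * (Em 0)⁻¹ i a

/-- The phase `s_l = l_i l_j F^{ij}_-(0) / (2 l₀)`. -/
def sPhase (Fm : ℝ → Matrix (Fin n) (Fin n) ℝ) (l₀ : ℝ) (l : Fin n → ℝ) : ℝ :=
  quad (Fm 0) l / (2 * l₀)

/-- The phase `r_{k,l} = (k - l c^{-1}) c b^{-1} (k - l c^{-1}) / (2 l₀)`, where `E^-(u) = u b + c` in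
the out-region. -/
def rPhase (Em : ℝ → Matrix (Fin n) (Fin n) ℝ) (l₀ : ℝ) (k l : Fin n → ℝ) : ℝ :=
  quad (Em 0 * (matDeriv Em 0)⁻¹) (momShift Em k l) / (2 * l₀)

/-- The integrand of the Gaussian integral
`e^{-i s_l} Ω^-(0) ∫ exp[i((k_a - l_i c^i_a) x^a - (l₀/2) σ^-_ab(0) x^a x^b)] dx`. -/
def gaussDensity (Em Fm : ℝ → Matrix (Fin n) (Fin n) ℝ) (l₀ : ℝ) (k l x : Fin n → ℝ) : ℂ :=
  Complex.exp (-Complex.I * (sPhase Fm l₀ l : ℂ)) * (Omega Em 0 : ℂ) *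
    Complex.exp (Complex.I * ((∑ a, momShift Em k l a * x a
      - l₀ / 2 * quad (shear Em 0) x : ℝ) : ℂ))

/-- Number of positive minus number of negative eigenvalues of a symmetric matrix. -/
def signature (M : Matrix (Fin n) (Fin n) ℝ) : ℝ :=
  (sigPos M.toQuadraticForm' : ℝ) - (sigNeg M.toQuadraticForm' : ℝ)

/-- The evaluated Gaussian integral
`(2π / l₀)^{n/2} e^{-iπ sgn(σ^-(0)) / 4} e^{-i(s_l + r_{k,l})} / √|det b|`. The signature factor is the
branch of the square root in `(2π / (i l₀))^{n/2} Ω^-(0) / √(det σ^-(0))`. -/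
def gaussKernel (Em Fm : ℝ → Matrix (Fin n) (Fin n) ℝ) (l₀ : ℝ) (k l : Fin n → ℝ) : ℂ :=
  (((2 * Real.pi / l₀) ^ ((n : ℝ) / 2) / Real.sqrt |(matDeriv Em 0).det| : ℝ) : ℂ) *
    Complex.exp (-Complex.I * ((Real.pi / 4 * signature (shear Em 0) : ℝ) : ℂ)) *
    Complex.exp (-Complex.I * ((sPhase Fm l₀ l + rPhase Em l₀ k l : ℝ) : ℂ))

/-- The smeared in–out overlap: `⟨Φ₁⁺|Φ₂⁻⟩ = 2k₀ w 2πδ(k₀ - l₀)` times the Gaussian integral, first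
unevaluated and then, if `b` is invertible, in closed form. -/
structure GravOverlap (Em Fm : ℝ → Matrix (Fin n) (Fin n) ℝ) (w : ℂ)
    (outIn : (Mom n → ℂ) → (Mom n → ℂ) → ℝ → ℝ × (Fin n → ℝ) → ℂ) : Prop where
  integral : ∀ f g, IsTest f → IsTest g →
    ∫ p, outIn f g 0 p = w * (2 * Real.pi) * ∫ k₀ : ℝ, 2 * (k₀ : ℂ) * ∫ x : Fin n → ℝ,
      ∫ k : Fin n → ℝ, ∫ l : Fin n → ℝ,
        f (k₀, k) * conj (g (k₀, l)) * gaussDensity Em Fm k₀ k l x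
  closed : (matDeriv Em 0).det ≠ 0 → ∀ f g, IsTest f → IsTest g →
    ∫ p, outIn f g 0 p = w * (2 * Real.pi) * ∫ k₀ : ℝ, 2 * (k₀ : ℂ) *
      ∫ k : Fin n → ℝ, ∫ l : Fin n → ℝ,
        f (k₀, k) * conj (g (k₀, l)) * gaussKernel Em Fm k₀ k l

/-- The Hermitian contraction `ε₁ · ε̄₂`. -/
def polDot (ε₁ ε₂ : Fin n → ℂ) : ℂ := ∑ a, ε₁ a * conj (ε₂ a)

/-- Scalar integrand of `⟨Φ_f[E₁,F₁]|Φ_g[E₂,F₂]⟩`. -/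
def scalarIP (E₁ F₁ E₂ F₂ : ℝ → Matrix (Fin n) (Fin n) ℝ) (f g : Mom n → ℂ) (u : ℝ)
    (p : ℝ × (Fin n → ℝ)) : ℂ :=
  scalarDensity (packet f (scalarMode E₁ F₁)) (packet g (scalarMode E₂ F₂)) u p

/-- Scalar integrand of `⟨Φ_f[E₁,F₁]|Φ̄_g[E₂,F₂]⟩`. -/
def scalarBarIP (E₁ F₁ E₂ F₂ : ℝ → Matrix (Fin n) (Fin n) ℝ) (f g : Mom n → ℂ) (u : ℝ)
    (p : ℝ × (Fin n → ℝ)) : ℂ :=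
  scalarDensity (packet f (scalarMode E₁ F₁)) (conj0 (packet g (scalarMode E₂ F₂))) u p

/-- Gauge field integrand of `⟨A_f|A_g⟩`. -/
def gaugeIP (H : ℝ → Matrix (Fin n) (Fin n) ℝ) (ε₁ ε₂ : Fin n → ℂ)
    (E₁ F₁ E₂ F₂ : ℝ → Matrix (Fin n) (Fin n) ℝ) (f g : Mom n → ℂ) (u : ℝ)
    (p : ℝ × (Fin n → ℝ)) : ℂ :=
  gaugeDensity H (packet1 f (gaugeMode E₁ F₁ ε₁)) (packet1 g (gaugeMode E₂ F₂ ε₂)) u p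

/-- Gauge field integrand of `⟨A_f|Ā_g⟩`. -/
def gaugeBarIP (H : ℝ → Matrix (Fin n) (Fin n) ℝ) (ε₁ ε₂ : Fin n → ℂ)
    (E₁ F₁ E₂ F₂ : ℝ → Matrix (Fin n) (Fin n) ℝ) (f g : Mom n → ℂ) (u : ℝ)
    (p : ℝ × (Fin n → ℝ)) : ℂ :=
  gaugeDensity H (packet1 f (gaugeMode E₁ F₁ ε₁)) (conj1 (packet1 g (gaugeMode E₂ F₂ ε₂))) u p

/-- Graviton integrand of `⟨h_f|h_g⟩`. -/
def gravitonIP (H : ℝ → Matrix (Fin n) (Fin n) ℝ) (ε₁ ε₂ : Fin n → ℂ)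
    (E₁ F₁ E₂ F₂ : ℝ → Matrix (Fin n) (Fin n) ℝ) (f g : Mom n → ℂ) (u : ℝ)
    (p : ℝ × (Fin n → ℝ)) : ℂ :=
  gravitonDensity H (packet2 f (gravitonMode H E₁ F₁ ε₁)) (packet2 g (gravitonMode H E₂ F₂ ε₂)) u p

/-- Graviton integrand of `⟨h_f|h̄_g⟩`. -/
def gravitonBarIP (H : ℝ → Matrix (Fin n) (Fin n) ℝ) (ε₁ ε₂ : Fin n → ℂ)
    (E₁ F₁ E₂ F₂ : ℝ → Matrix (Fin n) (Fin n) ℝ) (f g : Mom n → ℂ) (u : ℝ)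
    (p : ℝ × (Fin n → ℝ)) : ℂ :=
  gravitonDensity H (packet2 f (gravitonMode H E₁ F₁ ε₁))
    (conj2 (packet2 g (gravitonMode H E₂ F₂ ε₂))) u p

/-! ### Charged fields on a gauge theory plane wave

The background is valued in a Cartan subalgebra `𝔥`, with field strength `Fs_a(u) dx^a ∧ du`; a field of
charge (root) `e : 𝔥 → ℝ` sees it through `e`. -/

section Gauge

variable {𝔥 : Type*} [NormedAddCommGroup 𝔥] [NormedSpace ℝ 𝔥]

/-- The Brinkmann potential `e 𝖠 = x^a e(Fs_a(u)) du`. -/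
def background (e : 𝔥 →ₗ[ℝ] ℝ) (Fs : ℝ → Fin n → 𝔥) (μ : Idx n) (X : Pt n) : ℝ :=
  if μ = iu then ∑ a, X (Sum.inr a) * e (Fs (X iu) a) else 0

/-- `e 𝖠^-_a(u)`: the potential with `𝖠̇_a = Fs_a` vanishing in the past. -/
def potIn (e : 𝔥 →ₗ[ℝ] ℝ) (Fs : ℝ → Fin n → 𝔥) (u : ℝ) (a : Fin n) : ℝ :=
  e (∫ s in Set.Iic u, Fs s a)

/-- `e 𝖠^+_a(u)`: the potential with `𝖠̇_a = Fs_a` vanishing in the future. -/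
def potOut (e : 𝔥 →ₗ[ℝ] ℝ) (Fs : ℝ → Fin n → 𝔥) (u : ℝ) (a : Fin n) : ℝ :=
  -e (∫ s in Set.Ioi u, Fs s a)

end Gauge

/-- `f_-(u) = ∫^u |k + e𝖠(s)|² ds`, normalised to `u |k|²` in the in-region. -/
def fIn (eA : ℝ → Fin n → ℝ) (k : Fin n → ℝ) (u : ℝ) : ℝ :=
  u * ∑ a, k a ^ 2 + ∫ s in Set.Iic u, ((∑ a, (k a + eA s a) ^ 2) - ∑ a, k a ^ 2)

/-- `f_+(u) = ∫^u |k + e𝖠(s)|² ds`, normalised to `u |k|²` in the out-region. -/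
def fOut (eA : ℝ → Fin n → ℝ) (k : Fin n → ℝ) (u : ℝ) : ℝ :=
  u * ∑ a, k a ^ 2 - ∫ s in Set.Ioi u, ((∑ a, (k a + eA s a) ^ 2) - ∑ a, k a ^ 2)

/-- `φ̃_k = k₀ v + (k_a + e𝖠_a) x^a + f(u) / (2k₀)`. -/
def chargedPhase (eA : ℝ → Fin n → ℝ) (f : (Fin n → ℝ) → ℝ → ℝ) (k : Mom n) (X : Pt n) : ℝ :=
  k.1 * X iv + ∑ a, (k.2 a + eA (X iu) a) * X (Sum.inr a) + f k.2 (X iu) / (2 * k.1)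

/-- The charged scalar mode `e^{i φ̃_k}`. -/
def chargedMode (eA : ℝ → Fin n → ℝ) (f : (Fin n → ℝ) → ℝ → ℝ) (k : Mom n) (X : Pt n) : ℂ :=
  Complex.exp (Complex.I * (chargedPhase eA f k X : ℂ))

/-- The gluon mode `(i k₀)^{-1} ε_a R^a e^{i φ̃_k}`. -/
def gluonMode (eA : ℝ → Fin n → ℝ) (f : (Fin n → ℝ) → ℝ → ℝ) (ε : Fin n → ℂ) (k : Mom n)
    (μ : Idx n) (X : Pt n) : ℂ :=
  (Complex.I * k.1)⁻¹ * raise1 ε (chargedMode eA f k) μ X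

/-- The polarisation `ε_a (dx^a + (k^a + e𝖠^a) du / k₀)`. -/
def gluonPol (eA : ℝ → Fin n → ℝ) (ε : Fin n → ℂ) (k : Mom n) (μ : Idx n) (X : Pt n) : ℂ :=
  match μ with
  | Sum.inl j => if j = 0 then ∑ a, ε a * (((k.2 a + eA (X iu) a) / k.1 : ℝ) : ℂ) else 0
  | Sum.inr a => ε a

/-- The Minkowski inverse metric. -/
def eta (X : Pt n) : Matrix (Idx n) (Idx n) ℝ := invMetric 0 X

/-- The gauge covariant derivative `D_μ = ∂_μ - i B_μ`, where `B = e𝖠`. -/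
def gD (B : Idx n → Pt n → ℝ) (μ : Idx n) (ψ : Pt n → ℂ) (X : Pt n) : ℂ :=
  pd μ ψ X - Complex.I * (B μ X : ℂ) * ψ X

/-- `D_μ a_ν - D_ν a_μ`. -/
def gluonStrength (B : Idx n → Pt n → ℝ) (a : Idx n → Pt n → ℂ) (μ ν : Idx n) (X : Pt n) : ℂ :=
  gD B μ (a ν) X - gD B ν (a μ) X

/-- The covariant momentum `K_μ = -i e^{-iφ̃} D_μ e^{iφ̃} = ∂_μ φ̃ - e𝖠_μ`. -/
def gMomentum (B : Idx n → Pt n → ℝ) (eA : ℝ → Fin n → ℝ) (f : (Fin n → ℝ) → ℝ → ℝ) (k : Mom n)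
    (μ : Idx n) (X : Pt n) : ℂ :=
  -Complex.I * Complex.exp (-Complex.I * (chargedPhase eA f k X : ℂ)) *
    gD B μ (chargedMode eA f k) X

/-- The linear field equations and gauge conditions of charged scalar and gluon modes. -/
structure ChargedModesSolve (B : Idx n → Pt n → ℝ) (eA : ℝ → Fin n → ℝ)
    (f : (Fin n → ℝ) → ℝ → ℝ) : Prop where
  momentum_null : ∀ k : Mom n, k.1 ≠ 0 → ∀ X : Pt n,
    ∑ μ, ∑ ν, (eta X μ ν : ℂ) * gMomentum B eA f k μ X * gMomentum B eA f k ν X = 0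
  scalar_wave : ∀ k : Mom n, k.1 ≠ 0 → ∀ X : Pt n,
    ∑ μ, ∑ ν, (eta X μ ν : ℂ) * gD B μ (gD B ν (chargedMode eA f k)) X = 0
  gluon_closed : ∀ (ε : Fin n → ℂ) (k : Mom n), k.1 ≠ 0 → ∀ (X : Pt n) (μ : Idx n),
    gluonMode eA f ε k μ X = gluonPol eA ε k μ X * chargedMode eA f k X
  gluon_onshell : ∀ (ε : Fin n → ℂ) (k : Mom n), k.1 ≠ 0 → ∀ X : Pt n,
    ∑ μ, ∑ ν, (eta X μ ν : ℂ) * gluonPol eA ε k μ X * gMomentum B eA f k ν X = 0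
  gluon_lightcone : ∀ (ε : Fin n → ℂ) (k : Mom n), k.1 ≠ 0 → ∀ X : Pt n,
    gluonMode eA f ε k iv X = 0
  gluon_lorenz : ∀ (ε : Fin n → ℂ) (k : Mom n), k.1 ≠ 0 → ∀ X : Pt n,
    ∑ μ, ∑ ν, (eta X μ ν : ℂ) * gD B μ (gluonMode eA f ε k ν) X = 0
  gluon_divergence : ∀ (ε : Fin n → ℂ) (k : Mom n), k.1 ≠ 0 → ∀ X : Pt n,
    ∑ μ, ∑ ν, (eta X μ ν : ℂ) * pd μ (gluonMode eA f ε k ν) X = 0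
  /-- `D_μ (D^μ a_ν - D_ν a^μ) + i a^μ (∂_μ e𝖠_ν - ∂_ν e𝖠_μ) = 0`, the Yang–Mills equation linearised
  about the background, in the root space `e`. -/
  gluon_eq : ∀ (ε : Fin n → ℂ) (k : Mom n), k.1 ≠ 0 → ∀ (X : Pt n) (ν : Idx n),
    ∑ μ, ∑ ρ, (eta X μ ρ : ℂ) * (gD B μ (gluonStrength B (gluonMode eA f ε k) ρ ν) X
      + Complex.I * gluonMode eA f ε k ρ X * ((pd μ (B ν) X - pd ν (B μ) X : ℝ) : ℂ)) = 0

/-- In the asymptotic region `u ∈ R` the charged modes are Minkowski momentum eigenstates. -/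
structure ChargedModesFlat (eA : ℝ → Fin n → ℝ) (f : (Fin n → ℝ) → ℝ → ℝ) (R : Set ℝ) : Prop where
  scalar : ∀ k : Mom n, k.1 ≠ 0 → ∀ X : Pt n, X iu ∈ R → chargedMode eA f k X = flatWave k X
  gluon : ∀ (ε : Fin n → ℂ) (k : Mom n), k.1 ≠ 0 → ∀ X : Pt n, X iu ∈ R → ∀ μ,
    gluonMode eA f ε k μ X = flatPol ε k μ * flatWave k X

/-- Integrand of `⟨a₁|a₂⟩ = -i ∫_{Σ_u} (a₁^μ f̄₂_{vμ} - ā₂^μ f₁_{vμ}) dv dx`, where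
`f_{μν} = D_μ a_ν - D_ν a_μ`. -/
def gluonDensity (B : Idx n → Pt n → ℝ) (a₁ a₂ : Idx n → Pt n → ℂ) (u : ℝ)
    (p : ℝ × (Fin n → ℝ)) : ℂ :=
  let X := pt u p.1 p.2;
  -Complex.I * ∑ μ, (up1 0 a₁ μ X * conj (gluonStrength B a₂ iv μ X)
    - conj (up1 0 a₂ μ X) * gluonStrength B a₁ iv μ X)

/-- Integrand of `⟨a₁|ā₂⟩`; the conjugate `ā₂` has charge `-e`, so its field strength is
the conjugate of that of `a₂`. -/
def gluonBarDensity (B : Idx n → Pt n → ℝ) (a₁ a₂ : Idx n → Pt n → ℂ) (u : ℝ)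
    (p : ℝ × (Fin n → ℝ)) : ℂ :=
  let X := pt u p.1 p.2;
  -Complex.I * ∑ μ, (up1 0 a₁ μ X * gluonStrength B a₂ iv μ X
    - up1 0 a₂ μ X * gluonStrength B a₁ iv μ X)

/-- The smeared overlap `2k₀ w (2π)^{n+1} δ(k₀ - l₀) δⁿ(k - l - c) e^{-i f_-(0)/(2l₀)}`, where
`c_a = e𝖠^-_a(0)` is the memory and `f_-` is formed with `l`. -/
def kickPairing (eAm : ℝ → Fin n → ℝ) (w : ℂ) (f g : Mom n → ℂ) : ℂ :=
  w * (2 * Real.pi : ℂ) ^ (n + 1) * ∫ l : Mom n, 2 * (l.1 : ℂ) * f (l.1, l.2 + eAm 0) * conj (g l) *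
    Complex.exp (-Complex.I * ((fIn eAm l.2 0 / (2 * l.1) : ℝ) : ℂ))

/-- Charged scalar integrand of `⟨Φ_f|Φ_g⟩`. -/
def chargedIP (eA₁ : ℝ → Fin n → ℝ) (f₁ : (Fin n → ℝ) → ℝ → ℝ) (eA₂ : ℝ → Fin n → ℝ)
    (f₂ : (Fin n → ℝ) → ℝ → ℝ) (f g : Mom n → ℂ) (u : ℝ) (p : ℝ × (Fin n → ℝ)) : ℂ :=
  scalarDensity (packet f (chargedMode eA₁ f₁)) (packet g (chargedMode eA₂ f₂)) u p

/-- Charged scalar integrand of `⟨Φ_f|Φ̄_g⟩`. -/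
def chargedBarIP (eA₁ : ℝ → Fin n → ℝ) (f₁ : (Fin n → ℝ) → ℝ → ℝ) (eA₂ : ℝ → Fin n → ℝ)
    (f₂ : (Fin n → ℝ) → ℝ → ℝ) (f g : Mom n → ℂ) (u : ℝ) (p : ℝ × (Fin n → ℝ)) : ℂ :=
  scalarDensity (packet f (chargedMode eA₁ f₁)) (conj0 (packet g (chargedMode eA₂ f₂))) u p

/-- Gluon integrand of `⟨a_f|a_g⟩`. -/
def gluonIP (B : Idx n → Pt n → ℝ) (ε₁ ε₂ : Fin n → ℂ) (eA₁ : ℝ → Fin n → ℝ)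
    (f₁ : (Fin n → ℝ) → ℝ → ℝ) (eA₂ : ℝ → Fin n → ℝ) (f₂ : (Fin n → ℝ) → ℝ → ℝ)
    (f g : Mom n → ℂ) (u : ℝ) (p : ℝ × (Fin n → ℝ)) : ℂ :=
  gluonDensity B (packet1 f (gluonMode eA₁ f₁ ε₁)) (packet1 g (gluonMode eA₂ f₂ ε₂)) u p

/-- Gluon integrand of `⟨a_f|ā_g⟩`. -/
def gluonBarIP (B : Idx n → Pt n → ℝ) (ε₁ ε₂ : Fin n → ℂ) (eA₁ : ℝ → Fin n → ℝ)
    (f₁ : (Fin n → ℝ) → ℝ → ℝ) (eA₂ : ℝ → Fin n → ℝ) (f₂ : (Fin n → ℝ) → ℝ → ℝ)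
    (f g : Mom n → ℂ) (u : ℝ) (p : ℝ × (Fin n → ℝ)) : ℂ :=
  gluonBarDensity B (packet1 f (gluonMode eA₁ f₁ ε₁)) (packet1 g (gluonMode eA₂ f₂ ε₂)) u p

end PlaneWave

end

open PlaneWave

/-!
The proof treats both backgrounds alike and separates algebra, Fourier analysis on a slice, and
evolution between slices.

*Classical solutions.* The vielbeins solve a linear equation that is trivial outside `[a, b]`
(`existsUnique_inVielbein`, `existsUnique_outVielbein`); the conserved Wronskian makes `Ėᵀ E`
symmetric, and gives `γ⁻¹` the antiderivative `E⁻¹ E'`, with `E'` a second solution, across all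
regular values. A gradient computation shows that the transverse part of `dφ_k` is `k₀` times a
field of rays `velocity`, and the wave equations of all spins reduce to one formula,
`boxOf_dressed`, for the box of `c Φ_k` with a coefficient `c` that does not depend on `v`:
polarisations and tails only enter through their derivatives along the rays and their transverse
Laplacian. Charged modes are handled by direct computation, all coefficients being functions
of `u`.

*Slices.* All modes of higher spin are in lightcone gauge with transverse components `ε_a Φ` or
`ε_a ε_b Φ`, so that their inner product densities are pointwise multiples of the scalar one
(`gaugeDensity_eq`, `gravitonDensity_eq`, `gluonDensity_eq`). On the slice `u = const` a scalar
packet with profile `f` is the Fourier transform of `f`, times a phase, in the coordinates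
`(v + σ x x / 2, E⁻¹ x)`, and `Ω` is the square root of the Jacobian. Hence packets depend unitarily
on their profiles (`exists_unitary_slicePacket`), which is the `δ`-normalisation; and Parseval's
formula along `v` turns an overlap of two packets into an integral over the common frequency `k₀`
(`integral_slicePacket_mul_conj_eq_fiber`). Positive and negative frequencies therefore do not
overlap.

*Evolution.* At fixed `k₀` a packet solves a Schrödinger equation in `u` whose Hamiltonian, a
Laplacian plus a quadratic potential, does not refer to the vielbein. Packets decay rapidly in `x`,
locally uniformly in regular `u` (`IsBump.decay_fiberPacket`), and integration by parts shows that
their overlap is constant (`integral_modeFiber_conserved`).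

*Scattering.* At `u = 0` the out modes are plane waves, so the overlap with an in mode is the stated
Gaussian integral; it is evaluated by diagonalising `σ` and removing a Gaussian regulator
(`integral_fresnel`), and each eigenvalue contributes `e^{∓iπ/4}`. The unitary map from in to out
profiles on the slice preserves positive frequency because opposite frequencies are orthogonal, and
so induces `S` on the one-particle space (`exists_scalar_scattering`). On the gauge theory
background the in and out modes differ by a shift of the momentum by the memory and by a phase, and
`S` is explicit (`exists_charged_scattering`).
-/

noncomputable section

namespace PlaneWave

variable {n : ℕ}

/-! ### Global solutions of linear equations of second order -/

/-- Coordinatewise truncation to `[-R, R]`. -/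
def clamp {ι : Type*} (R : ℝ) (x : ι → ℝ) (i : ι) : ℝ := max (-R) (min R (x i))

theorem lipschitzWith_clamp {ι : Type*} [Fintype ι] (R : ℝ) :
    LipschitzWith 1 (clamp R : (ι → ℝ) → ι → ℝ) := by
  refine LipschitzWith.of_dist_le_mul fun x y => ?_
  rw [NNReal.coe_one, one_mul, dist_pi_le_iff dist_nonneg]
  intro i
  have h1 : dist (x i) (y i) ≤ dist x y := dist_le_pi_dist x y i
  refine le_trans ?_ h1
  simp only [clamp, Real.dist_eq]
  exact (abs_max_sub_max_le_max _ _ _ _).trans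
    (by simpa using (abs_min_sub_min_le_max R (x i) R (y i)))

theorem norm_clamp_le {ι : Type*} [Fintype ι] {R : ℝ} (hR : 0 ≤ R) (x : ι → ℝ) :
    ‖clamp R x‖ ≤ R := by
  rw [pi_norm_le_iff_of_nonneg hR]
  intro i
  rw [Real.norm_eq_abs, abs_le]
  exact ⟨le_max_left _ _, max_le (by linarith) (min_le_left _ _)⟩

theorem clamp_eq_self {ι : Type*} [Fintype ι] {R : ℝ} {x : ι → ℝ} (h : ‖x‖ ≤ R) :
    clamp R x = x := by
  funext i
  have := (norm_le_pi_norm x i).trans h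
  rw [Real.norm_eq_abs, abs_le] at this
  simp [clamp, min_eq_right this.2, max_eq_right this.1]

theorem norm_clamp_le_norm {ι : Type*} [Fintype ι] {R : ℝ} (hR : 0 ≤ R) (x : ι → ℝ) :
    ‖clamp R x‖ ≤ ‖x‖ := by
  have h0 : clamp R (0 : ι → ℝ) = 0 := clamp_eq_self (by simpa using hR)
  simpa [h0, dist_eq_norm] using (lipschitzWith_clamp R).dist_le_mul x 0

/-- A linear equation has a solution on the whole compact interval. Truncating the unknown makes the
right-hand side bounded, and Grönwall's inequality shows that the truncation is never active. -/
theorem exists_linear_ode_Icc {ι : Type*} [Fintype ι] {a b : ℝ} (hab : a ≤ b)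
    (A : ℝ → (ι → ℝ) →L[ℝ] (ι → ℝ)) (hA : Continuous A) (x₀ : ι → ℝ) :
    ∃ α : ℝ → ι → ℝ, α a = x₀ ∧
      ∀ t ∈ Set.Icc a b, HasDerivWithinAt α (A t (α t)) (Set.Icc a b) t := by
  obtain ⟨K₀, hK₀⟩ := (isCompact_Icc (a := a) (b := b)).exists_bound_of_continuousOn hA.continuousOn
  set K : ℝ := max K₀ 0 with hKdef
  have hK : 0 ≤ K := le_max_right _ _
  have hAK : ∀ t ∈ Set.Icc a b, ‖A t‖ ≤ K := fun t ht => (hK₀ t ht).trans (le_max_left _ _)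
  set R : ℝ := ‖x₀‖ * Real.exp (K * (b - a)) with hRdef
  have hR : 0 ≤ R := by positivity
  have hba : 0 ≤ b - a := by linarith
  -- the vector field is cut off at the a priori bound `R` to make it bounded
  have hPL : IsPicardLindelof (fun t x => A t (clamp R x))
    (⟨a, Set.left_mem_Icc.2 hab⟩ : Set.Icc a b)
      x₀ (Real.toNNReal (K * R * (b - a))) 0 (Real.toNNReal (K * R)) (Real.toNNReal K) := by
    refine ⟨fun t ht => ?_, fun x _ => ?_, fun t ht x _ => ?_, ?_⟩
    · refine (LipschitzWith.of_dist_le_mul fun x y => ?_).lipschitzOnWith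
      rw [Real.coe_toNNReal K hK, dist_eq_norm, dist_eq_norm, ← map_sub]
      refine ((A t).le_opNorm _).trans ?_
      refine mul_le_mul (hAK t ht) ?_ (norm_nonneg _) hK
      simpa [dist_eq_norm] using (lipschitzWith_clamp R).dist_le_mul x y
    · exact (hA.clm_apply continuous_const).continuousOn
    · rw [Real.coe_toNNReal _ (by positivity)]
      exact ((A t).le_opNorm _).trans
        (mul_le_mul (hAK t ht) (norm_clamp_le hR x) (norm_nonneg _) hK)
    · rw [Real.coe_toNNReal _ (by positivity), Real.coe_toNNReal _ (by positivity)]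
      simp [max_eq_left hba]
  obtain ⟨α, hα0, hα⟩ := hPL.exists_eq_forall_mem_Icc_hasDerivWithinAt₀
  refine ⟨α, hα0, fun t ht => ?_⟩
  have hcont : ContinuousOn α (Set.Icc a b) := fun s hs => (hα s hs).continuousWithinAt
  -- Grönwall: the solution of the truncated equation stays below the cutoff
  have hb : ∀ s ∈ Set.Icc a b, ‖α s‖ ≤ R := by
    intro s hs
    have := norm_le_gronwallBound_of_norm_deriv_right_le (f := α)
      (f' := fun t => A t (clamp R (α t))) (δ := ‖x₀‖) (K := K) (ε := 0) hcont
      (fun r hr => (hα r ⟨hr.1, hr.2.le⟩).mono_of_mem_nhdsWithin (Icc_mem_nhdsGE_of_mem hr))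
      (by simpa using (congrArg norm hα0).le)
      (fun r hr => by
        rw [add_zero]
        exact ((A r).le_opNorm _).trans (mul_le_mul (hAK r ⟨hr.1, hr.2.le⟩)
          (norm_clamp_le_norm hR _) (norm_nonneg _) hK)) s hs
    rw [gronwallBound_ε0] at this
    refine this.trans ?_
    rw [hRdef]
    gcongr
    exact hs.2
  have := hα t ht
  rwa [clamp_eq_self (hb t ht)] at this

/-- The first-order system `(x, y)' = (y, H x)` as a path of linear maps. -/
def phaseFlow (H : ℝ → Matrix (Fin n) (Fin n) ℝ) (t : ℝ) :
    (Fin n ⊕ Fin n → ℝ) →L[ℝ] (Fin n ⊕ Fin n → ℝ) :=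
  LinearMap.toContinuousLinearMap
    (Matrix.toLin' (Matrix.fromBlocks 0 (1 : Matrix (Fin n) (Fin n) ℝ) (H t) 0))

theorem continuous_phaseFlow {H : ℝ → Matrix (Fin n) (Fin n) ℝ} (hH : Continuous H) :
    Continuous (phaseFlow H) := by
  have h1 : Continuous fun t => Matrix.fromBlocks 0 (1 : Matrix (Fin n) (Fin n) ℝ) (H t) 0 :=
    Continuous.matrix_fromBlocks continuous_const continuous_const hH continuous_const
  have h2 : Continuous ((LinearMap.toContinuousLinearMap (𝕜 := ℝ) (E := Fin n ⊕ Fin n → ℝ)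
      (F' := Fin n ⊕ Fin n → ℝ)).toLinearMap ∘ₗ
        (Matrix.toLin' (R := ℝ) (m := Fin n ⊕ Fin n) (n := Fin n ⊕ Fin n)).toLinearMap) :=
    LinearMap.continuous_of_finiteDimensional _
  exact h2.comp h1

theorem phaseFlow_apply (H : ℝ → Matrix (Fin n) (Fin n) ℝ) (t : ℝ) (z : Fin n ⊕ Fin n → ℝ) :
    phaseFlow H t z = Sum.elim (z ∘ Sum.inr) (H t *ᵥ (z ∘ Sum.inl)) := by
  rw [phaseFlow, LinearMap.coe_toContinuousLinearMap', Matrix.toLin'_apply,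
    Matrix.fromBlocks_mulVec]
  simp

/-- Solutions of `x'' = H x` with data on the past edge of the support of `H` exist for all times:
outside the support they are continued with vanishing acceleration. -/
theorem exists_second_order {H : ℝ → Matrix (Fin n) (Fin n) ℝ} (hH : Continuous H) {a b : ℝ}
    (hab : a ≤ b) (hsupp : ∀ u, u ∉ Set.Icc a b → H u = 0) (x₀ y₀ : Fin n → ℝ) :
    ∃ x y : ℝ → Fin n → ℝ, x a = x₀ ∧ y a = y₀ ∧ (∀ t, HasDerivAt x (y t) t) ∧
      ∀ t, HasDerivAt y (H t *ᵥ x t) t := by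
  obtain ⟨α, hα0, hα⟩ := exists_linear_ode_Icc hab (phaseFlow H) (continuous_phaseFlow hH)
    (Sum.elim x₀ y₀)
  have hαc : ContinuousOn α (Set.Icc a b) := fun s hs => (hα s hs).continuousWithinAt
  -- the solution on `[a, b]`, continued by constants, is fed once into the integral equation; as
  -- `H` vanishes off `[a, b]` this yields a solution on the whole line
  set β : ℝ → Fin n ⊕ Fin n → ℝ := fun t => α (Set.projIcc a b hab t) with hβ
  have hβc : Continuous β := hαc.comp_continuous (continuous_subtype_val.comp continuous_projIcc)
    fun t => (Set.projIcc a b hab t).2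
  set G : ℝ → Fin n → ℝ := fun t => H t *ᵥ (β t ∘ Sum.inl) with hG
  have hGc : Continuous G := hH.matrix_mulVec (by fun_prop)
  set y : ℝ → Fin n → ℝ := fun t => y₀ + ∫ s in a..t, G s with hy
  have hyd : ∀ t, HasDerivAt y (G t) t := fun t =>
    (hGc.integral_hasStrictDerivAt a t).hasDerivAt.const_add y₀
  have hyc : Continuous y := continuous_iff_continuousAt.2 fun t => (hyd t).continuousAt
  set x : ℝ → Fin n → ℝ := fun t => x₀ + ∫ s in a..t, y s with hx
  have hxd : ∀ t, HasDerivAt x (y t) t := fun t =>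
    (hyc.integral_hasStrictDerivAt a t).hasDerivAt.const_add x₀
  have hxc : Continuous x := continuous_iff_continuousAt.2 fun t => (hxd t).continuousAt
  have hβα : ∀ t ∈ Set.Icc a b, β t = α t := fun t ht => by
    simp only [hβ, Set.projIcc_of_mem hab ht]
  have key : Set.EqOn (fun t => Sum.elim (x t) (y t)) α (Set.Icc a b) := by
    have hmono : ∀ t ∈ Set.Ico a b, HasDerivWithinAt α (phaseFlow H t (α t)) (Set.Ici t) t :=
      fun t ht => (hα t ⟨ht.1, ht.2.le⟩).mono_of_mem_nhdsWithin (Icc_mem_nhdsGE_of_mem ht)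
    have hy' : ∀ t ∈ Set.Icc a b, y t = fun i => α t (Sum.inr i) := by
      refine eq_of_has_deriv_right_eq (f' := G) (fun t _ => (hyd t).hasDerivWithinAt)
        (fun t ht => ?_)
        hyc.continuousOn (by fun_prop) (by simp only [hy, hα0]; simp)
      refine hasDerivWithinAt_pi.2 fun i => ?_
      convert! (hasDerivWithinAt_pi.1 (hmono t ht)) (Sum.inr i) using 1
      rw [phaseFlow_apply, hG]
      simp only [hβα t ⟨ht.1, ht.2.le⟩, Sum.elim_inr]
    have hx' : ∀ t ∈ Set.Icc a b, x t = fun i => α t (Sum.inl i) := by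
      refine eq_of_has_deriv_right_eq (f' := y) (fun t _ => (hxd t).hasDerivWithinAt)
        (fun t ht => ?_)
        hxc.continuousOn (by fun_prop) (by simp only [hx, hα0]; simp)
      refine hasDerivWithinAt_pi.2 fun i => ?_
      convert! (hasDerivWithinAt_pi.1 (hmono t ht)) (Sum.inl i) using 1
      rw [phaseFlow_apply, hy' t ⟨ht.1, ht.2.le⟩]
      rfl
    intro t ht
    funext j
    rcases j with i | i
    · exact congrFun (hx' t ht) i
    · exact congrFun (hy' t ht) i
  refine ⟨x, y, by simp [hx], by simp [hy], hxd, fun t => ?_⟩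
  have : G t = H t *ᵥ x t := by
    by_cases ht : t ∈ Set.Icc a b
    · have h1 := key ht
      simp only [hG, hβα t ht, ← h1]
      rfl
    · simp [hG, hsupp t ht]
  rw [← this]; exact hyd t

/-- A solution of `x'' = H x` is determined by its data at any one time. -/
theorem second_order_unique {H : ℝ → Matrix (Fin n) (Fin n) ℝ} (hH : Continuous H) {a b : ℝ}
    (hsupp : ∀ u, u ∉ Set.Icc a b → H u = 0) {x y x' y' : ℝ → Fin n → ℝ}
    (hx : ∀ t, HasDerivAt x (y t) t) (hy : ∀ t, HasDerivAt y (H t *ᵥ x t) t)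
    (hx' : ∀ t, HasDerivAt x' (y' t) t) (hy' : ∀ t, HasDerivAt y' (H t *ᵥ x' t) t) {t₀ : ℝ}
    (h0 : x t₀ = x' t₀) (h1 : y t₀ = y' t₀) : x = x' ∧ y = y' := by
  obtain ⟨K₀, hK₀⟩ := (isCompact_Icc (a := a) (b := b)).exists_bound_of_continuousOn
    (continuous_phaseFlow hH).continuousOn
  set K : ℝ := max K₀ ‖phaseFlow (0 : ℝ → Matrix (Fin n) (Fin n) ℝ) 0‖
  have hK : 0 ≤ K := (norm_nonneg _).trans (le_max_right _ _)
  have hb : ∀ t, ‖phaseFlow H t‖ ≤ K := by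
    intro t
    by_cases ht : t ∈ Set.Icc a b
    · exact (hK₀ t ht).trans (le_max_left _ _)
    · refine le_trans (le_of_eq ?_) (le_max_right _ _)
      simp [phaseFlow, hsupp t ht]
  have hd : ∀ {x y : ℝ → Fin n → ℝ}, (∀ t, HasDerivAt x (y t) t) →
      (∀ t, HasDerivAt y (H t *ᵥ x t) t) →
      ∀ t, HasDerivAt (fun s => Sum.elim (x s) (y s)) (phaseFlow H t (Sum.elim (x t) (y t))) t := by
    intro x y hx hy t
    rw [phaseFlow_apply]
    refine hasDerivAt_pi.2 fun j => ?_
    rcases j with i | i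
    · exact (hasDerivAt_pi.1 (hx t)) i
    · exact (hasDerivAt_pi.1 (hy t)) i
  have := ODE_solution_unique_univ (v := fun t z => phaseFlow H t z) (K := Real.toNNReal K)
    (s := fun _ => Set.univ) (t₀ := t₀)
    (fun t => ((LipschitzWith.of_dist_le_mul fun z w => by
      rw [Real.coe_toNNReal K hK, dist_eq_norm, dist_eq_norm, ← map_sub]
      exact ((phaseFlow H t).le_opNorm _).trans
        (mul_le_mul_of_nonneg_right (hb t) (norm_nonneg _)))).lipschitzOnWith)
    (fun t => ⟨hd hx hy t, trivial⟩) (fun t => ⟨hd hx' hy' t, trivial⟩) (by simp [h0, h1])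
  constructor
  · funext t i; exact congrFun (congrFun this t) (Sum.inl i)
  · funext t i; exact congrFun (congrFun this t) (Sum.inr i)

/-! ### Vielbeins -/

/-- A matrix of solutions of `Ë = H E`, without the symmetry condition of a vielbein. -/
structure IsSolution (H E : ℝ → Matrix (Fin n) (Fin n) ℝ) : Prop where
  hasDeriv : ∀ u a i, HasDerivAt (fun s => E s a i) (matDeriv E u a i) u
  ode : ∀ u a i, HasDerivAt (fun s => matDeriv E s a i) ((H u * E u) a i) u

theorem IsVielbein.isSolution {H E : ℝ → Matrix (Fin n) (Fin n) ℝ} (h : IsVielbein H E) :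
    IsSolution H E := ⟨h.hasDeriv, h.ode⟩

theorem matDeriv_eq {E : ℝ → Matrix (Fin n) (Fin n) ℝ} {E' : Matrix (Fin n) (Fin n) ℝ} {u : ℝ}
    (h : ∀ a i, HasDerivAt (fun s => E s a i) (E' a i) u) : matDeriv E u = E' := by
  ext a i
  exact (h a i).deriv

theorem IsSolution.of_hasDerivAt {H E E' : ℝ → Matrix (Fin n) (Fin n) ℝ}
    (h : ∀ u a i, HasDerivAt (fun s => E s a i) (E' u a i) u)
    (h' : ∀ u a i, HasDerivAt (fun s => E' s a i) ((H u * E u) a i) u) :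
    IsSolution H E ∧ matDeriv E = E' := by
  have : matDeriv E = E' := funext fun u => matDeriv_eq (h u)
  exact ⟨⟨by simpa only [this] using h, by simpa only [this] using h'⟩, this⟩

theorem matDeriv_comp_neg (E : ℝ → Matrix (Fin n) (Fin n) ℝ) (u : ℝ) :
    matDeriv (fun s => E (-s)) u = -matDeriv E (-u) := by
  ext a i
  simp only [matDeriv, Matrix.of_apply, Matrix.neg_apply]
  exact deriv_comp_neg (fun s => E s a i) u

theorem hasDerivAt_comp_neg_apply {f : ℝ → ℝ} {f' u : ℝ} (h : HasDerivAt f f' (-u)) :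
    HasDerivAt (fun s => f (-s)) (-f') u := by
  simpa [Function.comp_def] using HasDerivAt.comp u h (hasDerivAt_neg u)

/-- Time reversal. -/
theorem IsSolution.comp_neg {H E : ℝ → Matrix (Fin n) (Fin n) ℝ} (h : IsSolution H E) :
    IsSolution (fun u => H (-u)) (fun u => E (-u)) := by
  have h1 : ∀ u a i, HasDerivAt (fun s => E (-s) a i) ((-matDeriv E (-u)) a i) u := by
    intro u a i
    simpa using hasDerivAt_comp_neg_apply (h.hasDeriv (-u) a i)
  have h2 : ∀ u a i, HasDerivAt (fun s => (-matDeriv E (-s)) a i)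
      ((H (-u) * E (-u)) a i) u := by
    intro u a i
    simpa using (hasDerivAt_comp_neg_apply (h.ode (-u) a i)).fun_neg
  exact (IsSolution.of_hasDerivAt h1 h2).1

theorem exists_isSolution {H : ℝ → Matrix (Fin n) (Fin n) ℝ} (hH : Continuous H) {a b : ℝ}
    (hab : a ≤ b) (hsupp : ∀ u, u ∉ Set.Icc a b → H u = 0) (A B : Matrix (Fin n) (Fin n) ℝ) :
    ∃ E, IsSolution H E ∧ E a = A ∧ matDeriv E a = B := by
  choose x y hx0 hy0 hx hy using fun i => exists_second_order hH hab hsupp (fun c => A c i)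
    (fun c => B c i)
  obtain ⟨h1, h2⟩ := IsSolution.of_hasDerivAt (H := H) (E := fun t => Matrix.of fun c i => x i t c)
    (E' := fun t => Matrix.of fun c i => y i t c)
    (fun u c i => (hasDerivAt_pi.1 (hx i u)) c)
    (fun u c i => (hasDerivAt_pi.1 (hy i u)) c)
  refine ⟨_, h1, ?_, ?_⟩
  · ext c i; simp [hx0]
  · rw [h2]; ext c i; simp [hy0]

theorem IsSolution.ext {H E E' : ℝ → Matrix (Fin n) (Fin n) ℝ} (hE : IsSolution H E)
    (hE' : IsSolution H E') (hH : Continuous H) {a b : ℝ} (hsupp : ∀ u, u ∉ Set.Icc a b → H u = 0)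
    {t : ℝ} (h0 : E t = E' t) (h1 : matDeriv E t = matDeriv E' t) : E = E' := by
  have key : ∀ i, (fun u c => E u c i) = fun u c => E' u c i := fun i =>
    (second_order_unique hH hsupp (x := fun u c => E u c i) (y := fun u c => matDeriv E u c i)
      (x' := fun u c => E' u c i) (y' := fun u c => matDeriv E' u c i)
      (fun u => hasDerivAt_pi.2 fun c => hE.hasDeriv u c i)
      (fun u => hasDerivAt_pi.2 fun c => hE.ode u c i)
      (fun u => hasDerivAt_pi.2 fun c => hE'.hasDeriv u c i)
      (fun u => hasDerivAt_pi.2 fun c => hE'.ode u c i) (t₀ := t)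
      (funext fun c => congrFun (congrFun h0 c) i) (funext fun c => congrFun (congrFun h1 c) i)).1
  funext u
  ext c i
  exact congrFun (congrFun (key i) u) c

theorem IsSolution.continuous {H E : ℝ → Matrix (Fin n) (Fin n) ℝ} (hE : IsSolution H E) :
    Continuous E :=
  continuous_matrix fun a i => continuous_iff_continuousAt.2 fun u =>
    (hE.hasDeriv u a i).continuousAt

/-- Abel's identity: the Wronskian of two solutions is constant. -/
theorem IsSolution.wronskian_const {H E E' : ℝ → Matrix (Fin n) (Fin n) ℝ} (hE : IsSolution H E)
    (hE' : IsSolution H E') (hH : ∀ u, (H u).IsSymm) (u u' : ℝ) :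
    (matDeriv E u)ᵀ * E' u - (E u)ᵀ * matDeriv E' u
      = (matDeriv E u')ᵀ * E' u' - (E u')ᵀ * matDeriv E' u' := by
  ext i j
  have hd : ∀ u, HasDerivAt (fun u => ((matDeriv E u)ᵀ * E' u - (E u)ᵀ * matDeriv E' u) i j) 0 u :=
    by
    intro u
    simp only [Matrix.sub_apply, Matrix.mul_apply, Matrix.transpose_apply]
    have := (HasDerivAt.fun_sum (u := Finset.univ) fun a _ => (hE.ode u a i).mul
      (hE'.hasDeriv u a j)).sub
      (HasDerivAt.fun_sum (u := Finset.univ) fun a _ => (hE.hasDeriv u a i).mul (hE'.ode u a j))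
    convert! this using 1
    rw [Finset.sum_add_distrib, Finset.sum_add_distrib]
    have h1 : ∑ a, (H u * E u) a i * E' u a j = ∑ a, E u a i * (H u * E' u) a j := by
      have : (H u * E u)ᵀ * E' u = (E u)ᵀ * (H u * E' u) := by
        rw [Matrix.transpose_mul, (hH u).eq, Matrix.mul_assoc]
      have h2 := congrFun (congrFun this i) j
      rwa [Matrix.mul_apply, Matrix.mul_apply] at h2
    rw [h1]; ring
  exact is_const_of_deriv_eq_zero (fun u => (hd u).differentiableAt) (fun u => (hd u).deriv) u u'

/-- Where `H` vanishes the solutions are affine in `u`. -/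
theorem IsSolution.affine {H E : ℝ → Matrix (Fin n) (Fin n) ℝ} (hE : IsSolution H E) {s : Set ℝ}
    (hs : Convex ℝ s) (hH : ∀ u ∈ s, H u = 0) {u u₀ : ℝ} (hu : u ∈ s) (hu₀ : u₀ ∈ s) :
    matDeriv E u = matDeriv E u₀ ∧ E u = E u₀ + (u - u₀) • matDeriv E u₀ := by
  have h1 : ∀ v ∈ s, matDeriv E v = matDeriv E u₀ := by
    intro v hv
    ext a i
    have := hs.norm_image_sub_le_of_norm_hasDerivWithin_le (f := fun w => matDeriv E w a i)
      (f' := fun _ => 0) (C := 0) (fun w hw => by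
        simpa [hH w hw] using (hE.ode w a i).hasDerivWithinAt) (by simp) hu₀ hv
    rw [zero_mul, norm_le_zero_iff, sub_eq_zero] at this
    exact this
  refine ⟨h1 u hu, ?_⟩
  ext a i
  have := hs.norm_image_sub_le_of_norm_hasDerivWithin_le
    (f := fun w => E w a i - (w - u₀) * matDeriv E u₀ a i)
    (f' := fun _ => 0) (C := 0) (fun w hw => by
      convert! (((hE.hasDeriv w a i).sub (((hasDerivAt_id w).sub_const u₀).mul_const
        (matDeriv E u₀ a i)))).hasDerivWithinAt using 1
      simp [h1 w hw]) (by simp) hu₀ hu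
  rw [zero_mul, norm_le_zero_iff, sub_eq_zero] at this
  simp only [sub_self, zero_mul, sub_zero] at this
  simp only [Matrix.add_apply, Matrix.smul_apply, smul_eq_mul]
  linarith

/-- `H` vanishes on the boundary of the interval outside of which it vanishes. -/
theorem eq_zero_of_le {H : ℝ → Matrix (Fin n) (Fin n) ℝ} (hH : Continuous H) {a b : ℝ}
    (hsupp : ∀ u, u ∉ Set.Icc a b → H u = 0) : ∀ u ∈ Set.Iic a, H u = 0 := by
  have : IsClosed {u | H u = 0} := isClosed_eq hH continuous_const
  have h : Set.Iio a ⊆ {u | H u = 0} := fun u hu => hsupp u fun h => absurd hu (not_lt.2 h.1)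
  have := this.closure_subset_iff.2 h
  rwa [closure_Iio] at this

/-- Before the wave arrives `E` is affine in `u`; having a limit in the past it is constant there.
-/
theorem IsInVielbein.eq_one {H E : ℝ → Matrix (Fin n) (Fin n) ℝ} (hE : IsInVielbein H E)
    (hH : Continuous H) {a b : ℝ} (hsupp : ∀ u, u ∉ Set.Icc a b → H u = 0) :
    ∀ u ≤ a, E u = 1 ∧ matDeriv E u = 0 := by
  have hz := eq_zero_of_le hH hsupp
  have haff : ∀ u ≤ a, _ := fun u hu =>
    hE.1.isSolution.affine (convex_Iic a) hz (u := u) (u₀ := a) hu (Set.mem_Iic.2 le_rfl)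
  have hb : matDeriv E a = 0 := by
    ext c i
    -- the slope is the difference quotient from `u` to `a`, whose numerator stays bounded as `u →
    -- -∞`
    have h1 : Tendsto (fun u => (E u c i - E a c i) * (u - a)⁻¹) atBot (𝓝 0) := by
      have h2 : Tendsto (fun u : ℝ => (u - a)⁻¹) atBot (𝓝 0) :=
        tendsto_inv_atBot_zero.comp (tendsto_atBot_add_const_right _ _ tendsto_id)
      simpa using ((hE.2 c i).sub_const (E a c i)).mul h2
    refine tendsto_nhds_unique (tendsto_const_nhds.congr' ?_) h1
    filter_upwards [Iio_mem_atBot a] with u hu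
    have := congrFun (congrFun (haff u hu.le).2 c) i
    simp only [Matrix.add_apply, Matrix.smul_apply, smul_eq_mul] at this
    have h3 : u - a ≠ 0 := sub_ne_zero.2 hu.ne
    rw [this]; field_simp; ring
  intro u hu
  obtain ⟨h1, h2⟩ := haff u hu
  have ha : E a = 1 := by
    ext c i
    refine tendsto_nhds_unique (tendsto_const_nhds.congr' ?_) (hE.2 c i)
    filter_upwards [Iic_mem_atBot a] with u hu
    rw [(haff u hu).2, hb]; simp
  exact ⟨by rw [h2, ha, hb]; simp, by rw [h1, hb]⟩

theorem IsVielbein.comp_neg {H E : ℝ → Matrix (Fin n) (Fin n) ℝ} (h : IsVielbein H E) :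
    IsVielbein (fun u => H (-u)) (fun u => E (-u)) := by
  refine ⟨h.isSolution.comp_neg.hasDeriv, h.isSolution.comp_neg.ode, fun u => ?_⟩
  have := h.symm (-u)
  rw [matDeriv_comp_neg, Matrix.transpose_neg, Matrix.neg_mul]
  exact this.neg

theorem IsOutVielbein.comp_neg {H E : ℝ → Matrix (Fin n) (Fin n) ℝ} (h : IsOutVielbein H E) :
    IsInVielbein (fun u => H (-u)) (fun u => E (-u)) :=
  ⟨h.1.comp_neg, fun a i => (h.2 a i).comp tendsto_neg_atBot_atTop⟩

theorem IsInVielbein.comp_neg {H E : ℝ → Matrix (Fin n) (Fin n) ℝ} (h : IsInVielbein H E) :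
    IsOutVielbein (fun u => H (-u)) (fun u => E (-u)) :=
  ⟨h.1.comp_neg, fun a i => (h.2 a i).comp tendsto_neg_atTop_atBot⟩

theorem neg_notMem_Icc {H : ℝ → Matrix (Fin n) (Fin n) ℝ} {a b : ℝ}
    (hsupp : ∀ u, u ∉ Set.Icc a b → H u = 0) : ∀ u, u ∉ Set.Icc (-b) (-a) → H (-u) = 0 :=
  fun _ hu => hsupp _ fun h => hu ⟨by linarith [h.2], by linarith [h.1]⟩

theorem IsOutVielbein.eq_one {H E : ℝ → Matrix (Fin n) (Fin n) ℝ} (hE : IsOutVielbein H E)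
    (hH : Continuous H) {a b : ℝ} (hsupp : ∀ u, u ∉ Set.Icc a b → H u = 0) :
    ∀ u, b ≤ u → E u = 1 ∧ matDeriv E u = 0 := by
  intro u hu
  have := hE.comp_neg.eq_one (hH.comp continuous_neg) (neg_notMem_Icc hsupp) (-u) (by linarith)
  rwa [matDeriv_comp_neg, neg_neg, neg_eq_zero] at this

theorem existsUnique_inVielbein {H : ℝ → Matrix (Fin n) (Fin n) ℝ} (hH : Continuous H)
    (hsymm : ∀ u, (H u).IsSymm) {a b : ℝ} (hab : a ≤ b)
    (hsupp : ∀ u, u ∉ Set.Icc a b → H u = 0) : ∃! E, IsInVielbein H E := by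
  obtain ⟨E, hE, h0, h1⟩ := exists_isSolution hH hab hsupp 1 0
  refine ⟨E, ⟨⟨hE.hasDeriv, hE.ode, fun u => ?_⟩, fun c i => ?_⟩, fun E' hE' => ?_⟩
  · have := hE.wronskian_const hE hsymm u a
    rw [h0, h1] at this
    simp only [Matrix.transpose_zero, Matrix.zero_mul, Matrix.mul_zero, sub_zero,
      sub_eq_zero] at this
    rw [Matrix.IsSymm, Matrix.transpose_mul, Matrix.transpose_transpose, this]
  · refine tendsto_const_nhds.congr' ?_
    filter_upwards [Iic_mem_atBot a] with u hu
    rw [(hE.affine (convex_Iic a) (eq_zero_of_le hH hsupp) hu (Set.mem_Iic.2 le_rfl)).2, h0, h1]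
    simp
  · have := hE'.eq_one hH hsupp a le_rfl
    exact hE'.1.isSolution.ext hE hH hsupp (this.1.trans h0.symm) (this.2.trans h1.symm)

theorem existsUnique_outVielbein {H : ℝ → Matrix (Fin n) (Fin n) ℝ} (hH : Continuous H)
    (hsymm : ∀ u, (H u).IsSymm) {a b : ℝ} (hab : a ≤ b)
    (hsupp : ∀ u, u ∉ Set.Icc a b → H u = 0) : ∃! E, IsOutVielbein H E := by
  obtain ⟨E, hE, hu⟩ := existsUnique_inVielbein (hH.comp continuous_neg) (fun u => hsymm (-u))
    (neg_le_neg hab) (neg_notMem_Icc hsupp)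
  refine ⟨fun u => E (-u), by simpa using IsInVielbein.comp_neg hE, fun E' hE' => ?_⟩
  have := hu _ hE'.comp_neg
  funext u
  simpa using congrFun this (-u)

theorem IsInVielbein.memory {H E : ℝ → Matrix (Fin n) (Fin n) ℝ} (hE : IsInVielbein H E)
    (hH : Continuous H) {a b : ℝ} (hsupp : ∀ u, u ∉ Set.Icc a b → H u = 0) (hb : b ≤ 0) {u : ℝ}
    (hu : b < u) : E u = u • matDeriv E 0 + E 0 := by
  have hz : ∀ u ∈ Set.Ici b, H u = 0 := fun u hu => by
    simpa using eq_zero_of_le (hH.comp continuous_neg) (neg_notMem_Icc hsupp) (-u)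
      (Set.mem_Iic.2 (neg_le_neg (Set.mem_Ici.1 hu)))
  rw [(hE.1.isSolution.affine (convex_Ici b) hz (u := u) (u₀ := 0) hu.le hb).2, sub_zero, add_comm]

/-! ### Inverse vielbein, Rosen metric and their derivatives -/

theorem hasDerivAt_inv_apply {E : ℝ → Matrix (Fin n) (Fin n) ℝ} {E' : Matrix (Fin n) (Fin n) ℝ}
    {u : ℝ} (h : ∀ a i, HasDerivAt (fun s => E s a i) (E' a i) u) (hu : (E u).det ≠ 0)
    (i a : Fin n) :
    HasDerivAt (fun s => (E s)⁻¹ i a) ((-((E u)⁻¹ * E' * (E u)⁻¹)) i a) u := by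
  let _ : NormedRing (Matrix (Fin n) (Fin n) ℝ) := Matrix.linftyOpNormedRing
  let _ : NormedAlgebra ℝ (Matrix (Fin n) (Fin n) ℝ) := Matrix.linftyOpNormedAlgebra
  have _ : CompleteSpace (Matrix (Fin n) (Fin n) ℝ) := FiniteDimensional.complete ℝ _
  have h1 : HasDerivAt E E' u := by
    have : HasDerivAt (fun s => ∑ a, ∑ i, E s a i • Matrix.single a i (1 : ℝ))
        (∑ a, ∑ i, E' a i • Matrix.single a i (1 : ℝ)) u :=
      HasDerivAt.fun_sum fun a _ => HasDerivAt.fun_sum fun i _ => (h a i).smul_const _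
    have hs : ∀ M : Matrix (Fin n) (Fin n) ℝ, ∑ a, ∑ i, M a i • Matrix.single a i (1 : ℝ) = M := by
      intro M
      conv_rhs => rw [Matrix.matrix_eq_sum_single M]
      simp [Matrix.smul_single]
    simpa only [hs] using this
  obtain ⟨U, hU⟩ := (Matrix.isUnit_iff_isUnit_det _).2 (isUnit_iff_ne_zero.2 hu)
  have h2 := hasFDerivAt_ringInverse (𝕜 := ℝ) U
  rw [hU] at h2
  have h3 := h2.comp_hasDerivAt u h1
  have h4 : ((U⁻¹ : (Matrix (Fin n) (Fin n) ℝ)ˣ) : Matrix (Fin n) (Fin n) ℝ) = (E u)⁻¹ := by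
    rw [← hU, Matrix.coe_units_inv]
  let ent : Matrix (Fin n) (Fin n) ℝ →L[ℝ] ℝ :=
    LinearMap.toContinuousLinearMap (Matrix.entryLinearMap ℝ ℝ i a)
  have h5 := ent.hasFDerivAt.comp_hasDerivAt u h3
  simp only [neg_apply, ContinuousLinearMap.mulLeftRight_apply, h4] at h5
  convert! h5 using 1
  funext s
  simp [ent, Matrix.nonsing_inv_eq_ringInverse]

theorem isOpen_regular {E : ℝ → Matrix (Fin n) (Fin n) ℝ} (hE : Continuous E) :
    IsOpen {u | Regular E u} :=
  isOpen_ne_fun hE.matrix_det continuous_const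

theorem Regular.isUnit {E : ℝ → Matrix (Fin n) (Fin n) ℝ} {u : ℝ} (h : Regular E u) :
    IsUnit (E u).det := isUnit_iff_ne_zero.2 h

/-- The deformation tensor is `-Ė E⁻¹`. -/
theorem shear_eq {E : ℝ → Matrix (Fin n) (Fin n) ℝ} {u : ℝ}
    (h : ∀ a i, HasDerivAt (fun s => E s a i) (matDeriv E u a i) u) (hu : Regular E u) :
    shear E u = (-(matDeriv E u * (E u)⁻¹))ᵀ := by
  have h1 : matDeriv (fun s => (E s)⁻¹) u = -((E u)⁻¹ * matDeriv E u * (E u)⁻¹) :=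
    matDeriv_eq (hasDerivAt_inv_apply h hu)
  have h2 : shear E u = (E u * matDeriv (fun s => (E s)⁻¹) u)ᵀ := by
    ext a b
    simp [shear, Matrix.mul_apply, mul_comm]
  rw [h2, h1, Matrix.mul_neg, ← Matrix.mul_assoc, ← Matrix.mul_assoc,
    Matrix.mul_nonsing_inv _ hu.isUnit, Matrix.one_mul]

/-- `Ė E⁻¹` is symmetric because `Ėᵀ E` is. -/
theorem IsVielbein.matDeriv_mul_inv_symm {H E : ℝ → Matrix (Fin n) (Fin n) ℝ} (hE : IsVielbein H E)
    {u : ℝ} (hu : Regular E u) : (matDeriv E u * (E u)⁻¹)ᵀ = matDeriv E u * (E u)⁻¹ := by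
  have h := (hE.symm u).eq
  rw [Matrix.transpose_mul, Matrix.transpose_transpose] at h
  have hi := Matrix.mul_nonsing_inv _ hu.isUnit
  have hi' : (E u)⁻¹ᵀ * (E u)ᵀ = 1 := by rw [← Matrix.transpose_mul, hi, Matrix.transpose_one]
  calc (matDeriv E u * (E u)⁻¹)ᵀ = (E u)⁻¹ᵀ * ((matDeriv E u)ᵀ * E u) * (E u)⁻¹ := by
        rw [Matrix.mul_assoc, Matrix.mul_assoc, hi, Matrix.mul_one, Matrix.transpose_mul]
    _ = matDeriv E u * (E u)⁻¹ := by
        rw [← h, ← Matrix.mul_assoc, hi', Matrix.one_mul]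

theorem IsVielbein.shear_eq {H E : ℝ → Matrix (Fin n) (Fin n) ℝ} (hE : IsVielbein H E)
    {u : ℝ} (hu : Regular E u) : shear E u = -(matDeriv E u * (E u)⁻¹) := by
  rw [PlaneWave.shear_eq (hE.hasDeriv u) hu, Matrix.transpose_neg, hE.matDeriv_mul_inv_symm hu]

theorem IsVielbein.shear_symm {H E : ℝ → Matrix (Fin n) (Fin n) ℝ} (hE : IsVielbein H E)
    {u : ℝ} (hu : Regular E u) : (shear E u)ᵀ = shear E u := by
  rw [hE.shear_eq hu, Matrix.transpose_neg, hE.matDeriv_mul_inv_symm hu]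

theorem IsVielbein.eventually_regular {H E : ℝ → Matrix (Fin n) (Fin n) ℝ} (hE : IsVielbein H E)
    {u : ℝ} (hu : Regular E u) : ∀ᶠ s in 𝓝 u, Regular E s :=
  (isOpen_regular hE.isSolution.continuous).mem_nhds hu

/-- The inverse vielbein is transported by the deformation tensor: `d(E⁻¹)/du = E⁻¹ σ`. -/
theorem IsVielbein.hasDerivAt_inv {H E : ℝ → Matrix (Fin n) (Fin n) ℝ} (hE : IsVielbein H E)
    {u : ℝ} (hu : Regular E u) (i a : Fin n) :
    HasDerivAt (fun s => (E s)⁻¹ i a) (((E u)⁻¹ * shear E u) i a) u := by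
  have := hasDerivAt_inv_apply (hE.hasDeriv u) hu i a
  rwa [hE.shear_eq hu, Matrix.mul_neg, ← Matrix.mul_assoc]

/-- The Riccati (Raychaudhuri) equation `σ̇ = σ² - H`. -/
theorem IsVielbein.hasDerivAt_shear {H E : ℝ → Matrix (Fin n) (Fin n) ℝ} (hE : IsVielbein H E)
    {u : ℝ} (hu : Regular E u) (a b : Fin n) :
    HasDerivAt (fun s => shear E s a b) ((shear E u * shear E u - H u) a b) u := by
  have h1 : (fun s => shear E s a b) =ᶠ[𝓝 u] fun s => -∑ i, matDeriv E s a i * (E s)⁻¹ i b := by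
    filter_upwards [hE.eventually_regular hu] with s hs
    rw [hE.shear_eq hs]
    simp [Matrix.mul_apply]
  refine HasDerivAt.congr_of_eventuallyEq ?_ h1
  have h2 := (HasDerivAt.fun_sum (u := Finset.univ) fun i _ =>
    (hE.ode u a i).mul (hE.hasDerivAt_inv hu i b)).neg
  convert! h2 using 1
  rw [Finset.sum_add_distrib]
  have h3 : ∑ i, (H u * E u) a i * (E u)⁻¹ i b = H u a b := by
    have : H u * E u * (E u)⁻¹ = H u := by
      rw [Matrix.mul_assoc, Matrix.mul_nonsing_inv _ hu.isUnit, Matrix.mul_one]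
    simpa [Matrix.mul_apply] using congrFun (congrFun this a) b
  have h4 : ∑ i, matDeriv E u a i * ((E u)⁻¹ * shear E u) i b = -(shear E u * shear E u) a b := by
    have : matDeriv E u * ((E u)⁻¹ * shear E u) = -(shear E u * shear E u) := by
      nth_rewrite 2 [hE.shear_eq hu]
      rw [Matrix.neg_mul, neg_neg, Matrix.mul_assoc]
    simpa [Matrix.mul_apply] using congrFun (congrFun this a) b
  rw [h3, h4, Matrix.sub_apply]; ring

theorem rosen_inv (E : ℝ → Matrix (Fin n) (Fin n) ℝ) (u : ℝ) :
    (rosen E u)⁻¹ = (E u)⁻¹ * ((E u)⁻¹)ᵀ := by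
  rw [rosen, Matrix.mul_inv_rev, Matrix.transpose_nonsing_inv]

theorem Omega_eq (E : ℝ → Matrix (Fin n) (Fin n) ℝ) (u : ℝ) :
    Omega E u = |(E u).det| ^ (-(1 / 2) : ℝ) := by
  have h : |(rosen E u)⁻¹.det| = (|(E u).det|⁻¹) ^ (2 : ℝ) := by
    rw [rosen_inv, Matrix.det_mul, Matrix.det_transpose, abs_mul, Matrix.det_nonsing_inv,
      Ring.inverse_eq_inv', abs_inv]
    norm_num [sq]
  rw [Omega, h, ← Real.rpow_mul (by positivity), Real.inv_rpow (abs_nonneg _),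
    ← Real.rpow_neg (abs_nonneg _)]
  norm_num

/-- Jacobi's formula for the logarithmic derivative of a determinant. -/
theorem hasDerivAt_det {E : ℝ → Matrix (Fin n) (Fin n) ℝ} {E' : Matrix (Fin n) (Fin n) ℝ}
    {u : ℝ} (h : ∀ a i, HasDerivAt (fun s => E s a i) (E' a i) u) (hu : (E u).det ≠ 0) :
    HasDerivAt (fun s => (E s).det) ((E u).det * ((E u)⁻¹ * E').trace) u := by
  set M : ℝ → Matrix (Fin n) (Fin n) ℝ := fun s => (E u)⁻¹ * E s with hM
  have hM1 : M u = 1 := Matrix.nonsing_inv_mul _ (isUnit_iff_ne_zero.2 hu)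
  have hMd : ∀ a i, HasDerivAt (fun s => M s a i) (((E u)⁻¹ * E') a i) u := by
    intro a i
    simp only [hM, Matrix.mul_apply]
    exact HasDerivAt.fun_sum fun b _ => (h b i).const_mul _
  have hdet : (fun s => (E s).det) = fun s => (E u).det * (M s).det := by
    funext s
    rw [← Matrix.det_mul, hM, ← Matrix.mul_assoc,
      Matrix.mul_nonsing_inv _ (isUnit_iff_ne_zero.2 hu), Matrix.one_mul]
  rw [hdet]
  refine HasDerivAt.const_mul _ ?_
  simp only [Matrix.det_apply]
  have h1 := HasDerivAt.fun_sum (u := (Finset.univ : Finset (Equiv.Perm (Fin n)))) fun σ _ =>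
    (HasDerivAt.fun_finsetProd (u := Finset.univ) fun i _ => hMd (σ i) i).const_smul
      (Equiv.Perm.sign σ)
  convert! h1 using 1
  rw [Finset.sum_eq_single (1 : Equiv.Perm (Fin n)), Matrix.trace]
  · simp [hM1]
  · intro σ _ hσ
    obtain ⟨j, hj⟩ : ∃ j, σ j ≠ j := by
      by_contra! hc
      exact hσ (Equiv.ext hc)
    convert smul_zero _
    refine Finset.sum_eq_zero fun i _ => ?_
    rw [Finset.prod_eq_zero_iff.2, zero_smul]
    -- a nontrivial permutation moves at least two points, so one of them differs from `i`
    by_cases hij : i = j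
    · refine ⟨σ j, Finset.mem_erase.2 ⟨by rwa [hij], Finset.mem_univ _⟩, ?_⟩
      rw [hM1, Matrix.one_apply_ne]
      exact fun hc => hj (σ.injective hc)
    · refine ⟨j, Finset.mem_erase.2 ⟨Ne.symm hij, Finset.mem_univ _⟩, ?_⟩
      rw [hM1, Matrix.one_apply_ne hj]
  · simp

/-- The amplitude obeys the transport equation `Ω̇ = ½ tr(σ) Ω`. -/
theorem IsVielbein.hasDerivAt_Omega {H E : ℝ → Matrix (Fin n) (Fin n) ℝ} (hE : IsVielbein H E)
    {u : ℝ} (hu : Regular E u) :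
    HasDerivAt (Omega E) (Omega E u * ((1 / 2) * (shear E u).trace)) u := by
  have h1 : Omega E = fun s => |(E s).det| ^ (-(1 / 2) : ℝ) := funext (Omega_eq E)
  have hd := hasDerivAt_det (hE.hasDeriv u) hu
  have habs : HasDerivAt (fun s => |(E s).det|)
      (|(E u).det| * ((E u)⁻¹ * matDeriv E u).trace) u := by
    rcases lt_or_gt_of_ne hu with h | h
    · have := (hasDerivAt_abs_neg h).comp u hd
      rw [abs_of_neg h]
      convert! this using 1; ring
    · have := (hasDerivAt_abs_pos h).comp u hd
      rw [abs_of_pos h]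
      convert! this using 1; ring
  have hpos : 0 < |(E u).det| := abs_pos.2 hu
  have h2 := habs.rpow_const (p := (-(1 / 2) : ℝ)) (Or.inl hpos.ne')
  rw [h1]
  convert! h2 using 1
  rw [hE.shear_eq hu, Matrix.trace_neg, Matrix.trace_mul_comm, Real.rpow_sub_one hpos.ne']
  field_simp

/-! ### Existence of the integrated Rosen metric -/

/-- If `Ẽ` is a second solution with Wronskian `1` relative to the vielbein `E`, then `E⁻¹ Ẽ` is an
antiderivative of `γ⁻¹`. It is defined across caustics without further choices. -/
theorem IsVielbein.hasDerivAt_inv_mul {H E E' : ℝ → Matrix (Fin n) (Fin n) ℝ} (hE : IsVielbein H E)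
    (hE' : IsSolution H E') {u : ℝ} (hu : Regular E u)
    (hW : (matDeriv E u)ᵀ * E' u - (E u)ᵀ * matDeriv E' u = -1) (i j : Fin n) :
    HasDerivAt (fun s => ((E s)⁻¹ * E' s) i j) ((rosen E u)⁻¹ i j) u := by
  simp only [Matrix.mul_apply]
  have h := HasDerivAt.fun_sum (u := Finset.univ) fun a _ =>
    (hE.hasDerivAt_inv hu i a).mul (hE'.hasDeriv u a j)
  convert! h using 1
  rw [Finset.sum_add_distrib]
  have hi := Matrix.mul_nonsing_inv _ hu.isUnit
  have hi' : ((E u)⁻¹)ᵀ * (E u)ᵀ = 1 := by rw [← Matrix.transpose_mul, hi, Matrix.transpose_one]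
  have hs : ((E u)⁻¹)ᵀ * (matDeriv E u)ᵀ = -shear E u := by
    rw [← Matrix.transpose_mul, hE.shear_eq hu, neg_neg, hE.matDeriv_mul_inv_symm hu]
  have key : (rosen E u)⁻¹ = (E u)⁻¹ * shear E u * E' u + (E u)⁻¹ * matDeriv E' u := by
    have h1 : ((E u)⁻¹)ᵀ * ((matDeriv E u)ᵀ * E' u - (E u)ᵀ * matDeriv E' u) = -((E u)⁻¹)ᵀ := by
      rw [hW]; simp
    rw [Matrix.mul_sub, ← Matrix.mul_assoc, ← Matrix.mul_assoc, hi', hs, Matrix.one_mul] at h1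
    rw [rosen_inv, ← neg_neg ((E u)⁻¹)ᵀ, ← h1]
    simp only [Matrix.neg_mul, Matrix.mul_neg, Matrix.mul_sub, Matrix.mul_assoc]
    abel
  rw [key]
  simp [Matrix.mul_apply]

theorem IsInVielbein.exists_rosenIntegral {H E : ℝ → Matrix (Fin n) (Fin n) ℝ}
    (hE : IsInVielbein H E) (hH : Continuous H) (hsymm : ∀ u, (H u).IsSymm) {a b : ℝ} (hab : a ≤ b)
    (hsupp : ∀ u, u ∉ Set.Icc a b → H u = 0) : ∃ F, IsRosenIntegral E F (Set.Iio a) := by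
  obtain ⟨E', hE', h0, h1⟩ := exists_isSolution hH hab hsupp (a • 1) 1
  refine ⟨fun s => (E s)⁻¹ * E' s, fun u hu i j => hE.1.hasDerivAt_inv_mul hE' hu ?_ i j,
    fun u hu => ?_⟩
  · rw [hE.1.isSolution.wronskian_const hE' hsymm u a, h0, h1, (hE.eq_one hH hsupp a le_rfl).1,
      (hE.eq_one hH hsupp a le_rfl).2]
    simp
  · simp only [(hE.eq_one hH hsupp u (le_of_lt hu)).1]
    rw [(hE'.affine (convex_Iic a) (eq_zero_of_le hH hsupp) (u := u) (u₀ := a)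
      (Set.mem_Iic.2 (le_of_lt hu))
      (Set.mem_Iic.2 le_rfl)).2, h0, h1, inv_one, Matrix.one_mul, ← add_smul]
    congr 1; ring

theorem IsOutVielbein.exists_rosenIntegral {H E : ℝ → Matrix (Fin n) (Fin n) ℝ}
    (hE : IsOutVielbein H E) (hH : Continuous H) (hsymm : ∀ u, (H u).IsSymm) {a b : ℝ} (hab : a ≤ b)
    (hsupp : ∀ u, u ∉ Set.Icc a b → H u = 0) : ∃ F, IsRosenIntegral E F (Set.Ioi b) := by
  obtain ⟨F, hF⟩ := hE.comp_neg.exists_rosenIntegral (hH.comp continuous_neg)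
    (fun u => hsymm (-u)) (neg_le_neg hab) (neg_notMem_Icc hsupp)
  refine ⟨fun u => -F (-u), fun u hu i j => ?_, fun u hu => ?_⟩
  · have h1 : Regular (fun u => E (-u)) (-u) := by simpa [Regular] using hu
    have := (hasDerivAt_comp_neg_apply (hF.hasDeriv (-u) h1 i j)).fun_neg
    simpa [rosen] using this
  · rw [hF.asymptotic (-u) (by simpa using hu)]
    simp

/-! ### Partial derivatives -/

section PartialDerivatives

variable {V : Type*} [NormedAddCommGroup V] [NormedSpace ℝ V]

/-- `f` has the partial derivative `f'` in the coordinate direction `μ` at `X`. -/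
def HasPD (μ : Idx n) (f : Pt n → V) (f' : V) (X : Pt n) : Prop :=
  HasDerivAt (fun t : ℝ => f (Function.update X μ t)) f' (X μ)

theorem HasPD.pd_eq {μ : Idx n} {f : Pt n → V} {f' : V} {X : Pt n} (h : HasPD μ f f' X) :
    pd μ f X = f' := h.deriv

theorem hasPD_const (μ : Idx n) (c : V) (X : Pt n) : HasPD μ (fun _ => c) 0 X :=
  hasDerivAt_const _ _

theorem pd_const (μ : Idx n) (c : V) (X : Pt n) : pd μ (fun _ => c) X = 0 :=
  (hasPD_const μ c X).pd_eq

theorem HasPD.congr_deriv {μ : Idx n} {f : Pt n → V} {f' g' : V} {X : Pt n}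
    (hf : HasPD μ f f' X) (h : f' = g') : HasPD μ f g' X := h ▸ hf

theorem HasPD.add {μ : Idx n} {f g : Pt n → V} {f' g' : V} {X : Pt n} (hf : HasPD μ f f' X)
    (hg : HasPD μ g g' X) : HasPD μ (fun Y => f Y + g Y) (f' + g') X := HasDerivAt.add hf hg

theorem HasPD.sub {μ : Idx n} {f g : Pt n → V} {f' g' : V} {X : Pt n} (hf : HasPD μ f f' X)
    (hg : HasPD μ g g' X) : HasPD μ (fun Y => f Y - g Y) (f' - g') X := HasDerivAt.sub hf hg

theorem HasPD.neg {μ : Idx n} {f : Pt n → V} {f' : V} {X : Pt n} (hf : HasPD μ f f' X) :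
    HasPD μ (fun Y => -f Y) (-f') X := HasDerivAt.neg hf

theorem HasPD.sum {ι : Type*} {s : Finset ι} {μ : Idx n} {f : ι → Pt n → V} {f' : ι → V} {X : Pt n}
    (hf : ∀ i ∈ s, HasPD μ (f i) (f' i) X) :
    HasPD μ (fun Y => ∑ i ∈ s, f i Y) (∑ i ∈ s, f' i) X := HasDerivAt.fun_sum hf

theorem HasPD.mul {𝔸 : Type*} [NormedRing 𝔸] [NormedAlgebra ℝ 𝔸] {μ : Idx n} {f g : Pt n → 𝔸}
    {f' g' : 𝔸} {X : Pt n} (hf : HasPD μ f f' X) (hg : HasPD μ g g' X) :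
    HasPD μ (fun Y => f Y * g Y) (f' * g X + f X * g') X := by
  have := HasDerivAt.mul hf hg
  rwa [Function.update_eq_self] at this

theorem HasPD.const_mul {𝔸 : Type*} [NormedRing 𝔸] [NormedAlgebra ℝ 𝔸] {μ : Idx n} {f : Pt n → 𝔸}
    {f' : 𝔸} {X : Pt n} (c : 𝔸) (hf : HasPD μ f f' X) :
    HasPD μ (fun Y => c * f Y) (c * f') X := HasDerivAt.const_mul c hf

theorem HasPD.mul_const {𝔸 : Type*} [NormedRing 𝔸] [NormedAlgebra ℝ 𝔸] {μ : Idx n} {f : Pt n → 𝔸}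
    {f' : 𝔸} {X : Pt n} (hf : HasPD μ f f' X) (c : 𝔸) :
    HasPD μ (fun Y => f Y * c) (f' * c) X := HasDerivAt.mul_const hf c

theorem HasPD.ofReal {μ : Idx n} {f : Pt n → ℝ} {f' : ℝ} {X : Pt n} (hf : HasPD μ f f' X) :
    HasPD μ (fun Y => (f Y : ℂ)) (f' : ℂ) X := HasDerivAt.ofReal_comp hf

theorem HasPD.cexp {μ : Idx n} {f : Pt n → ℂ} {f' : ℂ} {X : Pt n} (hf : HasPD μ f f' X) :
    HasPD μ (fun Y => Complex.exp (f Y)) (Complex.exp (f X) * f') X := by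
  have := HasDerivAt.cexp hf
  rwa [Function.update_eq_self] at this

theorem hasPD_coord_self (μ : Idx n) (X : Pt n) : HasPD μ (fun Y : Pt n => Y μ) 1 X := by
  simpa [HasPD] using hasDerivAt_id' (X μ)

theorem hasPD_coord_ne {μ ν : Idx n} (h : ν ≠ μ) (X : Pt n) :
    HasPD μ (fun Y : Pt n => Y ν) 0 X := by
  simpa [HasPD, Function.update_of_ne h] using hasDerivAt_const (X μ) (X ν)

theorem hasPD_coord (a b : Fin n) (X : Pt n) :
    HasPD (Sum.inr a) (fun Y : Pt n => Y (Sum.inr b)) (if b = a then 1 else 0) X := by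
  split_ifs with h
  · subst h; exact hasPD_coord_self _ X
  · exact hasPD_coord_ne (by simpa using h) X

/-- A function of `u` alone. -/
theorem hasPD_comp_u {g : ℝ → V} {g' : V} {X : Pt n} (h : HasDerivAt g g' (X iu)) :
    HasPD iu (fun Y => g (Y iu)) g' X := by
  simpa [HasPD] using h

theorem hasPD_comp_u_ne {μ : Idx n} (hμ : μ ≠ iu) (g : ℝ → V) (X : Pt n) :
    HasPD μ (fun Y => g (Y iu)) 0 X := by
  simpa [HasPD, Function.update_of_ne (Ne.symm hμ)] using hasDerivAt_const (X μ) (g (X iu))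

/-- Partial derivatives at points with `u` in an open set only depend on the values over that set.
-/
theorem HasPD.congr {U : Set ℝ} (hU : IsOpen U) {μ : Idx n} {f g : Pt n → V} {f' : V} {X : Pt n}
    (hX : X iu ∈ U) (h : ∀ Y : Pt n, Y iu ∈ U → g Y = f Y) (hf : HasPD μ f f' X) :
    HasPD μ g f' X := by
  refine HasDerivAt.congr_of_eventuallyEq hf ?_
  by_cases hμ : μ = iu
  · subst hμ
    filter_upwards [hU.mem_nhds hX] with t ht
    exact h _ (by simpa using ht)
  · filter_upwards with t
    exact h _ (by simpa [Function.update_of_ne (Ne.symm hμ)] using hX)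

theorem pd_congr {U : Set ℝ} (hU : IsOpen U) {μ : Idx n} {f g : Pt n → V} {X : Pt n}
    (hX : X iu ∈ U) (h : ∀ Y : Pt n, Y iu ∈ U → g Y = f Y) : pd μ g X = pd μ f X := by
  refine Filter.EventuallyEq.deriv_eq ?_
  by_cases hμ : μ = iu
  · subst hμ
    filter_upwards [hU.mem_nhds hX] with t ht
    exact h _ (by simpa using ht)
  · filter_upwards with t
    exact h _ (by simpa [Function.update_of_ne (Ne.symm hμ)] using hX)

end PartialDerivatives

theorem iu_ne_iv : (iu : Idx n) ≠ iv := by simp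
theorem iv_ne_iu : (iv : Idx n) ≠ iu := by simp
theorem inr_ne_iu (a : Fin n) : (Sum.inr a : Idx n) ≠ iu := by simp
theorem inr_ne_iv (a : Fin n) : (Sum.inr a : Idx n) ≠ iv := by simp

theorem sum_idx {M : Type*} [AddCommMonoid M] (f : Idx n → M) :
    ∑ μ, f μ = f iu + f iv + ∑ a, f (Sum.inr a) := by
  rw [Fintype.sum_sum_type, Fin.sum_univ_two]

/-! ### The Levi-Civita connection of a plane wave -/

section Connection

variable (H : ℝ → Matrix (Fin n) (Fin n) ℝ)

theorem invMetric_eq (X : Pt n) :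
    invMetric H X = Matrix.fromBlocks !![0, 1; 1, quad (H (X iu)) (trans X)] 0 0 (-1) := by
  apply Matrix.inv_eq_right_inv
  rw [metric, Matrix.fromBlocks_multiply]
  simp only [Matrix.mul_zero, Matrix.zero_mul, add_zero, zero_add, neg_mul_neg, Matrix.one_mul]
  rw [← Matrix.fromBlocks_one]
  congr 1
  ext i j
  fin_cases i <;> fin_cases j <;> simp [Matrix.mul_apply, Fin.sum_univ_two]

theorem sqrt_abs_det_metric (X : Pt n) : Real.sqrt |(metric H X).det| = 1 := by
  rw [metric, Matrix.det_fromBlocks_zero₂₁, Matrix.det_neg, Matrix.det_one]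
  simp [Matrix.det_fin_two]

/-- Contraction with the inverse metric `2 ∂_u ∂_v + H_ab x^a x^b ∂_v² - ∂_a ∂_a`. -/
theorem sum_invMetric_mul (X : Pt n) (T : Idx n → Idx n → ℂ) :
    ∑ μ, ∑ ν, (invMetric H X μ ν : ℂ) * T μ ν
      = T iu iv + T iv iu + (quad (H (X iu)) (trans X) : ℂ) * T iv iv
        - ∑ a, T (Sum.inr a) (Sum.inr a) := by
  simp only [sum_idx, invMetric_eq]
  simp [Matrix.one_apply, Finset.sum_ite_eq, apply_ite]
  ring

theorem sum_invMetric_mul_real (X : Pt n) (T : Idx n → Idx n → ℝ) :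
    ∑ μ, ∑ ν, invMetric H X μ ν * T μ ν
      = T iu iv + T iv iu + quad (H (X iu)) (trans X) * T iv iv
        - ∑ a, T (Sum.inr a) (Sum.inr a) := by
  exact_mod_cast sum_invMetric_mul H X (fun μ ν => (T μ ν : ℂ))

theorem sum_invMetric_row (X : Pt n) (A : Idx n → ℂ) (μ : Idx n) :
    ∑ ν, (invMetric H X μ ν : ℂ) * A ν = match μ with
      | Sum.inl j => if j = 0 then A iv else A iu + (quad (H (X iu)) (trans X) : ℂ) * A iv
      | Sum.inr a => -A (Sum.inr a) := by
  rcases μ with j | a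
  · fin_cases j <;> simp [invMetric_eq]
  · simp [invMetric_eq, Matrix.one_apply, apply_ite]

variable {H}

theorem hasPD_quad {M : Matrix (Fin n) (Fin n) ℝ} (hM : M.IsSymm) (c : Fin n) (X : Pt n) :
    HasPD (Sum.inr c) (fun Y => quad M (trans Y)) (2 * ∑ b, M c b * X (Sum.inr b)) X := by
  have h := HasPD.sum (s := Finset.univ) (X := X) fun a _ => HasPD.sum (s := Finset.univ) fun b _ =>
    ((hasPD_coord c a X).const_mul (M a b)).mul (hasPD_coord c b X)
  refine h.congr_deriv ?_
  simp only [Finset.sum_add_distrib, mul_ite, mul_one, mul_zero, ite_mul, zero_mul,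
    Finset.sum_ite_eq', Finset.mem_univ, if_true]
  rw [Finset.sum_comm, two_mul]
  simp only [Finset.sum_ite_eq', Finset.mem_univ, if_true]
  congr 1
  exact Finset.sum_congr rfl fun b _ => by rw [hM.apply]

theorem metric_uu (X : Pt n) : metric H X iu iu = -quad (H (X iu)) (trans X) := rfl

/-- Apart from `g_uu` the metric components are constant. -/
theorem pd_metric_of_ne {μ ν ρ : Idx n} (h : ¬(μ = iu ∧ ν = iu)) (X : Pt n) :
    pd ρ (fun Y => metric H Y μ ν) X = 0 := by
  have : (fun Y => metric H Y μ ν) = fun _ => metric H 0 μ ν := by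
    funext Y
    rcases μ with i | a <;> rcases ν with j | b
    · fin_cases i <;> fin_cases j <;> simp_all [metric]
    all_goals simp [metric]
  rw [this, pd_const]

theorem hasPD_metric_uu_v (X : Pt n) : HasPD iv (fun Y => metric H Y iu iu) 0 X := by
  have : (fun t : ℝ => metric H (Function.update X iv t) iu iu) = fun _ => metric H X iu iu := by
    funext t
    simp only [metric_uu, Function.update_of_ne iu_ne_iv]
    rfl
  rw [HasPD, this]
  exact hasDerivAt_const _ _

theorem hasPD_metric_uu_x (hH : ∀ u, (H u).IsSymm) (c : Fin n) (X : Pt n) :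
    HasPD (Sum.inr c) (fun Y => metric H Y iu iu) (-(2 * ∑ b, H (X iu) c b * X (Sum.inr b))) X := by
  have h := (hasPD_quad (hH (X iu)) c X).neg
  have : (fun t : ℝ => metric H (Function.update X (Sum.inr c) t) iu iu)
      = fun t => -quad (H (X iu)) (trans (Function.update X (Sum.inr c) t)) := by
    funext t
    simp only [metric_uu, Function.update_of_ne (Ne.symm (inr_ne_iu c))]
  rw [HasPD, this]
  exact h

theorem christoffel_u (μ ν : Idx n) (X : Pt n) : christoffel H iu μ ν X = 0 := by
  have h1 : ∀ μ ρ, pd ρ (fun Y => metric H Y iv μ) X = 0 := fun μ ρ =>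
    pd_metric_of_ne (by simp) X
  have h2 : pd iv (fun Y => metric H Y μ ν) X = 0 := by
    by_cases h : μ = iu ∧ ν = iu
    · rw [h.1, h.2]; exact (hasPD_metric_uu_v X).pd_eq
    · exact pd_metric_of_ne h X
  simp [christoffel, invMetric_eq, h1, h2]

theorem christoffel_v_left (l ν : Idx n) (X : Pt n) : christoffel H l iv ν X = 0 := by
  have h1 : ∀ μ ρ, pd ρ (fun Y => metric H Y μ iv) X = 0 := fun μ ρ =>
    pd_metric_of_ne (by simp) X
  have h3 : ∀ μ ρ, pd ρ (fun Y => metric H Y iv μ) X = 0 := fun μ ρ =>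
    pd_metric_of_ne (by simp) X
  have h2 : ∀ μ ν, pd iv (fun Y => metric H Y μ ν) X = 0 := by
    intro μ ν
    by_cases h : μ = iu ∧ ν = iu
    · rw [h.1, h.2]; exact (hasPD_metric_uu_v X).pd_eq
    · exact pd_metric_of_ne h X
  simp [christoffel, h1, h2, h3]

theorem christoffel_comm (l μ ν : Idx n) (X : Pt n) :
    christoffel H l μ ν X = christoffel H l ν μ X := by
  have h : ∀ Y, metric H Y μ ν = metric H Y ν μ := by
    intro Y
    rcases μ with i | a <;> rcases ν with j | b
    · fin_cases i <;> fin_cases j <;> simp [metric]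
    all_goals simp [metric, Matrix.one_apply, eq_comm]
  simp only [christoffel, h]
  congr 1
  exact Finset.sum_congr rfl fun ρ _ => by ring

theorem christoffel_v_right (l μ : Idx n) (X : Pt n) : christoffel H l μ iv X = 0 := by
  rw [christoffel_comm, christoffel_v_left]

theorem christoffel_x_x (l : Idx n) (a b : Fin n) (X : Pt n) :
    christoffel H l (Sum.inr a) (Sum.inr b) X = 0 := by
  have h1 : ∀ μ ρ, pd ρ (fun Y => metric H Y μ (Sum.inr b)) X = 0 := fun μ ρ =>
    pd_metric_of_ne (by simp) X
  have h3 : ∀ μ ρ, pd ρ (fun Y => metric H Y μ (Sum.inr a)) X = 0 := fun μ ρ =>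
    pd_metric_of_ne (by simp) X
  simp [christoffel, h1, h3]

theorem christoffel_up_x_x (c a : Fin n) (ν : Idx n) (X : Pt n) :
    christoffel H (Sum.inr c) (Sum.inr a) ν X = 0 := by
  have h1 : ∀ a μ ρ, pd ρ (fun Y => metric H Y (Sum.inr a) μ) X = 0 := fun a μ ρ =>
    pd_metric_of_ne (by simp) X
  simp [christoffel, invMetric_eq, h1]

theorem christoffel_up_x_uu (hH : ∀ u, (H u).IsSymm) (c : Fin n) (X : Pt n) :
    christoffel H (Sum.inr c) iu iu X = -∑ b, H (X iu) c b * X (Sum.inr b) := by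
  have h1 : ∀ a μ ρ, pd ρ (fun Y => metric H Y (Sum.inr a) μ) X = 0 := fun a μ ρ =>
    pd_metric_of_ne (by simp) X
  simp [christoffel, invMetric_eq, h1, (hasPD_metric_uu_x hH _ X).pd_eq, Matrix.one_apply]

theorem christoffel_up_v_xu (hH : ∀ u, (H u).IsSymm) (c : Fin n) (X : Pt n) :
    christoffel H iv (Sum.inr c) iu X = -∑ b, H (X iu) c b * X (Sum.inr b) := by
  have h1 : ∀ a μ ρ, pd ρ (fun Y => metric H Y (Sum.inr a) μ) X = 0 := fun a μ ρ =>
    pd_metric_of_ne (by simp) X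
  have h2 : ∀ μ ρ, pd ρ (fun Y => metric H Y iv μ) X = 0 := fun μ ρ =>
    pd_metric_of_ne (by simp) X
  have h3 : ∀ a μ ρ, pd ρ (fun Y => metric H Y μ (Sum.inr a)) X = 0 := fun a μ ρ =>
    pd_metric_of_ne (by simp) X
  simp [christoffel, invMetric_eq, h1, h2, h3, (hasPD_metric_uu_x hH _ X).pd_eq]

/-- The force `H_ab x^b`, complexified. -/
def force (H : ℝ → Matrix (Fin n) (Fin n) ℝ) (a : Fin n) (X : Pt n) : ℂ :=
  ((∑ b, H (X iu) a b * X (Sum.inr b) : ℝ) : ℂ)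

/-- The covariant derivative of a covector field with `A_v = 0`. -/
theorem cov1_of_lightcone (hH : ∀ u, (H u).IsSymm) (A : Idx n → Pt n → ℂ) {X : Pt n}
    (hA : A iv X = 0) (μ α : Idx n) :
    cov1 H A μ α X = pd μ (A α) X
      + if μ = iu ∧ α = iu then ∑ a, force H a X * A (Sum.inr a) X else 0 := by
  rw [cov1, sum_idx, christoffel_u, hA]
  rcases μ with i | a
  · fin_cases i
    · rcases α with j | b
      · fin_cases j
        · simp [christoffel_up_x_uu hH, force, Finset.sum_neg_distrib]
        · simp [christoffel_v_right]
      · simp [christoffel_comm (H := H) _ _ (Sum.inr b), christoffel_up_x_x]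
    · simp [christoffel_v_left]
  · simp [christoffel_up_x_x]

theorem cov1_x (hH : ∀ u, (H u).IsSymm) (A : Idx n → Pt n → ℂ) (X : Pt n) (a : Fin n) (α : Idx n) :
    cov1 H A (Sum.inr a) α X = pd (Sum.inr a) (A α) X
      + if α = iu then force H a X * A iv X else 0 := by
  rw [cov1, sum_idx, christoffel_u]
  rcases α with j | b
  · fin_cases j
    · simp [christoffel_up_x_x, christoffel_up_v_xu hH, force]
    · simp [christoffel_v_right]
  · simp [christoffel_x_x]

/-- The covariant derivative of a tensor field with `h_{vμ} = h_{μv} = 0`. -/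
theorem cov2_of_lightcone (hH : ∀ u, (H u).IsSymm) (h : Idx n → Idx n → Pt n → ℂ) {X : Pt n}
    (hl : ∀ β, h iv β X = 0) (hr : ∀ β, h β iv X = 0) (μ α β : Idx n) :
    cov2 H h μ α β X = pd μ (h α β) X
      + (if μ = iu ∧ α = iu then ∑ a, force H a X * h (Sum.inr a) β X else 0)
      + (if μ = iu ∧ β = iu then ∑ a, force H a X * h α (Sum.inr a) X else 0) := by
  have h1 : ∀ α, ∑ l, (christoffel H l μ α X : ℂ) * h l β X
      = -(if μ = iu ∧ α = iu then ∑ a, force H a X * h (Sum.inr a) β X else 0) := by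
    intro α
    have := cov1_of_lightcone hH (fun l => h l β) (hl β) μ α
    rw [cov1] at this
    linear_combination -this
  have h2 : ∀ β, ∑ l, (christoffel H l μ β X : ℂ) * h α l X
      = -(if μ = iu ∧ β = iu then ∑ a, force H a X * h α (Sum.inr a) X else 0) := by
    intro β
    have := cov1_of_lightcone hH (fun l => h α l) (hr α) μ β
    rw [cov1] at this
    linear_combination -this
  rw [cov2, Finset.sum_add_distrib, h1, h2]
  ring

end Connection

/-! ### Contractions of second covariant derivatives -/

section Contractions

variable {H : ℝ → Matrix (Fin n) (Fin n) ℝ}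

theorem cov2_eq_cov1 (B : Idx n → Idx n → Pt n → ℂ) {α β : Idx n} {X : Pt n}
    (h : ∀ l, christoffel H l α β X = 0) (μ : Idx n) :
    cov2 H B α β μ X = cov1 H (B β) α μ X := by
  simp [cov2, cov1, h]

theorem cov3_eq_cov2 (T : Idx n → Idx n → Idx n → Pt n → ℂ) {α β : Idx n} {X : Pt n}
    (h : ∀ l, christoffel H l α β X = 0) (μ ν : Idx n) :
    cov3 H T α β μ ν X = cov2 H (T β) α μ ν X := by
  simp [cov3, cov2, h]

/-- The second-order operator of the metric applied to a field with partial derivatives `B`. -/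
def boxOf (H : ℝ → Matrix (Fin n) (Fin n) ℝ) (B : Idx n → Pt n → ℂ) (X : Pt n) : ℂ :=
  pd iu (B iv) X + pd iv (B iu) X + (quad (H (X iu)) (trans X) : ℂ) * pd iv (B iv) X
    - ∑ a, pd (Sum.inr a) (B (Sum.inr a)) X

/-- The divergence of a covariant derivative on the first index, reduced to `boxOf` and the force;
only the component along `u` sees the connection. -/
theorem sum_cov2 (hH : ∀ u, (H u).IsSymm) (B : Idx n → Idx n → Pt n → ℂ) {X : Pt n}
    (hB : B iv iv X = 0) (μ : Idx n) :
    ∑ α, ∑ β, (invMetric H X α β : ℂ) * cov2 H B α β μ X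
      = boxOf H (fun β => B β μ) X
        + if μ = iu then ∑ a, force H a X * (B iv (Sum.inr a) X - B (Sum.inr a) iv X) else 0 := by
  have h1 : cov1 H (B iu) iv μ X = pd iv (B iu μ) X := by
    simp [cov1, christoffel_v_left]
  rw [sum_invMetric_mul, cov2_eq_cov1 B (fun l => christoffel_v_right l _ X),
    cov2_eq_cov1 B (fun l => christoffel_v_left l _ X),
    cov2_eq_cov1 B (fun l => christoffel_v_left l _ X), h1]
  simp only [cov2_eq_cov1 B (fun l => christoffel_x_x l _ _ X), cov1_of_lightcone hH _ hB,
    cov1_x hH, Finset.sum_add_distrib]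
  by_cases hμ : μ = iu
  · simp [boxOf, hμ, mul_sub, Finset.sum_sub_distrib]
    ring
  · simp [boxOf, hμ]

/-- The analogue of `sum_cov2` for tensors in lightcone gauge. -/
theorem sum_cov3 (hH : ∀ u, (H u).IsSymm) (T : Idx n → Idx n → Idx n → Pt n → ℂ) {X : Pt n}
    (hl : ∀ β μ, T β iv μ X = 0) (hr : ∀ β μ, T β μ iv X = 0) (μ ν : Idx n) :
    ∑ α, ∑ β, (invMetric H X α β : ℂ) * cov3 H T α β μ ν X
      = boxOf H (fun β => T β μ ν) X
        + (if μ = iu then ∑ a, force H a X * T iv (Sum.inr a) ν X else 0)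
        + (if ν = iu then ∑ a, force H a X * T iv μ (Sum.inr a) X else 0) := by
  rw [sum_invMetric_mul, cov3_eq_cov2 T (fun l => christoffel_v_right l _ X),
    cov3_eq_cov2 T (fun l => christoffel_v_left l _ X),
    cov3_eq_cov2 T (fun l => christoffel_v_left l _ X)]
  simp only [cov3_eq_cov2 T (fun l => christoffel_x_x l _ _ X),
    cov2_of_lightcone hH _ (hl _) (hr _)]
  simp [boxOf]
  ring

end Contractions

/-! ### Gradients of the modes -/

section Modes

variable {H E F : ℝ → Matrix (Fin n) (Fin n) ℝ} {k : Mom n}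

/-- The transverse velocity `p_a = k_i E^i_a / k₀ + σ_ab x^b` of the congruence `dφ_k`. -/
def velocity (E : ℝ → Matrix (Fin n) (Fin n) ℝ) (k : Mom n) (a : Fin n) (X : Pt n) : ℝ :=
  (∑ i, k.2 i * (E (X iu))⁻¹ i a) / k.1 + ∑ b, shear E (X iu) a b * X (Sum.inr b)

theorem hasPD_velocity_v (a : Fin n) (X : Pt n) : HasPD iv (velocity E k a) 0 X := by
  have h := (hasPD_comp_u_ne (μ := iv) iv_ne_iu
    (fun u => (∑ i, k.2 i * (E u)⁻¹ i a) / k.1) X).add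
    (HasPD.sum (s := Finset.univ) fun b _ => (hasPD_comp_u_ne (μ := iv) iv_ne_iu
      (fun u => shear E u a b) X).mul (hasPD_coord_ne (inr_ne_iv b) X))
  exact h.congr_deriv (by simp)

theorem hasPD_velocity_x (a c : Fin n) (X : Pt n) :
    HasPD (Sum.inr c) (velocity E k a) (shear E (X iu) a c) X := by
  have h := (hasPD_comp_u_ne (inr_ne_iu c)
    (fun u => (∑ i, k.2 i * (E u)⁻¹ i a) / k.1) X).add
    (HasPD.sum (s := Finset.univ) fun b _ => (hasPD_comp_u_ne (inr_ne_iu c)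
      (fun u => shear E u a b) X).mul (hasPD_coord c b X))
  exact h.congr_deriv (by simp)

/-- The geodesic equation of the congruence, in the form `∂_u p = σ p - H x`. -/
theorem hasPD_velocity_u (hE : IsVielbein H E) {X : Pt n} (hX : Regular E (X iu)) (a : Fin n) :
    HasPD iu (velocity E k a) (∑ b, shear E (X iu) a b * velocity E k b X
      - ∑ b, H (X iu) a b * X (Sum.inr b)) X := by
  have h1 : HasPD iu (fun Y : Pt n => (∑ i, k.2 i * (E (Y iu))⁻¹ i a) / k.1)
      ((∑ i, k.2 i * ((E (X iu))⁻¹ * shear E (X iu)) i a) / k.1) X :=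
    hasPD_comp_u (g := fun u => (∑ i, k.2 i * (E u)⁻¹ i a) / k.1)
      ((HasDerivAt.fun_sum fun i _ => (hE.hasDerivAt_inv hX i a).const_mul (k.2 i)).div_const k.1)
  have h := h1.add (HasPD.sum (s := Finset.univ) fun b _ =>
    (hasPD_comp_u (g := fun u => shear E u a b) (hE.hasDerivAt_shear hX a b)).mul
      (hasPD_coord_ne (inr_ne_iu b) X))
  refine h.congr_deriv ?_
  have hs : ∀ a b, shear E (X iu) a b = shear E (X iu) b a := fun a b =>
    congrFun (congrFun (hE.shear_symm hX) b) a
  have e1 : (∑ i, k.2 i * ((E (X iu))⁻¹ * shear E (X iu)) i a) / k.1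
      = ∑ b, shear E (X iu) a b * ((∑ i, k.2 i * (E (X iu))⁻¹ i b) / k.1) := by
    simp only [Matrix.mul_apply, Finset.mul_sum, Finset.sum_div]
    rw [Finset.sum_comm]
    refine Finset.sum_congr rfl fun b _ => Finset.sum_congr rfl fun i _ => ?_
    rw [hs a b]; ring
  have e2 : ∑ b, (shear E (X iu) * shear E (X iu)) a b * X (Sum.inr b)
      = ∑ b, shear E (X iu) a b * ∑ c, shear E (X iu) b c * X (Sum.inr c) := by
    simp only [Matrix.mul_apply, Finset.mul_sum, Finset.sum_mul]
    rw [Finset.sum_comm]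
    refine Finset.sum_congr rfl fun b _ => Finset.sum_congr rfl fun i _ => by ring
  simp only [velocity, mul_add, Finset.sum_add_distrib, Matrix.sub_apply, sub_mul, mul_zero,
    add_zero, Finset.sum_sub_distrib]
  rw [e1, e2]; ring

theorem hasPD_phase_v (X : Pt n) : HasPD iv (phase E F k) k.1 X := by
  have h1 : HasPD iv (fun Y : Pt n => k.1 / 2 * quad (shear E (Y iu)) (trans Y)) 0 X := by
    have h := HasPD.sum (s := Finset.univ) (X := X) fun a _ => HasPD.sum (s := Finset.univ)
      fun b _ => ((hasPD_comp_u_ne (μ := iv) iv_ne_iu (fun u => shear E u a b) X).mul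
        (hasPD_coord_ne (inr_ne_iv a) X)).mul (hasPD_coord_ne (inr_ne_iv b) X)
    exact (h.const_mul (k.1 / 2)).congr_deriv (by simp)
  have h2 : HasPD iv (fun Y : Pt n => ∑ i, ∑ a, k.2 i * (E (Y iu))⁻¹ i a * Y (Sum.inr a)) 0 X := by
    have h := HasPD.sum (s := Finset.univ) (X := X) fun i _ => HasPD.sum (s := Finset.univ)
      fun a _ => (hasPD_comp_u_ne (μ := iv) iv_ne_iu (fun u => k.2 i * (E u)⁻¹ i a) X).mul
        (hasPD_coord_ne (inr_ne_iv a) X)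
    exact h.congr_deriv (by simp)
  have h := ((h1.add h2).add ((hasPD_coord_self iv X).const_mul k.1)).add
    (hasPD_comp_u_ne (μ := iv) iv_ne_iu (fun u => quad (F u) k.2 / (2 * k.1)) X)
  exact h.congr_deriv (by simp)

theorem hasPD_phase_x (hE : IsVielbein H E) (hk : k.1 ≠ 0) {X : Pt n} (hX : Regular E (X iu))
    (c : Fin n) : HasPD (Sum.inr c) (phase E F k) (k.1 * velocity E k c X) X := by
  have h1 : HasPD (Sum.inr c) (fun Y : Pt n => k.1 / 2 * quad (shear E (Y iu)) (trans Y))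
      (k.1 / 2 * (2 * ∑ b, shear E (X iu) c b * X (Sum.inr b))) X := by
    have h := (hasPD_quad (hE.shear_symm hX) c X).const_mul (k.1 / 2)
    have e : (fun t : ℝ => k.1 / 2 * quad (shear E (Function.update X (Sum.inr c) t iu))
        (trans (Function.update X (Sum.inr c) t)))
        = fun t => k.1 / 2 * quad (shear E (X iu)) (trans (Function.update X (Sum.inr c) t)) := by
      funext t
      simp only [Function.update_of_ne (Ne.symm (inr_ne_iu c))]
    rw [HasPD, e]
    exact h
  have h2 : HasPD (Sum.inr c) (fun Y : Pt n => ∑ i, ∑ a, k.2 i * (E (Y iu))⁻¹ i a * Y (Sum.inr a))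
      (∑ i, k.2 i * (E (X iu))⁻¹ i c) X := by
    have h := HasPD.sum (s := Finset.univ) (X := X) fun i _ => HasPD.sum (s := Finset.univ)
      fun a _ => (hasPD_comp_u_ne (inr_ne_iu c) (fun u => k.2 i * (E u)⁻¹ i a) X).mul
        (hasPD_coord c a X)
    exact h.congr_deriv (by simp)
  have h := ((h1.add h2).add ((hasPD_coord_ne (μ := Sum.inr c) (ν := iv) (by simp) X).const_mul
    k.1)).add (hasPD_comp_u_ne (inr_ne_iu c) (fun u => quad (F u) k.2 / (2 * k.1)) X)
  refine h.congr_deriv ?_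
  rw [velocity]
  field_simp
  ring

/-- The `u`-derivative of the phase is fixed by the Hamilton–Jacobi equation. -/
theorem hasPD_phase_u {R : Set ℝ} (hE : IsVielbein H E) (hF : IsRosenIntegral E F R) (hk : k.1 ≠ 0)
    {X : Pt n} (hX : Regular E (X iu)) :
    HasPD iu (phase E F k)
      (k.1 / 2 * (∑ a, velocity E k a X ^ 2 - quad (H (X iu)) (trans X))) X := by
  set x : Fin n → ℝ := trans X with hx
  set S := shear E (X iu) with hS
  set K : Fin n → ℝ := fun a => ∑ i, k.2 i * (E (X iu))⁻¹ i a with hK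
  have hs : ∀ a b, S a b = S b a := fun a b => congrFun (congrFun (hE.shear_symm hX) b) a
  have h1 : HasPD iu (fun Y : Pt n => k.1 / 2 * quad (shear E (Y iu)) (trans Y))
      (k.1 / 2 * ∑ a, ∑ b, (S * S - H (X iu)) a b * x a * x b) X := by
    have h := HasPD.sum (s := Finset.univ) (X := X) fun a _ => HasPD.sum (s := Finset.univ)
      fun b _ => ((hasPD_comp_u (g := fun u => shear E u a b) (hE.hasDerivAt_shear hX a b)).mul
        (hasPD_coord_ne (inr_ne_iu a) X)).mul (hasPD_coord_ne (inr_ne_iu b) X)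
    exact (h.const_mul (k.1 / 2)).congr_deriv (by simp [hx, trans, hS])
  have h2 : HasPD iu (fun Y : Pt n => ∑ i, ∑ a, k.2 i * (E (Y iu))⁻¹ i a * Y (Sum.inr a))
      (∑ i, ∑ a, k.2 i * ((E (X iu))⁻¹ * S) i a * x a) X := by
    have h := HasPD.sum (s := Finset.univ) (X := X) fun i _ => HasPD.sum (s := Finset.univ)
      fun a _ => ((hasPD_comp_u (g := fun u => (E u)⁻¹ i a) (hE.hasDerivAt_inv hX i a)).const_mul
        (k.2 i)).mul (hasPD_coord_ne (inr_ne_iu a) X)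
    exact h.congr_deriv (by simp [hx, trans, hS])
  have h3 : HasPD iu (fun Y : Pt n => quad (F (Y iu)) k.2 / (2 * k.1))
      ((∑ a, ∑ b, ((rosen E (X iu))⁻¹) a b * k.2 a * k.2 b) / (2 * k.1)) X :=
    hasPD_comp_u (g := fun u => quad (F u) k.2 / (2 * k.1))
      ((HasDerivAt.fun_sum fun a _ => HasDerivAt.fun_sum fun b _ =>
        ((hF.hasDeriv _ hX a b).mul_const (k.2 a)).mul_const (k.2 b)).div_const (2 * k.1))
  have h := ((h1.add h2).add ((hasPD_coord_ne iv_ne_iu X).const_mul k.1)).add h3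
  refine h.congr_deriv ?_
  have e1 : ∑ a, ∑ b, (S * S - H (X iu)) a b * x a * x b
      = ∑ a, (∑ b, S a b * x b) ^ 2 - quad (H (X iu)) x := by
    simp only [Matrix.sub_apply, sub_mul, Finset.sum_sub_distrib, quad]
    congr 1
    simp only [sq, Matrix.mul_apply, Finset.sum_mul, Finset.mul_sum]
    rw [Finset.sum_comm_cycle]
    refine Finset.sum_congr rfl fun c _ => Finset.sum_congr rfl fun a _ =>
      Finset.sum_congr rfl fun b _ => ?_
    rw [hs a c]; ring
  have e2 : ∑ i, ∑ a, k.2 i * ((E (X iu))⁻¹ * S) i a * x a = ∑ c, K c * ∑ a, S c a * x a := by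
    simp only [hK, Matrix.mul_apply, Finset.mul_sum, Finset.sum_mul]
    rw [Finset.sum_comm_cycle]
    refine Finset.sum_congr rfl fun c _ => ?_
    rw [Finset.sum_comm]
    refine Finset.sum_congr rfl fun a _ => Finset.sum_congr rfl fun i _ => by ring
  have e3 : ∑ a, ∑ b, ((rosen E (X iu))⁻¹) a b * k.2 a * k.2 b = ∑ c, K c ^ 2 := by
    simp only [hK, rosen_inv, Matrix.mul_apply, Matrix.transpose_apply, sq, Finset.sum_mul,
      Finset.mul_sum]
    rw [Finset.sum_comm_cycle]
    refine Finset.sum_congr rfl fun c _ => Finset.sum_congr rfl fun a _ =>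
      Finset.sum_congr rfl fun b _ => by ring
  have e4 : ∑ a, velocity E k a X ^ 2 = (∑ c, K c ^ 2) / k.1 ^ 2
      + 2 * (∑ c, K c * ∑ a, S c a * x a) / k.1 + ∑ a, (∑ b, S a b * x b) ^ 2 := by
    rw [Finset.sum_div, Finset.mul_sum, Finset.sum_div, ← Finset.sum_add_distrib,
      ← Finset.sum_add_distrib]
    refine Finset.sum_congr rfl fun a _ => ?_
    simp only [velocity, hK, hS, hx, trans]
    field_simp
    ring
  rw [e1, e2, e3, e4, mul_zero]
  field_simp
  ring

/-- The logarithmic `u`-derivative of the scalar mode. -/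
def rate (H E : ℝ → Matrix (Fin n) (Fin n) ℝ) (k : Mom n) (X : Pt n) : ℂ :=
  Complex.I * k.1 / 2 * (∑ a, (velocity E k a X : ℂ) ^ 2 - (quad (H (X iu)) (trans X) : ℂ))
    + (1 / 2) * ∑ a, (shear E (X iu) a a : ℂ)

theorem hasPD_scalarMode_v (X : Pt n) :
    HasPD iv (scalarMode E F k) (Complex.I * k.1 * scalarMode E F k X) X := by
  have h := (hasPD_comp_u_ne (μ := iv) iv_ne_iu (fun u => (Omega E u : ℂ)) X).mul
    (((hasPD_phase_v (E := E) (F := F) (k := k) X).ofReal.const_mul Complex.I).cexp)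
  refine h.congr_deriv ?_
  simp only [scalarMode]; ring

theorem hasPD_scalarMode_x (hE : IsVielbein H E) (hk : k.1 ≠ 0) {X : Pt n}
    (hX : Regular E (X iu)) (a : Fin n) : HasPD (Sum.inr a) (scalarMode E F k)
      (Complex.I * k.1 * velocity E k a X * scalarMode E F k X) X := by
  have h := (hasPD_comp_u_ne (inr_ne_iu a) (fun u => (Omega E u : ℂ)) X).mul
    (((hasPD_phase_x (F := F) hE hk hX a).ofReal.const_mul Complex.I).cexp)
  refine h.congr_deriv ?_
  simp only [scalarMode]; push_cast; ring

theorem hasPD_scalarMode_u {R : Set ℝ} (hE : IsVielbein H E) (hF : IsRosenIntegral E F R)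
    (hk : k.1 ≠ 0) {X : Pt n} (hX : Regular E (X iu)) :
    HasPD iu (scalarMode E F k) (rate H E k X * scalarMode E F k X) X := by
  have h := (hasPD_comp_u (g := fun u => (Omega E u : ℂ)) (hE.hasDerivAt_Omega hX).ofReal_comp).mul
    (((hasPD_phase_u hE hF hk hX).ofReal.const_mul Complex.I).cexp)
  refine h.congr_deriv ?_
  simp only [scalarMode, rate, Matrix.trace, Matrix.diag]; push_cast; ring

end Modes

/-! ### Field equations on the gravitational background -/

section FieldEquations

variable {H E F : ℝ → Matrix (Fin n) (Fin n) ℝ} {k : Mom n} {R : Set ℝ}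

/-- `c` has gradient `(cu, 0, cx)` at the points that are regular for `E`. -/
structure HasGrad (E : ℝ → Matrix (Fin n) (Fin n) ℝ) (c cu : Pt n → ℂ) (cx : Fin n → Pt n → ℂ) :
    Prop where
  u : ∀ X : Pt n, Regular E (X iu) → HasPD iu c (cu X) X
  v : ∀ X : Pt n, Regular E (X iu) → HasPD iv c 0 X
  x : ∀ a, ∀ X : Pt n, Regular E (X iu) → HasPD (Sum.inr a) c (cx a X) X

theorem hasGrad_const (E : ℝ → Matrix (Fin n) (Fin n) ℝ) (c : ℂ) :
    HasGrad E (fun _ => c) (fun _ => 0) (fun _ _ => 0) :=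
  ⟨fun X _ => hasPD_const _ c X, fun X _ => hasPD_const _ c X, fun _ X _ => hasPD_const _ c X⟩

theorem HasGrad.mul {c cu d du : Pt n → ℂ} {cx dx : Fin n → Pt n → ℂ} (hc : HasGrad E c cu cx)
    (hd : HasGrad E d du dx) : HasGrad E (fun X => c X * d X)
      (fun X => cu X * d X + c X * du X) (fun a X => cx a X * d X + c X * dx a X) :=
  ⟨fun X h => (hc.u X h).mul (hd.u X h), fun X h => ((hc.v X h).mul (hd.v X h)).congr_deriv
    (by simp),
    fun a X h => (hc.x a X h).mul (hd.x a X h)⟩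

theorem HasGrad.add {c cu d du : Pt n → ℂ} {cx dx : Fin n → Pt n → ℂ} (hc : HasGrad E c cu cx)
    (hd : HasGrad E d du dx) : HasGrad E (fun X => c X + d X)
      (fun X => cu X + du X) (fun a X => cx a X + dx a X) :=
  ⟨fun X h => (hc.u X h).add (hd.u X h), fun X h => ((hc.v X h).add (hd.v X h)).congr_deriv
    (by simp),
    fun a X h => (hc.x a X h).add (hd.x a X h)⟩

/-- The field `c Φ_k` with coefficient function `c`. -/
def dressed (E F : ℝ → Matrix (Fin n) (Fin n) ℝ) (k : Mom n) (c : Pt n → ℂ) (X : Pt n) : ℂ :=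
  c X * scalarMode E F k X

theorem hasPD_dressed_v {c : Pt n → ℂ} {X : Pt n} (hc : HasPD iv c 0 X) :
    HasPD iv (dressed E F k c) (dressed E F k (fun Y => Complex.I * k.1 * c Y) X) X :=
  (hc.mul (hasPD_scalarMode_v X)).congr_deriv (by simp only [dressed]; ring)

theorem hasPD_dressed_x (hE : IsVielbein H E) (hk : k.1 ≠ 0) {c : Pt n → ℂ} {cx : ℂ} {a : Fin n}
    {X : Pt n} (hX : Regular E (X iu)) (hc : HasPD (Sum.inr a) c cx X) :
    HasPD (Sum.inr a) (dressed E F k c)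
      ((cx + Complex.I * k.1 * velocity E k a X * c X) * scalarMode E F k X) X :=
  (hc.mul (hasPD_scalarMode_x hE hk hX a)).congr_deriv (by ring)

theorem hasPD_dressed_u (hE : IsVielbein H E) (hF : IsRosenIntegral E F R) (hk : k.1 ≠ 0)
    {c : Pt n → ℂ} {cu : ℂ} {X : Pt n} (hX : Regular E (X iu)) (hc : HasPD iu c cu X) :
    HasPD iu (dressed E F k c) ((cu + rate H E k X * c X) * scalarMode E F k X) X :=
  (hc.mul (hasPD_scalarMode_u hE hF hk hX)).congr_deriv (by ring)

theorem hasGrad_velocity (hE : IsVielbein H E) (a : Fin n) :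
    HasGrad E (fun X => (velocity E k a X : ℂ))
      (fun X => ∑ b, (shear E (X iu) a b : ℂ) * velocity E k b X - force H a X)
      (fun c X => (shear E (X iu) a c : ℂ)) :=
  ⟨fun X h => (hasPD_velocity_u hE h a).ofReal.congr_deriv (by simp [force]),
    fun X _ => (hasPD_velocity_v a X).ofReal.congr_deriv (by simp),
    fun c X _ => (hasPD_velocity_x a c X).ofReal⟩

theorem pol_iu (ε : Fin n → ℂ) (X : Pt n) : pol E ε k iu X = ∑ a, ε a * velocity E k a X := rfl

theorem pol_iv (ε : Fin n → ℂ) (X : Pt n) : pol E ε k iv X = 0 := rfl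

theorem pol_inr (ε : Fin n → ℂ) (a : Fin n) (X : Pt n) : pol E ε k (Sum.inr a) X = ε a := rfl

/-- The gradient of the only non-constant component of the polarisation, `q = ε · p`. -/
theorem hasGrad_pol (hE : IsVielbein H E) (ε : Fin n → ℂ) :
    HasGrad E (pol E ε k iu)
      (fun X => ∑ a, ε a * (∑ b, (shear E (X iu) a b : ℂ) * velocity E k b X - force H a X))
      (fun c X => ∑ a, ε a * (shear E (X iu) a c : ℂ)) := by
  have e : pol E ε k iu = fun X => ∑ a, ε a * (velocity E k a X : ℂ) := rfl
  rw [e]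
  exact ⟨fun X h => HasPD.sum fun a _ => ((hasGrad_velocity hE a).u X h).const_mul (ε a),
    fun X h => (HasPD.sum fun a _ => ((hasGrad_velocity hE a).v X h).const_mul (ε a)).congr_deriv
      (by simp),
    fun c X h => HasPD.sum fun a _ => ((hasGrad_velocity hE a).x c X h).const_mul (ε a)⟩

/-- The `dx^a` components need no regularity, since only the phase `k₀ v` is differentiated. -/
theorem gaugeMode_inr (hk : k.1 ≠ 0) (ε : Fin n → ℂ) (a : Fin n) (X : Pt n) :
    gaugeMode E F ε k (Sum.inr a) X = ε a * scalarMode E F k X := by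
  have := Complex.ofReal_ne_zero.2 hk
  simp only [gaugeMode, raise1, (hasPD_scalarMode_v X).pd_eq]
  field_simp

theorem gaugeMode_iv (ε : Fin n → ℂ) (X : Pt n) : gaugeMode E F ε k iv X = 0 := by
  simp [gaugeMode, raise1]

theorem gaugeMode_closed (hE : IsVielbein H E) (hk : k.1 ≠ 0) (ε : Fin n → ℂ) {X : Pt n}
    (hX : Regular E (X iu)) (μ : Idx n) :
    gaugeMode E F ε k μ X = pol E ε k μ X * scalarMode E F k X := by
  rcases μ with j | a
  · fin_cases j
    · have h0 := Complex.ofReal_ne_zero.2 hk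
      change (Complex.I * (k.1 : ℂ))⁻¹ * ∑ a, ε a * pd (Sum.inr a) (scalarMode E F k) X
        = pol E ε k iu X * scalarMode E F k X
      simp only [(hasPD_scalarMode_x hE hk hX _).pd_eq, pol_iu, Finset.mul_sum, Finset.sum_mul]
      refine Finset.sum_congr rfl fun a _ => ?_
      field_simp
    · change gaugeMode E F ε k iv X = pol E ε k iv X * scalarMode E F k X
      rw [gaugeMode_iv, pol_iv, zero_mul]
  · exact gaugeMode_inr hk ε a X

theorem IsVielbein.isOpen (hE : IsVielbein H E) : IsOpen {u | Regular E u} :=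
  isOpen_regular hE.isSolution.continuous

/-- The null condition `2 φ_u φ_v + H x x φ_v² = |∂_x φ|²`, read off from the gradient of `φ`. -/
theorem hamiltonJacobi (hE : IsVielbein H E) (hF : IsRosenIntegral E F R) (hk : k.1 ≠ 0) {X : Pt n}
    (hX : Regular E (X iu)) :
    ∑ μ, ∑ ν, invMetric H X μ ν * pd μ (phase E F k) X * pd ν (phase E F k) X = 0 := by
  simp only [mul_assoc]
  rw [sum_invMetric_mul_real H X (fun μ ν => pd μ (phase E F k) X * pd ν (phase E F k) X)]
  simp only [(hasPD_phase_u hE hF hk hX).pd_eq, (hasPD_phase_v X).pd_eq,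
    (hasPD_phase_x hE hk hX _).pd_eq]
  have : ∑ a, k.1 * velocity E k a X * (k.1 * velocity E k a X)
      = k.1 ^ 2 * ∑ a, velocity E k a X ^ 2 := by
    rw [Finset.mul_sum]; exact Finset.sum_congr rfl fun a _ => by ring
  rw [this]; ring

theorem hasPD_quad_v (H : ℝ → Matrix (Fin n) (Fin n) ℝ) (X : Pt n) :
    HasPD iv (fun Y : Pt n => (quad (H (Y iu)) (trans Y) : ℂ)) 0 X := by
  have h := (hasPD_metric_uu_v (H := H) X).neg.ofReal
  simpa [metric_uu] using h

theorem hasPD_rate_v (X : Pt n) : HasPD iv (rate H E k) 0 X := by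
  have h1 := (((HasPD.sum (s := Finset.univ) fun a _ =>
    ((hasPD_velocity_v (E := E) (k := k) a X).ofReal.mul
      (hasPD_velocity_v (E := E) (k := k) a X).ofReal)).sub (hasPD_quad_v H X)).const_mul
      (Complex.I * k.1 / 2)).add ((HasPD.sum (s := Finset.univ) fun a _ =>
        hasPD_comp_u_ne (μ := iv) iv_ne_iu (fun u => (shear E u a a : ℂ)) X).const_mul (1 / 2))
  refine HasPD.congr (U := Set.univ) isOpen_univ trivial (fun Y _ => ?_)
    (h1.congr_deriv (by simp))
  simp only [rate, sq]

/-- The wave operator on `c Φ_k`, possibly with an extra term `d Φ_k` in the `u`-derivative coming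
from the connection: since `Φ_k` is annihilated only derivatives of `c` survive. -/
theorem boxOf_dressed (hE : IsVielbein H E) (hF : IsRosenIntegral E F R) (hk : k.1 ≠ 0)
    {c cu d : Pt n → ℂ} {cx : Fin n → Pt n → ℂ} {cxx : Fin n → ℂ} (hc : HasGrad E c cu cx)
    {B : Idx n → Pt n → ℂ} {X : Pt n} (hX : Regular E (X iu))
    (hcu : HasPD iv cu 0 X) (hd : HasPD iv d 0 X)
    (hcxx : ∀ a, HasPD (Sum.inr a) (cx a) (cxx a) X)
    (hBv : ∀ Y : Pt n, Regular E (Y iu) → B iv Y = pd iv (dressed E F k c) Y)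
    (hBu : ∀ Y : Pt n, Regular E (Y iu) →
      B iu Y = pd iu (dressed E F k c) Y + d Y * scalarMode E F k Y)
    (hBx : ∀ a, ∀ Y : Pt n, Regular E (Y iu) → B (Sum.inr a) Y = pd (Sum.inr a) (dressed E F k c)
      Y) :
    boxOf H B X = (2 * (Complex.I * k.1) * (cu X - ∑ a, (velocity E k a X : ℂ) * cx a X)
      + Complex.I * k.1 * d X - ∑ a, cxx a) * scalarMode E F k X := by
  have hO := hE.isOpen
  have hrate := hasPD_rate_v (H := H) (E := E) (k := k) X
  have e1 : pd iu (B iv) X = Complex.I * k.1 * (cu X + rate H E k X * c X) * scalarMode E F k X :=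
    by
    refine (HasPD.congr hO hX (fun Y hY => (hBv Y hY).trans (hasPD_dressed_v (hc.v Y hY)).pd_eq)
      (hasPD_dressed_u hE hF hk hX ((hc.u X hX).const_mul (Complex.I * k.1)))).pd_eq.trans ?_
    ring
  have e2 : pd iv (B iv) X = (Complex.I * k.1) ^ 2 * c X * scalarMode E F k X := by
    refine (HasPD.congr hO hX (fun Y hY => (hBv Y hY).trans (hasPD_dressed_v (hc.v Y hY)).pd_eq)
      (hasPD_dressed_v (((hc.v X hX).const_mul (Complex.I * k.1)).congr_deriv
        (mul_zero _)))).pd_eq.trans ?_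
    simp only [dressed]; ring
  have e3 : pd iv (B iu) X
      = Complex.I * k.1 * (cu X + rate H E k X * c X + d X) * scalarMode E F k X := by
    have h : HasPD iv (fun Y => cu Y + rate H E k Y * c Y + d Y) 0 X :=
      ((hcu.add (hrate.mul (hc.v X hX))).add hd).congr_deriv (by simp)
    refine (HasPD.congr hO hX (fun Y hY => ?_)
      (hasPD_dressed_v (E := E) (F := F) (k := k) h)).pd_eq.trans ?_
    · rw [hBu Y hY, (hasPD_dressed_u hE hF hk hY (hc.u Y hY)).pd_eq]
      simp only [dressed]; ring
    · simp only [dressed]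
  have e4 : ∀ a, pd (Sum.inr a) (B (Sum.inr a)) X = (cxx a
      + Complex.I * k.1 * (shear E (X iu) a a * c X + 2 * (velocity E k a X * cx a X))
      + (Complex.I * k.1) ^ 2 * velocity E k a X ^ 2 * c X) * scalarMode E F k X := by
    intro a
    have h : HasPD (Sum.inr a) (fun Y => cx a Y + Complex.I * k.1 * (velocity E k a Y * c Y)) _ X :=
      (hcxx a).add (((hasPD_velocity_x a a X).ofReal.mul (hc.x a X hX)).const_mul (Complex.I * k.1))
    refine (HasPD.congr hO hX (fun Y hY => ?_)
      (hasPD_dressed_x (F := F) hE hk hX h)).pd_eq.trans ?_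
    · rw [hBx a Y hY, (hasPD_dressed_x hE hk hY (hc.x a Y hY)).pd_eq]
      simp only [dressed]; ring
    · ring
  rw [boxOf, e1, e2, e3]
  simp only [e4]
  rw [← Finset.sum_mul]
  simp only [Finset.sum_add_distrib, mul_add, ← Finset.mul_sum, ← Finset.sum_mul]
  simp only [rate]
  ring

/-- Since `|det g| = 1`, the wave operator is `boxOf` of the gradient. -/
theorem waveOp_eq (H : ℝ → Matrix (Fin n) (Fin n) ℝ) (Φ : Pt n → ℂ) {X : Pt n}
    {Φv Φu : ℂ} (h1 : HasPD iv (pd iv Φ) Φv X) (h2 : HasPD iv (pd iu Φ) Φu X) :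
    waveOp H Φ X = boxOf H (fun μ => pd μ Φ) X := by
  simp only [waveOp, sqrt_abs_det_metric, Complex.ofReal_one, inv_one, one_mul, sum_invMetric_row]
  rw [sum_idx]
  have hquad := hasPD_quad_v H X
  have h3 := (h2.add (hquad.mul h1)).pd_eq
  have h4 : ∀ a, pd (Sum.inr a) (fun Y => -pd (Sum.inr a) Φ Y) X
      = -pd (Sum.inr a) (pd (Sum.inr a) Φ) X := fun a => deriv.fun_neg
  simp only [boxOf, h4, Finset.sum_neg_distrib]
  change pd iu (pd iv Φ) X + pd iv (fun Y => pd iu Φ Y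
    + (quad (H (Y iu)) (trans Y) : ℂ) * pd iv Φ Y) X + _ = _
  rw [h3, h1.pd_eq, h2.pd_eq]; ring

theorem scalarMode_eq_dressed : scalarMode E F k = dressed E F k fun _ => 1 := by
  funext X; simp [dressed]

/-- `Ω̇ / Ω` is half the trace of the deformation tensor, which cancels the divergence of the rays
`velocity`; this is contained in `boxOf_dressed` with constant coefficient. -/
theorem scalarMode_wave (hE : IsVielbein H E) (hF : IsRosenIntegral E F R) (hk : k.1 ≠ 0)
    {X : Pt n} (hX : Regular E (X iu)) : waveOp H (scalarMode E F k) X = 0 := by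
  have hO := hE.isOpen
  have h1 : HasPD iv (pd iv (scalarMode E F k)) _ X := HasPD.congr hO hX
    (fun Y _ => (hasPD_scalarMode_v Y).pd_eq)
    ((hasPD_scalarMode_v X).const_mul (Complex.I * k.1))
  have h2 : HasPD iv (pd iu (scalarMode E F k)) _ X := HasPD.congr hO hX
    (fun Y hY => (hasPD_scalarMode_u hE hF hk hY).pd_eq)
    ((hasPD_rate_v X).mul (hasPD_scalarMode_v X))
  rw [waveOp_eq H _ h1 h2, boxOf_dressed hE hF hk (hasGrad_const E 1) hX (hasPD_const _ 0 X)
    (d := fun _ => 0) (cxx := fun _ => 0) (hasPD_const _ 0 X) (fun a => hasPD_const _ 0 X)]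
  · simp
  · intro Y _; rw [scalarMode_eq_dressed]
  · intro Y _; rw [scalarMode_eq_dressed, zero_mul, add_zero]
  · intro a Y _; rw [scalarMode_eq_dressed]

end FieldEquations

/-! ### Gauge fields -/

section GaugeField

variable {H E F : ℝ → Matrix (Fin n) (Fin n) ℝ} {k : Mom n} {R : Set ℝ}

/-- The `u`-derivative of `q = ε · p`. -/
def polRate (H E : ℝ → Matrix (Fin n) (Fin n) ℝ) (ε : Fin n → ℂ) (k : Mom n) (X : Pt n) : ℂ :=
  ∑ a, ε a * (∑ b, (shear E (X iu) a b : ℂ) * velocity E k b X - force H a X)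

theorem hasPD_force_v (a : Fin n) (X : Pt n) : HasPD iv (force H a) 0 X := by
  refine (HasPD.ofReal (HasPD.sum (s := Finset.univ) fun b _ => (hasPD_comp_u_ne (μ := iv) iv_ne_iu
    (fun u => H u a b) X).mul (hasPD_coord_ne (inr_ne_iv b) X))).congr_deriv ?_
  simp

theorem hasPD_polRate_v (ε : Fin n → ℂ) (X : Pt n) : HasPD iv (polRate H E ε k) 0 X := by
  refine (HasPD.sum (s := Finset.univ) fun a _ => HasPD.const_mul (ε a)
    (HasPD.sub (HasPD.sum (s := Finset.univ) fun b _ => (hasPD_comp_u_ne (μ := iv) iv_ne_iu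
      (fun u => (shear E u a b : ℂ)) X).mul (hasPD_velocity_v b X).ofReal)
    (hasPD_force_v a X))).congr_deriv ?_
  simp

/-- The contraction `ε_b σ_ba`. -/
def polShear (E : ℝ → Matrix (Fin n) (Fin n) ℝ) (ε : Fin n → ℂ) (a : Fin n) (X : Pt n) : ℂ :=
  ∑ b, ε b * (shear E (X iu) b a : ℂ)

theorem hasPD_polShear_x (ε : Fin n → ℂ) (a c : Fin n) (X : Pt n) :
    HasPD (Sum.inr c) (polShear E ε a) 0 X :=
  (HasPD.sum (s := Finset.univ) fun b _ => (hasPD_comp_u_ne (inr_ne_iu c)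
    (fun u => (shear E u b a : ℂ)) X).const_mul (ε b)).congr_deriv (by simp)

/-- The change of `ε_u` along the rays `velocity` is its rate of change along `u` plus the force. -/
theorem sum_velocity_mul_polShear (ε : Fin n → ℂ) (X : Pt n) :
    ∑ a, (velocity E k a X : ℂ) * polShear E ε a X
      = polRate H E ε k X + ∑ a, force H a X * ε a := by
  simp only [polRate, polShear, mul_sub, Finset.sum_sub_distrib, Finset.mul_sum]
  rw [Finset.sum_comm]
  have : ∑ a, force H a X * ε a = ∑ a, ε a * force H a X :=
    Finset.sum_congr rfl fun a _ => mul_comm _ _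
  rw [this, sub_add_cancel]
  exact Finset.sum_congr rfl fun b _ => Finset.sum_congr rfl fun a _ => by ring

theorem hasPD_rate_x (hH : ∀ u, (H u).IsSymm) (X : Pt n) (c : Fin n) : HasPD (Sum.inr c)
    (rate H E k)
      (Complex.I * k.1 * (∑ a, (velocity E k a X : ℂ) * shear E (X iu) a c - force H c X)) X := by
  have hq : HasPD (Sum.inr c) (fun Y : Pt n => (quad (H (Y iu)) (trans Y) : ℂ))
      (2 * force H c X) X := by
    have h := (hasPD_metric_uu_x hH c X).neg.ofReal
    simp only [metric_uu, neg_neg] at h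
    exact h.congr_deriv (by simp [force])
  have h1 := (((HasPD.sum (s := Finset.univ) fun a _ =>
    ((hasPD_velocity_x (E := E) (k := k) a c X).ofReal.mul
      (hasPD_velocity_x (E := E) (k := k) a c X).ofReal)).sub hq).const_mul
      (Complex.I * k.1 / 2)).add ((HasPD.sum (s := Finset.univ) fun a _ =>
        hasPD_comp_u_ne (inr_ne_iu c) (fun u => (shear E u a a : ℂ)) X).const_mul (1 / 2))
  refine HasPD.congr (U := Set.univ) isOpen_univ trivial (fun Y _ => ?_) (h1.congr_deriv ?_)
  · simp only [rate, sq]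
  · simp only [Finset.sum_add_distrib, Finset.sum_const_zero]
    have : ∑ a, (shear E (X iu) a c : ℂ) * velocity E k a X
        = ∑ a, (velocity E k a X : ℂ) * shear E (X iu) a c :=
      Finset.sum_congr rfl fun a _ => mul_comm _ _
    rw [this]; ring

theorem hasPD_gaugeMode_u_v (hE : IsVielbein H E) (hk : k.1 ≠ 0) (ε : Fin n → ℂ) {X : Pt n}
    (hX : Regular E (X iu)) : HasPD iv (gaugeMode E F ε k iu)
    (Complex.I * k.1 * pol E ε k iu X * scalarMode E F k X) X :=
  HasPD.congr hE.isOpen hX (fun _ hY => gaugeMode_closed hE hk ε hY iu)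
    (hasPD_dressed_v ((hasGrad_pol hE ε).v X hX))

theorem hasPD_gaugeMode_u_x (hE : IsVielbein H E) (hk : k.1 ≠ 0) (ε : Fin n → ℂ) {X : Pt n}
    (hX : Regular E (X iu)) (c : Fin n) :
    HasPD (Sum.inr c) (gaugeMode E F ε k iu) ((polShear E ε c X
      + Complex.I * k.1 * velocity E k c X * pol E ε k iu X) * scalarMode E F k X) X :=
  HasPD.congr hE.isOpen hX (fun _ hY => gaugeMode_closed hE hk ε hY iu)
    (hasPD_dressed_x hE hk hX ((hasGrad_pol hE ε).x c X hX))

theorem hasPD_gaugeMode_x_v (hk : k.1 ≠ 0) (ε : Fin n → ℂ) (X : Pt n) (a : Fin n) :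
    HasPD iv (gaugeMode E F ε k (Sum.inr a)) (Complex.I * k.1 * ε a * scalarMode E F k X) X :=
  HasPD.congr isOpen_univ trivial (fun Y _ => gaugeMode_inr hk ε a Y)
    (((hasPD_scalarMode_v X).const_mul (ε a)).congr_deriv (by ring))

theorem hasPD_gaugeMode_x_x (hE : IsVielbein H E) (hk : k.1 ≠ 0) (ε : Fin n → ℂ) {X : Pt n}
    (hX : Regular E (X iu)) (a c : Fin n) : HasPD (Sum.inr c) (gaugeMode E F ε k (Sum.inr a))
      (Complex.I * k.1 * velocity E k c X * ε a * scalarMode E F k X) X :=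
  HasPD.congr isOpen_univ trivial (fun Y _ => gaugeMode_inr hk ε a Y)
    (((hasPD_scalarMode_x hE hk hX c).const_mul (ε a)).congr_deriv (by ring))

theorem hasPD_gaugeMode_x_u (hE : IsVielbein H E) (hF : IsRosenIntegral E F R) (hk : k.1 ≠ 0)
    (ε : Fin n → ℂ) {X : Pt n} (hX : Regular E (X iu)) (a : Fin n) :
    HasPD iu (gaugeMode E F ε k (Sum.inr a)) (rate H E k X * ε a * scalarMode E F k X) X :=
  HasPD.congr isOpen_univ trivial (fun Y _ => gaugeMode_inr hk ε a Y)
    (((hasPD_scalarMode_u hE hF hk hX).const_mul (ε a)).congr_deriv (by ring))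

theorem pd_gaugeMode_v (ε : Fin n → ℂ) (μ : Idx n) (X : Pt n) :
    pd μ (gaugeMode E F ε k iv) X = 0 := by
  have : gaugeMode E F ε k iv = fun _ => 0 := funext fun X => gaugeMode_iv ε X
  rw [this, pd_const]

theorem pd_gaugeMode_u (hE : IsVielbein H E) (hk : k.1 ≠ 0) (ε : Fin n → ℂ) {X : Pt n}
    (hX : Regular E (X iu)) (μ : Idx n) :
    pd μ (gaugeMode E F ε k iu) X = pd μ (dressed E F k (pol E ε k iu)) X :=
  pd_congr hE.isOpen hX fun _ hY => gaugeMode_closed hE hk ε hY iu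

theorem pd_gaugeMode_x (hk : k.1 ≠ 0) (ε : Fin n → ℂ) (a : Fin n) (X : Pt n) (μ : Idx n) :
    pd μ (gaugeMode E F ε k (Sum.inr a)) X = pd μ (dressed E F k fun _ => ε a) X :=
  pd_congr isOpen_univ trivial fun Y _ => gaugeMode_inr hk ε a Y

theorem gaugeMode_divergence_sum (hE : IsVielbein H E) (hk : k.1 ≠ 0) (ε : Fin n → ℂ) {X : Pt n}
    (hX : Regular E (X iu)) :
    pd iv (gaugeMode E F ε k iu) X - ∑ a, pd (Sum.inr a) (gaugeMode E F ε k (Sum.inr a)) X = 0 := by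
  rw [(hasPD_gaugeMode_u_v hE hk ε hX).pd_eq]
  simp only [(hasPD_gaugeMode_x_x hE hk ε hX _ _).pd_eq, pol_iu, Finset.mul_sum, Finset.sum_mul,
    ← Finset.sum_sub_distrib]
  exact Finset.sum_eq_zero fun a _ => by ring

theorem gaugeMode_onshell (hE : IsVielbein H E) (hk : k.1 ≠ 0) (ε : Fin n → ℂ) {X : Pt n}
    (hX : Regular E (X iu)) :
    ∑ μ, ∑ ν, (invMetric H X μ ν : ℂ) * pol E ε k μ X * ((pd ν (phase E F k) X : ℝ) : ℂ) = 0 := by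
  simp only [mul_assoc]
  rw [sum_invMetric_mul H X (fun μ ν => pol E ε k μ X * ((pd ν (phase E F k) X : ℝ) : ℂ))]
  simp only [(hasPD_phase_v X).pd_eq, (hasPD_phase_x hE hk hX _).pd_eq, pol_iv, pol_inr, pol_iu,
    Finset.sum_mul, zero_mul, mul_zero, add_zero, ← Finset.sum_sub_distrib]
  exact Finset.sum_eq_zero fun a _ => by push_cast; ring

theorem gaugeMode_lorenz (hH : ∀ u, (H u).IsSymm) (hE : IsVielbein H E) (hk : k.1 ≠ 0)
    (ε : Fin n → ℂ) {X : Pt n} (hX : Regular E (X iu)) :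
    ∑ μ, ∑ ν, (invMetric H X μ ν : ℂ) * cov1 H (gaugeMode E F ε k) μ ν X = 0 := by
  rw [sum_invMetric_mul H X (fun μ ν => cov1 H (gaugeMode E F ε k) μ ν X)]
  simp only [cov1_of_lightcone hH _ (gaugeMode_iv ε X), pd_gaugeMode_v]
  simpa using gaugeMode_divergence_sum hE hk ε hX

theorem gaugeMode_divergence (hE : IsVielbein H E) (hk : k.1 ≠ 0) (ε : Fin n → ℂ) {X : Pt n}
    (hX : Regular E (X iu)) :
    ∑ μ, pd μ (fun Y => ∑ ν, (invMetric H Y μ ν : ℂ) * gaugeMode E F ε k ν Y) X = 0 := by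
  have h4 : ∀ a, pd (Sum.inr a) (fun Y => -gaugeMode E F ε k (Sum.inr a) Y) X
      = -pd (Sum.inr a) (gaugeMode E F ε k (Sum.inr a)) X := fun a => deriv.fun_neg
  simp only [sum_invMetric_row, gaugeMode_iv, mul_zero, add_zero]
  rw [sum_idx]
  simp only [h4, Finset.sum_neg_distrib]
  simpa [pd_const, ← sub_eq_add_neg] using gaugeMode_divergence_sum hE hk ε hX

/-- The box of `ε_μ Φ` is computed by `boxOf_dressed` with coefficient `ε_μ`; the term from the
force in the connection cancels the failure of `ε_u` to be transported along the rays. -/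
theorem gaugeMode_wave (hH : ∀ u, (H u).IsSymm) (hE : IsVielbein H E) (hF : IsRosenIntegral E F R)
    (hk : k.1 ≠ 0) (ε : Fin n → ℂ) {X : Pt n} (hX : Regular E (X iu)) (μ : Idx n) :
    ∑ α, ∑ β, (invMetric H X α β : ℂ) * cov2 H (cov1 H (gaugeMode E F ε k)) α β μ X = 0 := by
  have hA := fun Y => gaugeMode_iv (E := E) (F := F) (k := k) ε Y
  have hcov : ∀ μ α Y, cov1 H (gaugeMode E F ε k) μ α Y = _ :=
    fun μ α Y => cov1_of_lightcone hH _ (hA Y) μ α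
  rw [sum_cov2 hH _ (by rw [hcov]; simp [pd_gaugeMode_v])]
  rcases μ with j | b
  · fin_cases j
    · change boxOf H (fun β => cov1 H (gaugeMode E F ε k) β iu) X + (if (iu : Idx n) = iu then
        ∑ a, force H a X * (cov1 H (gaugeMode E F ε k) iv (Sum.inr a) X
          - cov1 H (gaugeMode E F ε k) (Sum.inr a) iv X) else 0) = 0
      rw [boxOf_dressed hE hF hk (hasGrad_pol (k := k) hE ε) hX (hasPD_polRate_v ε X)
        (d := fun Y => ∑ a, force H a Y * ε a) (cxx := fun _ => 0)
        ((HasPD.sum (s := Finset.univ) fun a _ => (hasPD_force_v a X).mul_const (ε a)).congr_deriv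
          (by simp))
        (fun a => hasPD_polShear_x ε a a X)
        (fun Y hY => by rw [hcov]; simp [pd_gaugeMode_u hE hk ε hY])
        (fun Y hY => by
          rw [hcov]
          simp [pd_gaugeMode_u hE hk ε hY, gaugeMode_inr hk, Finset.sum_mul, mul_assoc])
        (fun a Y hY => by rw [hcov]; simp [pd_gaugeMode_u hE hk ε hY])]
      have h1 := sum_velocity_mul_polShear (H := H) (E := E) (k := k) ε X
      simp only [polRate, polShear] at h1
      have h2 : ∑ a, force H a X * (Complex.I * k.1 * ε a * scalarMode E F k X)
          = Complex.I * k.1 * (∑ a, force H a X * ε a) * scalarMode E F k X := by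
        rw [Finset.mul_sum, Finset.sum_mul]
        exact Finset.sum_congr rfl fun a _ => by ring
      simp only [hcov, (hasPD_gaugeMode_x_v hk ε X _).pd_eq, h1, pd_gaugeMode_v]
      simp only [inr_ne_iu, and_false, if_false, add_zero, if_true, sub_zero, iv_ne_iu, h2,
        Finset.sum_const_zero]
      ring
    · have h0 : ∀ β, (fun Y => cov1 H (gaugeMode E F ε k) β iv Y) = fun _ => 0 := fun β =>
        funext fun Y => by rw [hcov]; simp [pd_gaugeMode_v]
      change boxOf H (fun β => cov1 H (gaugeMode E F ε k) β iv) X + _ = 0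
      simp [boxOf, h0, pd_const]
  · rw [boxOf_dressed hE hF hk (hasGrad_const E (ε b)) hX (hasPD_const _ 0 X)
      (d := fun _ => 0) (cxx := fun _ => 0) (hasPD_const _ 0 X) (fun a => hasPD_const _ 0 X)
      (fun Y hY => by rw [hcov]; simp [pd_gaugeMode_x hk])
      (fun Y hY => by rw [hcov]; simp [pd_gaugeMode_x hk])
      (fun a Y hY => by rw [hcov]; simp [pd_gaugeMode_x hk])]
    simp

theorem fieldStrength_vu (hE : IsVielbein H E) (hk : k.1 ≠ 0) (ε : Fin n → ℂ) {X : Pt n}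
    (hX : Regular E (X iu)) : fieldStrength (gaugeMode E F ε k) iv iu X
      = dressed E F k (fun Y => Complex.I * k.1 * pol E ε k iu Y) X := by
  simp [fieldStrength, pd_gaugeMode_v, (hasPD_gaugeMode_u_v hE hk ε hX).pd_eq, dressed]

theorem fieldStrength_vx (hk : k.1 ≠ 0) (ε : Fin n → ℂ) (a : Fin n) (X : Pt n) :
    fieldStrength (gaugeMode E F ε k) iv (Sum.inr a) X
      = dressed E F k (fun _ => Complex.I * k.1 * ε a) X := by
  simp [fieldStrength, pd_gaugeMode_v, (hasPD_gaugeMode_x_v hk ε X a).pd_eq, dressed]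

theorem fieldStrength_xu (hE : IsVielbein H E) (hF : IsRosenIntegral E F R) (hk : k.1 ≠ 0)
    (ε : Fin n → ℂ) (a : Fin n) {X : Pt n} (hX : Regular E (X iu)) :
    fieldStrength (gaugeMode E F ε k) (Sum.inr a) iu X = dressed E F k (fun Y => polShear E ε a Y
      + Complex.I * k.1 * (velocity E k a Y * pol E ε k iu Y) - rate H E k Y * ε a) X := by
  simp only [fieldStrength, (hasPD_gaugeMode_u_x hE hk ε hX a).pd_eq,
    (hasPD_gaugeMode_x_u hE hF hk ε hX a).pd_eq, dressed]
  ring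

theorem fieldStrength_xx (hE : IsVielbein H E) (hk : k.1 ≠ 0)
    (ε : Fin n → ℂ) (a b : Fin n) {X : Pt n} (hX : Regular E (X iu)) :
    fieldStrength (gaugeMode E F ε k) (Sum.inr a) (Sum.inr b) X = dressed E F k (fun Y =>
      Complex.I * k.1 * (velocity E k a Y * ε b - velocity E k b Y * ε a)) X := by
  simp only [fieldStrength, (hasPD_gaugeMode_x_x hE hk ε hX _ _).pd_eq, dressed]
  ring

theorem fieldStrength_antisymm (A : Idx n → Pt n → ℂ) (μ ν : Idx n) (X : Pt n) :
    fieldStrength A μ ν X = -fieldStrength A ν μ X := by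
  simp [fieldStrength]

theorem pd_neg (μ : Idx n) (f : Pt n → ℂ) (X : Pt n) : pd μ (fun Y => -f Y) X = -pd μ f X :=
  deriv.fun_neg

theorem sum_maxwell_u (κ q r Φ : ℂ) (v d m g e : Fin n → ℂ) :
    ∑ x, (0 + κ * (d x * q + v x * m x) - κ * g x * e x
      + κ * v x * (m x + κ * (v x * q) - r * e x)) * Φ
      = (κ * (q * ∑ x, d x + 2 * ∑ x, v x * m x) - κ * ∑ x, e x * g x
        + κ ^ 2 * q * ∑ x, v x ^ 2 - κ * r * ∑ x, e x * v x) * Φ := by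
  simp only [Finset.mul_sum, Finset.sum_mul, ← Finset.sum_add_distrib, ← Finset.sum_sub_distrib]
  exact Finset.sum_congr rfl fun x _ => by ring

theorem sum_maxwell_x (κ e' v' Φ : ℂ) (v d s e : Fin n → ℂ) :
    ∑ x, (κ * (d x * e' - s x * e x) + κ * v x * (κ * (v x * e' - v' * e x))) * Φ
      = (κ * (e' * ∑ x, d x - ∑ x, e x * s x)
        + κ ^ 2 * (e' * ∑ x, v x ^ 2 - v' * ∑ x, e x * v x)) * Φ := by
  simp only [Finset.mul_sum, Finset.sum_mul, ← Finset.sum_add_distrib, ← Finset.sum_sub_distrib]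
  exact Finset.sum_congr rfl fun x _ => by ring

/-- The divergence of the field strength, from its components `F_{vu}`, `F_{vx}`, `F_{xu}`,
`F_{xx}`; the partial derivatives of second order combine as in the wave equation. -/
theorem gaugeMode_maxwell (hH : ∀ u, (H u).IsSymm) (hE : IsVielbein H E)
    (hF : IsRosenIntegral E F R) (hk : k.1 ≠ 0) (ε : Fin n → ℂ) {X : Pt n}
    (hX : Regular E (X iu)) (μ : Idx n) :
    ∑ α, ∑ β, (invMetric H X α β : ℂ) *
      cov2 H (fieldStrength (gaugeMode E F ε k)) α β μ X = 0 := by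
  have hO := hE.isOpen
  set A := gaugeMode E F ε k with hA
  have hdiag : ∀ μ, fieldStrength A μ μ = fun _ => 0 := fun μ => funext fun Y => by
    simp [fieldStrength]
  have hanti : ∀ μ ν, fieldStrength A μ ν = fun Y => -fieldStrength A ν μ Y := fun μ ν =>
    funext fun Y => fieldStrength_antisymm A μ ν Y
  have hvx_v : ∀ a, HasPD iv (fieldStrength A iv (Sum.inr a)) _ X := fun a =>
    HasPD.congr hO hX (fun Y _ => fieldStrength_vx hk ε a Y) (hasPD_dressed_v (hasPD_const _ _ X))
  have hvx_x : ∀ a c, HasPD (Sum.inr c) (fieldStrength A iv (Sum.inr a)) _ X := fun a c =>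
    HasPD.congr hO hX (fun Y _ => fieldStrength_vx hk ε a Y)
      (hasPD_dressed_x hE hk hX (hasPD_const _ _ X))
  have hvx_u : ∀ a, HasPD iu (fieldStrength A iv (Sum.inr a)) _ X := fun a =>
    HasPD.congr hO hX (fun Y _ => fieldStrength_vx hk ε a Y)
      (hasPD_dressed_u hE hF hk hX (hasPD_const _ _ X))
  have hvu_v : HasPD iv (fieldStrength A iv iu) _ X :=
    HasPD.congr hO hX (fun Y hY => fieldStrength_vu hE hk ε hY)
      (hasPD_dressed_v ((((hasGrad_pol hE ε).v X hX).const_mul _).congr_deriv (mul_zero _)))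
  have hvu_u : HasPD iu (fieldStrength A iv iu) _ X :=
    HasPD.congr hO hX (fun Y hY => fieldStrength_vu hE hk ε hY)
      (hasPD_dressed_u hE hF hk hX (((hasGrad_pol hE ε).u X hX).const_mul _))
  have hxu_x : ∀ a, HasPD (Sum.inr a) (fieldStrength A (Sum.inr a) iu) _ X := fun a =>
    HasPD.congr hO hX (fun Y hY => fieldStrength_xu hE hF hk ε a hY)
      (hasPD_dressed_x hE hk hX (((hasPD_polShear_x ε a a X).add
        (((hasPD_velocity_x a a X).ofReal.mul ((hasGrad_pol hE ε).x a X hX)).const_mul _)).sub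
          ((hasPD_rate_x hH X a).mul_const _)))
  have hpolS_v : ∀ a, HasPD iv (polShear E ε a) 0 X := fun a =>
    (HasPD.sum (s := Finset.univ) fun b _ => (hasPD_comp_u_ne (μ := iv) iv_ne_iu
      (fun u => (shear E u b a : ℂ)) X).const_mul (ε b)).congr_deriv (by simp)
  have hxu_v : ∀ a, HasPD iv (fieldStrength A (Sum.inr a) iu) _ X := fun a =>
    HasPD.congr hO hX (fun Y hY => fieldStrength_xu hE hF hk ε a hY)
      (hasPD_dressed_v ((((hpolS_v a).add (((hasPD_velocity_v a X).ofReal.mul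
        ((hasGrad_pol hE ε).v X hX)).const_mul _)).sub
          ((hasPD_rate_v X).mul_const _)).congr_deriv (by simp)))
  have hxx_x : ∀ a b, HasPD (Sum.inr a) (fieldStrength A (Sum.inr a) (Sum.inr b)) _ X := fun a b =>
    HasPD.congr hO hX (fun Y hY => fieldStrength_xx hE hk ε a b hY)
      (hasPD_dressed_x hE hk hX ((((hasPD_velocity_x a a X).ofReal.mul_const _).sub
        ((hasPD_velocity_x b a X).ofReal.mul_const _)).const_mul _))
  rw [sum_cov2 hH _ (by rw [hdiag])]
  have h1 := sum_velocity_mul_polShear (H := H) (E := E) (k := k) ε X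
  set Φ := scalarMode E F k X with hΦ
  rcases μ with j | b
  · fin_cases j
    · change boxOf H (fun β => fieldStrength A β iu) X + (if (iu : Idx n) = iu then
        ∑ a, force H a X * (fieldStrength A iv (Sum.inr a) X
          - fieldStrength A (Sum.inr a) iv X) else 0) = 0
      simp only [boxOf, hdiag, pd_const, hvu_v.pd_eq, hvu_u.pd_eq, (hxu_x _).pd_eq,
        hanti (Sum.inr _) iv, if_true, sub_neg_eq_add]
      have e1 : ∑ a, force H a X * (fieldStrength A iv (Sum.inr a) X
          + fieldStrength A iv (Sum.inr a) X)
          = 2 * (Complex.I * k.1) * (∑ a, force H a X * ε a) * Φ := by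
        simp only [hA, fieldStrength_vx hk, dressed, ← hΦ]
        rw [Finset.mul_sum, Finset.sum_mul]
        exact Finset.sum_congr rfl fun a _ => by ring
      have e2 : ∑ a, ε a * (∑ b, (velocity E k b X : ℂ) * shear E (X iu) b a - force H a X)
          = polRate H E ε k X := by
        refine Finset.sum_congr rfl fun a _ => ?_
        congr 2
        refine Finset.sum_congr rfl fun b _ => ?_
        rw [show shear E (X iu) b a = shear E (X iu) a b from
          congrFun (congrFun (hE.shear_symm hX) a) b, mul_comm]
      have hs : ∀ c, ∑ a, ε a * (shear E (X iu) a c : ℂ) = polShear E ε c X := fun _ => rfl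
      have hr : ∑ a, ε a * (∑ b, (shear E (X iu) a b : ℂ) * velocity E k b X - force H a X)
        = polRate H E ε k X := rfl
      simp only [hs, hr]
      rw [e1, sum_maxwell_u (Complex.I * k.1) _ _ _ (fun a => (velocity E k a X : ℂ))
        (fun a => (shear E (X iu) a a : ℂ)) _ (fun c => ∑ a, (velocity E k a X : ℂ)
          * (shear E (X iu) a c : ℂ) - force H c X) ε, h1, e2, ← pol_iu ε X]
      simp only [dressed, rate, ← hΦ]
      ring
    · change boxOf H (fun β => fieldStrength A β iv) X
        + (if (iv : Idx n) = iu then _ else 0) = 0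
      simp only [boxOf, hdiag, pd_const, hvu_v.pd_eq, hanti _ iv, pd_neg, (hvx_x _ _).pd_eq]
      rw [if_neg (show ¬ ((iv : Idx n) = iu) from iv_ne_iu)]
      have e3 : ∑ a, Complex.I * k.1 * (velocity E k a X : ℂ) * (Complex.I * k.1 * ε a) * Φ
          = (Complex.I * k.1) ^ 2 * pol E ε k iu X * Φ := by
        rw [pol_iu, Finset.mul_sum, Finset.sum_mul]
        exact Finset.sum_congr rfl fun a _ => by ring
      simp only [Finset.sum_neg_distrib, zero_add, e3, dressed, ← hΦ]
      ring
  · change boxOf H (fun β => fieldStrength A β (Sum.inr b)) X + _ = 0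
    simp only [boxOf, hanti iu (Sum.inr b), pd_neg, (hvx_v _).pd_eq, (hvx_u _).pd_eq,
      (hxu_v _).pd_eq, (hxx_x _ _).pd_eq]
    rw [if_neg (inr_ne_iu b), sum_maxwell_x, ← pol_iu ε X]
    have e4 : ∑ a, ε a * (shear E (X iu) b a : ℂ) = polShear E ε b X :=
      Finset.sum_congr rfl fun a _ => by
        rw [show shear E (X iu) b a = shear E (X iu) a b from
          congrFun (congrFun (hE.shear_symm hX) a) b]
    rw [e4]
    simp only [dressed, rate, ← hΦ]
    ring

end GaugeField

/-! ### Gravitons -/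

section Graviton

variable {H E F : ℝ → Matrix (Fin n) (Fin n) ℝ} {k : Mom n} {R : Set ℝ}

theorem idx_cases (μ : Idx n) : μ = iu ∨ μ = iv ∨ ∃ a, μ = Sum.inr a := by
  rcases μ with j | a
  · fin_cases j
    · exact Or.inl rfl
    · exact Or.inr (Or.inl rfl)
  · exact Or.inr (Or.inr ⟨a, rfl⟩)

/-- The coefficient `q² - (i / k₀) ε σ ε` of the `du²` component of a graviton. -/
def gravCoeff (E : ℝ → Matrix (Fin n) (Fin n) ℝ) (ε : Fin n → ℂ) (k : Mom n) (X : Pt n) : ℂ :=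
  pol E ε k iu X * pol E ε k iu X
    + -(Complex.I / k.1) * ∑ a, ∑ b, ε a * ε b * (shear E (X iu) a b : ℂ)

theorem gravitonMode_v_left (ε : Fin n → ℂ) (μ : Idx n) (X : Pt n) :
    gravitonMode H E F ε k iv μ X = 0 := by
  simp [gravitonMode, raise2]

theorem gravitonMode_v_right (hH : ∀ u, (H u).IsSymm) (ε : Fin n → ℂ) (μ : Idx n) (X : Pt n) :
    gravitonMode H E F ε k μ iv X = 0 := by
  have h : ∀ μ, cov1 H (gaugeMode E F ε k) μ iv X = 0 := fun μ => by
    rw [cov1_of_lightcone hH _ (gaugeMode_iv ε X), pd_gaugeMode_v, if_neg (by simp), add_zero]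
  rcases idx_cases μ with rfl | rfl | ⟨a, rfl⟩ <;> simp [gravitonMode, raise2, h]

/-- As for the gauge field, the transverse components are the scalar mode at all points. -/
theorem gravitonMode_x_x (hH : ∀ u, (H u).IsSymm) (hk : k.1 ≠ 0) (ε : Fin n → ℂ) (a b : Fin n)
    (X : Pt n) : gravitonMode H E F ε k (Sum.inr a) (Sum.inr b) X
      = ε a * ε b * scalarMode E F k X := by
  have := Complex.ofReal_ne_zero.2 hk
  simp only [gravitonMode, raise2, cov1_of_lightcone hH _ (gaugeMode_iv ε X),
    (hasPD_gaugeMode_x_v hk ε X b).pd_eq]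
  rw [if_neg (by simp)]
  field_simp
  ring

theorem gravitonMode_x_u (hH : ∀ u, (H u).IsSymm) (hE : IsVielbein H E) (hk : k.1 ≠ 0)
    (ε : Fin n → ℂ) (a : Fin n) {X : Pt n} (hX : Regular E (X iu)) :
    gravitonMode H E F ε k (Sum.inr a) iu X = ε a * pol E ε k iu X * scalarMode E F k X := by
  have := Complex.ofReal_ne_zero.2 hk
  simp only [gravitonMode, raise2, cov1_of_lightcone hH _ (gaugeMode_iv ε X),
    (hasPD_gaugeMode_u_v hE hk ε hX).pd_eq]
  rw [if_neg (by simp)]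
  field_simp
  ring

theorem gravitonMode_u_x (hH : ∀ u, (H u).IsSymm) (hE : IsVielbein H E) (hk : k.1 ≠ 0)
    (ε : Fin n → ℂ) (b : Fin n) {X : Pt n} (hX : Regular E (X iu)) :
    gravitonMode H E F ε k iu (Sum.inr b) X = ε b * pol E ε k iu X * scalarMode E F k X := by
  have h0 := Complex.ofReal_ne_zero.2 hk
  change (Complex.I * (k.1 : ℂ))⁻¹ * ∑ a, ε a * cov1 H (gaugeMode E F ε k) (Sum.inr a) (Sum.inr b)
    X = _
  simp only [cov1_of_lightcone hH _ (gaugeMode_iv ε X), (hasPD_gaugeMode_x_x hE hk ε hX _ _).pd_eq,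
    inr_ne_iu, and_false, if_false, add_zero, pol_iu, Finset.mul_sum, Finset.sum_mul]
  refine Finset.sum_congr rfl fun a _ => ?_
  field_simp

/-- The component `h_uu`; the derivative of the polarisation produces the tail. -/
theorem gravitonMode_u_u (hH : ∀ u, (H u).IsSymm) (hE : IsVielbein H E) (hk : k.1 ≠ 0)
    (ε : Fin n → ℂ) {X : Pt n} (hX : Regular E (X iu)) :
    gravitonMode H E F ε k iu iu X = gravCoeff E ε k X * scalarMode E F k X := by
  have h0 := Complex.ofReal_ne_zero.2 hk
  change (Complex.I * (k.1 : ℂ))⁻¹ * ∑ a, ε a * cov1 H (gaugeMode E F ε k) (Sum.inr a) iu X = _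
  simp only [cov1_of_lightcone hH _ (gaugeMode_iv ε X), (hasPD_gaugeMode_u_x hE hk ε hX _).pd_eq,
    inr_ne_iu, false_and, if_false, add_zero]
  have e1 : ∑ a, ε a * ((polShear E ε a X + Complex.I * k.1 * velocity E k a X * pol E ε k iu X)
      * scalarMode E F k X) = (∑ a, ε a * polShear E ε a X
        + Complex.I * k.1 * pol E ε k iu X * ∑ a, ε a * velocity E k a X) * scalarMode E F k X := by
    simp only [Finset.mul_sum, Finset.sum_mul, ← Finset.sum_add_distrib]
    exact Finset.sum_congr rfl fun a _ => by ring
  have e2 : ∑ a, ε a * polShear E ε a X = ∑ a, ∑ b, ε a * ε b * (shear E (X iu) a b : ℂ) := by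
    simp only [polShear, Finset.mul_sum]
    rw [Finset.sum_comm]
    exact Finset.sum_congr rfl fun a _ => Finset.sum_congr rfl fun b _ => by ring
  rw [e1, e2, ← pol_iu ε X, gravCoeff]
  have h1 : (Complex.I * (k.1 : ℂ))⁻¹ = -(Complex.I / k.1) := by
    rw [mul_inv, Complex.inv_I]; ring
  have h2 : (Complex.I * (k.1 : ℂ))⁻¹ * (Complex.I * k.1) = 1 :=
    inv_mul_cancel₀ (mul_ne_zero Complex.I_ne_zero h0)
  rw [← h1]
  linear_combination pol E ε k iu X ^ 2 * scalarMode E F k X * h2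

theorem gravitonMode_closed (hH : ∀ u, (H u).IsSymm) (hE : IsVielbein H E) (hk : k.1 ≠ 0)
    (ε : Fin n → ℂ) {X : Pt n} (hX : Regular E (X iu)) (μ ν : Idx n) :
    gravitonMode H E F ε k μ ν X
      = (pol E ε k μ X * pol E ε k ν X + tail E ε k μ ν X) * scalarMode E F k X := by
  rcases idx_cases μ with rfl | rfl | ⟨a, rfl⟩
  · rcases idx_cases ν with rfl | rfl | ⟨b, rfl⟩
    · rw [gravitonMode_u_u hH hE hk ε hX, tail, if_pos ⟨rfl, rfl⟩, gravCoeff]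
    · rw [gravitonMode_v_right hH, pol_iv, tail, if_neg (by simp)]; simp
    · rw [gravitonMode_u_x hH hE hk ε b hX, tail, if_neg (by simp), pol_inr]; ring
  · rw [gravitonMode_v_left, pol_iv, tail, if_neg (by simp)]; simp
  · rcases idx_cases ν with rfl | rfl | ⟨b, rfl⟩
    · rw [gravitonMode_x_u hH hE hk ε a hX, tail, if_neg (by simp), pol_inr]; ring
    · rw [gravitonMode_v_right hH, pol_iv, tail, if_neg (by simp)]; simp
    · rw [gravitonMode_x_x hH hk, tail, if_neg (by simp), pol_inr, pol_inr]; ring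

theorem gravitonMode_traceless (hH : ∀ u, (H u).IsSymm) (hk : k.1 ≠ 0)
    {ε : Fin n → ℂ} (hε : ∑ a, ε a * ε a = 0) (X : Pt n) :
    ∑ μ, ∑ ν, (invMetric H X μ ν : ℂ) * gravitonMode H E F ε k μ ν X = 0 := by
  rw [sum_invMetric_mul H X (fun μ ν => gravitonMode H E F ε k μ ν X)]
  simp only [gravitonMode_v_left, gravitonMode_v_right hH, gravitonMode_x_x hH hk,
    ← Finset.sum_mul, hε]
  ring

/-- The `u`-derivative of `gravCoeff`. -/
def gravRate (H E : ℝ → Matrix (Fin n) (Fin n) ℝ) (ε : Fin n → ℂ) (k : Mom n) (X : Pt n) : ℂ :=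
  polRate H E ε k X * pol E ε k iu X + pol E ε k iu X * polRate H E ε k X + -(Complex.I / k.1) *
    ∑ a, ∑ b, ε a * ε b * ((shear E (X iu) * shear E (X iu) - H (X iu)) a b : ℝ)

theorem hasGrad_gravCoeff (hE : IsVielbein H E) (ε : Fin n → ℂ) :
    HasGrad E (gravCoeff E ε k) (gravRate H E ε k)
      (fun c X => 2 * pol E ε k iu X * polShear E ε c X) := by
  have h2 : HasGrad E
      (fun X => -(Complex.I / k.1) * ∑ a, ∑ b, ε a * ε b * (shear E (X iu) a b : ℂ))
      (fun X => -(Complex.I / k.1) * ∑ a, ∑ b, ε a * ε b *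
        ((shear E (X iu) * shear E (X iu) - H (X iu)) a b : ℝ)) (fun _ _ => 0) :=
    ⟨fun X hX => HasPD.const_mul _ (HasPD.sum fun a _ => HasPD.sum fun b _ =>
      HasPD.const_mul _ (hasPD_comp_u (hE.hasDerivAt_shear hX a b)).ofReal),
    fun X _ => (HasPD.const_mul _ (HasPD.sum fun a _ => HasPD.sum fun b _ => HasPD.const_mul _
      (hasPD_comp_u_ne (μ := iv) iv_ne_iu (fun u => (shear E u a b : ℂ)) X))).congr_deriv (by simp),
    fun c X _ => (HasPD.const_mul _ (HasPD.sum fun a _ => HasPD.sum fun b _ => HasPD.const_mul _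
      (hasPD_comp_u_ne (inr_ne_iu c) (fun u => (shear E u a b : ℂ)) X))).congr_deriv (by simp)⟩
  have h := ((hasGrad_pol (k := k) hE ε).mul (hasGrad_pol (k := k) hE ε)).add h2
  exact ⟨h.u, h.v, fun c X hX => (h.x c X hX).congr_deriv (by simp only [polShear]; ring)⟩

theorem hasPD_gravRate_v (hE : IsVielbein H E) (ε : Fin n → ℂ) {X : Pt n} (hX : Regular E (X iu)) :
    HasPD iv (gravRate H E ε k) 0 X := by
  have h1 := hasPD_polRate_v (H := H) (E := E) (k := k) ε X
  have h2 := (hasGrad_pol (k := k) hE ε).v X hX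
  exact (((h1.mul h2).add (h2.mul h1)).add (HasPD.const_mul _ (HasPD.sum fun a _ =>
    HasPD.sum fun b _ => HasPD.const_mul _ (hasPD_comp_u_ne (μ := iv) iv_ne_iu
      (fun u => (((shear E u * shear E u - H u) a b : ℝ) : ℂ)) X)))).congr_deriv (by simp)

theorem sum_mul_polShear (ε : Fin n → ℂ) (X : Pt n) :
    ∑ a, ε a * polShear E ε a X = ∑ a, ∑ b, ε a * ε b * (shear E (X iu) a b : ℂ) := by
  simp only [polShear, Finset.mul_sum]
  rw [Finset.sum_comm]
  exact Finset.sum_congr rfl fun a _ => Finset.sum_congr rfl fun b _ => by ring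

theorem sum_polShear_sq (hE : IsVielbein H E) (ε : Fin n → ℂ) {X : Pt n} (hX : Regular E (X iu)) :
    ∑ a, polShear E ε a X ^ 2
      = ∑ a, ∑ b, ε a * ε b * ((shear E (X iu) * shear E (X iu)) a b : ℝ) := by
  simp only [polShear, sq, Finset.sum_mul, Finset.mul_sum, Matrix.mul_apply, Complex.ofReal_sum]
  rw [Finset.sum_comm_cycle]
  refine Finset.sum_congr rfl fun a _ => ?_
  rw [Finset.sum_comm]
  refine Finset.sum_congr rfl fun b _ => Finset.sum_congr rfl fun c _ => ?_
  rw [show shear E (X iu) c b = shear E (X iu) b c from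
    congrFun (congrFun (hE.shear_symm hX) b) c]
  push_cast
  ring

theorem pd_gravitonMode_x_u (hH : ∀ u, (H u).IsSymm) (hE : IsVielbein H E) (hk : k.1 ≠ 0)
    (ε : Fin n → ℂ) (a : Fin n) {X : Pt n} (hX : Regular E (X iu)) (μ : Idx n) :
    pd μ (gravitonMode H E F ε k (Sum.inr a) iu) X
      = pd μ (dressed E F k fun Y => ε a * pol E ε k iu Y) X :=
  pd_congr hE.isOpen hX fun _ hY => gravitonMode_x_u hH hE hk ε a hY

theorem pd_gravitonMode_u_x (hH : ∀ u, (H u).IsSymm) (hE : IsVielbein H E) (hk : k.1 ≠ 0)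
    (ε : Fin n → ℂ) (a : Fin n) {X : Pt n} (hX : Regular E (X iu)) (μ : Idx n) :
    pd μ (gravitonMode H E F ε k iu (Sum.inr a)) X
      = pd μ (dressed E F k fun Y => ε a * pol E ε k iu Y) X :=
  pd_congr hE.isOpen hX fun _ hY => gravitonMode_u_x hH hE hk ε a hY

theorem pd_gravitonMode_u_u (hH : ∀ u, (H u).IsSymm) (hE : IsVielbein H E) (hk : k.1 ≠ 0)
    (ε : Fin n → ℂ) {X : Pt n} (hX : Regular E (X iu)) (μ : Idx n) :
    pd μ (gravitonMode H E F ε k iu iu) X = pd μ (dressed E F k (gravCoeff E ε k)) X :=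
  pd_congr hE.isOpen hX fun _ hY => gravitonMode_u_u hH hE hk ε hY

theorem pd_gravitonMode_x_x (hH : ∀ u, (H u).IsSymm) (hk : k.1 ≠ 0)
    (ε : Fin n → ℂ) (a b : Fin n) (X : Pt n) (μ : Idx n) :
    pd μ (gravitonMode H E F ε k (Sum.inr a) (Sum.inr b)) X
      = pd μ (dressed E F k fun _ => ε a * ε b) X :=
  pd_congr isOpen_univ trivial fun Y _ => gravitonMode_x_x hH hk ε a b Y

theorem pd_gravitonMode_v_left (ε : Fin n → ℂ) (μ ν : Idx n) (X : Pt n) :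
    pd μ (gravitonMode H E F ε k iv ν) X = 0 := by
  have : gravitonMode H E F ε k iv ν = fun _ => 0 := funext fun X => gravitonMode_v_left ε ν X
  rw [this, pd_const]

theorem pd_gravitonMode_v_right (hH : ∀ u, (H u).IsSymm) (ε : Fin n → ℂ) (μ ν : Idx n) (X : Pt n) :
    pd μ (gravitonMode H E F ε k ν iv) X = 0 := by
  have : gravitonMode H E F ε k ν iv = fun _ => 0 := funext fun X => gravitonMode_v_right hH ε ν X
  rw [this, pd_const]

theorem gravitonMode_transverse (hH : ∀ u, (H u).IsSymm) (hE : IsVielbein H E) (hk : k.1 ≠ 0)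
    (ε : Fin n → ℂ) {X : Pt n} (hX : Regular E (X iu)) (σ : Idx n) :
    ∑ μ, ∑ ν, (invMetric H X μ ν : ℂ) * cov2 H (gravitonMode H E F ε k) μ ν σ X = 0 := by
  have h0 := Complex.ofReal_ne_zero.2 hk
  simp only [cov2_of_lightcone hH _ (fun β => gravitonMode_v_left ε β X)
    (fun β => gravitonMode_v_right hH ε β X)]
  rw [sum_invMetric_mul H X (fun μ ν => pd μ (gravitonMode H E F ε k ν σ) X
    + (if μ = iu ∧ ν = iu then ∑ a, force H a X * gravitonMode H E F ε k (Sum.inr a) σ X else 0)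
    + (if μ = iu ∧ σ = iu then ∑ a, force H a X * gravitonMode H E F ε k ν (Sum.inr a) X else 0))]
  simp only [gravitonMode_v_left, pd_gravitonMode_v_left, inr_ne_iu, iv_ne_iu, false_and, and_false,
    if_false, add_zero, mul_zero, Finset.sum_const_zero, ite_self, zero_add]
  rcases idx_cases σ with rfl | rfl | ⟨b, rfl⟩
  · have e1 : ∑ a, pd (Sum.inr a) (gravitonMode H E F ε k (Sum.inr a) iu) X
        = ((∑ a, ε a * polShear E ε a X) + Complex.I * k.1 * pol E ε k iu X *
          ∑ a, ε a * velocity E k a X) * scalarMode E F k X := by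
      simp only [pd_gravitonMode_x_u hH hE hk ε _ hX, (hasPD_dressed_x hE hk hX
        (((hasGrad_pol (k := k) hE ε).x _ X hX).const_mul _)).pd_eq, Finset.mul_sum,
        Finset.sum_mul, ← Finset.sum_add_distrib]
      refine Finset.sum_congr rfl fun a _ => ?_
      simp only [polShear, Finset.mul_sum, Finset.sum_mul, add_mul]
      congr 1
      ring
    rw [e1, pd_gravitonMode_u_u hH hE hk ε hX,
      (hasPD_dressed_v ((hasGrad_gravCoeff hE ε).v X hX)).pd_eq, sum_mul_polShear, ← pol_iu ε X]
    simp only [dressed, gravCoeff]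
    field_simp
    linear_combination (-(∑ a, ∑ b, ε a * ε b * (shear E (X iu) a b : ℂ)) * scalarMode E F k X)
      * Complex.I_sq
  · simp only [pd_gravitonMode_v_right hH, Finset.sum_const_zero, sub_zero]
  · have e1 : ∑ a, pd (Sum.inr a) (gravitonMode H E F ε k (Sum.inr a) (Sum.inr b)) X
        = Complex.I * k.1 * (∑ a, ε a * velocity E k a X) * ε b * scalarMode E F k X := by
      simp only [pd_gravitonMode_x_x hH hk ε _ b X, (hasPD_dressed_x hE hk hX
        (hasPD_const _ _ X)).pd_eq, Finset.mul_sum, Finset.sum_mul]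
      exact Finset.sum_congr rfl fun a _ => by ring
    rw [e1, ← pol_iu ε X, pd_gravitonMode_u_x hH hE hk ε b hX, (hasPD_dressed_v
      ((((hasGrad_pol (k := k) hE ε).v X hX).const_mul (ε b)).congr_deriv (mul_zero _))).pd_eq]
    simp only [dressed]
    ring

/-- Of the curvature components `R^c_{μνσ}` with `σ` transverse only `R^c_{uud} = H_cd` survives. -/
theorem riemann_x_x (hH : ∀ u, (H u).IsSymm) (c d : Fin n) (μ ν : Idx n) (X : Pt n) :
    riemann H (Sum.inr c) μ ν (Sum.inr d) X = if μ = iu ∧ ν = iu then H (X iu) c d else 0 := by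
  have h1 : ∀ l, christoffel H (Sum.inr c) ν l X * christoffel H l (Sum.inr d) μ X = 0 := by
    intro l
    rcases idx_cases l with rfl | rfl | ⟨a, rfl⟩
    · rw [christoffel_u, mul_zero]
    · rw [christoffel_v_right, zero_mul]
    · rw [christoffel_up_x_x, mul_zero]
  have h2 : christoffel H (Sum.inr c) (Sum.inr d) μ = fun _ => 0 :=
    funext fun Y => christoffel_up_x_x c d μ Y
  simp only [riemann, h1, h2, pd_const, christoffel_up_x_x, zero_mul, sub_zero,
    Finset.sum_const_zero, add_zero, zero_sub]
  by_cases h : μ = iu ∧ ν = iu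
  · obtain ⟨rfl, rfl⟩ := h
    have h3 : christoffel H (Sum.inr c) iu iu
        = fun Y => -∑ b, H (Y iu) c b * Y (Sum.inr b) := funext fun Y =>
      christoffel_up_x_uu hH c Y
    have h4 := (HasPD.sum (s := Finset.univ) fun b _ => (hasPD_comp_u_ne (inr_ne_iu d)
      (fun u => H u c b) X).mul (hasPD_coord d b X)).neg
    rw [h3, h4.pd_eq]
    simp
  · rw [if_neg h]
    have h3 : christoffel H (Sum.inr c) ν μ = fun _ => 0 := by
      funext Y
      rcases idx_cases ν with rfl | rfl | ⟨a, rfl⟩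
      · rcases idx_cases μ with rfl | rfl | ⟨b, rfl⟩
        · exact absurd ⟨rfl, rfl⟩ h
        · exact christoffel_v_right _ _ _
        · rw [christoffel_comm, christoffel_up_x_x]
      · exact christoffel_v_left _ _ _
      · exact christoffel_up_x_x _ _ _ _
    rw [h3, pd_const, neg_zero]

theorem riemann_u (ρ μ ν : Idx n) (X : Pt n) : riemann H iu ρ μ ν X = 0 := by
  have : ∀ μ ν, christoffel H iu μ ν = fun _ => 0 := fun μ ν => funext fun Y => christoffel_u μ ν Y
  simp [riemann, this, pd_const]

theorem christoffel_pd_v (hH : ∀ u, (H u).IsSymm) (c : Fin n) (μ ν : Idx n) (X : Pt n) :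
    pd iv (christoffel H (Sum.inr c) μ ν) X = 0 := by
  rcases idx_cases μ with rfl | rfl | ⟨a, rfl⟩
  · rcases idx_cases ν with rfl | rfl | ⟨b, rfl⟩
    · have h3 : christoffel H (Sum.inr c) iu iu
          = fun Y => -∑ b, H (Y iu) c b * Y (Sum.inr b) := funext fun Y =>
        christoffel_up_x_uu hH c Y
      have h4 := (HasPD.sum (s := Finset.univ) fun b _ => (hasPD_comp_u_ne (μ := iv) iv_ne_iu
        (fun u => H u c b) X).mul (hasPD_coord_ne (inr_ne_iv b) X)).neg
      rw [h3, h4.pd_eq]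
      simp
    · rw [show christoffel H (Sum.inr c) iu iv = fun _ => 0 from
        funext fun Y => christoffel_v_right _ _ _, pd_const]
    · rw [show christoffel H (Sum.inr c) iu (Sum.inr b) = fun _ => 0 from
        funext fun Y => by rw [christoffel_comm, christoffel_up_x_x], pd_const]
  · rw [show christoffel H (Sum.inr c) iv ν = fun _ => 0 from
      funext fun Y => christoffel_v_left _ _ _, pd_const]
  · rw [show christoffel H (Sum.inr c) (Sum.inr a) ν = fun _ => 0 from
      funext fun Y => christoffel_up_x_x _ _ _ _, pd_const]

theorem riemann_x_v (hH : ∀ u, (H u).IsSymm) (c : Fin n) (μ ν : Idx n) (X : Pt n) :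
    riemann H (Sum.inr c) μ ν iv X = 0 := by
  have h2 : christoffel H (Sum.inr c) iv μ = fun _ => 0 :=
    funext fun Y => christoffel_v_left _ _ _
  simp [riemann, christoffel_pd_v hH, h2, pd_const, christoffel_v_left]

/-- The curvature term of the linearised Einstein equation only involves the transverse components
of `h`, contracted with `H`. -/
theorem sum_riemann (hH : ∀ u, (H u).IsSymm) (h : Idx n → Idx n → ℂ) (hl : ∀ μ, h iv μ = 0)
    (hr : ∀ μ, h μ iv = 0) (μ ν : Idx n) (X : Pt n) :
    ∑ ρ, ∑ σ, ∑ τ, (riemann H ρ μ ν σ X : ℂ) * (invMetric H X σ τ : ℂ) * h ρ τ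
      = -if μ = iu ∧ ν = iu then ∑ c, ∑ d, (H (X iu) c d : ℂ) * h (Sum.inr c) (Sum.inr d) else 0 :=
        by
  have h1 : ∀ ρ, ∑ σ, ∑ τ, (riemann H ρ μ ν σ X : ℂ) * (invMetric H X σ τ : ℂ) * h ρ τ
      = ∑ σ, (riemann H ρ μ ν σ X : ℂ) * ∑ τ, (invMetric H X σ τ : ℂ) * h ρ τ := fun ρ => by
    simp only [Finset.mul_sum, mul_assoc]
  simp only [h1, sum_invMetric_row H X (h _)]
  rw [sum_idx]
  simp only [riemann_u, sum_idx (n := n) (M := ℂ), riemann_x_v hH, riemann_x_x hH, hr, hl]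
  split_ifs <;> simp

/-- The component `uu` is where the tail matters: its rate of change cancels the square of the
shear of the polarisation and leaves `ε ε H`, which is the curvature term. The mixed components are
as for gauge fields, the transverse ones as for scalars. -/
theorem gravitonMode_einstein (hH : ∀ u, (H u).IsSymm) (hE : IsVielbein H E)
    (hF : IsRosenIntegral E F R) (hk : k.1 ≠ 0) (ε : Fin n → ℂ) {X : Pt n}
    (hX : Regular E (X iu)) (μ ν : Idx n) :
    ∑ α, ∑ β, (invMetric H X α β : ℂ) * cov3 H (cov2 H (gravitonMode H E F ε k)) α β μ ν X
      - 2 * ∑ ρ, ∑ σ, ∑ τ, (riemann H ρ μ ν σ X : ℂ) * (invMetric H X σ τ : ℂ)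
          * gravitonMode H E F ε k ρ τ X = 0 := by
  have h0 := Complex.ofReal_ne_zero.2 hk
  have hκ : (Complex.I * (k.1 : ℂ)) * (Complex.I / k.1) = -1 := by
    field_simp; exact Complex.I_sq
  have hl := fun β Y => gravitonMode_v_left (H := H) (E := E) (F := F) (k := k) ε β Y
  have hr := fun β Y => gravitonMode_v_right (E := E) (F := F) (k := k) hH ε β Y
  have hcov : ∀ β α γ Y, cov2 H (gravitonMode H E F ε k) β α γ Y = _ := fun β α γ Y =>
    cov2_of_lightcone hH _ (hl · Y) (hr · Y) β α γ
  have hcl : ∀ β α Y, cov2 H (gravitonMode H E F ε k) β iv α Y = 0 := fun β α Y => by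
    rw [hcov]; simp [pd_gravitonMode_v_left, hl]
  have hcr : ∀ β α Y, cov2 H (gravitonMode H E F ε k) β α iv Y = 0 := fun β α Y => by
    rw [hcov]; simp [pd_gravitonMode_v_right hH, hr]
  rw [sum_riemann hH _ (hl · X) (hr · X), sum_cov3 hH _ (hcl · · X) (hcr · · X)]
  have hf : HasPD iv (fun Y => ∑ a, force H a Y * ε a) 0 X :=
    (HasPD.sum (s := Finset.univ) fun a _ => (hasPD_force_v a X).mul_const (ε a)).congr_deriv
      (by simp)
  have hq := hasGrad_pol (k := k) hE ε
  have h1 := sum_velocity_mul_polShear (H := H) (E := E) (k := k) ε X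
  set f : Pt n → ℂ := fun Y => ∑ a, force H a Y * ε a with hfdef
  have hbox0 : ∀ γ α, (∀ β Y, cov2 H (gravitonMode H E F ε k) β γ α Y = 0) →
      boxOf H (fun β => cov2 H (gravitonMode H E F ε k) β γ α) X = 0 := by
    intro γ α h
    have : ∀ β, cov2 H (gravitonMode H E F ε k) β γ α = fun _ => 0 := fun β => funext (h β)
    simp [boxOf, this, pd_const]
  -- the sum over the force in the mixed components
  have hmix : ∀ b Y, ∑ a, force H a Y * gravitonMode H E F ε k (Sum.inr a) (Sum.inr b) Y
      = (f Y * ε b) * scalarMode E F k Y := fun b Y => by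
    simp only [hfdef, Finset.sum_mul, gravitonMode_x_x hH hk]
    exact Finset.sum_congr rfl fun a _ => by ring
  have hmix' : ∀ b Y, ∑ a, force H a Y * gravitonMode H E F ε k (Sum.inr b) (Sum.inr a) Y
      = (f Y * ε b) * scalarMode E F k Y := fun b Y => by
    simp only [hfdef, Finset.sum_mul, gravitonMode_x_x hH hk]
    exact Finset.sum_congr rfl fun a _ => by ring
  have hmixed : ∀ b, 2 * (Complex.I * k.1) * (ε b * polRate H E ε k X
      - ∑ a, (velocity E k a X : ℂ) * (ε b * polShear E ε a X)) = -2 * (Complex.I * k.1) * f X * ε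
        b := by
    intro b
    have : ∑ a, (velocity E k a X : ℂ) * (ε b * polShear E ε a X)
        = ε b * (polRate H E ε k X + f X) := by
      rw [← h1, Finset.mul_sum]; exact Finset.sum_congr rfl fun a _ => by ring
    rw [this]; ring
  have hforce : ∀ b, ∑ a, force H a X * (Complex.I * k.1 * (ε a * ε b) * scalarMode E F k X)
      = Complex.I * k.1 * f X * ε b * scalarMode E F k X := fun b => by
    simp only [hfdef, Finset.mul_sum, Finset.sum_mul]
    exact Finset.sum_congr rfl fun a _ => by ring
  have hgq : ∀ b, HasGrad E (fun Y => ε b * pol E ε k iu Y) (fun Y => ε b * polRate H E ε k Y)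
      (fun c Y => ε b * polShear E ε c Y) := fun b =>
    ⟨fun Y hY => (hq.u Y hY).const_mul _, fun Y hY => ((hq.v Y hY).const_mul _).congr_deriv
      (mul_zero _), fun c Y hY => (hq.x c Y hY).const_mul _⟩
  have hpv : ∀ a b, pd iv (gravitonMode H E F ε k (Sum.inr a) (Sum.inr b)) X
      = Complex.I * k.1 * (ε a * ε b) * scalarMode E F k X := fun a b => by
    rw [pd_gravitonMode_x_x hH hk, (hasPD_dressed_v (hasPD_const _ _ X)).pd_eq, dressed]
  rcases idx_cases μ with rfl | rfl | ⟨a, rfl⟩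
  · rcases idx_cases ν with rfl | rfl | ⟨b, rfl⟩
    -- the component `uu`, with coefficient `ε_u²` plus the tail
    · have hb := boxOf_dressed hE hF hk (hasGrad_gravCoeff (k := k) hE ε) hX
        (hasPD_gravRate_v hE ε hX) (d := fun Y => 2 * f Y * pol E ε k iu Y)
        (((hf.const_mul 2).mul (hq.v X hX)).congr_deriv (by simp))
        (cxx := fun a => 2 * polShear E ε a X ^ 2)
        (fun a => (((hq.x a X hX).const_mul 2).mul (hasPD_polShear_x ε a a X)).congr_deriv
          (by simp only [polShear]; ring))
        (B := fun β => cov2 H (gravitonMode H E F ε k) β iu iu)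
        (fun Y hY => by rw [hcov]; simp [pd_gravitonMode_u_u hH hE hk ε hY])
        (fun Y hY => by
          rw [hcov]
          simp only [pd_gravitonMode_u_u hH hE hk ε hY, gravitonMode_x_u hH hE hk ε _ hY,
            gravitonMode_u_x hH hE hk ε _ hY, and_self, if_true]
          have : ∑ a, force H a Y * (ε a * pol E ε k iu Y * scalarMode E F k Y)
              = f Y * pol E ε k iu Y * scalarMode E F k Y := by
            simp only [hfdef, Finset.sum_mul]
            exact Finset.sum_congr rfl fun a _ => by ring
          rw [this]; ring)
        (fun a Y hY => by rw [hcov]; simp [pd_gravitonMode_u_u hH hE hk ε hY])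
      have hpq : ∀ a, pd iv (dressed E F k fun Y => ε a * pol E ε k iu Y) X
          = Complex.I * k.1 * (ε a * pol E ε k iu X) * scalarMode E F k X := fun a => by
        rw [(hasPD_dressed_v ((hgq a).v X hX)).pd_eq, dressed]
      have hs : ∑ a, force H a X * (Complex.I * k.1 * (ε a * pol E ε k iu X) * scalarMode E F k X)
          = Complex.I * k.1 * f X * pol E ε k iu X * scalarMode E F k X := by
        simp only [hfdef, Finset.mul_sum, Finset.sum_mul]
        exact Finset.sum_congr rfl fun a _ => by ring
      have hv : ∑ a, (velocity E k a X : ℂ) * (2 * pol E ε k iu X * polShear E ε a X)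
          = 2 * pol E ε k iu X * (polRate H E ε k X + f X) := by
        rw [← h1, Finset.mul_sum]; exact Finset.sum_congr rfl fun a _ => by ring
      have hHs : ∑ c, ∑ d, (H (X iu) c d : ℂ) * (ε c * ε d * scalarMode E F k X)
          = (∑ c, ∑ d, ε c * ε d * (H (X iu) c d : ℂ)) * scalarMode E F k X := by
        simp only [Finset.sum_mul]
        exact Finset.sum_congr rfl fun a _ => Finset.sum_congr rfl fun b _ => by ring
      have hrate : gravRate H E ε k X = 2 * pol E ε k iu X * polRate H E ε k X - Complex.I / k.1 *
          (∑ a, polShear E ε a X ^ 2 - ∑ c, ∑ d, ε c * ε d * (H (X iu) c d : ℂ)) := by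
        simp only [sum_polShear_sq hE ε hX, gravRate, Matrix.sub_apply, Complex.ofReal_sub, mul_sub,
          Finset.sum_sub_distrib]
        ring
      rw [hb]
      simp only [hcov, if_true, iv_ne_iu, false_and, if_false, add_zero, and_self,
        pd_gravitonMode_x_u hH hE hk ε _ hX, pd_gravitonMode_u_x hH hE hk ε _ hX, hpq, hs, hv,
        gravitonMode_x_x hH hk, hHs, hrate, ← Finset.mul_sum]
      linear_combination (-2 * scalarMode E F k X * (∑ a, polShear E ε a X ^ 2
        - ∑ c, ∑ d, ε c * ε d * (H (X iu) c d : ℂ))) * hκ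
    · rw [hbox0 _ _ fun β Y => hcr β _ Y]
      simp [hcr]
    · have hb := boxOf_dressed hE hF hk (hgq b) hX
        (((hasPD_polRate_v ε X).const_mul (ε b)).congr_deriv (mul_zero _))
        (d := fun Y => f Y * ε b) ((hf.mul_const (ε b)).congr_deriv (zero_mul _))
        (cxx := fun _ => 0)
        (fun a => ((hasPD_polShear_x ε a a X).const_mul (ε b)).congr_deriv (mul_zero _))
        (B := fun β => cov2 H (gravitonMode H E F ε k) β iu (Sum.inr b))
        (fun Y hY => by rw [hcov]; simp [pd_gravitonMode_u_x hH hE hk ε _ hY])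
        (fun Y hY => by rw [hcov]; simp [pd_gravitonMode_u_x hH hE hk ε _ hY, hmix])
        (fun a Y hY => by rw [hcov]; simp [pd_gravitonMode_u_x hH hE hk ε _ hY])
      rw [hb, hmixed]
      simp only [hcov, if_true, iv_ne_iu, inr_ne_iu, and_false, false_and, if_false, add_zero, hpv,
        hforce, Finset.sum_const_zero]
      ring
  · rw [hbox0 _ _ fun β Y => hcl β _ Y]
    simp [hcl]
  · rcases idx_cases ν with rfl | rfl | ⟨b, rfl⟩
    · have hb := boxOf_dressed hE hF hk (hgq a) hX
        (((hasPD_polRate_v ε X).const_mul (ε a)).congr_deriv (mul_zero _))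
        (d := fun Y => f Y * ε a) ((hf.mul_const (ε a)).congr_deriv (zero_mul _))
        (cxx := fun _ => 0)
        (fun b => ((hasPD_polShear_x ε b b X).const_mul (ε a)).congr_deriv (mul_zero _))
        (B := fun β => cov2 H (gravitonMode H E F ε k) β (Sum.inr a) iu)
        (fun Y hY => by rw [hcov]; simp [pd_gravitonMode_x_u hH hE hk ε _ hY])
        (fun Y hY => by rw [hcov]; simp [pd_gravitonMode_x_u hH hE hk ε _ hY, hmix'])
        (fun b Y hY => by rw [hcov]; simp [pd_gravitonMode_x_u hH hE hk ε _ hY])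
      rw [hb, hmixed]
      simp only [hcov, if_true, iv_ne_iu, inr_ne_iu, and_false, false_and, if_false, add_zero, hpv,
        mul_comm (ε a) (ε _), hforce, Finset.sum_const_zero]
      ring
    · rw [hbox0 _ _ fun β Y => hcr β _ Y]
      simp
    · have hb := boxOf_dressed hE hF hk (hasGrad_const E (ε a * ε b)) hX (hasPD_const _ 0 X)
        (d := fun _ => 0) (cxx := fun _ => 0) (hasPD_const _ 0 X) (fun a => hasPD_const _ 0 X)
        (B := fun β => cov2 H (gravitonMode H E F ε k) β (Sum.inr a) (Sum.inr b))
        (fun Y hY => by rw [hcov]; simp [pd_gravitonMode_x_x hH hk])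
        (fun Y hY => by rw [hcov]; simp [pd_gravitonMode_x_x hH hk])
        (fun c Y hY => by rw [hcov]; simp [pd_gravitonMode_x_x hH hk])
      rw [hb]
      simp

end Graviton

section Assembly

variable {H E F : ℝ → Matrix (Fin n) (Fin n) ℝ} {R : Set ℝ}

theorem quad_smul_one (c : ℝ) (x : Fin n → ℝ) :
    quad (c • (1 : Matrix (Fin n) (Fin n) ℝ)) x = c * ∑ a, x a ^ 2 := by
  simp [quad, Matrix.one_apply, Finset.mul_sum, sq, mul_assoc]

theorem gravModesSolve (hH : ∀ u, (H u).IsSymm) (hE : IsVielbein H E)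
    (hF : IsRosenIntegral E F R) : GravModesSolve H E F where
  hamiltonJacobi _ hk _ hX := hamiltonJacobi hE hF hk hX
  scalar_wave _ hk _ hX := scalarMode_wave hE hF hk hX
  gauge_closed ε _ hk _ hX μ := gaugeMode_closed hE hk ε hX μ
  gauge_onshell ε _ hk _ hX := gaugeMode_onshell hE hk ε hX
  gauge_lightcone ε _ _ X _ := gaugeMode_iv ε X
  gauge_lorenz ε _ hk _ hX := gaugeMode_lorenz hH hE hk ε hX
  gauge_divergence ε _ hk _ hX := gaugeMode_divergence hE hk ε hX
  gauge_wave ε _ hk _ hX μ := gaugeMode_wave hH hE hF hk ε hX μ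
  gauge_maxwell ε _ hk _ hX μ := gaugeMode_maxwell hH hE hF hk ε hX μ
  graviton_closed _ ε _ _ hk _ hX μ ν := gravitonMode_closed hH hE hk ε hX μ ν
  graviton_lightcone _ ε _ _ _ X _ μ :=
    ⟨gravitonMode_v_left ε μ X, gravitonMode_v_right hH ε μ X⟩
  graviton_traceless _ _ hε _ hk X _ := gravitonMode_traceless hH hk hε X
  graviton_transverse _ ε _ _ hk _ hX σ := gravitonMode_transverse hH hE hk ε hX σ
  graviton_einstein _ ε _ _ hk _ hX μ ν := gravitonMode_einstein hH hE hF hk ε hX μ ν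

/-- Where `E = 1` and `Ė = 0` the shear vanishes and the modes reduce to those of Minkowski space.
-/
theorem gravModesFlat (hH : ∀ u, (H u).IsSymm) (hE : IsVielbein H E) (hF : IsRosenIntegral E F R)
    (h1 : ∀ u ∈ R, E u = 1 ∧ matDeriv E u = 0) : GravModesFlat H E F R := by
  have hreg : ∀ u ∈ R, Regular E u := fun u hu => by rw [Regular, (h1 u hu).1]; simp
  have hs : ∀ u ∈ R, shear E u = 0 := fun u hu => by
    rw [hE.shear_eq (hreg u hu), (h1 u hu).2]; simp
  have hscalar : ∀ k : Mom n, k.1 ≠ 0 → ∀ X : Pt n, X iu ∈ R →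
      scalarMode E F k X = flatWave k X := by
    intro k _ X hX
    have e1 : Omega E (X iu) = 1 := by simp [Omega, rosen, (h1 _ hX).1]
    have e2 : phase E F k X = flatPhase k X := by
      rw [phase, flatPhase, hs _ hX, hF.asymptotic _ hX, (h1 _ hX).1, quad_smul_one]
      simp [quad, Matrix.one_apply]
      ring
    rw [scalarMode, e1, e2, flatWave, Complex.ofReal_one, one_mul]
  have hpol : ∀ (ε : Fin n → ℂ) (k : Mom n) (X : Pt n), X iu ∈ R → ∀ μ,
      pol E ε k μ X = flatPol ε k μ := by
    intro ε k X hX μ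
    rcases μ with j | a
    · simp only [pol, flatPol, hs _ hX, (h1 _ hX).1, inv_one]
      simp [Matrix.one_apply]
    · rfl
  refine ⟨hscalar, fun ε k hk X hX μ => ?_, fun ε k hk X hX μ ν => ?_⟩
  · rw [gaugeMode_closed hE hk ε (hreg _ hX), hpol ε k X hX, hscalar k hk X hX]
  · rw [gravitonMode_closed hH hE hk ε (hreg _ hX), hpol ε k X hX, hpol ε k X hX, hscalar k hk X hX,
      tail, hs _ hX]
    simp

end Assembly

/-! ### Charged fields -/

section HalfLine

variable {V : Type*} [NormedAddCommGroup V] [NormedSpace ℝ V]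

theorem setIntegral_Iic_eq_zero {g : ℝ → V} {a u : ℝ} (h : ∀ s < a, g s = 0) (hu : u ≤ a) :
    ∫ s in Set.Iic u, g s = 0 := by
  rw [integral_Iic_eq_integral_Iio]
  exact setIntegral_eq_zero_of_forall_eq_zero fun s hs => h s (lt_of_lt_of_le hs hu)

theorem hasDerivAt_setIntegral_Iic [CompleteSpace V] {g : ℝ → V} (hg : Continuous g) {a : ℝ}
    (h : ∀ s < a, g s = 0) (u : ℝ) : HasDerivAt (fun u => ∫ s in Set.Iic u, g s) (g u) u := by
  have hi : ∀ u, IntegrableOn g (Set.Iic u) := fun u => by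
    have h1 : IntegrableOn g (Set.Iio a) :=
      (integrableOn_zero (μ := volume) (s := Set.Iio a)).congr_fun (fun s hs => (h s hs).symm)
        measurableSet_Iio
    refine (h1.union (hg.continuousOn.integrableOn_compact
      (isCompact_Icc (a := a) (b := u)))).mono_set
      fun s hs => ?_
    rcases lt_or_ge s a with h | h
    · exact Or.inl h
    · exact Or.inr ⟨h, hs⟩
  have he : (fun u => ∫ s in Set.Iic u, g s) = fun u => ∫ s in a..u, g s := funext fun u => by
    rw [← intervalIntegral.integral_Iic_sub_Iic (hi a) (hi u), setIntegral_Iic_eq_zero h le_rfl,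
      sub_zero]
  rw [he]
  exact intervalIntegral.integral_hasDerivAt_right (hg.intervalIntegrable _ _)
    hg.stronglyMeasurable.stronglyMeasurableAtFilter hg.continuousAt

theorem setIntegral_Ioi_eq_comp_neg (g : ℝ → V) (u : ℝ) :
    ∫ s in Set.Ioi u, g s = ∫ s in Set.Iic (-u), g (-s) := by
  rw [integral_comp_neg_Iic, neg_neg]

theorem setIntegral_Ioi_eq_zero {g : ℝ → V} {b u : ℝ} (h : ∀ s, b < s → g s = 0) (hu : b ≤ u) :
    ∫ s in Set.Ioi u, g s = 0 :=
  setIntegral_eq_zero_of_forall_eq_zero fun s hs => h s (lt_of_le_of_lt hu hs)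

theorem hasDerivAt_setIntegral_Ioi [CompleteSpace V] {g : ℝ → V} (hg : Continuous g) {b : ℝ}
    (h : ∀ s, b < s → g s = 0) (u : ℝ) :
    HasDerivAt (fun u => ∫ s in Set.Ioi u, g s) (-g u) u := by
  simp only [setIntegral_Ioi_eq_comp_neg g]
  have h1 := hasDerivAt_setIntegral_Iic (hg.comp continuous_neg) (a := -b)
    (fun s hs => h (-s) (by linarith)) (-u)
  exact (h1.scomp u (hasDerivAt_neg u)).congr_deriv (by simp)

end HalfLine

section Potential

variable {𝔥 : Type*} [NormedAddCommGroup 𝔥] [NormedSpace ℝ 𝔥]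
  {e : 𝔥 →ₗ[ℝ] ℝ} {Fs : ℝ → Fin n → 𝔥}

/-- A potential of the field strength together with an antiderivative of `|k + e𝖠|²`. -/
structure IsChargedData (e : 𝔥 →ₗ[ℝ] ℝ) (Fs : ℝ → Fin n → 𝔥) (eA : ℝ → Fin n → ℝ)
    (f : (Fin n → ℝ) → ℝ → ℝ) : Prop where
  pot : ∀ u a, HasDerivAt (fun s => eA s a) (e (Fs u a)) u
  action : ∀ k u, HasDerivAt (f k) (∑ a, (k a + eA u a) ^ 2) u

theorem continuous_pot {eA : ℝ → Fin n → ℝ}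
    (h : ∀ u a, HasDerivAt (fun s => eA s a) (e (Fs u a)) u) : Continuous eA :=
  continuous_pi fun a => continuous_iff_continuousAt.2 fun u => (h u a).continuousAt

theorem potIn_hasDerivAt [FiniteDimensional ℝ 𝔥] (hFs : Continuous Fs) {a : ℝ}
    (h : ∀ s < a, Fs s = 0) (u : ℝ) (i : Fin n) :
    HasDerivAt (fun s => potIn e Fs s i) (e (Fs u i)) u := by
  have : CompleteSpace 𝔥 := FiniteDimensional.complete ℝ 𝔥
  exact (LinearMap.toContinuousLinearMap e).hasFDerivAt.comp_hasDerivAt u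
    (hasDerivAt_setIntegral_Iic (g := fun s => Fs s i) (by fun_prop) (a := a)
      (fun s hs => by simp [h s hs]) u)

theorem potOut_hasDerivAt [FiniteDimensional ℝ 𝔥] (hFs : Continuous Fs) {b : ℝ}
    (h : ∀ s, b < s → Fs s = 0) (u : ℝ)
    (i : Fin n) : HasDerivAt (fun s => potOut e Fs s i) (e (Fs u i)) u := by
  have : CompleteSpace 𝔥 := FiniteDimensional.complete ℝ 𝔥
  have := ((LinearMap.toContinuousLinearMap e).hasFDerivAt.comp_hasDerivAt u
    (hasDerivAt_setIntegral_Ioi (g := fun s => Fs s i) (by fun_prop) (b := b)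
      (fun s hs => by simp [h s hs])
      u)).neg
  exact this.congr_deriv (by simp)

theorem potIn_eq_zero {a u : ℝ} (h : ∀ s < a, Fs s = 0) (hu : u ≤ a) :
    potIn e Fs u = 0 := funext fun i => by
  simp [potIn, setIntegral_Iic_eq_zero (g := fun s => Fs s i) (fun s hs => by simp [h s hs]) hu]

theorem potOut_eq_zero {b u : ℝ} (h : ∀ s, b < s → Fs s = 0) (hu : b ≤ u) :
    potOut e Fs u = 0 := funext fun i => by
  simp [potOut, setIntegral_Ioi_eq_zero (g := fun s => Fs s i) (fun s hs => by simp [h s hs]) hu]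

theorem isChargedData_in [FiniteDimensional ℝ 𝔥] (hFs : Continuous Fs) {a : ℝ}
    (h : ∀ s < a, Fs s = 0) :
    IsChargedData e Fs (potIn e Fs) (fIn (potIn e Fs)) := by
  have hp := potIn_hasDerivAt (e := e) hFs h
  have hc := continuous_pot hp
  refine ⟨hp, fun k u => ?_⟩
  have h1 := ((hasDerivAt_id u).mul_const (∑ a, k a ^ 2)).add (hasDerivAt_setIntegral_Iic
    (g := fun s => (∑ a, (k a + potIn e Fs s a) ^ 2) - ∑ a, k a ^ 2) (by fun_prop) (a := a)
    (fun s hs => by simp [potIn_eq_zero h hs.le]) u)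
  exact h1.congr_deriv (by simp)

theorem isChargedData_out [FiniteDimensional ℝ 𝔥] (hFs : Continuous Fs) {b : ℝ}
    (h : ∀ s, b < s → Fs s = 0) :
    IsChargedData e Fs (potOut e Fs) (fOut (potOut e Fs)) := by
  have hp := potOut_hasDerivAt (e := e) hFs h
  have hc := continuous_pot hp
  refine ⟨hp, fun k u => ?_⟩
  have h1 := ((hasDerivAt_id u).mul_const (∑ a, k a ^ 2)).sub (hasDerivAt_setIntegral_Ioi
    (g := fun s => (∑ a, (k a + potOut e Fs s a) ^ 2) - ∑ a, k a ^ 2) (by fun_prop) (b := b)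
    (fun s hs => by simp [potOut_eq_zero h hs.le]) u)
  exact h1.congr_deriv (by simp)

theorem fIn_eq {a u : ℝ} (h : ∀ s < a, Fs s = 0) (hu : u ≤ a) (k : Fin n → ℝ) :
    fIn (potIn e Fs) k u = u * ∑ a, k a ^ 2 := by
  rw [fIn, setIntegral_Iic_eq_zero (a := a) (fun s hs => by simp [potIn_eq_zero h hs.le]) hu,
    add_zero]

theorem fOut_eq {b u : ℝ} (h : ∀ s, b < s → Fs s = 0) (hu : b ≤ u) (k : Fin n → ℝ) :
    fOut (potOut e Fs) k u = u * ∑ a, k a ^ 2 := by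
  rw [fOut, setIntegral_Ioi_eq_zero (b := b) (fun s hs => by simp [potOut_eq_zero h hs.le]) hu,
    sub_zero]

end Potential

section Charged

variable {𝔥 : Type*} [NormedAddCommGroup 𝔥] [NormedSpace ℝ 𝔥]
  {e : 𝔥 →ₗ[ℝ] ℝ} {Fs : ℝ → Fin n → 𝔥} {eA : ℝ → Fin n → ℝ} {f : (Fin n → ℝ) → ℝ → ℝ} {k : Mom n}

/-- The field `C(u) e^{iφ̃_k}`. -/
def chargedField (eA : ℝ → Fin n → ℝ) (f : (Fin n → ℝ) → ℝ → ℝ) (k : Mom n) (C : ℝ → ℂ)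
    (X : Pt n) : ℂ := C (X iu) * chargedMode eA f k X

/-- The transverse velocity `(k_a + e𝖠_a) / k₀`. -/
def chargedVel (eA : ℝ → Fin n → ℝ) (k : Mom n) (a : Fin n) (u : ℝ) : ℂ :=
  ((k.2 a + eA u a : ℝ) : ℂ) / k.1

theorem background_iu (X : Pt n) : background e Fs iu X = ∑ a, X (Sum.inr a) * e (Fs (X iu) a) := by
  simp [background]

theorem background_iv (X : Pt n) : background e Fs iv X = 0 := by simp [background]

theorem background_inr (a : Fin n) (X : Pt n) : background e Fs (Sum.inr a) X = 0 := by
  simp [background]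

theorem hasPD_chargedMode {μ : Idx n} {p : ℝ} {X : Pt n} (h : HasPD μ (chargedPhase eA f k) p X) :
    HasPD μ (chargedMode eA f k) (Complex.I * p * chargedMode eA f k X) X :=
  (h.ofReal.const_mul Complex.I).cexp.congr_deriv (by simp only [chargedMode]; ring)

theorem hasPD_chargedPhase_v (X : Pt n) : HasPD iv (chargedPhase eA f k) k.1 X := by
  have h := (((hasPD_coord_self iv X).const_mul k.1).add (HasPD.sum (s := Finset.univ) fun a _ =>
    (hasPD_comp_u_ne (μ := iv) iv_ne_iu (fun u => k.2 a + eA u a) X).mul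
      (hasPD_coord_ne (inr_ne_iv a) X))).add
    (hasPD_comp_u_ne (μ := iv) iv_ne_iu (fun u => f k.2 u / (2 * k.1)) X)
  exact h.congr_deriv (by simp)

theorem hasPD_chargedPhase_x (c : Fin n) (X : Pt n) :
    HasPD (Sum.inr c) (chargedPhase eA f k) (k.2 c + eA (X iu) c) X := by
  have h := (((hasPD_coord_ne (inr_ne_iv c).symm X).const_mul k.1).add
    (HasPD.sum (s := Finset.univ) fun a _ =>
    (hasPD_comp_u_ne (inr_ne_iu c) (fun u => k.2 a + eA u a) X).mul (hasPD_coord c a X))).add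
    (hasPD_comp_u_ne (inr_ne_iu c) (fun u => f k.2 u / (2 * k.1)) X)
  exact h.congr_deriv (by simp)

theorem hasPD_chargedPhase_u (h : IsChargedData e Fs eA f) (X : Pt n) :
    HasPD iu (chargedPhase eA f k) (background e Fs iu X
      + (∑ a, (k.2 a + eA (X iu) a) ^ 2) / (2 * k.1)) X := by
  have h := (((hasPD_coord_ne iv_ne_iu X).const_mul k.1).add
    (HasPD.sum (s := Finset.univ) fun a _ =>
    (hasPD_comp_u ((h.pot (X iu) a).const_add (k.2 a))).mul
      (hasPD_coord_ne (inr_ne_iu a) X))).add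
    (hasPD_comp_u ((h.action k.2 (X iu)).div_const (2 * k.1)))
  refine h.congr_deriv ?_
  simp only [mul_zero, zero_mul, add_zero, zero_add, background_iu, mul_comm]

theorem hasPD_chargedField_v (C : ℝ → ℂ) (X : Pt n) : HasPD iv (chargedField eA f k C)
    (chargedField eA f k (fun u => Complex.I * k.1 * C u) X) X :=
  ((hasPD_comp_u_ne (μ := iv) iv_ne_iu C X).mul
    (hasPD_chargedMode (hasPD_chargedPhase_v X))).congr_deriv (by simp only [chargedField]; ring)

theorem hasPD_chargedField_x (hk : k.1 ≠ 0) (C : ℝ → ℂ) (c : Fin n) (X : Pt n) :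
    HasPD (Sum.inr c) (chargedField eA f k C) (chargedField eA f k
      (fun u => Complex.I * k.1 * chargedVel eA k c u * C u) X) X := by
  have := Complex.ofReal_ne_zero.2 hk
  refine ((hasPD_comp_u_ne (inr_ne_iu c) C X).mul
    (hasPD_chargedMode (hasPD_chargedPhase_x c X))).congr_deriv ?_
  simp only [chargedField, chargedVel]
  field_simp
  push_cast
  ring

theorem hasPD_chargedField_u (h : IsChargedData e Fs eA f) (hk : k.1 ≠ 0) {C : ℝ → ℂ} {C' : ℂ}
    {X : Pt n} (hC : HasDerivAt C C' (X iu)) : HasPD iu (chargedField eA f k C)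
      ((C' + (Complex.I * background e Fs iu X + Complex.I * k.1 / 2 *
        ∑ a, chargedVel eA k a (X iu) ^ 2) * C (X iu)) * chargedMode eA f k X) X := by
  have h0 := Complex.ofReal_ne_zero.2 hk
  refine ((hasPD_comp_u hC).mul (hasPD_chargedMode (hasPD_chargedPhase_u h X))).congr_deriv ?_
  have : ∑ a, chargedVel eA k a (X iu) ^ 2
      = ((∑ a, (k.2 a + eA (X iu) a) ^ 2 : ℝ) : ℂ) / (k.1 : ℂ) ^ 2 := by
    rw [Complex.ofReal_sum, Finset.sum_div]
    refine Finset.sum_congr rfl fun a _ => ?_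
    rw [chargedVel, div_pow, Complex.ofReal_pow]
  rw [this]
  push_cast
  field_simp

theorem gD_chargedField_v (C : ℝ → ℂ) : gD (background e Fs) iv (chargedField eA f k C)
    = chargedField eA f k (fun u => Complex.I * k.1 * C u) := funext fun X => by
  rw [gD, (hasPD_chargedField_v C X).pd_eq, background_iv]; simp

theorem gD_chargedField_x (hk : k.1 ≠ 0) (C : ℝ → ℂ) (c : Fin n) :
    gD (background e Fs) (Sum.inr c) (chargedField eA f k C)
      = chargedField eA f k (fun u => Complex.I * k.1 * chargedVel eA k c u * C u) := funext fun X
        => by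
  rw [gD, (hasPD_chargedField_x hk C c X).pd_eq, background_inr]; simp

theorem gD_chargedField_u (h : IsChargedData e Fs eA f) (hk : k.1 ≠ 0) {C C' : ℝ → ℂ}
    (hC : ∀ u, HasDerivAt C (C' u) u) : gD (background e Fs) iu (chargedField eA f k C)
      = chargedField eA f k (fun u => C' u
        + Complex.I * k.1 / 2 * (∑ a, chargedVel eA k a u ^ 2) * C u) := funext fun X => by
  rw [gD, (hasPD_chargedField_u h hk (hC (X iu))).pd_eq]
  simp only [chargedField]
  ring

theorem chargedMode_eq : chargedMode eA f k = chargedField eA f k fun _ => 1 :=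
  funext fun X => by simp [chargedField]

theorem chargedField_zero : (chargedField eA f k fun _ => 0) = fun _ => 0 :=
  funext fun X => by simp [chargedField]

theorem gluonMode_iv (ε : Fin n → ℂ) : gluonMode eA f ε k iv = chargedField eA f k fun _ => 0 :=
  funext fun X => by simp [gluonMode, raise1, chargedField]

theorem gluonMode_inr (hk : k.1 ≠ 0) (ε : Fin n → ℂ) (a : Fin n) :
    gluonMode eA f ε k (Sum.inr a) = chargedField eA f k fun _ => ε a := funext fun X => by
  have := Complex.ofReal_ne_zero.2 hk
  change (Complex.I * (k.1 : ℂ))⁻¹ * (ε a * pd iv (chargedMode eA f k) X) = _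
  rw [chargedMode_eq, (hasPD_chargedField_v _ X).pd_eq]
  simp only [chargedField]
  field_simp

/-- The `du` component of the gluon polarisation as a function of `u`. -/
def gluonCoeff (eA : ℝ → Fin n → ℝ) (ε : Fin n → ℂ) (k : Mom n) (u : ℝ) : ℂ :=
  ∑ a, ε a * chargedVel eA k a u

theorem gluonMode_iu (hk : k.1 ≠ 0) (ε : Fin n → ℂ) :
    gluonMode eA f ε k iu = chargedField eA f k (gluonCoeff eA ε k) := funext fun X => by
  have := Complex.ofReal_ne_zero.2 hk
  change (Complex.I * (k.1 : ℂ))⁻¹ * ∑ a, ε a * pd (Sum.inr a) (chargedMode eA f k) X = _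
  rw [chargedMode_eq]
  simp only [(hasPD_chargedField_x hk _ _ X).pd_eq, chargedField, gluonCoeff, Finset.mul_sum,
    Finset.sum_mul]
  refine Finset.sum_congr rfl fun a _ => ?_
  field_simp

theorem hasDerivAt_gluonCoeff (h : IsChargedData e Fs eA f) (ε : Fin n → ℂ) (u : ℝ) :
    HasDerivAt (gluonCoeff eA ε k) (∑ a, ε a * ((e (Fs u a) : ℂ) / k.1)) u :=
  HasDerivAt.fun_sum fun a _ =>
    ((((h.pot u a).const_add (k.2 a)).ofReal_comp).div_const _).const_mul _

theorem gluonPol_eq (ε : Fin n → ℂ) (X : Pt n) : gluonPol eA ε k iu X = gluonCoeff eA ε k (X iu) :=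
    by
  simp [gluonPol, gluonCoeff, chargedVel]

theorem gMomentum_v (X : Pt n) : gMomentum (background e Fs) eA f k iv X = k.1 := by
  rw [gMomentum, chargedMode_eq, gD_chargedField_v]
  have := Complex.exp_ne_zero (Complex.I * (chargedPhase eA f k X : ℂ))
  simp only [chargedField, chargedMode, neg_mul, Complex.exp_neg]
  field_simp
  linear_combination -(k.1 : ℂ) * Complex.I_sq

theorem gMomentum_x (hk : k.1 ≠ 0) (a : Fin n) (X : Pt n) :
    gMomentum (background e Fs) eA f k (Sum.inr a) X = k.1 * chargedVel eA k a (X iu) := by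
  rw [gMomentum, chargedMode_eq, gD_chargedField_x hk]
  have := Complex.exp_ne_zero (Complex.I * (chargedPhase eA f k X : ℂ))
  simp only [chargedField, chargedMode, neg_mul, Complex.exp_neg]
  field_simp
  linear_combination -(k.1 : ℂ) * chargedVel eA k a (X iu) * Complex.I_sq

theorem gMomentum_u (h : IsChargedData e Fs eA f) (hk : k.1 ≠ 0) (X : Pt n) :
    gMomentum (background e Fs) eA f k iu X
      = k.1 / 2 * ∑ a, chargedVel eA k a (X iu) ^ 2 := by
  rw [gMomentum, chargedMode_eq, gD_chargedField_u h hk (fun u => hasDerivAt_const u 1)]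
  have := Complex.exp_ne_zero (Complex.I * (chargedPhase eA f k X : ℂ))
  simp only [chargedField, chargedMode, neg_mul, Complex.exp_neg]
  field_simp
  linear_combination -(k.1 : ℂ) * (∑ a, chargedVel eA k a (X iu) ^ 2) * Complex.I_sq

theorem sum_eta (X : Pt n) (T : Idx n → Idx n → ℂ) : ∑ μ, ∑ ν, (eta X μ ν : ℂ) * T μ ν
    = T iu iv + T iv iu - ∑ a, T (Sum.inr a) (Sum.inr a) := by
  rw [show eta X = invMetric 0 X from rfl, sum_invMetric_mul]
  simp [quad]

theorem hasPD_background_u_x (c : Fin n) (X : Pt n) :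
    HasPD (Sum.inr c) (background e Fs iu) (e (Fs (X iu) c)) X := by
  refine HasPD.congr (U := Set.univ) isOpen_univ trivial (fun Y _ => background_iu Y)
    ((HasPD.sum (s := Finset.univ) fun a _ => (hasPD_coord c a X).mul
      (hasPD_comp_u_ne (inr_ne_iu c) (fun u => e (Fs u a)) X)).congr_deriv ?_)
  simp

theorem hasPD_background_u_v (X : Pt n) : HasPD iv (background e Fs iu) 0 X := by
  refine HasPD.congr (U := Set.univ) isOpen_univ trivial (fun Y _ => background_iu Y)
    ((HasPD.sum (s := Finset.univ) fun a _ => (hasPD_coord_ne (inr_ne_iv a) X).mul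
      (hasPD_comp_u_ne (μ := iv) iv_ne_iu (fun u => e (Fs u a)) X)).congr_deriv ?_)
  simp

theorem sum_gluon_u (κ q W Φ : ℂ) (v e g : Fin n → ℂ) :
    ∑ x, (κ * v x * (κ * v x * q - κ / 2 * W * e x) * Φ + Complex.I * (e x * Φ) * g x)
      = (κ ^ 2 * q * ∑ x, v x ^ 2 - κ ^ 2 / 2 * W * ∑ x, e x * v x
        + Complex.I * ∑ x, e x * g x) * Φ := by
  simp only [Finset.mul_sum, Finset.sum_mul, ← Finset.sum_add_distrib, ← Finset.sum_sub_distrib]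
  exact Finset.sum_congr rfl fun x _ => by ring

/-- The components of the field strength are all multiples of `e^{iφ̃}` by functions of `u`, so that
each component of the equation is an identity between these functions; in the component along `u`
the derivative of the polarisation is cancelled by the spin coupling `i a^μ (∂_μ B_ν - ∂_ν B_μ)`. -/
theorem gluonMode_eq (h : IsChargedData e Fs eA f) (hk : k.1 ≠ 0) (ε : Fin n → ℂ) (X : Pt n)
    (ν : Idx n) :
    ∑ μ, ∑ ρ, (eta X μ ρ : ℂ) * (gD (background e Fs) μ
      (gluonStrength (background e Fs) (gluonMode eA f ε k) ρ ν) X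
      + Complex.I * gluonMode eA f ε k ρ X *
        ((pd μ (background e Fs ν) X - pd ν (background e Fs μ) X : ℝ) : ℂ)) = 0 := by
  have hBv : background e Fs iv = fun _ => 0 := funext background_iv
  have hBx : ∀ a, background e Fs (Sum.inr a) = fun _ => 0 := fun a => funext (background_inr a)
  have h0 := Complex.ofReal_ne_zero.2 hk
  set κ : ℂ := Complex.I * k.1 with hκ
  set v := chargedVel eA k with hv
  set q := gluonCoeff eA ε k with hq
  have hz : ∀ μ, gD (background e Fs) μ (fun _ => 0) = fun _ => 0 := fun μ => funext fun X => by
    simp [gD, pd_const]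
  have hdiag : ∀ μ, gluonStrength (background e Fs) (gluonMode eA f ε k) μ μ = fun _ => 0 :=
    fun μ => funext fun Y => sub_self _
  have hvu : gluonStrength (background e Fs) (gluonMode eA f ε k) iv iu
      = chargedField eA f k (fun u => κ * q u) := funext fun Y => by
    rw [gluonStrength, gluonMode_iv, gluonMode_iu hk, gD_chargedField_v, chargedField_zero, hz]
    simp [hκ, hq]
  have huv : gluonStrength (background e Fs) (gluonMode eA f ε k) iu iv
      = chargedField eA f k (fun u => -(κ * q u)) := funext fun Y => by
    rw [gluonStrength, gluonMode_iv, gluonMode_iu hk, gD_chargedField_v, chargedField_zero, hz]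
    simp [hκ, hq, chargedField]
  have hvx : ∀ a, gluonStrength (background e Fs) (gluonMode eA f ε k) iv (Sum.inr a)
      = chargedField eA f k (fun _ => κ * ε a) := fun a => funext fun Y => by
    rw [gluonStrength, gluonMode_iv, gluonMode_inr hk, gD_chargedField_v, chargedField_zero, hz]
    simp [hκ]
  have hxv : ∀ a, gluonStrength (background e Fs) (gluonMode eA f ε k) (Sum.inr a) iv
      = chargedField eA f k (fun _ => -(κ * ε a)) := fun a => funext fun Y => by
    rw [gluonStrength, gluonMode_iv, gluonMode_inr hk, gD_chargedField_v, chargedField_zero, hz]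
    simp [hκ, chargedField]
  have hxu : ∀ a, gluonStrength (background e Fs) (gluonMode eA f ε k) (Sum.inr a) iu
      = chargedField eA f k (fun u => κ * v a u * q u - κ / 2 * (∑ c, v c u ^ 2) * ε a) :=
    fun a => funext fun Y => by
      rw [gluonStrength, gluonMode_iu hk, gluonMode_inr hk, gD_chargedField_x hk,
        gD_chargedField_u h hk (fun u => hasDerivAt_const u (ε a))]
      simp only [chargedField, hκ, hv, hq]; ring
  have hux : ∀ a, gluonStrength (background e Fs) (gluonMode eA f ε k) iu (Sum.inr a)
      = chargedField eA f k (fun u => κ / 2 * (∑ c, v c u ^ 2) * ε a - κ * v a u * q u) :=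
    fun a => funext fun Y => by
      rw [gluonStrength, gluonMode_iu hk, gluonMode_inr hk, gD_chargedField_x hk,
        gD_chargedField_u h hk (fun u => hasDerivAt_const u (ε a))]
      simp only [chargedField, hκ, hv, hq]; ring
  have hxx : ∀ a b, gluonStrength (background e Fs) (gluonMode eA f ε k) (Sum.inr a) (Sum.inr b)
      = chargedField eA f k (fun u => κ * v a u * ε b - κ * v b u * ε a) :=
    fun a b => funext fun Y => by
      rw [gluonStrength, gluonMode_inr hk, gluonMode_inr hk, gD_chargedField_x hk,
        gD_chargedField_x hk]
      simp only [chargedField, hκ, hv]; ring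
  have hqs : ∑ a, ε a * v a (X iu) = q (X iu) := rfl
  rw [sum_eta X (fun μ ρ => gD (background e Fs) μ
      (gluonStrength (background e Fs) (gluonMode eA f ε k) ρ ν) X
      + Complex.I * gluonMode eA f ε k ρ X *
        ((pd μ (background e Fs ν) X - pd ν (background e Fs μ) X : ℝ) : ℂ))]
  rcases idx_cases ν with rfl | rfl | ⟨b, rfl⟩
  · have e1 := sum_gluon_u κ (q (X iu)) (∑ c, v c (X iu) ^ 2) (chargedMode eA f k X)
      (fun a => v a (X iu)) ε (fun a => ((e (Fs (X iu) a) : ℝ) : ℂ))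
    have e2 : Complex.I * ∑ a, ε a * ((e (Fs (X iu) a) : ℝ) : ℂ)
        = κ * ∑ a, ε a * ((e (Fs (X iu) a) : ℂ) / k.1) := by
      rw [Finset.mul_sum, Finset.mul_sum]
      refine Finset.sum_congr rfl fun a _ => ?_
      rw [hκ]; field_simp
    simp only [hvu, hdiag, hz, hxu, gD_chargedField_u h hk
      (show ∀ u, HasDerivAt (fun u => κ * q u) _ u from
        fun u => (hasDerivAt_gluonCoeff h ε u).const_mul κ), gD_chargedField_x hk, hBv, hBx,
          pd_const,
      (hasPD_background_u_x _ X).pd_eq, (hasPD_background_u_v X).pd_eq, gluonMode_iv,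
      gluonMode_inr hk]
    simp only [← hκ, ← hv, chargedField, sub_zero] at e1 ⊢
    rw [e1, e2, hqs]
    push_cast
    ring
  · have e1 : ∑ a, chargedField eA f k (fun u => κ * v a u * -(κ * ε a)) X
        = -(κ ^ 2 * ∑ a, ε a * v a (X iu)) * chargedMode eA f k X := by
      rw [Finset.mul_sum, ← Finset.sum_neg_distrib, Finset.sum_mul]
      exact Finset.sum_congr rfl fun a _ => by simp only [chargedField]; ring
    simp only [huv, hdiag, hz, hxv, gD_chargedField_v, gD_chargedField_x hk, hBv, hBx, pd_const,
      (hasPD_background_u_v X).pd_eq, sub_zero, Complex.ofReal_zero, mul_zero, add_zero]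
    simp only [← hκ, ← hv, chargedField] at e1 ⊢
    rw [e1, hqs]
    ring
  · have e1 : ∑ a, chargedField eA f k (fun u => κ * v a u * (κ * v a u * ε b - κ * v b u * ε a)) X
        = κ ^ 2 * (ε b * ∑ a, v a (X iu) ^ 2 - v b (X iu) * ∑ a, ε a * v a (X iu))
          * chargedMode eA f k X := by
      simp only [Finset.mul_sum, Finset.sum_mul, ← Finset.sum_sub_distrib]
      exact Finset.sum_congr rfl fun a _ => by simp only [chargedField]; ring
    simp only [hvx, hux, hxx, gD_chargedField_v, gD_chargedField_x hk, hBv, hBx, pd_const,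
      gD_chargedField_u h hk (fun u => hasDerivAt_const u (κ * ε b)), gluonMode_iv,
        chargedField_zero,
      sub_zero, Complex.ofReal_zero, mul_zero, zero_mul, add_zero]
    simp only [← hκ, ← hv, chargedField] at e1 ⊢
    rw [e1, hqs]
    ring

theorem chargedModesSolve (h : IsChargedData e Fs eA f) :
    ChargedModesSolve (background e Fs) eA f where
  momentum_null k hk X := by
    simp only [mul_assoc]
    rw [sum_eta X (fun μ ν => gMomentum (background e Fs) eA f k μ X
      * gMomentum (background e Fs) eA f k ν X)]
    have : ∑ a, (k.1 : ℂ) * chargedVel eA k a (X iu) * (k.1 * chargedVel eA k a (X iu))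
        = k.1 ^ 2 * ∑ a, chargedVel eA k a (X iu) ^ 2 := by
      rw [Finset.mul_sum]; exact Finset.sum_congr rfl fun a _ => by ring
    simp only [gMomentum_v, gMomentum_u h hk, gMomentum_x hk, this]
    ring
  scalar_wave k hk X := by
    rw [sum_eta X (fun μ ν => gD (background e Fs) μ (gD (background e Fs) ν (chargedMode eA f k))
      X)]
    have : ∑ a, chargedField eA f k (fun u => Complex.I * k.1 * chargedVel eA k a u *
        (Complex.I * k.1 * chargedVel eA k a u * 1)) X
        = (Complex.I * k.1) ^ 2 * (∑ a, chargedVel eA k a (X iu) ^ 2) * chargedMode eA f k X := by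
      rw [Finset.mul_sum, Finset.sum_mul]
      exact Finset.sum_congr rfl fun a _ => by simp only [chargedField]; ring
    rw [chargedMode_eq]
    simp only [gD_chargedField_v, gD_chargedField_x hk, gD_chargedField_u h hk
      (fun u => hasDerivAt_const u (1 : ℂ)), gD_chargedField_u h hk
      (fun u => hasDerivAt_const u (Complex.I * (k.1 : ℂ) * 1)), this]
    simp only [chargedField]
    ring
  gluon_closed ε k hk X μ := by
    rcases idx_cases μ with rfl | rfl | ⟨a, rfl⟩
    · rw [gluonMode_iu hk, gluonPol_eq, chargedField]
    · rw [gluonMode_iv, chargedField]; simp [gluonPol]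
    · rw [gluonMode_inr hk]; rfl
  gluon_onshell ε k hk X := by
    simp only [mul_assoc]
    rw [sum_eta X (fun μ ν => gluonPol eA ε k μ X * gMomentum (background e Fs) eA f k ν X)]
    have h1 : gluonPol eA ε k iv X = 0 := rfl
    have h2 : ∀ a, gluonPol eA ε k (Sum.inr a) X = ε a := fun _ => rfl
    simp only [h1, h2, gMomentum_v, gMomentum_x hk, gluonPol_eq, gluonCoeff, Finset.sum_mul,
      zero_mul,
      add_zero, ← Finset.sum_sub_distrib]
    exact Finset.sum_eq_zero fun a _ => by ring
  gluon_lightcone ε k hk X := by rw [gluonMode_iv, chargedField, zero_mul]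
  gluon_lorenz ε k hk X := by
    rw [sum_eta X (fun μ ν => gD (background e Fs) μ (gluonMode eA f ε k ν) X), gluonMode_iv,
      gluonMode_iu hk, chargedField_zero]
    simp only [gluonMode_inr hk, gD_chargedField_v, gD_chargedField_x hk]
    simp only [gD, pd_const, chargedField, gluonCoeff, Finset.mul_sum, Finset.sum_mul, mul_zero,
      sub_zero, zero_add, ← Finset.sum_sub_distrib]
    exact Finset.sum_eq_zero fun a _ => by ring
  gluon_divergence ε k hk X := by
    rw [sum_eta X (fun μ ν => pd μ (gluonMode eA f ε k ν) X), gluonMode_iv, gluonMode_iu hk,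
      chargedField_zero]
    simp only [gluonMode_inr hk, (hasPD_chargedField_v _ X).pd_eq,
      (hasPD_chargedField_x hk _ _ X).pd_eq]
    simp only [pd_const, chargedField, gluonCoeff, Finset.mul_sum, Finset.sum_mul,
      zero_add, ← Finset.sum_sub_distrib]
    exact Finset.sum_eq_zero fun a _ => by ring
  gluon_eq ε k hk X ν := gluonMode_eq h hk ε X ν

theorem chargedModesFlat {R : Set ℝ} (hA : ∀ u ∈ R, eA u = 0)
    (hf : ∀ u ∈ R, ∀ k, f k u = u * ∑ a, k a ^ 2) : ChargedModesFlat eA f R := by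
  have hscalar : ∀ k : Mom n, k.1 ≠ 0 → ∀ X : Pt n, X iu ∈ R →
      chargedMode eA f k X = flatWave k X := by
    intro k _ X hX
    simp [chargedMode, flatWave, chargedPhase, flatPhase, hA _ hX, hf _ hX]
  refine ⟨hscalar, fun ε k hk X hX μ => ?_⟩
  rcases idx_cases μ with rfl | rfl | ⟨a, rfl⟩
  · rw [gluonMode_iu hk, chargedField, hscalar k hk X hX]
    simp [gluonCoeff, flatPol, chargedVel, hA _ hX]
  · rw [gluonMode_iv, chargedField]; simp [flatPol]
  · rw [gluonMode_inr hk, chargedField, hscalar k hk X hX]; rfl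

end Charged

/-! ### Integrals over smearing functions -/

/-- A smooth smearing function of compact support, without a sign condition on the frequency. -/
structure IsBump {V : Type*} [NormedAddCommGroup V] [NormedSpace ℝ V] (f : V → ℂ) : Prop where
  smooth : ContDiff ℝ ∞ f
  compact : HasCompactSupport f

theorem IsTest.isBump {f : Mom n → ℂ} (hf : IsTest f) : IsBump f := ⟨hf.smooth, hf.compact⟩

section Bump

variable {V : Type*} [NormedAddCommGroup V] [NormedSpace ℝ V]

theorem IsBump.continuous {f : V → ℂ} (hf : IsBump f) : Continuous f := hf.smooth.continuous

theorem IsBump.smooth_mul {f g : V → ℂ} (hf : IsBump f) (hg : ContDiff ℝ ∞ g) :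
    IsBump (fun k => g k * f k) :=
  ⟨hg.mul hf.smooth, hf.compact.mul_left⟩

theorem IsBump.integrable_mul [MeasurableSpace V] [BorelSpace V] {μ : Measure V}
    [IsFiniteMeasureOnCompacts μ] {f M : V → ℂ} (hf : IsBump f) (hM : Continuous M) :
    Integrable (fun k => f k * M k) μ :=
  (hf.continuous.mul hM).integrable_of_hasCompactSupport hf.compact.mul_right

theorem IsBump.integrable [MeasurableSpace V] [BorelSpace V] {μ : Measure V}
    [IsFiniteMeasureOnCompacts μ] {f : V → ℂ} (hf : IsBump f) : Integrable f μ :=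
  hf.continuous.integrable_of_hasCompactSupport hf.compact

theorem IsBump.memLp_two [MeasurableSpace V] [BorelSpace V] {μ : Measure V}
    [IsFiniteMeasureOnCompacts μ] {f : V → ℂ} (hf : IsBump f) : MemLp f 2 μ :=
  hf.continuous.memLp_of_hasCompactSupport hf.compact

/-- A smooth factor that is only smooth near the support may be multiplied in. -/
theorem IsBump.smoothOn_mul {f g : V → ℂ} (hf : IsBump f)
    (hg : ∀ k ∈ tsupport f, ContDiffAt ℝ ∞ g k) : IsBump (fun k => g k * f k) := by
  refine ⟨contDiff_iff_contDiffAt.2 fun k => ?_, hf.compact.mul_left⟩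
  by_cases hk : k ∈ tsupport f
  · exact (hg k hk).mul hf.smooth.contDiffAt
  · have h0 : (fun k => g k * f k) =ᶠ[𝓝 k] fun _ => 0 := by
      filter_upwards [notMem_tsupport_iff_eventuallyEq.1 hk] with l hl
      simp [hl]
    exact contDiffAt_const.congr_of_eventuallyEq h0

/-- Differentiation under the integral against a smearing function. -/
theorem IsBump.hasDerivAt_integral [MeasurableSpace V] [BorelSpace V] {μ : Measure V}
    [IsFiniteMeasureOnCompacts μ] {f : V → ℂ} (hf : IsBump f) {M M' : ℝ → V → ℂ} {s : ℝ}
    {U : Set ℝ} (hU : U ∈ 𝓝 s) (hM : ∀ t ∈ U, Continuous (M t))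
    (hd : ∀ t ∈ U, ∀ k, HasDerivAt (fun r => M r k) (M' t k) t)
    (hM' : ContinuousOn (Function.uncurry M') (U ×ˢ Set.univ)) :
    HasDerivAt (fun t => ∫ k, f k * M t k ∂μ) (∫ k, f k * M' s k ∂μ) s := by
  obtain ⟨ε, hε, hεU⟩ := Metric.nhds_basis_closedBall.mem_iff.1 hU
  have hcomp : IsCompact (Metric.closedBall s ε ×ˢ tsupport f) :=
    (isCompact_closedBall s ε).prod hf.compact
  obtain ⟨C, hC⟩ := hcomp.exists_bound_of_continuousOn
    (hM'.mono (Set.prod_mono hεU (Set.subset_univ _)))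
  have hM's : Continuous (M' s) := by
    rw [← continuousOn_univ]
    exact hM'.comp (f := fun k => (s, k)) (by fun_prop) fun k _ => ⟨mem_of_mem_nhds hU, trivial⟩
  refine (hasDerivAt_integral_of_dominated_loc_of_deriv_le (Metric.closedBall_mem_nhds s hε)
    (F' := fun t k => f k * M' t k) (bound := fun k => ‖f k‖ * C) ?_ ?_ ?_ ?_ ?_ ?_).2
  · filter_upwards [hU] with t ht
    exact (hf.integrable_mul (hM t ht)).aestronglyMeasurable
  · exact hf.integrable_mul (hM s (mem_of_mem_nhds hU))
  · exact (hf.integrable_mul hM's).aestronglyMeasurable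
  · refine ae_of_all _ fun k t ht => ?_
    rw [norm_mul]
    by_cases hk : k ∈ tsupport f
    · exact mul_le_mul_of_nonneg_left (hC (t, k) ⟨ht, hk⟩) (norm_nonneg _)
    · simp [image_eq_zero_of_notMem_tsupport hk]
  · exact hf.integrable.norm.mul_const C
  · exact ae_of_all _ fun k t ht => (hd t (hεU ht) k).const_mul _

end Bump

/-! ### Weighted composition operators -/

section WeightedComp

variable {α β : Type*} [MeasurableSpace α] [MeasurableSpace β] {μ : Measure α} {ν : Measure β}

theorem memLp_weightedComp {T : α ≃ᵐ β} {ρ : α → ℂ} {r : ℝ} (hr : 0 < r)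
    (hT : μ.map T = ENNReal.ofReal r⁻¹ • ν) (hρ : Measurable ρ) (hn : ∀ x, ‖ρ x‖ = √r)
    {f : β → ℂ} (hf : MemLp f 2 ν) :
    MemLp (fun x => ρ x * f (T x)) 2 μ ∧
      eLpNorm (fun x => ρ x * f (T x)) 2 μ = eLpNorm f 2 ν := by
  have h1 : MemLp f 2 (μ.map T) := by
    rw [hT]; exact hf.smul_measure ENNReal.ofReal_ne_top
  have h2 : MemLp (f ∘ T) 2 μ := (T.measurableEmbedding.memLp_map_measure_iff).1 h1
  have h3 : eLpNorm (fun x => ρ x * f (T x)) 2 μ = eLpNorm ((√r : ℂ) • (f ∘ T)) 2 μ := by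
    refine eLpNorm_congr_norm_ae (ae_of_all _ fun x => ?_)
    simp [hn, abs_of_nonneg (Real.sqrt_nonneg r)]
  have h4 : eLpNorm (fun x => ρ x * f (T x)) 2 μ = eLpNorm f 2 ν := by
    rw [h3, eLpNorm_const_smul, ← T.measurableEmbedding.eLpNorm_map_measure, hT,
      eLpNorm_smul_measure_of_ne_top (by simp), smul_eq_mul, ← mul_assoc]
    have h5 : ‖(√r : ℂ)‖ₑ * (ENNReal.ofReal r⁻¹) ^ (1 / (2 : ENNReal)).toReal = 1 := by
      rw [← ofReal_norm, ENNReal.ofReal_rpow_of_pos (inv_pos.2 hr),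
        ← ENNReal.ofReal_mul (norm_nonneg _)]
      simp only [Complex.norm_real, Real.norm_eq_abs, abs_of_nonneg (Real.sqrt_nonneg r)]
      rw [show (1 / (2 : ENNReal)).toReal = 1 / 2 by simp, ← Real.sqrt_eq_rpow, Real.sqrt_inv,
        mul_inv_cancel₀ (Real.sqrt_pos.2 hr).ne', ENNReal.ofReal_one]
    rw [h5, one_mul]
  exact ⟨⟨hρ.aestronglyMeasurable.mul h2.1, h4 ▸ hf.2⟩, h4⟩

theorem exists_isometry_weightedComp {T : α ≃ᵐ β} {ρ : α → ℂ} {r : ℝ} (hr : 0 < r)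
    (hT : μ.map T = ENNReal.ofReal r⁻¹ • ν) (hρ : Measurable ρ) (hn : ∀ x, ‖ρ x‖ = √r) :
    ∃ W : Lp ℂ 2 ν →ₗᵢ[ℂ] Lp ℂ 2 μ, ∀ f : Lp ℂ 2 ν, W f =ᵐ[μ] fun x => ρ x * f (T x) := by
  have hm := fun f : Lp ℂ 2 ν => memLp_weightedComp hr hT hρ hn (Lp.memLp f)
  have hq : Measure.QuasiMeasurePreserving T μ ν := by
    refine ⟨T.measurable, ?_⟩
    rw [hT]; exact Measure.smul_absolutelyContinuous
  refine ⟨{ toFun := fun f => (hm f).1.toLp _, map_add' := ?_, map_smul' := ?_, norm_map' := ?_ },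
    fun f => (hm f).1.coeFn_toLp⟩
  · intro f g
    rw [← MemLp.toLp_add (hm f).1 (hm g).1]
    refine MemLp.toLp_congr _ _ ?_
    filter_upwards [hq.ae_eq_comp (Lp.coeFn_add f g)] with x hx
    simp only [Function.comp_apply, Pi.add_apply] at hx
    simp only [Pi.add_apply, hx, mul_add]
  · intro c f
    rw [RingHom.id_apply, ← MemLp.toLp_const_smul c (hm f).1]
    refine MemLp.toLp_congr _ _ ?_
    filter_upwards [hq.ae_eq_comp (Lp.coeFn_smul c f)] with x hx
    simp only [Function.comp_apply, Pi.smul_apply] at hx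
    simp only [Pi.smul_apply, hx, smul_eq_mul]
    ring
  · intro f
    simp only [LinearMap.coe_mk, AddHom.coe_mk]
    rw [Lp.norm_toLp, (hm f).2, Lp.norm_def]

/-- If `T` rescales the measure by a constant and `|ρ|²` is the inverse constant, then
`f ↦ ρ · (f ∘ T)` is unitary. -/
theorem exists_unitary_weightedComp {T : α ≃ᵐ β} {ρ : α → ℂ} {r : ℝ} (hr : 0 < r)
    (hT : μ.map T = ENNReal.ofReal r⁻¹ • ν) (hρ : Measurable ρ) (hn : ∀ x, ‖ρ x‖ = √r) :
    ∃ W : Lp ℂ 2 ν ≃ₗᵢ[ℂ] Lp ℂ 2 μ, ∀ f : Lp ℂ 2 ν, W f =ᵐ[μ] fun x => ρ x * f (T x) := by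
  obtain ⟨W, hW⟩ := exists_isometry_weightedComp hr hT hρ hn
  have hr' : 0 < r⁻¹ := inv_pos.2 hr
  have hT' : ν.map T.symm = ENNReal.ofReal r⁻¹⁻¹ • μ := by
    have h1 : ν = ENNReal.ofReal r • μ.map T := by
      rw [hT, smul_smul, ← ENNReal.ofReal_mul hr.le, mul_inv_cancel₀ hr.ne', ENNReal.ofReal_one,
        one_smul]
    conv_lhs => rw [h1]
    rw [Measure.map_smul, inv_inv, MeasurableEquiv.map_symm_map]
  obtain ⟨W', hW'⟩ := exists_isometry_weightedComp (T := T.symm)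
    (ρ := fun y => (ρ (T.symm y))⁻¹) hr' hT' ((hρ.comp T.symm.measurable).inv)
    (fun y => by rw [norm_inv, hn, Real.sqrt_inv])
  have hq : Measure.QuasiMeasurePreserving T μ ν := by
    refine ⟨T.measurable, ?_⟩
    rw [hT]; exact Measure.smul_absolutelyContinuous
  have hsurj : Function.Surjective W := by
    intro g
    refine ⟨W' g, Lp.ext ?_⟩
    filter_upwards [hW (W' g), hq.ae_eq_comp (hW' g)] with x h1 h2
    simp only [Function.comp_apply, MeasurableEquiv.symm_apply_apply] at h2
    have h0 : ρ x ≠ 0 := by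
      rw [← norm_ne_zero_iff, hn]; exact (Real.sqrt_pos.2 hr).ne'
    rw [h1, h2, mul_inv_cancel_left₀ h0]
  exact ⟨LinearIsometryEquiv.ofSurjective W hsurj, hW⟩

end WeightedComp

/-! ### Packets of plane waves and the Fourier transform -/

/-- The plane wave `e^{i k · y}` on a slice, `y = (v, x)`. -/
def planeWave (k y : Mom n) : ℂ :=
  Complex.exp (Complex.I * ((k.1 * y.1 + ∑ a, k.2 a * y.2 a : ℝ) : ℂ))

/-- The packet `∫ f(k) e^{i k · y} dk`. -/
def flatPacket (f : Mom n → ℂ) (y : Mom n) : ℂ := ∫ k, f k * planeWave k y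

theorem continuous_planeWave : Continuous fun p : Mom n × Mom n => planeWave p.1 p.2 := by
  unfold planeWave; fun_prop

theorem continuous_planeWave_left (y : Mom n) : Continuous fun k : Mom n => planeWave k y :=
  continuous_planeWave.comp (by fun_prop : Continuous fun k : Mom n => (k, y))

/-- Euclidean space of dimension `n + 1` as a product of frequencies and transverse momenta. -/
def chart (n : ℕ) : EuclideanSpace ℝ (Fin (n + 1)) ≃L[ℝ] Mom n :=
  (EuclideanSpace.equiv (Fin (n + 1)) ℝ).trans (Fin.consEquivL ℝ (fun _ : Fin (n + 1) => ℝ)).symm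

theorem chart_fst (z : EuclideanSpace ℝ (Fin (n + 1))) : (chart n z).1 = z 0 := rfl

theorem chart_snd (z : EuclideanSpace ℝ (Fin (n + 1))) (a : Fin n) :
    (chart n z).2 a = z a.succ := rfl

theorem measurePreserving_chart : MeasurePreserving (chart n) := by
  have h := (volume_preserving_piFinSuccAbove (fun _ : Fin (n + 1) => ℝ) 0).comp
    (PiLp.volume_preserving_ofLp (Fin (n + 1)))
  refine h

theorem inner_chart_symm (z : EuclideanSpace ℝ (Fin (n + 1))) (y : Mom n) :
    inner ℝ z ((chart n).symm y) = (chart n z).1 * y.1 + ∑ a, (chart n z).2 a * y.2 a := by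
  obtain ⟨w, rfl⟩ := (chart n).surjective y
  rw [ContinuousLinearEquiv.symm_apply_apply, PiLp.inner_apply, Fin.sum_univ_succ]
  simp [chart_fst, chart_snd, mul_comm]

theorem flatPacket_eq_fourier (f : Mom n → ℂ) (y : Mom n) :
    flatPacket f y
      = FourierTransform.fourier (f ∘ chart n) (-(2 * Real.pi)⁻¹ • (chart n).symm y) := by
  rw [Real.fourier_eq', flatPacket, ← measurePreserving_chart.integral_comp
    (chart n).toHomeomorph.measurableEmbedding]
  refine integral_congr_ae (ae_of_all _ fun z => ?_)
  simp only [planeWave, inner_smul_right, inner_chart_symm, smul_eq_mul, Function.comp_apply]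
  rw [mul_comm]
  congr 2
  have : (Real.pi : ℂ) ≠ 0 := by exact_mod_cast Real.pi_ne_zero
  push_cast
  field_simp

/-- A smearing function as a Schwartz function on Euclidean space. -/
def IsBump.toSchwartz {f : Mom n → ℂ} (hf : IsBump f) :
    SchwartzMap (EuclideanSpace ℝ (Fin (n + 1))) ℂ :=
  HasCompactSupport.toSchwartzMap (f := f ∘ chart n)
    (hf.compact.comp_homeomorph (chart n).toHomeomorph) (hf.smooth.comp (chart n).contDiff)

theorem IsBump.flatPacket_eq {f : Mom n → ℂ} (hf : IsBump f) (y : Mom n) :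
    flatPacket f y
      = (FourierTransform.fourier hf.toSchwartz) (-(2 * Real.pi)⁻¹ • (chart n).symm y) := by
  rw [flatPacket_eq_fourier, SchwartzMap.fourier_coe]; rfl

/-! ### Slices -/

/-- The change of coordinates `(v, x) ↦ (v + ½ σ_ab x^a x^b, Λ x)` of a slice under which curved
packets become flat ones. -/
def sliceMap (σ Λ : Matrix (Fin n) (Fin n) ℝ) (p : Mom n) : Mom n :=
  (p.1 + quad σ p.2 / 2, Λ *ᵥ p.2)

theorem continuous_quad (σ : Matrix (Fin n) (Fin n) ℝ) : Continuous (quad σ) := by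
  unfold quad; fun_prop

theorem continuous_sliceMap (σ Λ : Matrix (Fin n) (Fin n) ℝ) : Continuous (sliceMap σ Λ) := by
  have := continuous_quad σ
  unfold sliceMap
  refine .prodMk (by fun_prop) ?_
  exact Continuous.matrix_mulVec continuous_const continuous_snd

/-- `sliceMap` as a measurable equivalence. -/
def sliceEquiv (σ Λ : Matrix (Fin n) (Fin n) ℝ) (h : Λ.det ≠ 0) : Mom n ≃ᵐ Mom n where
  toFun := sliceMap σ Λ
  invFun q := (q.1 - quad σ (Λ⁻¹ *ᵥ q.2) / 2, Λ⁻¹ *ᵥ q.2)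
  left_inv p := by
    have h1 : Λ⁻¹ * Λ = 1 := Matrix.nonsing_inv_mul _ (isUnit_iff_ne_zero.2 h)
    simp [sliceMap, Matrix.mulVec_mulVec, h1]
  right_inv p := by
    have h1 : Λ * Λ⁻¹ = 1 := Matrix.mul_nonsing_inv _ (isUnit_iff_ne_zero.2 h)
    simp [sliceMap, Matrix.mulVec_mulVec, h1]
  measurable_toFun := (continuous_sliceMap σ Λ).measurable
  measurable_invFun := by
    have h0 : Continuous fun q : Mom n => Λ⁻¹ *ᵥ q.2 :=
      Continuous.matrix_mulVec continuous_const continuous_snd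
    have h1 := (continuous_quad σ).comp h0
    simp only [Function.comp_def] at h1
    exact (Continuous.prodMk (by fun_prop) h0).measurable

theorem map_sliceMap (σ Λ : Matrix (Fin n) (Fin n) ℝ) (h : Λ.det ≠ 0) :
    (volume : Measure (Mom n)).map (sliceMap σ Λ)
      = ENNReal.ofReal |Λ.det⁻¹| • (volume : Measure (Mom n)) := by
  -- a shear along `v` followed by the linear map `Λ` of the transverse coordinates
  have hq := (continuous_quad σ).measurable
  have h1 : MeasurePreserving (fun p : (Fin n → ℝ) × ℝ => (p.1, p.2 + quad σ p.1 / 2))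
      ((volume : Measure (Fin n → ℝ)).prod (volume : Measure ℝ))
      ((volume : Measure (Fin n → ℝ)).prod (volume : Measure ℝ)) := by
    refine (MeasurePreserving.id _).skew_product
      (g := fun x v => v + quad σ x / 2) ?_ (ae_of_all _ fun x => ?_)
    · unfold Function.uncurry; fun_prop
    · exact map_add_right_eq_self _ _
  have h2 : MeasurePreserving (fun p : Mom n => (p.1 + quad σ p.2 / 2, p.2)) :=
    (Measure.measurePreserving_swap.comp h1).comp Measure.measurePreserving_swap
  have h3 : sliceMap σ Λ = Prod.map id (Matrix.toLin' Λ) ∘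
      fun p : Mom n => (p.1 + quad σ p.2 / 2, p.2) := by
    funext p; simp [sliceMap]
  have hm : Measurable (Matrix.toLin' Λ) := by
    have : Continuous (Matrix.toLin' Λ) := LinearMap.continuous_of_finiteDimensional _
    exact this.measurable
  rw [h3, ← Measure.map_map (measurable_id.prodMap hm) h2.measurable, h2.map_eq,
    Measure.volume_eq_prod, ← Measure.map_prod_map _ _ measurable_id hm, Measure.map_id,
    Real.map_matrix_volume_pi_eq_smul_volume_pi h, Measure.prod_smul_right]

/-- The packet `√|det Λ| ∫ f(k) e^{i k₀ (v + ½ σxx) + i k · Λx} dk` on a slice. -/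
def slicePacket (σ Λ : Matrix (Fin n) (Fin n) ℝ) (f : Mom n → ℂ) (p : Mom n) : ℂ :=
  (√|Λ.det| : ℂ) * flatPacket f (sliceMap σ Λ p)

/-- Up to a factor `(2π)^{(n+1)/2}`, packets on a slice are the image of their profile under a
unitary operator: completeness and orthonormality of the modes. -/
theorem exists_unitary_slicePacket (σ Λ : Matrix (Fin n) (Fin n) ℝ) (h : Λ.det ≠ 0) :
    ∃ W : Lp ℂ 2 (volume : Measure (Mom n)) ≃ₗᵢ[ℂ] Lp ℂ 2 (volume : Measure (Mom n)),
      ∀ (f : Mom n → ℂ), IsBump f → ∀ F : Lp ℂ 2 (volume : Measure (Mom n)), F =ᵐ[volume] f →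
        W F =ᵐ[volume] fun p => ((√((2 * Real.pi) ^ (n + 1)))⁻¹ : ℂ) * slicePacket σ Λ f p := by
  have h2pi : (0 : ℝ) < (2 * Real.pi) ^ (n + 1) := by positivity
  have hc : -(2 * Real.pi)⁻¹ ≠ 0 := by simp [Real.pi_ne_zero]
  -- `W` is the Fourier transform of the profile in the Euclidean chart, followed by the change of
  -- variables `T`, whose Jacobian is absorbed by the factor `√|det Λ|`
  set C : EuclideanSpace ℝ (Fin (n + 1)) ≃ᵐ Mom n :=
    (chart n).toHomeomorph.toMeasurableEquiv with hC
  obtain ⟨W1, hW1⟩ := exists_unitary_weightedComp (T := C)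
    (μ := volume) (ν := volume) (ρ := fun _ => 1) one_pos
    (by rw [inv_one, ENNReal.ofReal_one, one_smul]; exact measurePreserving_chart.map_eq)
    measurable_const (by simp)
  set T : Mom n ≃ᵐ EuclideanSpace ℝ (Fin (n + 1)) :=
    ((sliceEquiv σ Λ h).trans C.symm).trans (MeasurableEquiv.smul₀ (-(2 * Real.pi)⁻¹) hc) with hT
  have hTapp : ∀ p, T p = -(2 * Real.pi)⁻¹ • (chart n).symm (sliceMap σ Λ p) := fun p => rfl
  have hd : 0 < |Λ.det| := abs_pos.2 h
  have hTm : (volume : Measure (Mom n)).map T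
      = ENNReal.ofReal (|Λ.det| / (2 * Real.pi) ^ (n + 1))⁻¹ • volume := by
    have e1 : (volume : Measure (Mom n)).map T
        = (((volume : Measure (Mom n)).map (sliceMap σ Λ)).map C.symm).map
          (fun z => -(2 * Real.pi)⁻¹ • z) := by
      rw [Measure.map_map C.symm.measurable (continuous_sliceMap σ Λ).measurable,
        Measure.map_map (by fun_prop) (C.symm.measurable.comp (continuous_sliceMap σ Λ).measurable)]
      rfl
    have e2 : (volume : Measure (Mom n)).map C.symm = volume := by
      conv_lhs => rw [← measurePreserving_chart.map_eq]
      exact MeasurableEquiv.map_symm_map C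
    rw [e1, map_sliceMap σ Λ h, Measure.map_smul, e2, Measure.map_smul,
      Measure.map_addHaar_smul _ hc, smul_smul, ← ENNReal.ofReal_mul (abs_nonneg _)]
    congr 2
    rw [finrank_euclideanSpace, Fintype.card_fin, abs_inv, abs_inv, abs_pow, abs_neg,
      abs_of_pos (by positivity : 0 < (2 * Real.pi)⁻¹), inv_pow, inv_inv, inv_div,
      div_eq_inv_mul, mul_comm]
  obtain ⟨W2, hW2⟩ := exists_unitary_weightedComp (T := T) (μ := volume) (ν := volume)
    (ρ := fun _ => ((√((2 * Real.pi) ^ (n + 1)))⁻¹ : ℂ) * (√|Λ.det| : ℂ))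
    (div_pos hd h2pi) hTm measurable_const (fun _ => by
      rw [Real.sqrt_div hd.le, norm_mul, norm_inv, Complex.norm_real, Complex.norm_real,
        Real.norm_of_nonneg (Real.sqrt_nonneg _), Real.norm_of_nonneg (Real.sqrt_nonneg _)]
      rw [div_eq_inv_mul])
  refine ⟨(W1.trans (Lp.fourierTransformₗᵢ _ ℂ)).trans W2, fun f hf F hF => ?_⟩
  have e1 : W1 F = hf.toSchwartz.toLp 2 := by
    refine Lp.ext ?_
    filter_upwards [hW1 F, measurePreserving_chart.quasiMeasurePreserving.ae_eq_comp hF,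
      hf.toSchwartz.coeFn_toLp 2] with z h1 h2 h3
    rw [h1, h3, one_mul]
    exact h2
  have e2 : Lp.fourierTransformₗᵢ _ ℂ (W1 F)
      = (FourierTransform.fourier hf.toSchwartz).toLp 2 := by
    rw [e1, ← SchwartzMap.toLp_fourier_eq]; rfl
  have hq : Measure.QuasiMeasurePreserving T volume volume := by
    refine ⟨T.measurable, ?_⟩
    rw [hTm]; exact Measure.smul_absolutelyContinuous
  filter_upwards [hW2 (Lp.fourierTransformₗᵢ _ ℂ (W1 F)),
    hq.ae_eq_comp ((FourierTransform.fourier hf.toSchwartz).coeFn_toLp 2 volume)] with p h1 h2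
  simp only [LinearIsometryEquiv.trans_apply]
  rw [h1, e2]
  simp only [Function.comp_apply] at h2
  rw [h2, slicePacket, hf.flatPacket_eq, hTapp, mul_assoc]

/-! ### Packets at fixed frequency -/

/-- The packet `∫ f(k₀, κ) e^{i (κ · y + ½ N κκ)} dκ` at fixed frequency `k₀`. -/
def fiberPacket (f : Mom n → ℂ) (k₀ : ℝ) (N : Matrix (Fin n) (Fin n) ℝ) (y : Fin n → ℝ) : ℂ :=
  ∫ κ : Fin n → ℝ, f (k₀, κ) *
    Complex.exp (Complex.I * ((∑ a, κ a * y a + quad N κ / 2 : ℝ) : ℂ))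

theorem IsBump.slice {f : Mom n → ℂ} (hf : IsBump f) (k₀ : ℝ) : IsBump fun κ => f (k₀, κ) := by
  refine ⟨hf.smooth.comp (by fun_prop), ?_⟩
  refine HasCompactSupport.intro (hf.compact.isCompact.image continuous_snd) fun κ hκ => ?_
  exact image_eq_zero_of_notMem_tsupport fun h => hκ ⟨_, h, rfl⟩

theorem continuous_fiberPhase (N : Matrix (Fin n) (Fin n) ℝ) (y : Fin n → ℝ) :
    Continuous fun κ : Fin n → ℝ =>
      Complex.exp (Complex.I * ((∑ a, κ a * y a + quad N κ / 2 : ℝ) : ℂ)) := by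
  have := continuous_quad N
  fun_prop

theorem norm_expI (x : ℝ) : ‖Complex.exp (Complex.I * (x : ℂ))‖ = 1 := by
  rw [mul_comm, Complex.norm_exp_ofReal_mul_I]

theorem IsBump.mul_coord {f : Mom n → ℂ} (hf : IsBump f) (l : Fin n) :
    IsBump fun k => (k.2 l : ℂ) * f k := by
  refine hf.smooth_mul ?_
  have : ContDiff ℝ ∞ fun k : Mom n => k.2 l := by fun_prop
  exact Complex.ofRealCLM.contDiff.comp this

theorem IsBump.mul_freq {f : Mom n → ℂ} (hf : IsBump f) : IsBump fun k => (k.1 : ℂ) * f k := by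
  refine hf.smooth_mul ?_
  have : ContDiff ℝ ∞ fun k : Mom n => k.1 := by fun_prop
  exact Complex.ofRealCLM.contDiff.comp this

theorem IsBump.pderiv {f : Mom n → ℂ} (hf : IsBump f) (v : Mom n) :
    IsBump fun k => fderiv ℝ f k v :=
  ⟨(hf.smooth.fderiv_right (by simp)).clm_apply contDiff_const,
    (hf.compact.fderiv_apply ℝ v)⟩

theorem hasDerivAt_quad_line (N : Matrix (Fin n) (Fin n) ℝ) (κ : Fin n → ℝ) (j : Fin n) :
    HasDerivAt (fun t : ℝ => quad N (κ + t • Pi.single j 1)) (∑ l, (N j l + N l j) * κ l) 0 := by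
  have h1 : ∀ a, HasDerivAt (fun t : ℝ => (κ + t • (Pi.single j 1 : Fin n → ℝ)) a)
      ((Pi.single j 1 : Fin n → ℝ) a) 0 := fun a => by
    simpa using ((hasDerivAt_id (0 : ℝ)).smul_const ((Pi.single j 1 : Fin n → ℝ) a)).const_add (κ a)
  unfold quad
  refine (HasDerivAt.fun_sum fun a _ => HasDerivAt.fun_sum fun b _ =>
    (((h1 a).const_mul (N a b)).mul (h1 b))).congr_deriv ?_
  simp only [zero_smul, add_zero, Pi.single_apply, mul_ite, mul_one, mul_zero, ite_mul, zero_mul,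
    Finset.sum_add_distrib, Finset.sum_ite_eq', Finset.mem_univ, if_true, add_mul]
  rw [Finset.sum_comm]
  simp

theorem hasLineDerivAt_fiberPhase (N : Matrix (Fin n) (Fin n) ℝ) (y κ : Fin n → ℝ) (j : Fin n) :
    HasLineDerivAt ℝ (fun κ : Fin n → ℝ =>
      Complex.exp (Complex.I * ((∑ a, κ a * y a + quad N κ / 2 : ℝ) : ℂ)))
      (Complex.I * ((y j + (∑ l, (N j l + N l j) * κ l) / 2 : ℝ) : ℂ) *
        Complex.exp (Complex.I * ((∑ a, κ a * y a + quad N κ / 2 : ℝ) : ℂ))) κ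
      (Pi.single j 1) := by
  have h1 : ∀ a, HasDerivAt (fun t : ℝ => (κ + t • (Pi.single j 1 : Fin n → ℝ)) a)
      ((Pi.single j 1 : Fin n → ℝ) a) 0 := fun a => by
    simpa using ((hasDerivAt_id (0 : ℝ)).smul_const ((Pi.single j 1 : Fin n → ℝ) a)).const_add (κ a)
  have h2 : HasDerivAt (fun t : ℝ => ∑ a, (κ + t • (Pi.single j 1 : Fin n → ℝ)) a * y a
      + quad N (κ + t • Pi.single j 1) / 2) (y j + (∑ l, (N j l + N l j) * κ l) / 2) 0 := by
    refine ((HasDerivAt.fun_sum fun a _ => (h1 a).mul_const (y a)).add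
      ((hasDerivAt_quad_line N κ j).div_const 2)).congr_deriv ?_
    simp [Pi.single_apply]
  refine ((h2.ofReal_comp.const_mul Complex.I).cexp).congr_deriv ?_
  simp only [zero_smul, add_zero]
  ring

/-- Multiplication of a fixed-frequency packet by a coordinate, by integration by parts. -/
theorem IsBump.coord_mul_fiberPacket {f : Mom n → ℂ} (hf : IsBump f) (k₀ : ℝ)
    (N : Matrix (Fin n) (Fin n) ℝ) (y : Fin n → ℝ) (j : Fin n) :
    (y j : ℂ) * fiberPacket f k₀ N y
      = Complex.I * fiberPacket (fun k => fderiv ℝ f k (0, Pi.single j 1)) k₀ N y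
        - ∑ l, (((N j l + N l j) / 2 : ℝ) : ℂ) * fiberPacket (fun k => (k.2 l : ℂ) * f k) k₀ N y :=
          by
  set e : (Fin n → ℝ) → ℂ := fun κ =>
    Complex.exp (Complex.I * ((∑ a, κ a * y a + quad N κ / 2 : ℝ) : ℂ)) with he
  have hec : Continuous e := continuous_fiberPhase N y
  have hφ : ∀ κ, HasLineDerivAt ℝ (fun κ => f (k₀, κ)) (fderiv ℝ f (k₀, κ) (0, Pi.single j 1)) κ
      (Pi.single j 1) := by
    intro κ
    have h1 : HasDerivAt (fun t : ℝ => ((k₀, κ + t • Pi.single j 1) : Mom n))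
        (0, Pi.single j 1) 0 := by
      refine (hasDerivAt_const _ _).prodMk ?_
      simpa using ((hasDerivAt_id (0 : ℝ)).smul_const (Pi.single j 1 : Fin n → ℝ)).const_add κ
    have h2 : HasFDerivAt f (fderiv ℝ f (k₀, κ)) (k₀, κ + (0 : ℝ) • Pi.single j 1) := by
      rw [zero_smul, add_zero]
      exact (hf.smooth.differentiable (by simp) (k₀, κ)).hasFDerivAt
    exact h2.comp_hasDerivAt (0 : ℝ) h1
  have hsum : Continuous fun κ : Fin n → ℝ => (∑ l, (N j l + N l j) * κ l) / 2 := by fun_prop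
  -- integration by parts in the direction `j`
  have hibp := integral_bilinear_hasLineDerivAt_right_eq_neg_left_of_integrable
    (μ := (volume : Measure (Fin n → ℝ))) (B := ContinuousLinearMap.mul ℝ ℂ)
    (((hf.pderiv (0, Pi.single j 1)).slice k₀).integrable_mul hec)
    ((hf.slice k₀).integrable_mul (M := fun κ => Complex.I *
      ((y j + (∑ l, (N j l + N l j) * κ l) / 2 : ℝ) : ℂ) * e κ) (by fun_prop))
    ((hf.slice k₀).integrable_mul hec) (fun κ _ => hφ κ)
    (fun κ _ => hasLineDerivAt_fiberPhase N y κ j)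
  simp only [ContinuousLinearMap.mul_apply'] at hibp
  have h3 : ∫ κ, f (k₀, κ) * (Complex.I * ((y j + (∑ l, (N j l + N l j) * κ l) / 2 : ℝ) : ℂ) * e κ)
      = Complex.I * ((y j : ℂ) * fiberPacket f k₀ N y + ∑ l, (((N j l + N l j) / 2 : ℝ) : ℂ) *
          fiberPacket (fun k => (k.2 l : ℂ) * f k) k₀ N y) := by
    unfold fiberPacket
    simp only [← integral_const_mul]
    rw [← integral_finsetSum _ fun l _ =>
      (((hf.mul_coord l).slice k₀).integrable_mul hec).const_mul _,
      ← integral_add (((hf.slice k₀).integrable_mul hec).const_mul _)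
        (integrable_finsetSum _ fun l _ =>
          (((hf.mul_coord l).slice k₀).integrable_mul hec).const_mul _), ← integral_const_mul]
    refine integral_congr_ae (ae_of_all _ fun κ => ?_)
    have h4 : ∑ l, (((N j l + N l j) / 2 : ℝ) : ℂ) * ((κ l : ℂ) * f (k₀, κ) * e κ)
        = (((∑ l, (N j l + N l j) * κ l) / 2 : ℝ) : ℂ) * (f (k₀, κ) * e κ) := by
      rw [Finset.sum_div, Complex.ofReal_sum, Finset.sum_mul]
      refine Finset.sum_congr rfl fun l _ => ?_
      push_cast
      ring
    change f (k₀, κ) * (Complex.I * ((y j + (∑ l, (N j l + N l j) * κ l) / 2 : ℝ) : ℂ) * e κ)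
      = Complex.I * ((y j : ℂ) * (f (k₀, κ) * e κ)
      + ∑ l, (((N j l + N l j) / 2 : ℝ) : ℂ) * ((κ l : ℂ) * f (k₀, κ) * e κ))
    rw [h4, Complex.ofReal_add]
    ring
  rw [h3] at hibp
  have h4 : (∫ κ, fderiv ℝ f (k₀, κ) (0, Pi.single j 1) * e κ)
      = fiberPacket (fun k => fderiv ℝ f k (0, Pi.single j 1)) k₀ N y := rfl
  rw [h4] at hibp
  have h5 := congrArg (fun z => -Complex.I * z) hibp
  simp only [← mul_assoc, neg_mul, Complex.I_mul_I, neg_neg, one_mul, mul_neg] at h5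
  rw [eq_sub_iff_add_eq, h5]

theorem IsBump.exists_norm_fiberPacket_le {f : Mom n → ℂ} (hf : IsBump f) :
    ∃ C, ∀ k₀ N y, ‖fiberPacket f k₀ N y‖ ≤ C := by
  obtain ⟨M, hM⟩ := hf.continuous.bounded_above_of_compact_support hf.compact
  set K := Prod.snd '' tsupport f
  have hK : IsCompact K := hf.compact.isCompact.image continuous_snd
  refine ⟨∫ κ, K.indicator (fun _ => M) κ, fun k₀ N y => norm_integral_le_of_norm_le
    ((integrable_indicator_iff hK.measurableSet).2 (integrableOn_const hK.measure_lt_top.ne)) ?_⟩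
  refine ae_of_all _ fun κ => ?_
  rw [norm_mul, norm_expI, mul_one]
  by_cases h : κ ∈ K
  · rw [Set.indicator_of_mem h]; exact hM _
  · rw [Set.indicator_of_notMem h,
      image_eq_zero_of_notMem_tsupport fun h' => h ⟨_, h', rfl⟩, norm_zero]

/-- Fixed-frequency packets decay rapidly, uniformly in the frequency and in bounded `N`. -/
theorem IsBump.decay_fiberPacket {f : Mom n → ℂ} (hf : IsBump f) (B : ℝ) (m : ℕ) :
    ∃ C, ∀ k₀ N y, (∀ i j, |N i j| ≤ B) → ‖y‖ ^ m * ‖fiberPacket f k₀ N y‖ ≤ C := by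
  induction m generalizing f with
  | zero =>
    obtain ⟨C, hC⟩ := hf.exists_norm_fiberPacket_le
    exact ⟨C, fun k₀ N y _ => by simpa using hC k₀ N y⟩
  | succ m ih =>
    choose C1 hC1 using fun j : Fin n => ih (hf.pderiv (0, Pi.single j 1))
    choose C2 hC2 using fun l : Fin n => ih (hf.mul_coord l)
    refine ⟨∑ j, (C1 j + ∑ l, B * C2 l), fun k₀ N y hN => ?_⟩
    have hy : ‖y‖ ≤ ∑ j, |y j| := by
      refine (pi_norm_le_iff_of_nonneg (Finset.sum_nonneg fun _ _ => abs_nonneg _)).2 fun j => ?_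
      exact Finset.single_le_sum (f := fun j => |y j|) (fun _ _ => abs_nonneg _) (Finset.mem_univ j)
    calc ‖y‖ ^ (m + 1) * ‖fiberPacket f k₀ N y‖
        ≤ ‖y‖ ^ m * ((∑ j, |y j|) * ‖fiberPacket f k₀ N y‖) := by
          rw [pow_succ, mul_assoc]; gcongr
      _ = ∑ j, ‖y‖ ^ m * ‖(y j : ℂ) * fiberPacket f k₀ N y‖ := by
          rw [Finset.sum_mul, Finset.mul_sum]
          simp [Complex.norm_real]
      _ ≤ _ := Finset.sum_le_sum fun j _ => ?_
    rw [hf.coord_mul_fiberPacket]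
    calc _ ≤ ‖y‖ ^ m * (‖fiberPacket (fun k => fderiv ℝ f k (0, Pi.single j 1)) k₀ N y‖
          + ∑ l, B * ‖fiberPacket (fun k => (k.2 l : ℂ) * f k) k₀ N y‖) := by
          gcongr
          refine (norm_sub_le _ _).trans (add_le_add (by simp) ((norm_sum_le _ _).trans
            (Finset.sum_le_sum fun l _ => ?_)))
          rw [norm_mul, Complex.norm_real, Real.norm_eq_abs]
          gcongr
          rw [abs_div, abs_two, div_le_iff₀ two_pos]
          exact (abs_add_le _ _).trans (by linarith [hN j l, hN l j])
      _ ≤ _ := by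
          rw [mul_add, Finset.mul_sum]
          refine add_le_add (hC1 j k₀ N y hN) (Finset.sum_le_sum fun l _ => ?_)
          rw [mul_left_comm]
          exact mul_le_mul_of_nonneg_left (hC2 l k₀ N y hN) ((abs_nonneg _).trans (hN j l))

theorem IsBump.continuous_fiberPacket {f : Mom n → ℂ} (hf : IsBump f)
    (N : Matrix (Fin n) (Fin n) ℝ) :
    Continuous fun p : Mom n => fiberPacket f p.1 N p.2 := by
  have hK : IsCompact (Prod.snd '' tsupport f) := hf.compact.isCompact.image continuous_snd
  have hq := continuous_quad N
  have hc := hf.continuous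
  have h := continuous_parametric_integral_of_continuous (μ := volume) (X := Mom n)
    (f := fun p κ => f (p.1, κ) *
      Complex.exp (Complex.I * ((∑ a, κ a * p.2 a + quad N κ / 2 : ℝ) : ℂ)))
    (by unfold Function.uncurry; fun_prop) hK
  refine h.congr fun p => setIntegral_eq_integral_of_forall_compl_eq_zero fun κ hκ => ?_
  rw [image_eq_zero_of_notMem_tsupport fun h' => hκ ⟨_, h', rfl⟩, zero_mul]

/-! ### Overlaps as integrals over the frequency -/

/-- The part of frequency `k₀` of a packet on a slice; `N` is a quadratic phase of the profile. -/
def sliceFiber (σ Λ N : Matrix (Fin n) (Fin n) ℝ) (f : Mom n → ℂ) (k₀ : ℝ) (x : Fin n → ℝ) : ℂ :=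
  (√|Λ.det| : ℂ) * (Complex.exp (Complex.I * ((k₀ * (quad σ x / 2) : ℝ) : ℂ)) *
    fiberPacket f k₀ N (Λ *ᵥ x))

theorem quad_zero (x : Fin n → ℝ) : quad (0 : Matrix (Fin n) (Fin n) ℝ) x = 0 := by simp [quad]

theorem IsBump.slicePacket_eq {f : Mom n → ℂ} (hf : IsBump f) (σ Λ : Matrix (Fin n) (Fin n) ℝ)
    (v : ℝ) (x : Fin n → ℝ) :
    slicePacket σ Λ f (v, x)
      = ∫ k₀ : ℝ, sliceFiber σ Λ 0 f k₀ x * Complex.exp (Complex.I * ((k₀ * v : ℝ) : ℂ)) := by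
  have hi := hf.integrable_mul (μ := volume) (continuous_planeWave_left (sliceMap σ Λ (v, x)))
  rw [slicePacket, flatPacket, Measure.volume_eq_prod, integral_prod _ hi, ← integral_const_mul]
  refine integral_congr_ae (ae_of_all _ fun k₀ => ?_)
  simp only [sliceFiber, fiberPacket]
  rw [← integral_const_mul, ← integral_const_mul, ← integral_const_mul, ← integral_mul_const]
  refine integral_congr_ae (ae_of_all _ fun κ => ?_)
  have h : planeWave (k₀, κ) (sliceMap σ Λ (v, x))
      = Complex.exp (Complex.I * ((k₀ * (quad σ x / 2) : ℝ) : ℂ)) *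
        Complex.exp (Complex.I * ((∑ a, κ a * (Λ *ᵥ x) a + quad 0 κ / 2 : ℝ) : ℂ)) *
        Complex.exp (Complex.I * ((k₀ * v : ℝ) : ℂ)) := by
    rw [← Complex.exp_add, ← Complex.exp_add, planeWave, quad_zero]
    simp only [sliceMap]
    congr 1
    push_cast
    ring
  simp only [h]
  ring

theorem IsBump.continuous_sliceFiber {f : Mom n → ℂ} (hf : IsBump f)
    (σ Λ N : Matrix (Fin n) (Fin n) ℝ) :
    Continuous fun p : Mom n => sliceFiber σ Λ N f p.1 p.2 := by
  have hq := continuous_quad σ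
  have h1 : Continuous fun p : Mom n => ((p.1, Λ *ᵥ p.2) : Mom n) :=
    continuous_fst.prodMk (Continuous.matrix_mulVec continuous_const continuous_snd)
  have h2 := (hf.continuous_fiberPacket N).comp h1
  simp only [Function.comp_def] at h2
  unfold sliceFiber
  fun_prop

theorem fiberPacket_eq_zero {f : Mom n → ℂ} {k₀ : ℝ} (h : k₀ ∉ Prod.fst '' tsupport f)
    (N : Matrix (Fin n) (Fin n) ℝ) (y : Fin n → ℝ) : fiberPacket f k₀ N y = 0 := by
  refine integral_eq_zero_of_ae (ae_of_all _ fun κ => ?_)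
  change f (k₀, κ) * _ = 0
  rw [image_eq_zero_of_notMem_tsupport fun h' => h ⟨_, h', rfl⟩, zero_mul]

theorem sliceFiber_eq_zero {f : Mom n → ℂ} {k₀ : ℝ} (h : k₀ ∉ Prod.fst '' tsupport f)
    (σ Λ N : Matrix (Fin n) (Fin n) ℝ) (x : Fin n → ℝ) : sliceFiber σ Λ N f k₀ x = 0 := by
  rw [sliceFiber, fiberPacket_eq_zero h, mul_zero, mul_zero]

theorem IsBump.compact_freq {f : Mom n → ℂ} (hf : IsBump f) :
    IsCompact (Prod.fst '' tsupport f) := hf.compact.isCompact.image continuous_fst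

theorem IsBump.hasCompactSupport_sliceFiber {f : Mom n → ℂ} (hf : IsBump f)
    (σ Λ N : Matrix (Fin n) (Fin n) ℝ) (x : Fin n → ℝ) :
    HasCompactSupport fun k₀ => sliceFiber σ Λ N f k₀ x :=
  HasCompactSupport.intro hf.compact_freq fun _ h => sliceFiber_eq_zero h σ Λ N x

/-! #### Decay -/

theorem norm_mulVec_le {A : Matrix (Fin n) (Fin n) ℝ} {B : ℝ} (hA : ∀ i j, |A i j| ≤ B)
    (y : Fin n → ℝ) : ‖A *ᵥ y‖ ≤ n * |B| * ‖y‖ := by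
  refine (pi_norm_le_iff_of_nonneg (by positivity)).2 fun i => ?_
  rw [Matrix.mulVec, dotProduct, Real.norm_eq_abs]
  calc |∑ j, A i j * y j| ≤ ∑ j, |A i j * y j| := Finset.abs_sum_le_sum_abs _ _
    _ ≤ ∑ _j : Fin n, |B| * ‖y‖ := Finset.sum_le_sum fun j _ => by
        rw [abs_mul]
        exact mul_le_mul ((hA i j).trans (le_abs_self B)) (norm_le_pi_norm y j) (abs_nonneg _)
          (abs_nonneg _)
    _ = n * |B| * ‖y‖ := by simp [mul_assoc]

theorem IsBump.decay_sliceFiber {f : Mom n → ℂ} (hf : IsBump f) (B : ℝ) (m : ℕ) :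
    ∃ C, ∀ σ Λ N : Matrix (Fin n) (Fin n) ℝ, ∀ k₀ x, Λ.det ≠ 0 → |Λ.det| ≤ B →
      (∀ i j, |Λ⁻¹ i j| ≤ B) → (∀ i j, |N i j| ≤ B) →
      ‖x‖ ^ m * ‖sliceFiber σ Λ N f k₀ x‖ ≤ C := by
  obtain ⟨C, hC⟩ := hf.decay_fiberPacket B m
  refine ⟨√B * (n * |B|) ^ m * C, fun σ Λ N k₀ x hd hB hΛ hN => ?_⟩
  have h1 : Λ⁻¹ *ᵥ (Λ *ᵥ x) = x := by
    rw [Matrix.mulVec_mulVec, Matrix.nonsing_inv_mul _ (isUnit_iff_ne_zero.2 hd), Matrix.one_mulVec]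
  have h2 : ‖x‖ ≤ n * |B| * ‖Λ *ᵥ x‖ := by
    conv_lhs => rw [← h1]
    exact norm_mulVec_le hΛ _
  rw [sliceFiber, norm_mul, norm_mul, norm_expI, one_mul, Complex.norm_real,
    Real.norm_of_nonneg (Real.sqrt_nonneg _)]
  calc ‖x‖ ^ m * (√|Λ.det| * ‖fiberPacket f k₀ N (Λ *ᵥ x)‖)
      ≤ (n * |B| * ‖Λ *ᵥ x‖) ^ m * (√B * ‖fiberPacket f k₀ N (Λ *ᵥ x)‖) := by gcongr
    _ = √B * (n * |B|) ^ m * (‖Λ *ᵥ x‖ ^ m * ‖fiberPacket f k₀ N (Λ *ᵥ x)‖) := by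
        rw [mul_pow]; ring
    _ ≤ _ := mul_le_mul_of_nonneg_left (hC k₀ N _ hN) (by positivity)

/-- An integrable majorant of rapidly decaying functions. -/
def decayWeight (x : Fin n → ℝ) : ℝ := (1 + ‖x‖) ^ (-((n : ℝ) + 1))

theorem integrable_decayWeight : Integrable (decayWeight : (Fin n → ℝ) → ℝ) :=
  integrable_one_add_norm (by simp)

theorem norm_le_decayWeight {x : Fin n → ℝ} {z : ℂ} {C₀ C₁ : ℝ} (h0 : ‖z‖ ≤ C₀)
    (h1 : ‖x‖ ^ (n + 1) * ‖z‖ ≤ C₁) : ‖z‖ ≤ 2 ^ n * (C₀ + C₁) * decayWeight x := by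
  have hx : 0 < 1 + ‖x‖ := by positivity
  have h2 : decayWeight x = ((1 + ‖x‖) ^ (n + 1))⁻¹ := by
    rw [decayWeight, Real.rpow_neg hx.le]; congr 1; exact_mod_cast Real.rpow_natCast _ (n + 1)
  rw [h2, ← div_eq_mul_inv, le_div_iff₀ (by positivity)]
  have h3 := add_pow_le zero_le_one (norm_nonneg x) (n + 1)
  rw [one_pow, Nat.add_sub_cancel] at h3
  calc ‖z‖ * (1 + ‖x‖) ^ (n + 1) ≤ ‖z‖ * (2 ^ n * (1 + ‖x‖ ^ (n + 1))) := by gcongr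
    _ = 2 ^ n * (‖z‖ + ‖x‖ ^ (n + 1) * ‖z‖) := by ring
    _ ≤ _ := by gcongr

theorem exists_entries_le (A : Matrix (Fin n) (Fin n) ℝ) : ∃ B, ∀ i j, |A i j| ≤ B :=
  ⟨∑ i, ∑ j, |A i j|, fun i j =>
    (Finset.single_le_sum (f := fun j => |A i j|) (fun _ _ => abs_nonneg _)
      (Finset.mem_univ j)).trans (Finset.single_le_sum (f := fun i => ∑ j, |A i j|)
      (fun _ _ => Finset.sum_nonneg fun _ _ => abs_nonneg _) (Finset.mem_univ i))⟩

theorem IsBump.sliceFiber_le {f : Mom n → ℂ} (hf : IsBump f) (σ Λ N : Matrix (Fin n) (Fin n) ℝ)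
    (h : Λ.det ≠ 0) (m : ℕ) : ∃ C, ∀ k₀ x, ‖x‖ ^ m * ‖sliceFiber σ Λ N f k₀ x‖ ≤ C := by
  obtain ⟨B1, hB1⟩ := exists_entries_le Λ⁻¹
  obtain ⟨B2, hB2⟩ := exists_entries_le N
  obtain ⟨C, hC⟩ := hf.decay_sliceFiber (max (max B1 B2) |Λ.det|) m
  exact ⟨C, fun k₀ x => hC σ Λ N k₀ x h (le_max_right _ _)
    (fun i j => (hB1 i j).trans ((le_max_left _ _).trans (le_max_left _ _)))
    (fun i j => (hB2 i j).trans ((le_max_right _ _).trans (le_max_left _ _)))⟩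

/-- Products of fixed-frequency packets are integrable over frequency and slice. -/
theorem integrable_sliceFiber_mul {f g : Mom n → ℂ} (hf : IsBump f) (hg : IsBump g)
    (σ₁ Λ₁ N₁ σ₂ Λ₂ N₂ : Matrix (Fin n) (Fin n) ℝ) (h₁ : Λ₁.det ≠ 0) (h₂ : Λ₂.det ≠ 0) :
    Integrable (fun p : Mom n => sliceFiber σ₁ Λ₁ N₁ f p.1 p.2 *
      conj (sliceFiber σ₂ Λ₂ N₂ g p.1 p.2)) (volume.prod volume) := by
  obtain ⟨C0, hC0⟩ := hf.sliceFiber_le σ₁ Λ₁ N₁ h₁ 0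
  obtain ⟨C1, hC1⟩ := hf.sliceFiber_le σ₁ Λ₁ N₁ h₁ (n + 1)
  obtain ⟨D, hD⟩ := hg.sliceFiber_le σ₂ Λ₂ N₂ h₂ 0
  simp only [pow_zero, one_mul] at hC0 hD
  have hI : Integrable ((Prod.fst '' tsupport f).indicator fun _ : ℝ => (1 : ℝ)) :=
    (integrable_indicator_iff hf.compact_freq.measurableSet).2
      (integrableOn_const hf.compact_freq.measure_lt_top.ne)
  have hb := hI.mul_prod ((integrable_decayWeight (n := n)).const_mul (2 ^ n * (C0 + C1) * D))
  refine hb.mono' ((hf.continuous_sliceFiber σ₁ Λ₁ N₁).mul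
    (Complex.continuous_conj.comp (hg.continuous_sliceFiber σ₂ Λ₂ N₂))).aestronglyMeasurable
    (ae_of_all _ fun p => ?_)
  by_cases hp : p.1 ∈ Prod.fst '' tsupport f
  · rw [Set.indicator_of_mem hp, one_mul, norm_mul, RCLike.norm_conj]
    have h3 := norm_le_decayWeight (hC0 p.1 p.2) (hC1 p.1 p.2)
    calc _ ≤ 2 ^ n * (C0 + C1) * decayWeight p.2 * D :=
          mul_le_mul h3 (hD p.1 p.2) (norm_nonneg _) ((norm_nonneg _).trans h3)
      _ = _ := by ring
  · rw [Set.indicator_of_notMem hp, sliceFiber_eq_zero hp]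
    simp

/-! #### Parseval's formula along `v` -/

theorem lineIntegral_eq_fourier (a : ℝ → ℂ) (v : ℝ) :
    ∫ k : ℝ, a k * Complex.exp (Complex.I * ((k * v : ℝ) : ℂ))
      = FourierTransform.fourier a (-(2 * Real.pi)⁻¹ * v) := by
  rw [Real.fourier_eq']
  refine integral_congr_ae (ae_of_all _ fun k => ?_)
  simp only [smul_eq_mul, RCLike.inner_apply, conj_trivial]
  rw [mul_comm]
  congr 2
  have : (Real.pi : ℂ) ≠ 0 := by exact_mod_cast Real.pi_ne_zero
  push_cast
  field_simp

/-- Parseval's formula for one variable, by Fourier inversion; integrability of one of the two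
transforms suffices. -/
theorem parseval_line {a b : ℝ → ℂ} (ha : Continuous a) (hac : HasCompactSupport a)
    (hb : Continuous b) (hbc : HasCompactSupport b)
    (hi : Integrable fun v : ℝ => ∫ k : ℝ, a k * Complex.exp (Complex.I * ((k * v : ℝ) : ℂ))) :
    ∫ v : ℝ, (∫ k : ℝ, a k * Complex.exp (Complex.I * ((k * v : ℝ) : ℂ))) *
        conj (∫ k : ℝ, b k * Complex.exp (Complex.I * ((k * v : ℝ) : ℂ)))
      = 2 * Real.pi * ∫ k : ℝ, a k * conj (b k) := by
  have hai : Integrable a := ha.integrable_of_hasCompactSupport hac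
  have hbi : Integrable b := hb.integrable_of_hasCompactSupport hbc
  have hc : -(2 * Real.pi)⁻¹ ≠ 0 := by simp [Real.pi_ne_zero]
  simp only [lineIntegral_eq_fourier] at hi ⊢
  have hFa : Integrable (FourierTransform.fourier a) := by
    have := hi.comp_mul_left' (inv_ne_zero hc)
    simp only [mul_inv_cancel_left₀ hc] at this
    exact this
  rw [Measure.integral_comp_mul_left (fun w : ℝ => FourierTransform.fourier a w *
    conj (FourierTransform.fourier b w)) (-(2 * Real.pi)⁻¹)]
  -- the self-adjointness of the Fourier transform, applied to `b` and the transform of `a`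
  have h1 := VectorFourier.integral_sesq_fourierIntegral_eq_neg_flip
    (innerSL ℂ : ℂ →L⋆[ℂ] ℂ →L[ℂ] ℂ)
    (L := innerₗ ℝ) Real.continuous_fourierChar continuous_inner hbi hFa
  have h2 : ∫ w : ℝ, FourierTransform.fourier a w * conj (FourierTransform.fourier b w)
      = ∫ k : ℝ, a k * conj (b k) := by
    have h3 := ha.fourierInv_fourier_eq hai hFa
    have h4 : VectorFourier.fourierIntegral Real.fourierChar volume (-(innerₗ ℝ).flip)
        (FourierTransform.fourier a) = a := by
      conv_rhs => rw [← h3]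
      ext v
      rw [Real.fourierInv_eq]
      simp [VectorFourier.fourierIntegral]
    rw [h4] at h1
    simp only [innerSL_apply_apply, RCLike.inner_apply] at h1
    exact h1
  rw [h2, neg_inv, inv_inv, abs_neg, abs_of_pos (by positivity), Complex.real_smul]
  push_cast
  ring

theorem IsBump.integrable_slicePacket_line {f : Mom n → ℂ} (hf : IsBump f)
    (σ Λ : Matrix (Fin n) (Fin n) ℝ) (x : Fin n → ℝ) :
    Integrable fun v : ℝ => slicePacket σ Λ f (v, x) := by
  set φ := FourierTransform.fourier hf.toSchwartz with hφ
  -- quadratic decay of a Schwartz function along a line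
  obtain ⟨C0, _, hC0⟩ := φ.decay 0 0
  obtain ⟨C2, _, hC2⟩ := φ.decay 2 0
  have hc : -(2 * Real.pi)⁻¹ ≠ 0 := by simp [Real.pi_ne_zero]
  have h1 : Integrable fun v : ℝ => (1 + (-(2 * Real.pi)⁻¹ * (v + quad σ x / 2)) ^ 2)⁻¹ :=
    (integrable_inv_one_add_sq.comp_mul_left' hc).comp_add_right (quad σ x / 2)
  unfold slicePacket
  simp only [hf.flatPacket_eq]
  refine ((h1.const_mul (C0 + C2)).mono' ?_ (ae_of_all _ fun v => ?_)).const_mul _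
  · have hs := continuous_sliceMap σ Λ
    exact (φ.continuous.comp (((chart n).symm.continuous.comp
      (hs.comp (by fun_prop : Continuous fun v : ℝ => ((v, x) : Mom n)))).const_smul
      (-(2 * Real.pi)⁻¹))).aestronglyMeasurable
  · set z := -(2 * Real.pi)⁻¹ • (chart n).symm (sliceMap σ Λ (v, x)) with hz
    have hz0 : z 0 = -(2 * Real.pi)⁻¹ * (v + quad σ x / 2) := by
      have : ((chart n).symm (sliceMap σ Λ (v, x))) 0 = v + quad σ x / 2 := by
        rw [← chart_fst, ContinuousLinearEquiv.apply_symm_apply]; rfl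
      rw [hz, PiLp.smul_apply, this, smul_eq_mul]
    have h2 : (z 0) ^ 2 ≤ ‖z‖ ^ 2 := by
      rw [sq_le_sq, abs_norm]; exact PiLp.norm_apply_le z 0
    rw [← hz0, ← div_eq_mul_inv, le_div_iff₀ (by positivity)]
    have h3 := hC0 z
    have h4 := hC2 z
    rw [norm_iteratedFDeriv_zero] at h3 h4
    nlinarith [norm_nonneg (φ z)]

/-! ### Inner products of packets on a slice -/

theorem IsBump.memLp_slicePacket {f : Mom n → ℂ} (hf : IsBump f) {σ Λ : Matrix (Fin n) (Fin n) ℝ}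
    (h : Λ.det ≠ 0) : MemLp (slicePacket σ Λ f) 2 := by
  obtain ⟨W, hW⟩ := exists_unitary_slicePacket σ Λ h
  have h1 := hW f hf (hf.memLp_two.toLp f) hf.memLp_two.coeFn_toLp
  have h2 := ((Lp.memLp (W (hf.memLp_two.toLp f))).ae_eq h1).const_mul
    (√((2 * Real.pi) ^ (n + 1)) : ℂ)
  refine h2.ae_eq (ae_of_all _ fun p => ?_)
  have h3 : (√((2 * Real.pi) ^ (n + 1)) : ℂ) ≠ 0 := by
    exact_mod_cast (Real.sqrt_pos.2 (by positivity)).ne'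
  exact mul_inv_cancel_left₀ h3 _

theorem integrable_mul_conj_of_memLp {α : Type*} [MeasurableSpace α] {μ : Measure α} {φ ψ : α → ℂ}
    (hφ : MemLp φ 2 μ) (hψ : MemLp ψ 2 μ) : Integrable (fun x => φ x * conj (ψ x)) μ :=
  hφ.integrable_mul hψ.star

theorem inner_eq_integral {α : Type*} [MeasurableSpace α] {μ : Measure α} {F G : Lp ℂ 2 μ}
    {φ ψ : α → ℂ} (hφ : F =ᵐ[μ] φ) (hψ : G =ᵐ[μ] ψ) :
    inner ℂ G F = ∫ x, φ x * conj (ψ x) ∂μ := by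
  rw [L2.inner_def]
  refine integral_congr_ae ?_
  filter_upwards [hφ, hψ] with x h1 h2
  rw [h1, h2, RCLike.inner_apply]

/-- Orthonormality of the modes on a slice. -/
theorem integral_slicePacket_mul_conj {f g : Mom n → ℂ} (hf : IsBump f) (hg : IsBump g)
    {σ Λ : Matrix (Fin n) (Fin n) ℝ} (h : Λ.det ≠ 0) :
    ∫ p, slicePacket σ Λ f p * conj (slicePacket σ Λ g p)
      = (2 * Real.pi : ℂ) ^ (n + 1) * ∫ k, f k * conj (g k) := by
  obtain ⟨W, hW⟩ := exists_unitary_slicePacket σ Λ h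
  have hf2 := hf.memLp_two.coeFn_toLp (μ := volume)
  have hg2 := hg.memLp_two.coeFn_toLp (μ := volume)
  have h1 := inner_eq_integral (hW f hf _ hf2) (hW g hg _ hg2)
  rw [W.inner_map_map, inner_eq_integral hf2 hg2] at h1
  rw [h1, ← integral_const_mul]
  refine integral_congr_ae (ae_of_all _ fun p => ?_)
  simp only [map_mul, map_inv₀, Complex.conj_ofReal]
  have h2 : (2 * Real.pi : ℂ) ^ (n + 1)
      = (√((2 * Real.pi) ^ (n + 1)) : ℂ) * (√((2 * Real.pi) ^ (n + 1)) : ℂ) := by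
    rw [← Complex.ofReal_mul, Real.mul_self_sqrt (by positivity)]
    push_cast
    rfl
  have h3 : (√((2 * Real.pi) ^ (n + 1)) : ℂ) ≠ 0 := by
    exact_mod_cast (Real.sqrt_pos.2 (by positivity)).ne'
  rw [h2]
  field_simp

theorem IsBump.continuous_sliceFiber_freq {f : Mom n → ℂ} (hf : IsBump f)
    (σ Λ N : Matrix (Fin n) (Fin n) ℝ) (x : Fin n → ℝ) :
    Continuous fun k₀ => sliceFiber σ Λ N f k₀ x :=
  (hf.continuous_sliceFiber σ Λ N).comp (continuous_id.prodMk continuous_const)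

theorem integral_slicePacket_line {f g : Mom n → ℂ} (hf : IsBump f) (hg : IsBump g)
    (σ₁ Λ₁ σ₂ Λ₂ : Matrix (Fin n) (Fin n) ℝ) (x : Fin n → ℝ) :
    ∫ v : ℝ, slicePacket σ₁ Λ₁ f (v, x) * conj (slicePacket σ₂ Λ₂ g (v, x))
      = 2 * Real.pi * ∫ k₀ : ℝ, sliceFiber σ₁ Λ₁ 0 f k₀ x * conj (sliceFiber σ₂ Λ₂ 0 g k₀ x) := by
  have hl := hf.integrable_slicePacket_line σ₁ Λ₁ x
  simp only [hf.slicePacket_eq] at hl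
  refine Eq.trans ?_ (parseval_line (hf.continuous_sliceFiber_freq σ₁ Λ₁ 0 x)
    (hf.hasCompactSupport_sliceFiber σ₁ Λ₁ 0 x) (hg.continuous_sliceFiber_freq σ₂ Λ₂ 0 x)
    (hg.hasCompactSupport_sliceFiber σ₂ Λ₂ 0 x) hl)
  congr 1
  funext v
  rw [hf.slicePacket_eq, hg.slicePacket_eq]

/-- The overlap of two packets with respect to different slicings reduces to an integral over the
common frequency: Parseval's formula along `v`. -/
theorem integral_slicePacket_mul_conj_eq_fiber {f g : Mom n → ℂ} (hf : IsBump f) (hg : IsBump g)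
    {σ₁ Λ₁ σ₂ Λ₂ : Matrix (Fin n) (Fin n) ℝ} (h₁ : Λ₁.det ≠ 0) (h₂ : Λ₂.det ≠ 0) :
    ∫ p, slicePacket σ₁ Λ₁ f p * conj (slicePacket σ₂ Λ₂ g p)
      = 2 * Real.pi * ∫ k₀ : ℝ, ∫ x : Fin n → ℝ,
          sliceFiber σ₁ Λ₁ 0 f k₀ x * conj (sliceFiber σ₂ Λ₂ 0 g k₀ x) := by
  have hi := integrable_mul_conj_of_memLp (hf.memLp_slicePacket (σ := σ₁) h₁)
    (hg.memLp_slicePacket (σ := σ₂) h₂)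
  have hsw := integral_integral_swap (f := fun k₀ x =>
    sliceFiber σ₁ Λ₁ 0 f k₀ x * conj (sliceFiber σ₂ Λ₂ 0 g k₀ x))
    (integrable_sliceFiber_mul hf hg σ₁ Λ₁ 0 σ₂ Λ₂ 0 h₁ h₂)
  have h3 := integral_prod_symm (μ := (volume : Measure ℝ)) (ν := (volume : Measure (Fin n → ℝ)))
    (fun p => slicePacket σ₁ Λ₁ f p * conj (slicePacket σ₂ Λ₂ g p)) hi
  refine h3.trans ?_
  simp only [integral_slicePacket_line hf hg]
  rw [hsw, integral_const_mul]

theorem fiberPacket_freq_mul (h : ℝ → ℂ) (f : Mom n → ℂ) (k₀ : ℝ) (N : Matrix (Fin n) (Fin n) ℝ)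
    (y : Fin n → ℝ) : fiberPacket (fun k => h k.1 * f k) k₀ N y = h k₀ * fiberPacket f k₀ N y := by
  simp only [fiberPacket, mul_assoc, integral_const_mul]

theorem sliceFiber_freq_mul (h : ℝ → ℂ) (σ Λ N : Matrix (Fin n) (Fin n) ℝ) (f : Mom n → ℂ)
    (k₀ : ℝ) (x : Fin n → ℝ) :
    sliceFiber σ Λ N (fun k => h k.1 * f k) k₀ x = h k₀ * sliceFiber σ Λ N f k₀ x := by
  rw [sliceFiber, sliceFiber, fiberPacket_freq_mul]; ring

/-- Packets with disjoint frequency supports are orthogonal. -/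
theorem integral_slicePacket_mul_conj_eq_zero {f g : Mom n → ℂ} (hf : IsBump f) (hg : IsBump g)
    {σ₁ Λ₁ σ₂ Λ₂ : Matrix (Fin n) (Fin n) ℝ} (h₁ : Λ₁.det ≠ 0) (h₂ : Λ₂.det ≠ 0)
    (hd : ∀ k ∈ tsupport f, ∀ l ∈ tsupport g, k.1 ≠ l.1) :
    ∫ p, slicePacket σ₁ Λ₁ f p * conj (slicePacket σ₂ Λ₂ g p) = 0 := by
  rw [integral_slicePacket_mul_conj_eq_fiber hf hg h₁ h₂]
  refine mul_eq_zero_of_right _ (integral_eq_zero_of_ae (ae_of_all _ fun k₀ => ?_))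
  refine integral_eq_zero_of_ae (ae_of_all _ fun x => ?_)
  by_cases hk : k₀ ∈ Prod.fst '' tsupport f
  · obtain ⟨k, hk, rfl⟩ := hk
    have : k.1 ∉ Prod.fst '' tsupport g := fun ⟨l, hl, e⟩ => hd k hk l hl e.symm
    simp [sliceFiber_eq_zero this]
  · simp [sliceFiber_eq_zero hk]

theorem IsBump.hasDerivAt_slicePacket {f : Mom n → ℂ} (hf : IsBump f)
    (σ Λ : Matrix (Fin n) (Fin n) ℝ) (v : ℝ) (x : Fin n → ℝ) :
    HasDerivAt (fun v : ℝ => slicePacket σ Λ f (v, x))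
      (Complex.I * slicePacket σ Λ (fun k => (k.1 : ℂ) * f k) (v, x)) v := by
  have hs : ∀ v : ℝ, HasDerivAt (fun v : ℝ => (sliceMap σ Λ (v, x)).1) 1 v := fun v =>
    (hasDerivAt_id' v).add_const (quad σ x / 2)
  have h1 := hf.hasDerivAt_integral (μ := volume) (s := v) (U := Set.univ) Filter.univ_mem
    (M := fun v k => planeWave k (sliceMap σ Λ (v, x)))
    (M' := fun v k => Complex.I * (k.1 : ℂ) * planeWave k (sliceMap σ Λ (v, x)))
    (fun t _ => continuous_planeWave_left _) (fun t _ k => ?_) ?_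
  · refine (h1.const_mul (√|Λ.det| : ℂ)).congr_deriv ?_
    rw [slicePacket, flatPacket, mul_left_comm, ← integral_const_mul Complex.I]
    congr 1
    refine integral_congr_ae (ae_of_all _ fun k => ?_)
    ring
  · unfold planeWave
    refine ((((hs t).const_mul k.1).add_const
      (∑ a, k.2 a * (Λ *ᵥ x) a)).ofReal_comp.const_mul Complex.I).cexp.congr_deriv ?_
    simp only [sliceMap]
    push_cast
    ring
  · refine Continuous.continuousOn ?_
    have h2 := continuous_planeWave.comp (f := fun q : ℝ × Mom n => (q.2, sliceMap σ Λ (q.1, x)))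
      (continuous_snd.prodMk ((continuous_sliceMap σ Λ).comp (by fun_prop)))
    simp only [Function.comp_def] at h2
    unfold Function.uncurry
    fun_prop

/-! ### Scalar densities of slice packets -/

/-- On the slice `u` the field `Φ` is the slice packet of profile `f`. -/
def IsSlicePacket (Φ : Pt n → ℂ) (u : ℝ) (σ Λ : Matrix (Fin n) (Fin n) ℝ) (f : Mom n → ℂ) : Prop :=
  ∀ v x, Φ (pt u v x) = slicePacket σ Λ f (v, x)

theorem update_pt_iv (u v t : ℝ) (x : Fin n → ℝ) : Function.update (pt u v x) iv t = pt u t x := by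
  funext μ
  rcases idx_cases μ with rfl | rfl | ⟨a, rfl⟩ <;> simp [pt]

theorem pd_iv_pt (Φ : Pt n → ℂ) (u v : ℝ) (x : Fin n → ℝ) :
    pd iv Φ (pt u v x) = deriv (fun t => Φ (pt u t x)) v := by
  simp only [pd, update_pt_iv]
  rfl

theorem pd_conj0 (μ : Idx n) (Φ : Pt n → ℂ) (X : Pt n) : pd μ (conj0 Φ) X = conj (pd μ Φ X) :=
  deriv.star (f := fun t : ℝ => Φ (Function.update X μ t))

theorem conj0_conj0 (Φ : Pt n → ℂ) : conj0 (conj0 Φ) = Φ := funext fun _ => Complex.conj_conj _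

theorem IsBump.conj_neg {f : Mom n → ℂ} (hf : IsBump f) : IsBump fun k => conj (f (-k)) := by
  refine ⟨Complex.conjCLE.contDiff.comp (hf.smooth.comp contDiff_neg), ?_⟩
  exact (hf.compact.comp_homeomorph (Homeomorph.neg (Mom n))).comp_left (g := conj) (map_zero _)

theorem tsupport_conj_neg {f : Mom n → ℂ} {k : Mom n}
    (hk : k ∈ tsupport fun k => conj (f (-k))) : -k ∈ tsupport f := by
  by_contra h
  refine (notMem_tsupport_iff_eventuallyEq.2 ?_) hk
  have h1 := (continuous_neg.tendsto k).eventually (notMem_tsupport_iff_eventuallyEq.1 h)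
  filter_upwards [h1] with l hl
  rw [hl]; simp

/-- The complex conjugate of a packet is a packet of the opposite frequencies. -/
theorem conj_slicePacket (σ Λ : Matrix (Fin n) (Fin n) ℝ) (f : Mom n → ℂ) (p : Mom n) :
    conj (slicePacket σ Λ f p) = slicePacket σ Λ (fun k => conj (f (-k))) p := by
  rw [slicePacket, slicePacket, map_mul, Complex.conj_ofReal, flatPacket, flatPacket,
    ← integral_conj]
  congr 1
  have hneg : MeasurePreserving (fun k : Mom n => -k) :=
    (Measure.measurePreserving_neg (volume : Measure ℝ)).prod
      (Measure.measurePreserving_neg (volume : Measure (Fin n → ℝ)))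
  rw [← hneg.integral_comp (Homeomorph.neg (Mom n)).measurableEmbedding]
  refine integral_congr_ae (ae_of_all _ fun k => ?_)
  simp only [map_mul, planeWave, ← Complex.exp_conj, Complex.conj_I, Complex.conj_ofReal]
  congr 2
  simp only [Prod.fst_neg, Prod.snd_neg, Pi.neg_apply, neg_mul, Finset.sum_neg_distrib, ← neg_add]
  push_cast
  ring

theorem IsSlicePacket.conj0 {Φ : Pt n → ℂ} {u : ℝ} {σ Λ : Matrix (Fin n) (Fin n) ℝ}
    {f : Mom n → ℂ} (h : IsSlicePacket Φ u σ Λ f) :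
    IsSlicePacket (conj0 Φ) u σ Λ fun k => conj (f (-k)) := fun v x => by
  rw [PlaneWave.conj0, h v x, conj_slicePacket]

section Density

variable {Φ₁ Φ₂ : Pt n → ℂ} {u : ℝ} {σ₁ Λ₁ σ₂ Λ₂ : Matrix (Fin n) (Fin n) ℝ} {f g : Mom n → ℂ}

theorem IsSlicePacket.pd_iv (h : IsSlicePacket Φ₁ u σ₁ Λ₁ f) (hf : IsBump f) (v : ℝ)
    (x : Fin n → ℝ) : pd iv Φ₁ (pt u v x)
      = Complex.I * slicePacket σ₁ Λ₁ (fun k => (k.1 : ℂ) * f k) (v, x) := by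
  rw [pd_iv_pt]
  simp only [h _ x]
  exact (hf.hasDerivAt_slicePacket σ₁ Λ₁ v x).deriv

theorem scalarDensity_eq (h₁ : IsSlicePacket Φ₁ u σ₁ Λ₁ f) (h₂ : IsSlicePacket Φ₂ u σ₂ Λ₂ g)
    (hf : IsBump f) (hg : IsBump g) (p : Mom n) :
    scalarDensity Φ₁ Φ₂ u p
      = slicePacket σ₁ Λ₁ f p * conj (slicePacket σ₂ Λ₂ (fun k => (k.1 : ℂ) * g k) p)
        + slicePacket σ₁ Λ₁ (fun k => (k.1 : ℂ) * f k) p * conj (slicePacket σ₂ Λ₂ g p) := by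
  simp only [scalarDensity, pd_conj0]
  rw [h₁.pd_iv hf, h₂.pd_iv hg, h₁, h₂, map_mul, Complex.conj_I]
  linear_combination (-(slicePacket σ₁ Λ₁ f p *
    conj (slicePacket σ₂ Λ₂ (fun k => (k.1 : ℂ) * g k) p)) -
    slicePacket σ₁ Λ₁ (fun k => (k.1 : ℂ) * f k) p * conj (slicePacket σ₂ Λ₂ g p)) * Complex.I_mul_I

theorem integrable_scalarDensity (h₁ : IsSlicePacket Φ₁ u σ₁ Λ₁ f)
    (h₂ : IsSlicePacket Φ₂ u σ₂ Λ₂ g) (hf : IsBump f) (hg : IsBump g) (hΛ₁ : Λ₁.det ≠ 0)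
    (hΛ₂ : Λ₂.det ≠ 0) : Integrable (scalarDensity Φ₁ Φ₂ u) := by
  have h := (integrable_mul_conj_of_memLp (hf.memLp_slicePacket (σ := σ₁) hΛ₁)
    (hg.mul_freq.memLp_slicePacket (σ := σ₂) hΛ₂)).add
    (integrable_mul_conj_of_memLp (hf.mul_freq.memLp_slicePacket (σ := σ₁) hΛ₁)
    (hg.memLp_slicePacket (σ := σ₂) hΛ₂))
  exact h.congr (ae_of_all _ fun p => (scalarDensity_eq h₁ h₂ hf hg p).symm)

/-- Derivatives along `v` multiply profiles by the frequency. -/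
theorem integral_scalarDensity (h₁ : IsSlicePacket Φ₁ u σ₁ Λ₁ f)
    (h₂ : IsSlicePacket Φ₂ u σ₂ Λ₂ g) (hf : IsBump f) (hg : IsBump g) (hΛ₁ : Λ₁.det ≠ 0)
    (hΛ₂ : Λ₂.det ≠ 0) : ∫ p, scalarDensity Φ₁ Φ₂ u p
      = (∫ p, slicePacket σ₁ Λ₁ f p * conj (slicePacket σ₂ Λ₂ (fun k => (k.1 : ℂ) * g k) p))
        + ∫ p, slicePacket σ₁ Λ₁ (fun k => (k.1 : ℂ) * f k) p * conj (slicePacket σ₂ Λ₂ g p) := by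
  simp only [scalarDensity_eq h₁ h₂ hf hg]
  exact integral_add (integrable_mul_conj_of_memLp (hf.memLp_slicePacket (σ := σ₁) hΛ₁)
    (hg.mul_freq.memLp_slicePacket (σ := σ₂) hΛ₂))
    (integrable_mul_conj_of_memLp (hf.mul_freq.memLp_slicePacket (σ := σ₁) hΛ₁)
    (hg.memLp_slicePacket (σ := σ₂) hΛ₂))

/-- The inner product of packets with respect to the same slicing. -/
theorem integral_scalarDensity_same (h₁ : IsSlicePacket Φ₁ u σ₁ Λ₁ f)
    (h₂ : IsSlicePacket Φ₂ u σ₁ Λ₁ g) (hf : IsBump f) (hg : IsBump g) (hΛ₁ : Λ₁.det ≠ 0) :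
    ∫ p, scalarDensity Φ₁ Φ₂ u p
      = (2 * Real.pi : ℂ) ^ (n + 1) * ∫ k : Mom n, 2 * (k.1 : ℂ) * f k * conj (g k) := by
  rw [integral_scalarDensity h₁ h₂ hf hg hΛ₁ hΛ₁, integral_slicePacket_mul_conj hf hg.mul_freq hΛ₁,
    integral_slicePacket_mul_conj hf.mul_freq hg hΛ₁, ← mul_add, ← integral_add]
  · congr 1
    refine integral_congr_ae (ae_of_all _ fun k => ?_)
    simp only [map_mul, Complex.conj_ofReal]
    ring
  · exact integrable_mul_conj_of_memLp hf.memLp_two hg.mul_freq.memLp_two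
  · exact integrable_mul_conj_of_memLp hf.mul_freq.memLp_two hg.memLp_two

/-- The inner product of packets with respect to different slicings, as an integral over the common
frequency. -/
theorem integral_scalarDensity_fiber (h₁ : IsSlicePacket Φ₁ u σ₁ Λ₁ f)
    (h₂ : IsSlicePacket Φ₂ u σ₂ Λ₂ g) (hf : IsBump f) (hg : IsBump g) (hΛ₁ : Λ₁.det ≠ 0)
    (hΛ₂ : Λ₂.det ≠ 0) : ∫ p, scalarDensity Φ₁ Φ₂ u p
      = 2 * Real.pi * ∫ k₀ : ℝ, 2 * (k₀ : ℂ) * ∫ x : Fin n → ℝ,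
          sliceFiber σ₁ Λ₁ 0 f k₀ x * conj (sliceFiber σ₂ Λ₂ 0 g k₀ x) := by
  have hi := (integrable_sliceFiber_mul hf.mul_freq hg σ₁ Λ₁ 0 σ₂ Λ₂ 0 hΛ₁ hΛ₂).integral_prod_left
  rw [integral_scalarDensity h₁ h₂ hf hg hΛ₁ hΛ₂,
    integral_slicePacket_mul_conj_eq_fiber hf hg.mul_freq hΛ₁ hΛ₂,
    integral_slicePacket_mul_conj_eq_fiber hf.mul_freq hg hΛ₁ hΛ₂]
  simp only [sliceFiber_freq_mul (fun k₀ => (k₀ : ℂ)), map_mul, Complex.conj_ofReal, mul_assoc,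
    integral_const_mul] at hi ⊢
  simp only [mul_left_comm _ (Complex.ofReal _), integral_const_mul, ← two_mul]

/-- Packets whose frequencies do not meet are orthogonal: the overlap of a positive with a negative
frequency packet vanishes. -/
theorem integral_scalarDensity_eq_zero (h₁ : IsSlicePacket Φ₁ u σ₁ Λ₁ f)
    (h₂ : IsSlicePacket Φ₂ u σ₂ Λ₂ g) (hf : IsBump f) (hg : IsBump g) (hΛ₁ : Λ₁.det ≠ 0)
    (hΛ₂ : Λ₂.det ≠ 0) (hd : ∀ k ∈ tsupport f, ∀ l ∈ tsupport g, k.1 ≠ l.1) :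
    ∫ p, scalarDensity Φ₁ Φ₂ u p = 0 := by
  rw [integral_scalarDensity h₁ h₂ hf hg hΛ₁ hΛ₂,
    integral_slicePacket_mul_conj_eq_zero hf hg.mul_freq hΛ₁ hΛ₂
      (fun k hk l hl => hd k hk l (tsupport_mul_subset_right hl)),
    integral_slicePacket_mul_conj_eq_zero hf.mul_freq hg hΛ₁ hΛ₂
      (fun k hk l hl => hd k (tsupport_mul_subset_right hk) l hl), add_zero]

end Density

/-! ### Spinning packets -/

theorem pd_const_mul (μ : Idx n) (c : ℂ) (Φ : Pt n → ℂ) (X : Pt n) :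
    pd μ (fun Y => c * Φ Y) X = c * pd μ Φ X := deriv_const_mul_field _

theorem pd_zero (μ : Idx n) (X : Pt n) : pd μ (fun _ : Pt n => (0 : ℂ)) X = 0 := by simp [pd]

/-- A covector field in lightcone gauge whose transverse components are multiples of a scalar. -/
structure IsTransverse (ε : Fin n → ℂ) (Φ : Pt n → ℂ) (A : Idx n → Pt n → ℂ) : Prop where
  lightcone : A iv = fun _ => 0
  inr : ∀ a, A (Sum.inr a) = fun X => ε a * Φ X

/-- A tensor field in lightcone gauge whose transverse components are multiples of a scalar. -/
structure IsTransverse2 (ε : Fin n → ℂ) (Φ : Pt n → ℂ) (h : Idx n → Idx n → Pt n → ℂ) : Prop where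
  left : ∀ μ, h iv μ = fun _ => 0
  right : ∀ μ, h μ iv = fun _ => 0
  inr : ∀ a b, h (Sum.inr a) (Sum.inr b) = fun X => ε a * ε b * Φ X

theorem IsTransverse.conj1 {ε : Fin n → ℂ} {Φ : Pt n → ℂ} {A : Idx n → Pt n → ℂ}
    (h : IsTransverse ε Φ A) : IsTransverse (fun a => conj (ε a)) (conj0 Φ) (conj1 A) :=
  ⟨funext fun X => by simp [PlaneWave.conj1, h.lightcone],
    fun a => funext fun X => by simp [PlaneWave.conj1, conj0, h.inr]⟩

theorem IsTransverse2.conj2 {ε : Fin n → ℂ} {Φ : Pt n → ℂ} {h : Idx n → Idx n → Pt n → ℂ}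
    (hh : IsTransverse2 ε Φ h) : IsTransverse2 (fun a => conj (ε a)) (conj0 Φ) (conj2 h) :=
  ⟨fun μ => funext fun X => by simp [PlaneWave.conj2, hh.left],
    fun μ => funext fun X => by simp [PlaneWave.conj2, hh.right],
    fun a b => funext fun X => by simp [PlaneWave.conj2, conj0, hh.inr]⟩

section Spin

variable {ε₁ ε₂ : Fin n → ℂ} {Φ₁ Φ₂ : Pt n → ℂ} (H : ℝ → Matrix (Fin n) (Fin n) ℝ)

theorem up1_eq (A : Idx n → Pt n → ℂ) (X : Pt n) : up1 H A iu X = A iv X ∧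
    up1 H A iv X = A iu X + quad (H (X iu)) (trans X) * A iv X ∧
    ∀ a, up1 H A (Sum.inr a) X = -A (Sum.inr a) X := by
  simp only [up1]
  refine ⟨?_, ?_, fun a => ?_⟩
  · rw [sum_invMetric_row H X (fun ν => A ν X)]; simp
  · rw [sum_invMetric_row H X (fun ν => A ν X)]; simp
  · rw [sum_invMetric_row H X (fun ν => A ν X)]

theorem gaugeDensity_eq {A₁ A₂ : Idx n → Pt n → ℂ} (h₁ : IsTransverse ε₁ Φ₁ A₁)
    (h₂ : IsTransverse ε₂ Φ₂ A₂) (u : ℝ) (p : Mom n) :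
    gaugeDensity H A₁ A₂ u p = polDot ε₁ ε₂ * scalarDensity Φ₁ Φ₂ u p := by
  simp only [gaugeDensity, scalarDensity, sum_idx, fieldStrength, (up1_eq H _ _).1,
    (up1_eq H _ _).2.2, h₁.lightcone, h₂.lightcone, h₁.inr, h₂.inr, pd_const_mul, pd_zero, pd_conj0]
  simp only [sub_self, map_zero, mul_zero, zero_mul, sub_zero, add_zero, zero_add, map_mul, map_neg]
  rw [polDot, Finset.sum_mul, Finset.mul_sum]
  refine Finset.sum_congr rfl fun a _ => ?_
  ring

theorem gluonDensity_eq {B : Idx n → Pt n → ℝ} (hB : B iv = fun _ => 0) {A₁ A₂ : Idx n → Pt n → ℂ}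
    (h₁ : IsTransverse ε₁ Φ₁ A₁) (h₂ : IsTransverse ε₂ Φ₂ A₂) (u : ℝ) (p : Mom n) :
    gluonDensity B A₁ A₂ u p = polDot ε₁ ε₂ * scalarDensity Φ₁ Φ₂ u p := by
  simp only [gluonDensity, scalarDensity, sum_idx, gluonStrength, gD, (up1_eq 0 _ _).1,
    (up1_eq 0 _ _).2.2, h₁.lightcone, h₂.lightcone, h₁.inr, h₂.inr, pd_const_mul, pd_zero, pd_conj0,
    hB]
  simp only [sub_self, map_zero, mul_zero, zero_mul, sub_zero, add_zero, zero_add, map_mul, map_neg,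
    Complex.ofReal_zero]
  rw [polDot, Finset.sum_mul, Finset.mul_sum]
  refine Finset.sum_congr rfl fun a _ => ?_
  ring

theorem gluonBarDensity_eq {B : Idx n → Pt n → ℝ} (hB : B iv = fun _ => 0)
    {A₁ A₂ : Idx n → Pt n → ℂ} (h₁ : IsTransverse ε₁ Φ₁ A₁) (h₂ : IsTransverse ε₂ Φ₂ A₂) (u : ℝ)
    (p : Mom n) : gluonBarDensity B A₁ A₂ u p
      = polDot ε₁ (fun a => conj (ε₂ a)) * scalarDensity Φ₁ (conj0 Φ₂) u p := by
  simp only [gluonBarDensity, scalarDensity, sum_idx, gluonStrength, gD, (up1_eq 0 _ _).1,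
    (up1_eq 0 _ _).2.2, h₁.lightcone, h₂.lightcone, h₁.inr, h₂.inr, pd_const_mul, pd_zero,
    conj0_conj0, hB]
  simp only [sub_self, mul_zero, zero_mul, sub_zero, add_zero, zero_add,
    Complex.ofReal_zero, conj0, Complex.conj_conj]
  rw [polDot, Finset.sum_mul, Finset.mul_sum]
  refine Finset.sum_congr rfl fun a _ => ?_
  rw [Complex.conj_conj]
  ring

theorem up2_eq (h : Idx n → Idx n → Pt n → ℂ) (μ σ : Idx n) (X : Pt n) :
    up2 H h μ σ X = up1 H (fun ν Y => up1 H (h ν) σ Y) μ X := by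
  simp only [up2, up1, Finset.mul_sum, mul_assoc]

theorem gravitonDensity_eq {A₁ A₂ : Idx n → Idx n → Pt n → ℂ} (h₁ : IsTransverse2 ε₁ Φ₁ A₁)
    (h₂ : IsTransverse2 ε₂ Φ₂ A₂) (u : ℝ) (p : Mom n) :
    gravitonDensity H A₁ A₂ u p = polDot ε₁ ε₂ ^ 2 * scalarDensity Φ₁ Φ₂ u p := by
  have hc := h₂.conj2
  simp only [gravitonDensity, scalarDensity, sum_idx, up2_eq, (up1_eq H _ _).1,
    (up1_eq H _ _).2.2, h₁.left, h₁.right, h₁.inr, hc.left, hc.right, hc.inr, h₂.left, h₂.right,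
    h₂.inr, pd_const_mul, pd_zero, pd_conj0]
  simp only [map_zero, mul_zero, zero_mul, sub_zero, add_zero, zero_add, map_mul, map_neg, neg_neg,
    neg_zero, Finset.sum_const_zero]
  rw [polDot, sq, Finset.sum_mul_sum]
  simp only [Finset.mul_sum, Finset.sum_mul]
  refine Finset.sum_congr rfl fun a _ => Finset.sum_congr rfl fun b _ => ?_
  ring

end Spin

/-! ### The modes as slice packets -/

/-- Multiplication of a profile by the phase `e^{i q(k) / (2 k₀)}`. -/
def phased (q : (Fin n → ℝ) → ℝ) (f : Mom n → ℂ) (k : Mom n) : ℂ :=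
  Complex.exp (Complex.I * ((q k.2 / (2 * k.1) : ℝ) : ℂ)) * f k

theorem contDiff_quad (N : Matrix (Fin n) (Fin n) ℝ) : ContDiff ℝ ∞ (quad N) := by
  unfold quad; fun_prop

theorem IsTest.smoothOn_mul {f g : Mom n → ℂ} (hf : IsTest f)
    (hg : ∀ k : Mom n, 0 < k.1 → ContDiffAt ℝ ∞ g k) : IsTest (fun k => g k * f k) := by
  have h := hf.isBump.smoothOn_mul fun k hk => hg k (hf.positive k hk)
  exact ⟨h.smooth, h.compact, fun k hk => hf.positive k (tsupport_mul_subset_right hk)⟩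

theorem IsTest.phased {f : Mom n → ℂ} (hf : IsTest f) {q : (Fin n → ℝ) → ℝ} (hq : ContDiff ℝ ∞ q) :
    IsTest (phased q f) := by
  refine hf.smoothOn_mul fun k hk => ?_
  have h1 : ContDiffAt ℝ ∞ (fun k : Mom n => q k.2 / (2 * k.1)) k := by
    refine ContDiffAt.div (hq.comp contDiff_snd).contDiffAt ?_ (by positivity)
    exact (contDiff_const.mul contDiff_fst).contDiffAt
  exact (contDiffAt_const.mul (Complex.ofRealCLM.contDiff.contDiffAt.comp k h1)).cexp

theorem IsTest.shift {f : Mom n → ℂ} (hf : IsTest f) (A : Fin n → ℝ) :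
    IsTest fun k => f (k.1, k.2 - A) := by
  set τ : Mom n ≃ₜ Mom n := Homeomorph.addRight (0, -A) with hτ
  have h : (fun k : Mom n => f (k.1, k.2 - A)) = f ∘ τ := funext fun k => by
    simp [hτ, sub_eq_add_neg]
    congr 1
    ext <;> simp
  refine ⟨hf.smooth.comp (by fun_prop), h ▸ hf.compact.comp_homeomorph τ, fun k hk => ?_⟩
  rw [h, tsupport_comp_eq_preimage] at hk
  have h1 := hf.positive _ hk
  simpa [hτ] using h1

theorem sum_mulVec_mul (M : Matrix (Fin n) (Fin n) ℝ) (κ x : Fin n → ℝ) :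
    ∑ i, κ i * (M *ᵥ x) i = ∑ i, ∑ a, κ i * M i a * x a := by
  simp only [Matrix.mulVec, dotProduct, Finset.mul_sum, mul_assoc]

theorem phase_pt (E F : ℝ → Matrix (Fin n) (Fin n) ℝ) (k : Mom n) (u v : ℝ) (x : Fin n → ℝ) :
    phase E F k (pt u v x) = k.1 / 2 * quad (shear E u) x + ∑ i, k.2 i * ((E u)⁻¹ *ᵥ x) i
      + k.1 * v + quad (F u) k.2 / (2 * k.1) := by
  rw [sum_mulVec_mul]; rfl

theorem Omega_eq_sqrt (E : ℝ → Matrix (Fin n) (Fin n) ℝ) (u : ℝ) : Omega E u = √|(E u)⁻¹.det| := by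
  rw [Omega_eq, Matrix.det_nonsing_inv, Ring.inverse_eq_inv', abs_inv, Real.sqrt_inv,
    Real.rpow_neg (abs_nonneg _), Real.sqrt_eq_rpow]

/-- On a slice `u = const` a packet of scalar modes is a Fourier transform of the profile, up to the
unimodular phase from `F`, in coordinates sheared along `v` and transformed by `E⁻¹`. -/
theorem isSlicePacket_scalarMode (E F : ℝ → Matrix (Fin n) (Fin n) ℝ) (f : Mom n → ℂ) (u : ℝ) :
    IsSlicePacket (packet f (scalarMode E F)) u (shear E u) (E u)⁻¹ (phased (quad (F u)) f) := by
  intro v x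
  rw [slicePacket, flatPacket, packet, ← integral_const_mul]
  refine integral_congr_ae (ae_of_all _ fun k => ?_)
  simp only [scalarMode, phase_pt, phased, planeWave, sliceMap]
  change f k * ((Omega E u : ℂ) * _) = _
  rw [Omega_eq_sqrt]
  rw [mul_right_comm _ (f k), ← Complex.exp_add]
  have h2 : Complex.I * ((k.1 / 2 * quad (shear E u) x + ∑ i, k.2 i * ((E u)⁻¹ *ᵥ x) i
      + k.1 * v + quad (F u) k.2 / (2 * k.1) : ℝ) : ℂ)
      = Complex.I * ((quad (F u) k.2 / (2 * k.1) : ℝ) : ℂ)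
        + Complex.I * ((k.1 * (v + quad (shear E u) x / 2)
          + ∑ i, k.2 i * ((E u)⁻¹ *ᵥ x) i : ℝ) : ℂ) := by
    push_cast; ring
  rw [h2]
  ring

theorem integral_shift (G : Mom n → ℂ) (A : Fin n → ℝ) :
    ∫ k : Mom n, G (k.1, k.2 + A) = ∫ k, G k := by
  have h : MeasurePreserving (fun k : Mom n => (k.1, k.2 + A)) :=
    (MeasurePreserving.id (volume : Measure ℝ)).prod
      (measurePreserving_add_right (volume : Measure (Fin n → ℝ)) A)
  exact h.integral_comp
    ((Homeomorph.refl ℝ).prodCongr (Homeomorph.addRight A)).measurableEmbedding G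

/-- Packets of charged modes are slice packets of the shifted profile, with trivial coordinate
change. -/
theorem isSlicePacket_chargedMode (eA : ℝ → Fin n → ℝ) (φ : (Fin n → ℝ) → ℝ → ℝ) (f : Mom n → ℂ)
    (u : ℝ) : IsSlicePacket (packet f (chargedMode eA φ)) u 0 1
      (phased (fun κ => φ (κ - eA u) u) fun k => f (k.1, k.2 - eA u)) := by
  intro v x
  rw [slicePacket, flatPacket, packet, Matrix.det_one, abs_one, Real.sqrt_one, Complex.ofReal_one,
    one_mul, ← integral_shift (fun k : Mom n => phased (fun κ => φ (κ - eA u) u)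
      (fun k => f (k.1, k.2 - eA u)) k * planeWave k (sliceMap 0 1 (v, x))) (eA u)]
  refine integral_congr_ae (ae_of_all _ fun k => ?_)
  have h : ((phased (fun κ => φ (κ - eA u) u) fun k => f (k.1, k.2 - eA u)) (k.1, k.2 + eA u))
      = Complex.exp (Complex.I * ((φ k.2 u / (2 * k.1) : ℝ) : ℂ)) * f k := by
    simp only [phased, add_sub_cancel_right]
  simp only [h]
  rw [mul_comm (f k), mul_right_comm, chargedMode, planeWave, ← Complex.exp_add, ← mul_add,
    ← Complex.ofReal_add]
  congr 4
  change k.1 * v + ∑ a, (k.2 a + eA u a) * x a + φ k.2 u / (2 * k.1)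
    = φ k.2 u / (2 * k.1)
      + (k.1 * (v + quad 0 x / 2) + ∑ a, (k.2 a + eA u a) * ((1 : Matrix (Fin n) (Fin n) ℝ) *ᵥ x) a)
  rw [quad_zero, Matrix.one_mulVec]
  ring

theorem tests_apart {f g : Mom n → ℂ} (hf : IsTest f) (hg : IsTest g) :
    ∀ k ∈ tsupport f, ∀ l ∈ tsupport (fun k => conj (g (-k))), k.1 ≠ l.1 := by
  intro k hk l hl h
  have h1 := hf.positive k hk
  have h2 := hg.positive _ (tsupport_conj_neg hl)
  rw [Prod.fst_neg] at h2
  linarith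

/-! ### Packets of the modes of spin 1 and 2 -/

theorem packet_congr_const {f : Mom n → ℂ} (hf : IsTest f) {M M' : Mom n → Pt n → ℂ} {c : ℂ}
    {X : Pt n} (h : ∀ k : Mom n, k.1 ≠ 0 → M k X = c * M' k X) :
    packet f M X = c * packet f M' X := by
  rw [packet, packet, ← integral_const_mul]
  refine integral_congr_ae (ae_of_all _ fun k => ?_)
  by_cases hk : k.1 = 0
  · have : f k = 0 := image_eq_zero_of_notMem_tsupport fun h' => (hf.positive k h').ne' hk
    simp [this]
  · simp only [h k hk]; ring

theorem packet_zero {f : Mom n → ℂ} {M : Mom n → Pt n → ℂ} {X : Pt n} (h : ∀ k, M k X = 0) :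
    packet f M X = 0 := by simp [packet, h]

theorem isTransverse_gaugeMode (E F : ℝ → Matrix (Fin n) (Fin n) ℝ) (ε : Fin n → ℂ)
    {f : Mom n → ℂ} (hf : IsTest f) :
    IsTransverse ε (packet f (scalarMode E F)) (packet1 f (gaugeMode E F ε)) :=
  ⟨funext fun X => packet_zero fun _ => gaugeMode_iv ε X, fun a => funext fun X =>
    packet_congr_const hf fun _ hk => gaugeMode_inr hk ε a X⟩

theorem isTransverse2_gravitonMode {H : ℝ → Matrix (Fin n) (Fin n) ℝ} (hH : ∀ u, (H u).IsSymm)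
    (E F : ℝ → Matrix (Fin n) (Fin n) ℝ) (ε : Fin n → ℂ) {f : Mom n → ℂ} (hf : IsTest f) :
    IsTransverse2 ε (packet f (scalarMode E F)) (packet2 f (gravitonMode H E F ε)) :=
  ⟨fun μ => funext fun X => packet_zero fun _ => gravitonMode_v_left ε μ X,
    fun μ => funext fun X => packet_zero fun _ => gravitonMode_v_right hH ε μ X,
    fun a b => funext fun X => packet_congr_const hf fun _ hk => gravitonMode_x_x hH hk ε a b X⟩

theorem isTransverse_gluonMode (eA : ℝ → Fin n → ℝ) (φ : (Fin n → ℝ) → ℝ → ℝ) (ε : Fin n → ℂ)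
    {f : Mom n → ℂ} (hf : IsTest f) :
    IsTransverse ε (packet f (chargedMode eA φ)) (packet1 f (gluonMode eA φ ε)) :=
  ⟨funext fun X => packet_zero fun _ => by rw [gluonMode_iv]; simp [chargedField],
    fun a => funext fun X => packet_congr_const hf fun _ hk => by rw [gluonMode_inr hk]; rfl⟩

/-! ### From scalars to spin -/

section Smul

variable {w w' : ℂ} {a b c d a' b' c' d' : (Mom n → ℂ) → (Mom n → ℂ) → ℝ → ℝ × (Fin n → ℝ) → ℂ}

/-- Slice relations of spinning packets follow from those of scalar packets once the densities are
proportional; the constant of the vanishing overlap is arbitrary. -/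
theorem SliceRelations.smul {rI rO : ℝ → Prop} (h : SliceRelations 1 rI rO a b c d)
    (ha : ∀ f g, IsTest f → IsTest g → ∀ u, a' f g u = fun p => w * a f g u p)
    (hb : ∀ f g, IsTest f → IsTest g → ∀ u, b' f g u = fun p => w * b f g u p)
    (hc : ∀ f g, IsTest f → IsTest g → ∀ u, c' f g u = fun p => w * c f g u p)
    (hd : ∀ f g, IsTest f → IsTest g → ∀ u, d' f g u = fun p => w' * d f g u p) :
    SliceRelations w rI rO a' b' c' d' := by
  refine ⟨fun f g hf hg u hu => ?_, fun f g hf hg u hu => ?_, fun f g hf hg u hu hu' => ?_,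
    fun f g hf hg u hu hu' => ?_, fun f g hf hg u u' hu => ?_⟩
  · have := h.in_in f g hf hg u hu
    rw [ha f g hf hg]
    exact ⟨this.1.const_mul w, by rw [integral_const_mul, this.2, one_mul]⟩
  · have := h.out_out f g hf hg u hu
    rw [hb f g hf hg]
    exact ⟨this.1.const_mul w, by rw [integral_const_mul, this.2, one_mul]⟩
  · have := h.no_creation f g hf hg u hu hu'
    rw [hd f g hf hg]
    exact ⟨this.1.const_mul w', by rw [integral_const_mul, this.2, mul_zero]⟩
  · rw [hc f g hf hg]
    exact (h.out_in_integrable f g hf hg u hu hu').const_mul w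
  · rw [hc f g hf hg, hc f g hf hg, integral_const_mul, integral_const_mul,
      h.out_in_conserved f g hf hg u u' hu]

theorem ScattersBy.smul {S : Lp ℂ 2 (oneParticle n) ≃ₗᵢ[ℂ] Lp ℂ 2 (oneParticle n)} {u : ℝ}
    (h : ScattersBy S 1 u c)
    (hc : ∀ f g, IsTest f → IsTest g → ∀ u, c' f g u = fun p => w * c f g u p) :
    ScattersBy S w u c' := fun f g hf hg F G hF hG => by
  rw [hc f g hf hg, integral_const_mul, h f g hf hg F G hF hG, one_mul]

theorem GravOverlap.smul {Em Fm : ℝ → Matrix (Fin n) (Fin n) ℝ} (h : GravOverlap Em Fm 1 c)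
    (hc : ∀ f g, IsTest f → IsTest g → ∀ u, c' f g u = fun p => w * c f g u p) :
    GravOverlap Em Fm w c' := by
  refine ⟨fun f g hf hg => ?_, fun hb f g hf hg => ?_⟩
  · rw [hc f g hf hg, integral_const_mul, h.integral f g hf hg]; ring
  · rw [hc f g hf hg, integral_const_mul, h.closed hb f g hf hg]; ring

end Smul

/-! ### The one-particle space -/

theorem measurableSet_positive : MeasurableSet {k : Mom n | 0 < k.1} :=
  measurableSet_lt measurable_const measurable_fst

theorem integral_oneParticle {G : Mom n → ℂ} (hG : ∀ k : Mom n, k.1 ≤ 0 → G k = 0) :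
    ∫ k, G k ∂(oneParticle n) = (2 * Real.pi : ℂ) ^ (n + 1) * ∫ k : Mom n, 2 * (k.1 : ℂ) * G k := by
  have hm : Measurable fun k : Mom n => ENNReal.ofReal ((2 * Real.pi) ^ (n + 1) * (2 * k.1)) := by
    fun_prop
  rw [oneParticle, integral_withDensity_eq_integral_toReal_smul hm
    (ae_of_all _ fun _ => ENNReal.ofReal_lt_top), ← integral_const_mul,
    ← setIntegral_eq_integral_of_forall_compl_eq_zero (s := {k : Mom n | 0 < k.1})
      (μ := volume) (fun k hk => by rw [hG k (not_lt.1 hk), mul_zero, mul_zero])]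
  refine setIntegral_congr_fun measurableSet_positive fun k hk => ?_
  have hk' : 0 < k.1 := hk
  rw [ENNReal.toReal_ofReal (by positivity), Complex.real_smul]
  push_cast
  ring

theorem IsTest.eq_zero {f : Mom n → ℂ} (hf : IsTest f) {k : Mom n} (hk : k.1 ≤ 0) : f k = 0 :=
  image_eq_zero_of_notMem_tsupport fun h => (hf.positive k h).not_ge hk

/-- The translation of transverse momenta by `-c`. -/
def kick (c : Fin n → ℝ) : Mom n ≃ᵐ Mom n :=
  ((Homeomorph.refl ℝ).prodCongr (Homeomorph.addRight (-c))).toMeasurableEquiv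

theorem kick_apply (c : Fin n → ℝ) (k : Mom n) : kick c k = (k.1, k.2 + -c) := rfl

theorem measurePreserving_kick (c : Fin n → ℝ) :
    MeasurePreserving (kick c) (oneParticle n) (oneParticle n) := by
  have h : MeasurePreserving (kick c : Mom n → Mom n) :=
    (MeasurePreserving.id (volume : Measure ℝ)).prod
      (measurePreserving_add_right (volume : Measure (Fin n → ℝ)) (-c))
  have h1 := h.restrict_preimage (measurableSet_positive (n := n))
  refine ⟨(kick c).measurable, Measure.ext fun s hs => ?_⟩
  rw [Measure.map_apply (kick c).measurable hs, oneParticle,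
    withDensity_apply _ ((kick c).measurable hs), withDensity_apply _ hs,
    ← h1.setLIntegral_comp_preimage hs (by fun_prop)]
  rfl

/-! ### Overlaps of charged packets -/

section Charged

variable {eA₁ eA₂ : ℝ → Fin n → ℝ} {φ₁ φ₂ : (Fin n → ℝ) → ℝ → ℝ}

theorem IsTest.chargedProfile {f : Mom n → ℂ} (hf : IsTest f) {φ : (Fin n → ℝ) → ℝ → ℝ} {u : ℝ}
    (hφ : ContDiff ℝ ∞ fun κ => φ κ u) (A : Fin n → ℝ) :
    IsTest (PlaneWave.phased (fun κ => φ (κ - A) u) fun k => f (k.1, k.2 - A)) :=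
  (hf.shift A).phased (hφ.comp (by fun_prop : ContDiff ℝ ∞ fun κ : Fin n → ℝ => κ - A))

theorem det_one_ne_zero : (1 : Matrix (Fin n) (Fin n) ℝ).det ≠ 0 := by simp

theorem integrable_chargedIP {f g : Mom n → ℂ} (hf : IsTest f) (hg : IsTest g) {u : ℝ}
    (h₁ : ContDiff ℝ ∞ fun κ => φ₁ κ u) (h₂ : ContDiff ℝ ∞ fun κ => φ₂ κ u) :
    Integrable (chargedIP eA₁ φ₁ eA₂ φ₂ f g u) :=
  integrable_scalarDensity (isSlicePacket_chargedMode eA₁ φ₁ f u)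
    (isSlicePacket_chargedMode eA₂ φ₂ g u) (hf.chargedProfile h₁ _).isBump
    (hg.chargedProfile h₂ _).isBump det_one_ne_zero det_one_ne_zero

theorem chargedBarIP_spec {f g : Mom n → ℂ} (hf : IsTest f) (hg : IsTest g) {u : ℝ}
    (h₁ : ContDiff ℝ ∞ fun κ => φ₁ κ u) (h₂ : ContDiff ℝ ∞ fun κ => φ₂ κ u) :
    Integrable (chargedBarIP eA₁ φ₁ eA₂ φ₂ f g u) ∧
      ∫ p, chargedBarIP eA₁ φ₁ eA₂ φ₂ f g u p = 0 := by
  have hf' := hf.chargedProfile h₁ (eA₁ u)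
  have hg' := hg.chargedProfile h₂ (eA₂ u)
  have a := isSlicePacket_chargedMode eA₁ φ₁ f u
  have b := (isSlicePacket_chargedMode eA₂ φ₂ g u).conj0
  exact ⟨integrable_scalarDensity a b hf'.isBump hg'.isBump.conj_neg det_one_ne_zero
    det_one_ne_zero, integral_scalarDensity_eq_zero a b hf'.isBump hg'.isBump.conj_neg
    det_one_ne_zero det_one_ne_zero (tests_apart hf' hg')⟩

/-- Overlaps of charged packets at a slice: a translation of the transverse momenta by the
difference of the potentials and a phase. -/
theorem integral_chargedIP {f g : Mom n → ℂ} (hf : IsTest f) (hg : IsTest g) {u : ℝ}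
    (h₁ : ContDiff ℝ ∞ fun κ => φ₁ κ u) (h₂ : ContDiff ℝ ∞ fun κ => φ₂ κ u)
    {c : Fin n → ℝ} (hc : eA₂ u = eA₁ u + c) {θ : (Fin n → ℝ) → ℝ}
    (hθ : ∀ l, φ₁ (l + c) u = φ₂ l u - θ l) :
    ∫ p, chargedIP eA₁ φ₁ eA₂ φ₂ f g u p
      = (2 * Real.pi : ℂ) ^ (n + 1) * ∫ l : Mom n, 2 * (l.1 : ℂ) * f (l.1, l.2 + c) * conj (g l) *
          Complex.exp (-Complex.I * ((θ l.2 / (2 * l.1) : ℝ) : ℂ)) := by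
  have hf' := hf.chargedProfile h₁ (eA₁ u)
  have hg' := hg.chargedProfile h₂ (eA₂ u)
  rw [show (∫ p, chargedIP eA₁ φ₁ eA₂ φ₂ f g u p) = _ from
    integral_scalarDensity_same (isSlicePacket_chargedMode eA₁ φ₁ f u)
    (isSlicePacket_chargedMode eA₂ φ₂ g u) hf'.isBump hg'.isBump det_one_ne_zero,
    ← integral_shift _ (eA₂ u)]
  congr 1
  refine integral_congr_ae (ae_of_all _ fun l => ?_)
  have e1 : ∀ κ : Fin n → ℝ, κ + eA₂ u - eA₁ u = κ + c := fun κ => by rw [hc]; abel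
  simp only [phased, add_sub_cancel_right, e1, map_mul, ← Complex.exp_conj, Complex.conj_I,
    Complex.conj_ofReal]
  have e2 : Complex.exp (Complex.I * ((φ₁ (l.2 + c) u / (2 * l.1) : ℝ) : ℂ)) *
      Complex.exp (-Complex.I * ((φ₂ l.2 u / (2 * l.1) : ℝ) : ℂ))
      = Complex.exp (-Complex.I * ((θ l.2 / (2 * l.1) : ℝ) : ℂ)) := by
    rw [← Complex.exp_add, hθ, sub_div]
    congr 1
    push_cast
    ring
  rw [← e2]
  ring

theorem integral_chargedIP_self {f g : Mom n → ℂ} (hf : IsTest f) (hg : IsTest g) {u : ℝ}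
    (h₁ : ContDiff ℝ ∞ fun κ => φ₁ κ u) :
    ∫ p, chargedIP eA₁ φ₁ eA₁ φ₁ f g u p = deltaPairing f g := by
  rw [integral_chargedIP hf hg h₁ h₁ (c := 0) (θ := fun _ => 0) (by simp) (by simp), deltaPairing]
  simp

end Charged

section Background

variable {𝔥 : Type*} [NormedAddCommGroup 𝔥] [NormedSpace ℝ 𝔥] [FiniteDimensional ℝ 𝔥]
  {e : 𝔥 →ₗ[ℝ] ℝ} {Fs : ℝ → Fin n → 𝔥}

theorem integrableOn_Iic_of_eq_zero {g : ℝ → ℝ} (hg : Continuous g) {a : ℝ}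
    (h : ∀ s < a, g s = 0) (u : ℝ) : IntegrableOn g (Set.Iic u) := by
  have h1 : IntegrableOn g (Set.Iio a) :=
    integrableOn_zero.congr_fun (fun s hs => (h s hs).symm) measurableSet_Iio
  refine (h1.union (hg.integrableOn_Icc (a := a) (b := u))).mono_set fun s hs => ?_
  rcases lt_or_ge s a with h | h
  · exact Or.inl h
  · exact Or.inr ⟨h, hs⟩

theorem integrableOn_Ioi_of_eq_zero {g : ℝ → ℝ} (hg : Continuous g) {b : ℝ}
    (h : ∀ s, b < s → g s = 0) (u : ℝ) : IntegrableOn g (Set.Ioi u) := by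
  have h1 : IntegrableOn g (Set.Ioi b) :=
    integrableOn_zero.congr_fun (fun s hs => (h s hs).symm) measurableSet_Ioi
  refine (h1.union (hg.integrableOn_Icc (a := u) (b := b))).mono_set fun s hs => ?_
  rcases lt_or_ge b s with h | h
  · exact Or.inl h
  · exact Or.inr ⟨hs.le, h⟩

/-- The action is a polynomial in the momentum. -/
theorem contDiff_action_integral {A : ℝ → Fin n → ℝ} {s : Set ℝ}
    (h1 : ∀ a, IntegrableOn (fun t => A t a) s) (h2 : ∀ a, IntegrableOn (fun t => A t a ^ 2) s) :
    ContDiff ℝ ∞ fun k : Fin n → ℝ =>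
      ∫ t in s, ((∑ a, (k a + A t a) ^ 2) - ∑ a, k a ^ 2) := by
  have h : (fun k : Fin n → ℝ => ∫ t in s, ((∑ a, (k a + A t a) ^ 2) - ∑ a, k a ^ 2))
      = fun k => ∑ a, (2 * k a * ∫ t in s, A t a) + ∑ a, ∫ t in s, A t a ^ 2 := by
    funext k
    simp only [← integral_const_mul]
    rw [← integral_finsetSum _ fun a _ => (h1 a).const_mul _,
      ← integral_finsetSum _ fun a _ => h2 a, ← integral_add
        (integrable_finsetSum _ fun a _ => (h1 a).const_mul _)
        (integrable_finsetSum _ fun a _ => h2 a)]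
    refine integral_congr_ae (ae_of_all _ fun t => ?_)
    simp only [← Finset.sum_add_distrib, ← Finset.sum_sub_distrib]
    exact Finset.sum_congr rfl fun a _ => by ring
  rw [h]
  fun_prop

theorem contDiff_fIn (hFs : Continuous Fs) {a : ℝ} (h : ∀ s < a, Fs s = 0) (u : ℝ) :
    ContDiff ℝ ∞ fun k => fIn (potIn e Fs) k u := by
  have hc := continuous_pot (potIn_hasDerivAt (e := e) hFs h)
  have h0 : ∀ s < a, potIn e Fs s = 0 := fun s hs => potIn_eq_zero h hs.le
  have := contDiff_action_integral (A := potIn e Fs) (s := Set.Iic u)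
    (fun i => integrableOn_Iic_of_eq_zero (by fun_prop) (a := a) (fun s hs => by simp [h0 s hs]) u)
    (fun i => integrableOn_Iic_of_eq_zero (by fun_prop) (a := a) (fun s hs => by simp [h0 s hs]) u)
  unfold fIn
  fun_prop

theorem contDiff_fOut (hFs : Continuous Fs) {b : ℝ} (h : ∀ s, b < s → Fs s = 0) (u : ℝ) :
    ContDiff ℝ ∞ fun k => fOut (potOut e Fs) k u := by
  have hc := continuous_pot (potOut_hasDerivAt (e := e) hFs h)
  have h0 : ∀ s, b < s → potOut e Fs s = 0 := fun s hs => potOut_eq_zero h hs.le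
  have := contDiff_action_integral (A := potOut e Fs) (s := Set.Ioi u)
    (fun i => integrableOn_Ioi_of_eq_zero (by fun_prop) (b := b) (fun s hs => by simp [h0 s hs]) u)
    (fun i => integrableOn_Ioi_of_eq_zero (by fun_prop) (b := b) (fun s hs => by simp [h0 s hs]) u)
  unfold fOut
  fun_prop

/-- The in and out potentials differ by the memory. -/
theorem potIn_eq_potOut_add (hFs : Continuous Fs) {a b : ℝ} (ha : ∀ s < a, Fs s = 0)
    (hb : ∀ s, b < s → Fs s = 0) (hb0 : b ≤ 0) (u : ℝ) :
    potIn e Fs u = potOut e Fs u + potIn e Fs 0 := by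
  funext i
  have hd := fun s => (potIn_hasDerivAt (e := e) hFs ha s i).sub
    (potOut_hasDerivAt (e := e) hFs hb s i)
  have h1 := is_const_of_deriv_eq_zero (fun s => (hd s).differentiableAt)
    (fun s => by rw [(hd s).deriv, sub_self]) u 0
  have h0 : potOut e Fs 0 i = 0 := by rw [potOut_eq_zero hb hb0]; rfl
  simp only [Pi.sub_apply, h0] at h1
  simp only [Pi.add_apply]
  linarith

/-- Both sides have the same derivative, since the in and out potentials differ by the memory, and
both vanish at `u = 0`. -/
theorem fOut_kick (hFs : Continuous Fs) {a b : ℝ} (ha : ∀ s < a, Fs s = 0)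
    (hb : ∀ s, b < s → Fs s = 0) (hb0 : b ≤ 0) (u : ℝ) (l : Fin n → ℝ) :
    fOut (potOut e Fs) (l + potIn e Fs 0) u
      = fIn (potIn e Fs) l u - fIn (potIn e Fs) l 0 := by
  have hd := fun s => ((isChargedData_out (e := e) hFs hb).action (l + potIn e Fs 0) s).sub
    ((isChargedData_in (e := e) hFs ha).action l s)
  have h1 := is_const_of_deriv_eq_zero (fun s => (hd s).differentiableAt) (fun s => by
    rw [(hd s).deriv, potIn_eq_potOut_add hFs ha hb hb0 s, sub_eq_zero]
    refine Finset.sum_congr rfl fun i _ => ?_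
    simp only [Pi.add_apply]
    ring) u 0
  have h0 : fOut (potOut e Fs) (l + potIn e Fs 0) 0 = 0 := by rw [fOut_eq hb hb0, zero_mul]
  simp only [Pi.sub_apply, h0] at h1
  linarith

theorem integral_chargedIP_out_in (hFs : Continuous Fs) {a b : ℝ} (ha : ∀ s < a, Fs s = 0)
    (hb : ∀ s, b < s → Fs s = 0) (hb0 : b ≤ 0) {f g : Mom n → ℂ} (hf : IsTest f) (hg : IsTest g)
    (u : ℝ) :
    ∫ p, chargedIP (potOut e Fs) (fOut (potOut e Fs)) (potIn e Fs) (fIn (potIn e Fs)) f g u p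
      = kickPairing (potIn e Fs) 1 f g := by
  rw [integral_chargedIP hf hg (contDiff_fOut hFs hb u) (contDiff_fIn hFs ha u)
    (potIn_eq_potOut_add hFs ha hb hb0 u) (fOut_kick hFs ha hb hb0 u), kickPairing, one_mul]

theorem chargedRelations (hFs : Continuous Fs) {a b : ℝ} (ha : ∀ s < a, Fs s = 0)
    (hb : ∀ s, b < s → Fs s = 0) (hb0 : b ≤ 0) :
    SliceRelations 1 (fun _ => True) (fun _ => True)
      (chargedIP (potIn e Fs) (fIn (potIn e Fs)) (potIn e Fs) (fIn (potIn e Fs)))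
      (chargedIP (potOut e Fs) (fOut (potOut e Fs)) (potOut e Fs) (fOut (potOut e Fs)))
      (chargedIP (potOut e Fs) (fOut (potOut e Fs)) (potIn e Fs) (fIn (potIn e Fs)))
      (chargedBarIP (potOut e Fs) (fOut (potOut e Fs)) (potIn e Fs) (fIn (potIn e Fs))) := by
  have hI := contDiff_fIn (e := e) hFs ha
  have hO := contDiff_fOut (e := e) hFs hb
  refine ⟨fun f g hf hg u _ => ⟨integrable_chargedIP hf hg (hI u) (hI u), ?_⟩,
    fun f g hf hg u _ => ⟨integrable_chargedIP hf hg (hO u) (hO u), ?_⟩,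
    fun f g hf hg u _ _ => chargedBarIP_spec hf hg (hO u) (hI u),
    fun f g hf hg u _ _ => integrable_chargedIP hf hg (hO u) (hI u), fun f g hf hg u u' _ => ?_⟩
  · rw [integral_chargedIP_self hf hg (hI u), one_mul]
  · rw [integral_chargedIP_self hf hg (hO u), one_mul]
  · rw [integral_chargedIP_out_in hFs ha hb hb0 hf hg, integral_chargedIP_out_in hFs ha hb hb0 hf
    hg]

/-- The scattering operator on a gauge theory plane wave: a kick by the memory and a phase. -/
theorem exists_charged_scattering (hFs : Continuous Fs) {a b : ℝ} (ha : ∀ s < a, Fs s = 0)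
    (hb : ∀ s, b < s → Fs s = 0) (hb0 : b ≤ 0) :
    ∃ S : Lp ℂ 2 (oneParticle n) ≃ₗᵢ[ℂ] Lp ℂ 2 (oneParticle n), ∀ u,
      ScattersBy S 1 u
        (chargedIP (potOut e Fs) (fOut (potOut e Fs)) (potIn e Fs) (fIn (potIn e Fs))) := by
  set c := potIn e Fs 0 with hc
  have hm : Measurable fun k : Mom n => Complex.exp (Complex.I *
      ((fIn (potIn e Fs) (k.2 + -c) 0 / (2 * k.1) : ℝ) : ℂ)) := by
    have h1 : Measurable fun k : Mom n => fIn (potIn e Fs) (k.2 + -c) 0 :=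
      ((contDiff_fIn (e := e) hFs ha 0).continuous.comp
        (by fun_prop : Continuous fun k : Mom n => k.2 + -c)).measurable
    fun_prop
  -- `(S g)(k) = e^{i f₋(k - c) / 2k₀} g(k - c)`
  obtain ⟨S, hS⟩ := exists_unitary_weightedComp (T := kick c) (μ := oneParticle n)
    (ν := oneParticle n) one_pos (by simp [(measurePreserving_kick c).map_eq]) hm
    (fun k => by rw [norm_expI, Real.sqrt_one])
  refine ⟨S, fun u f g hf hg F G hF hG => ?_⟩
  have hSG : S G =ᵐ[oneParticle n] fun k => Complex.exp (Complex.I *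
      ((fIn (potIn e Fs) (k.2 + -c) 0 / (2 * k.1) : ℝ) : ℂ)) * g (kick c k) := by
    filter_upwards [hS G, (measurePreserving_kick c).quasiMeasurePreserving.ae_eq_comp hG]
      with k h1 h2
    simp only [Function.comp_apply] at h2
    rw [h1, h2]
  rw [inner_eq_integral hF hSG, integral_oneParticle (fun k hk => by rw [hf.eq_zero hk, zero_mul]),
    integral_chargedIP_out_in hFs ha hb hb0 hf hg, kickPairing, one_mul, one_mul,
    ← integral_shift (fun k : Mom n => 2 * (k.1 : ℂ) * (f k * conj (Complex.exp (Complex.I *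
      ((fIn (potIn e Fs) (k.2 + -c) 0 / (2 * k.1) : ℝ) : ℂ)) * g (kick c k)))) c]
  congr 1
  refine integral_congr_ae (ae_of_all _ fun k => ?_)
  simp only [kick_apply, add_neg_cancel_right, map_mul, ← Complex.exp_conj, Complex.conj_I,
    Complex.conj_ofReal, ← hc]
  ring

end Background

/-! ### Conservation of overlaps at fixed frequency -/

/-- Rapid decay in `x`, uniformly for `s ∈ K`. -/
def Decays (K : Set ℝ) (Ψ : ℝ → (Fin n → ℝ) → ℂ) : Prop :=
  ∀ m : ℕ, ∃ C, ∀ s ∈ K, ∀ x, ‖x‖ ^ m * ‖Ψ s x‖ ≤ C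

section Decays

variable {K : Set ℝ} {Ψ Ψ' : ℝ → (Fin n → ℝ) → ℂ}

theorem Decays.add (h : Decays K Ψ) (h' : Decays K Ψ') :
    Decays K fun s x => Ψ s x + Ψ' s x := fun m => by
  obtain ⟨C, hC⟩ := h m
  obtain ⟨C', hC'⟩ := h' m
  refine ⟨C + C', fun s hs x => ?_⟩
  calc _ ≤ ‖x‖ ^ m * (‖Ψ s x‖ + ‖Ψ' s x‖) := by gcongr; exact norm_add_le _ _
    _ ≤ _ := by rw [mul_add]; exact add_le_add (hC s hs x) (hC' s hs x)

theorem Decays.sum {ι : Type*} {t : Finset ι} {Ψ : ι → ℝ → (Fin n → ℝ) → ℂ}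
    (h : ∀ i ∈ t, Decays K (Ψ i)) : Decays K fun s x => ∑ i ∈ t, Ψ i s x := by
  classical
  induction t using Finset.induction_on with
  | empty => exact fun m => ⟨0, fun s _ x => by simp⟩
  | insert i t hi ih =>
    simp only [Finset.sum_insert hi]
    exact (h i (Finset.mem_insert_self i t)).add (ih fun j hj => h j (Finset.mem_insert_of_mem hj))

/-- Coefficients of linear growth preserve rapid decay. -/
theorem Decays.mul_left (h : Decays K Ψ) {c : ℝ → (Fin n → ℝ) → ℂ} {B : ℝ}
    (hc : ∀ s ∈ K, ∀ x, ‖c s x‖ ≤ B * (1 + ‖x‖)) : Decays K fun s x => c s x * Ψ s x := fun m => by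
  obtain ⟨C, hC⟩ := h m
  obtain ⟨C', hC'⟩ := h (m + 1)
  refine ⟨|B| * (C + C'), fun s hs x => ?_⟩
  have h1 : ‖c s x‖ ≤ |B| * (1 + ‖x‖) := (hc s hs x).trans (by gcongr; exact le_abs_self B)
  rw [norm_mul]
  calc _ ≤ ‖x‖ ^ m * (|B| * (1 + ‖x‖) * ‖Ψ s x‖) := by gcongr
    _ = |B| * (‖x‖ ^ m * ‖Ψ s x‖ + ‖x‖ ^ (m + 1) * ‖Ψ s x‖) := by ring
    _ ≤ _ := by gcongr; exacts [hC s hs x, hC' s hs x]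

theorem Decays.mul_conj (h : Decays K Ψ) (h' : Decays K Ψ') :
    Decays K fun s x => Ψ s x * conj (Ψ' s x) := fun m => by
  obtain ⟨C, hC⟩ := h m
  obtain ⟨C', hC'⟩ := h' 0
  refine ⟨C * |C'|, fun s hs x => ?_⟩
  have h1 := hC s hs x
  have h2 := (hC' s hs x).trans (le_abs_self C')
  rw [pow_zero, one_mul] at h2
  rw [norm_mul, RCLike.norm_conj, ← mul_assoc]
  exact mul_le_mul h1 h2 (norm_nonneg _) ((by positivity : (0:ℝ) ≤ _).trans h1)

theorem Decays.exists_le (h : Decays K Ψ) :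
    ∃ C, ∀ s ∈ K, ∀ x, ‖Ψ s x‖ ≤ C * decayWeight x := by
  obtain ⟨C, hC⟩ := h 0
  obtain ⟨C', hC'⟩ := h (n + 1)
  exact ⟨_, fun s hs x => norm_le_decayWeight (by simpa using hC s hs x) (hC' s hs x)⟩

theorem Decays.integrable (h : Decays K Ψ) {s : ℝ} (hs : s ∈ K) (hc : Continuous (Ψ s)) :
    Integrable (Ψ s) := by
  obtain ⟨C, hC⟩ := h.exists_le
  exact (integrable_decayWeight.const_mul C).mono' hc.aestronglyMeasurable
    (ae_of_all _ fun x => hC s hs x)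

end Decays

theorem exists_entries_bound {M : ℝ → Matrix (Fin n) (Fin n) ℝ} {K : Set ℝ} (hK : IsCompact K)
    (hM : ∀ i j, ContinuousOn (fun s => M s i j) K) : ∃ B, ∀ s ∈ K, ∀ i j, |M s i j| ≤ B := by
  choose C hC using fun i j => hK.exists_bound_of_continuousOn (hM i j)
  obtain ⟨B, hB⟩ := exists_entries_le (Matrix.of C)
  exact ⟨B, fun s hs i j => (hC i j s hs).trans ((le_abs_self _).trans (hB i j))⟩

/-! #### Fixed-frequency packets of the modes -/

/-- The part of frequency `k₀` of a packet of scalar modes, without its dependence on `v`. -/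
def modeFiber (E F : ℝ → Matrix (Fin n) (Fin n) ℝ) (k₀ : ℝ) (f : Mom n → ℂ) (s : ℝ)
    (x : Fin n → ℝ) : ℂ :=
  ∫ κ : Fin n → ℝ, f (k₀, κ) * scalarMode E F (k₀, κ) (pt s 0 x)

/-- The derivative of `modeFiber` along `x^a`. -/
def gradFiber (E F : ℝ → Matrix (Fin n) (Fin n) ℝ) (k₀ : ℝ) (a : Fin n) (f : Mom n → ℂ) (s : ℝ)
    (x : Fin n → ℝ) : ℂ :=
  Complex.I * ((∑ i, ((E s)⁻¹ i a : ℂ) * modeFiber E F k₀ (fun k => (k.2 i : ℂ) * f k) s x)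
    + ((k₀ * ∑ b, shear E s a b * x b : ℝ) : ℂ) * modeFiber E F k₀ f s x)

/-- The second derivative of `modeFiber` along `x^a`. -/
def hessFiber (E F : ℝ → Matrix (Fin n) (Fin n) ℝ) (k₀ : ℝ) (a : Fin n) (f : Mom n → ℂ) (s : ℝ)
    (x : Fin n → ℝ) : ℂ :=
  Complex.I * ((∑ i, ((E s)⁻¹ i a : ℂ) * gradFiber E F k₀ a (fun k => (k.2 i : ℂ) * f k) s x)
    + ((k₀ * ∑ b, shear E s a b * x b : ℝ) : ℂ) * gradFiber E F k₀ a f s x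
    + ((k₀ * shear E s a a : ℝ) : ℂ) * modeFiber E F k₀ f s x)

theorem sliceFiber_phased (σ Λ F : Matrix (Fin n) (Fin n) ℝ) (f : Mom n → ℂ) (k₀ : ℝ)
    (x : Fin n → ℝ) :
    sliceFiber σ Λ 0 (phased (quad F) f) k₀ x = sliceFiber σ Λ (k₀⁻¹ • F) f k₀ x := by
  rw [sliceFiber, sliceFiber, fiberPacket, fiberPacket]
  congr 2
  refine integral_congr_ae (ae_of_all _ fun κ => ?_)
  simp only [phased, quad_zero, zero_div, add_zero]
  rw [mul_assoc, mul_left_comm, ← Complex.exp_add, ← mul_add, ← Complex.ofReal_add]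
  have : quad (k₀⁻¹ • F) κ = k₀⁻¹ * quad F κ := by
    simp only [quad, Matrix.smul_apply, smul_eq_mul, Finset.mul_sum, mul_assoc]
  rw [this]
  congr 4
  rw [add_comm]
  congr 1
  rw [div_mul_eq_div_div, div_right_comm, inv_mul_eq_div]

section Fiber

variable {H E F : ℝ → Matrix (Fin n) (Fin n) ℝ} {R : Set ℝ} {k₀ : ℝ} {f : Mom n → ℂ}

theorem modeFiber_eq (E F : ℝ → Matrix (Fin n) (Fin n) ℝ) (k₀ : ℝ) (f : Mom n → ℂ) (s : ℝ)
    (x : Fin n → ℝ) :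
    modeFiber E F k₀ f s x = sliceFiber (shear E s) (E s)⁻¹ (k₀⁻¹ • F s) f k₀ x := by
  rw [← sliceFiber_phased, sliceFiber, fiberPacket, modeFiber, ← integral_const_mul,
    ← integral_const_mul]
  refine integral_congr_ae (ae_of_all _ fun κ => ?_)
  simp only [scalarMode, phase_pt, phased, quad_zero, zero_div, add_zero, mul_zero]
  change f (k₀, κ) * ((Omega E s : ℂ) * _) = _
  rw [Omega_eq_sqrt]
  have h2 : Complex.I * ((k₀ / 2 * quad (shear E s) x + ∑ i, κ i * ((E s)⁻¹ *ᵥ x) i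
      + quad (F s) κ / (2 * k₀) : ℝ) : ℂ)
      = Complex.I * ((k₀ * (quad (shear E s) x / 2) : ℝ) : ℂ)
        + Complex.I * ((quad (F s) κ / (2 * k₀) : ℝ) : ℂ)
        + Complex.I * ((∑ i, κ i * ((E s)⁻¹ *ᵥ x) i : ℝ) : ℂ) := by
    push_cast; ring
  rw [h2, Complex.exp_add, Complex.exp_add]
  ring

theorem continuous_scalarMode_fiber (E F : ℝ → Matrix (Fin n) (Fin n) ℝ) (k₀ s : ℝ) :
    Continuous fun q : (Fin n → ℝ) × (Fin n → ℝ) => scalarMode E F (k₀, q.2) (pt s 0 q.1) := by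
  have h1 := (continuous_quad (shear E s)).comp
    (continuous_fst : Continuous (Prod.fst : (Fin n → ℝ) × (Fin n → ℝ) → _))
  have h2 := (continuous_quad (F s)).comp
    (continuous_snd : Continuous (Prod.snd : (Fin n → ℝ) × (Fin n → ℝ) → _))
  simp only [Function.comp_def] at h1 h2
  simp only [scalarMode, phase_pt, sum_mulVec_mul]
  change Continuous fun q : (Fin n → ℝ) × (Fin n → ℝ) => (Omega E s : ℂ) * _
  fun_prop

theorem continuous_scalarMode_momentum (E F : ℝ → Matrix (Fin n) (Fin n) ℝ) (k₀ s : ℝ)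
    (x : Fin n → ℝ) : Continuous fun κ : Fin n → ℝ => scalarMode E F (k₀, κ) (pt s 0 x) := by
  have h2 := continuous_quad (F s)
  simp only [scalarMode, phase_pt, sum_mulVec_mul]
  change Continuous fun κ : Fin n → ℝ => (Omega E s : ℂ) * _
  fun_prop

theorem velocity_pt (E : ℝ → Matrix (Fin n) (Fin n) ℝ) (k₀ s : ℝ) (κ x : Fin n → ℝ) (a : Fin n) :
    velocity E (k₀, κ) a (pt s 0 x)
      = (∑ i, κ i * (E s)⁻¹ i a) / k₀ + ∑ b, shear E s a b * x b := rfl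

theorem IsBump.lin_integral (hf : IsBump f) (k₀ : ℝ) {w : (Fin n → ℝ) → ℂ} (hw : Continuous w)
    (c : Fin n → ℝ) (d : ℝ) :
    (∑ i, (c i : ℂ) * (∫ κ : Fin n → ℝ, (fun k : Mom n => (k.2 i : ℂ) * f k) (k₀, κ) * w κ))
        + (d : ℂ) * (∫ κ : Fin n → ℝ, f (k₀, κ) * w κ)
      = ∫ κ : Fin n → ℝ, f (k₀, κ) * ((((∑ i, κ i * c i) + d : ℝ) : ℂ) * w κ) := by
  simp only [← integral_const_mul]
  rw [← integral_finsetSum _ fun i _ => (((hf.mul_coord i).slice k₀).integrable_mul hw).const_mul _,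
    ← integral_add (integrable_finsetSum _ fun i _ =>
      (((hf.mul_coord i).slice k₀).integrable_mul hw).const_mul _)
      (((hf.slice k₀).integrable_mul hw).const_mul _)]
  refine integral_congr_ae (ae_of_all _ fun κ => ?_)
  push_cast
  rw [add_mul, mul_add, Finset.sum_mul, Finset.mul_sum]
  congr 1
  · exact Finset.sum_congr rfl fun i _ => by ring
  · ring

theorem gradFiber_eq (hf : IsBump f) (hk : k₀ ≠ 0) (a : Fin n) (s : ℝ) (x : Fin n → ℝ) :
    gradFiber E F k₀ a f s x = ∫ κ : Fin n → ℝ, f (k₀, κ) *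
      (Complex.I * k₀ * velocity E (k₀, κ) a (pt s 0 x) * scalarMode E F (k₀, κ) (pt s 0 x)) := by
  have h := hf.lin_integral k₀ (continuous_scalarMode_momentum E F k₀ s x) (fun i => (E s)⁻¹ i a)
    (k₀ * ∑ b, shear E s a b * x b)
  rw [gradFiber, show ((∑ i, ((E s)⁻¹ i a : ℂ) * modeFiber E F k₀ (fun k => (k.2 i : ℂ) * f k) s x)
    + ((k₀ * ∑ b, shear E s a b * x b : ℝ) : ℂ) * modeFiber E F k₀ f s x) = _ from h,
    ← integral_const_mul]
  refine integral_congr_ae (ae_of_all _ fun κ => ?_)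
  have hk' : (k₀ : ℂ) ≠ 0 := Complex.ofReal_ne_zero.2 hk
  simp only [velocity_pt]
  push_cast
  field_simp

theorem hessFiber_eq (hf : IsBump f) (hk : k₀ ≠ 0) (a : Fin n) (s : ℝ) (x : Fin n → ℝ) :
    hessFiber E F k₀ a f s x = ∫ κ : Fin n → ℝ, f (k₀, κ) *
      (((Complex.I * k₀ * velocity E (k₀, κ) a (pt s 0 x)) ^ 2 + Complex.I * k₀ * shear E s a a) *
        scalarMode E F (k₀, κ) (pt s 0 x)) := by
  have hm := continuous_scalarMode_momentum E F k₀ s x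
  have hw : Continuous fun κ : Fin n → ℝ => Complex.I * k₀ * velocity E (k₀, κ) a (pt s 0 x) *
      scalarMode E F (k₀, κ) (pt s 0 x) := by
    simp only [velocity_pt]; fun_prop
  have h := hf.lin_integral k₀ hw (fun i => (E s)⁻¹ i a) (k₀ * ∑ b, shear E s a b * x b)
  simp only [← gradFiber_eq (hf.mul_coord _) hk, ← gradFiber_eq hf hk] at h
  have h2 : Continuous fun κ : Fin n → ℝ => (((∑ i, κ i * (E s)⁻¹ i a)
      + k₀ * ∑ b, shear E s a b * x b : ℝ) : ℂ) * (Complex.I * k₀ *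
        velocity E (k₀, κ) a (pt s 0 x) * scalarMode E F (k₀, κ) (pt s 0 x)) := by
    fun_prop
  rw [hessFiber, h, modeFiber, ← integral_const_mul,
    ← integral_add ((hf.slice k₀).integrable_mul h2)
      (((hf.slice k₀).integrable_mul hm).const_mul _), ← integral_const_mul]
  refine integral_congr_ae (ae_of_all _ fun κ => ?_)
  have hk' : (k₀ : ℂ) ≠ 0 := Complex.ofReal_ne_zero.2 hk
  simp only [velocity_pt]
  push_cast
  field_simp

/-! #### Derivatives -/

theorem update_pt_inr (s v t : ℝ) (x : Fin n → ℝ) (a : Fin n) :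
    Function.update (pt s v x) (Sum.inr a) t = pt s v (Function.update x a t) := by
  funext μ
  rcases idx_cases μ with rfl | rfl | ⟨b, rfl⟩
  · simp [pt]
  · simp [pt]
  · by_cases h : b = a
    · subst h; simp [pt]
    · simp [pt, h]

theorem hasLineDerivAt_of_update {Ψ : (Fin n → ℝ) → ℂ} {D : ℂ} {x : Fin n → ℝ} {a : Fin n}
    (h : HasDerivAt (fun t => Ψ (Function.update x a t)) D (x a)) :
    HasLineDerivAt ℝ Ψ D x (Pi.single a 1) := by
  have h1 : (fun t : ℝ => Ψ (x + t • Pi.single a 1))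
      = (fun t => Ψ (Function.update x a t)) ∘ fun t => x a + t := by
    funext t
    simp only [Function.comp_apply]
    congr 1
    funext b
    by_cases hb : b = a
    · subst hb; simp
    · simp [hb]
  rw [HasLineDerivAt, h1]
  have h2 : HasDerivAt (fun t : ℝ => x a + t) 1 0 := (hasDerivAt_id' 0).const_add _
  have h3 : HasDerivAt (fun t => Ψ (Function.update x a t)) D (x a + 0) := by rwa [add_zero]
  exact (h3.scomp (0 : ℝ) h2).congr_deriv (one_smul _ _)

theorem hasDerivAt_modeFiber_x (hE : IsVielbein H E) (hk : k₀ ≠ 0) {s : ℝ} (hs : Regular E s)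
    (hf : IsBump f) (a : Fin n) (x : Fin n → ℝ) :
    HasDerivAt (fun t => modeFiber E F k₀ f s (Function.update x a t))
      (gradFiber E F k₀ a f s x) (x a) := by
  have hc := continuous_scalarMode_fiber E F k₀ s
  have h := (hf.slice k₀).hasDerivAt_integral (μ := volume) (s := x a) (U := Set.univ)
    Filter.univ_mem
    (M := fun t κ => scalarMode E F (k₀, κ) (pt s 0 (Function.update x a t)))
    (M' := fun t κ => Complex.I * k₀ * velocity E (k₀, κ) a (pt s 0 (Function.update x a t)) *
      scalarMode E F (k₀, κ) (pt s 0 (Function.update x a t)))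
    (fun t _ => continuous_scalarMode_momentum E F k₀ s _) (fun t _ κ => ?_) ?_
  · rw [gradFiber_eq hf hk]
    simp only [Function.update_eq_self] at h
    exact h
  · have h := hasPD_scalarMode_x (F := F) hE (k := (k₀, κ)) hk
      (X := Function.update (pt s 0 x) (Sum.inr a) t) (by simpa [pt] using hs) a
    simp only [HasPD, Function.update_idem, Function.update_self, update_pt_inr] at h
    exact h
  · refine Continuous.continuousOn ?_
    have hu : Continuous fun q : ℝ × (Fin n → ℝ) => Function.update x a q.1 :=
      continuous_const.update a continuous_fst
    have h1 := hc.comp (hu.prodMk continuous_snd)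
    simp only [Function.comp_def] at h1
    simp only [Function.uncurry_def, velocity_pt]
    fun_prop

theorem hasLineDerivAt_modeFiber (hE : IsVielbein H E) (hk : k₀ ≠ 0) {s : ℝ} (hs : Regular E s)
    (hf : IsBump f) (a : Fin n) (x : Fin n → ℝ) :
    HasLineDerivAt ℝ (modeFiber E F k₀ f s) (gradFiber E F k₀ a f s x) x (Pi.single a 1) :=
  hasLineDerivAt_of_update (hasDerivAt_modeFiber_x hE hk hs hf a x)

theorem hasLineDerivAt_gradFiber (hE : IsVielbein H E) (hk : k₀ ≠ 0) {s : ℝ} (hs : Regular E s)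
    (hf : IsBump f) (a : Fin n) (x : Fin n → ℝ) :
    HasLineDerivAt ℝ (gradFiber E F k₀ a f s) (hessFiber E F k₀ a f s x) x (Pi.single a 1) := by
  refine hasLineDerivAt_of_update ?_
  have h1 : ∀ b, HasDerivAt (fun t => Function.update x a t b) ((Pi.single a 1 : Fin n → ℝ) b)
      (x a) := fun b => hasDerivAt_pi.1 (hasDerivAt_update x a (x a)) b
  have h2 : HasDerivAt (fun t => ((k₀ * ∑ b, shear E s a b * Function.update x a t b : ℝ) : ℂ))
      ((k₀ * shear E s a a : ℝ) : ℂ) (x a) := by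
    refine HasDerivAt.ofReal_comp (((HasDerivAt.fun_sum fun b _ =>
      (h1 b).const_mul (shear E s a b)).const_mul k₀).congr_deriv ?_)
    simp [Pi.single_apply]
  have h3 := ((HasDerivAt.fun_sum (u := Finset.univ) fun i _ =>
    (hasDerivAt_modeFiber_x (F := F) hE hk hs (hf.mul_coord i) a x).const_mul
      ((E s)⁻¹ i a : ℂ)).add (h2.mul (hasDerivAt_modeFiber_x (F := F) hE hk hs hf a x))).const_mul
      Complex.I
  refine h3.congr_deriv ?_
  simp only [Function.update_eq_self, hessFiber]
  ring

end Fiber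

section Schrodinger

variable {H E F : ℝ → Matrix (Fin n) (Fin n) ℝ} {R : Set ℝ} {k₀ : ℝ} {f : Mom n → ℂ}

/-- The derivative of `modeFiber` along `u` dictated by the wave equation, which at fixed frequency
is a Schrödinger equation with an oscillator potential. -/
def timeFiber (H E F : ℝ → Matrix (Fin n) (Fin n) ℝ) (k₀ : ℝ) (f : Mom n → ℂ) (s : ℝ)
    (x : Fin n → ℝ) : ℂ :=
  (-(Complex.I / (2 * k₀))) * ∑ a, hessFiber E F k₀ a f s x
    + (-(Complex.I * k₀ / 2)) * (∑ a, (x a : ℂ) * ((((H s *ᵥ x) a : ℝ) : ℂ) *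
      modeFiber E F k₀ f s x))

theorem quad_eq_sum_mulVec (M : Matrix (Fin n) (Fin n) ℝ) (x : Fin n → ℝ) :
    quad M x = ∑ a, x a * (M *ᵥ x) a := by
  simp only [quad, Matrix.mulVec, dotProduct, Finset.mul_sum]
  exact Finset.sum_congr rfl fun a _ => Finset.sum_congr rfl fun b _ => by ring

section Aux

variable {T : Type*} [TopologicalSpace T] {κ : T → Fin n → ℝ} {h Λ σ N : Fin n → Fin n → T → ℝ}

theorem continuous_rate_aux (hκ : Continuous κ) (hh : ∀ a b, Continuous (h a b))
    (hΛ : ∀ a b, Continuous (Λ a b)) (hσ : ∀ a b, Continuous (σ a b)) (k₀ : ℝ) (x : Fin n → ℝ) :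
    Continuous fun p => Complex.I * k₀ / 2 * (∑ a, (((∑ i, κ p i * Λ i a p) / k₀
      + ∑ b, σ a b p * x b : ℝ) : ℂ) ^ 2 - ((∑ a, ∑ b, h a b p * x a * x b : ℝ) : ℂ))
      + (1 / 2) * ∑ a, (σ a a p : ℂ) := by
  fun_prop

theorem continuous_phase_aux (hκ : Continuous κ) (hN : ∀ a b, Continuous (N a b))
    (hΛ : ∀ a b, Continuous (Λ a b)) (hσ : ∀ a b, Continuous (σ a b)) (k₀ : ℝ) (x : Fin n → ℝ) :
    Continuous fun p => k₀ / 2 * (∑ a, ∑ b, σ a b p * x a * x b)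
      + ∑ i, ∑ a, κ p i * Λ i a p * x a + k₀ * 0
      + (∑ i, ∑ j, N i j p * κ p i * κ p j) / (2 * k₀) := by
  fun_prop

end Aux

theorem continuous_rate_mul_scalarMode {T : Type*} [TopologicalSpace T] {τ : T → ℝ}
    {κ : T → Fin n → ℝ} (hκ : Continuous κ) (hH : ∀ a b, Continuous fun p => H (τ p) a b)
    (hΛ : ∀ i a, Continuous fun p => (E (τ p))⁻¹ i a)
    (hσ : ∀ a b, Continuous fun p => shear E (τ p) a b)
    (hF : ∀ i j, Continuous fun p => F (τ p) i j) (hΩ : Continuous fun p => Omega E (τ p))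
    (k₀ : ℝ) (x : Fin n → ℝ) :
    Continuous fun p =>
      rate H E (k₀, κ p) (pt (τ p) 0 x) * scalarMode E F (k₀, κ p) (pt (τ p) 0 x) := by
  have h1 : Continuous fun p => rate H E (k₀, κ p) (pt (τ p) 0 x) :=
    continuous_rate_aux hκ hH hΛ hσ k₀ x
  have h2 : Continuous fun p => phase E F (k₀, κ p) (pt (τ p) 0 x) :=
    continuous_phase_aux hκ hF hΛ hσ k₀ x
  exact h1.mul ((Complex.continuous_ofReal.comp hΩ).mul
    (Complex.continuous_exp.comp (continuous_const.mul (Complex.continuous_ofReal.comp h2))))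

theorem continuousOn_rate_mul_scalarMode (hE : IsVielbein H E) (hF : IsRosenIntegral E F R)
    (hH : ∀ a b, Continuous fun s => H s a b) (k₀ : ℝ) (x : Fin n → ℝ) :
    ContinuousOn (Function.uncurry fun (t : ℝ) (κ : Fin n → ℝ) =>
      rate H E (k₀, κ) (pt t 0 x) * scalarMode E F (k₀, κ) (pt t 0 x))
      ({s | Regular E s} ×ˢ Set.univ) := by
  rw [continuousOn_iff_continuous_domRestrict]
  have key : ∀ {G : ℝ → ℝ}, (∀ s, Regular E s → ContinuousAt G s) → Continuous
      fun p : ({s | Regular E s} ×ˢ (Set.univ : Set (Fin n → ℝ)) : Set _) => G p.1.1 := fun hG =>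
    continuous_iff_continuousAt.2 fun p =>
      ContinuousAt.comp (f := fun p : ({s | Regular E s} ×ˢ (Set.univ : Set (Fin n → ℝ)) : Set _) =>
        p.1.1) (hG p.1.1 p.2.1) (continuous_fst.comp continuous_subtype_val).continuousAt
  exact continuous_rate_mul_scalarMode (continuous_snd.comp continuous_subtype_val)
    (fun a b => key fun s _ => (hH a b).continuousAt)
    (fun i a => key fun s hs => (hE.hasDerivAt_inv hs i a).continuousAt)
    (fun a b => key fun s hs => (hE.hasDerivAt_shear hs a b).continuousAt)
    (fun i j => key fun s hs => (hF.hasDeriv s hs i j).continuousAt)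
    (key fun s hs => (hE.hasDerivAt_Omega hs).continuousAt) k₀ x

theorem update_pt_iu (s v t : ℝ) (x : Fin n → ℝ) : Function.update (pt s v x) iu t = pt t v x := by
  funext μ
  rcases idx_cases μ with rfl | rfl | ⟨a, rfl⟩ <;> simp [pt]

/-- The Schrödinger equation of fixed-frequency packets along `u`. -/
theorem hasDerivAt_modeFiber_u (hE : IsVielbein H E) (hF : IsRosenIntegral E F R)
    (hH : ∀ a b, Continuous fun s => H s a b) (hk : k₀ ≠ 0) {s : ℝ} (hs : Regular E s)
    (hf : IsBump f) (x : Fin n → ℝ) :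
    HasDerivAt (fun t => modeFiber E F k₀ f t x) (timeFiber H E F k₀ f s x) s := by
  have h := (hf.slice k₀).hasDerivAt_integral (μ := volume) (s := s) (U := {s | Regular E s})
    (hE.eventually_regular hs)
    (M := fun t κ => scalarMode E F (k₀, κ) (pt t 0 x))
    (M' := fun t κ => rate H E (k₀, κ) (pt t 0 x) * scalarMode E F (k₀, κ) (pt t 0 x))
    (fun t _ => continuous_scalarMode_momentum E F k₀ t x) (fun t ht κ => ?_)
    (continuousOn_rate_mul_scalarMode hE hF hH k₀ x)
  · refine HasDerivAt.congr_deriv h ?_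
    have hm := continuous_scalarMode_momentum E F k₀ s x
    have hw : ∀ a, Continuous fun κ : Fin n → ℝ =>
        ((Complex.I * k₀ * velocity E (k₀, κ) a (pt s 0 x)) ^ 2 + Complex.I * k₀ * shear E s a a) *
        scalarMode E F (k₀, κ) (pt s 0 x) := fun a => by
      simp only [velocity_pt]; fun_prop
    rw [timeFiber]
    simp only [hessFiber_eq hf hk, modeFiber, ← integral_const_mul]
    have hi := fun a => (hf.slice k₀).integrable_mul (μ := volume) (hw a)
    have hj := (hf.slice k₀).integrable_mul (μ := volume) hm
    rw [← integral_finsetSum _ fun a _ => hi a,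
      ← integral_finsetSum _ fun a _ => (hj.const_mul _).const_mul _, ← integral_const_mul,
      ← integral_const_mul, ← integral_add ((integrable_finsetSum _ fun a _ => hi a).const_mul _)
        ((integrable_finsetSum _ fun a _ => (hj.const_mul _).const_mul _).const_mul _)]
    refine integral_congr_ae (ae_of_all _ fun κ => ?_)
    have hk' : (k₀ : ℂ) ≠ 0 := Complex.ofReal_ne_zero.2 hk
    have hq : (quad (H s) x : ℂ) = ∑ a, (x a : ℂ) * (((H s *ᵥ x) a : ℝ) : ℂ) := by
      rw [quad_eq_sum_mulVec]; push_cast; rfl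
    have e1 : rate H E (k₀, κ) (pt s 0 x) = Complex.I * k₀ / 2 *
        (∑ a, (velocity E (k₀, κ) a (pt s 0 x) : ℂ) ^ 2 - (quad (H s) x : ℂ))
        + (1 / 2) * ∑ a, (shear E s a a : ℂ) := rfl
    have e2 : ∑ i, (x i : ℂ) *
      (((H s *ᵥ x) i : ℝ) * (f (k₀, κ) * scalarMode E F (k₀, κ) (pt s 0 x)))
        = (∑ a, (x a : ℂ) * (((H s *ᵥ x) a : ℝ) : ℂ)) *
          (f (k₀, κ) * scalarMode E F (k₀, κ) (pt s 0 x)) := by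
      rw [Finset.sum_mul]; exact Finset.sum_congr rfl fun a _ => by ring
    have e3 : ∑ a, f (k₀, κ) * (((Complex.I * k₀ * velocity E (k₀, κ) a (pt s 0 x)) ^ 2
        + Complex.I * k₀ * shear E s a a) * scalarMode E F (k₀, κ) (pt s 0 x))
        = ((Complex.I * k₀) ^ 2 * ∑ a, (velocity E (k₀, κ) a (pt s 0 x) : ℂ) ^ 2
          + Complex.I * k₀ * ∑ a, (shear E s a a : ℂ)) *
          (f (k₀, κ) * scalarMode E F (k₀, κ) (pt s 0 x)) := by
      rw [Finset.mul_sum, Finset.mul_sum, ← Finset.sum_add_distrib, Finset.sum_mul]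
      exact Finset.sum_congr rfl fun a _ => by ring
    beta_reduce
    rw [e1, hq, e2, e3]
    generalize (∑ a, (x a : ℂ) * (((H s *ᵥ x) a : ℝ) : ℂ)) = A
    generalize ∑ a, (velocity E (k₀, κ) a (pt s 0 x) : ℂ) ^ 2 = B
    generalize ∑ a, (shear E s a a : ℂ) = C
    field_simp
    linear_combination (f (k₀, κ) * scalarMode E F (k₀, κ) (pt s 0 x) *
      (Complex.I * k₀ * B + C)) * Complex.I_sq
  · have h := hasPD_scalarMode_u (F := F) hE hF (k := (k₀, κ)) hk
      (X := pt t 0 x) ht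
    simp only [HasPD, update_pt_iu] at h
    exact h

/-! #### Decay and continuity of the fixed-frequency packets -/

variable {K : Set ℝ}

theorem decays_modeFiber (hE : IsVielbein H E) (hF : IsRosenIntegral E F R) (hK : IsCompact K)
    (hreg : ∀ s ∈ K, Regular E s) (hf : IsBump f) : Decays K (modeFiber E F k₀ f) := by
  intro m
  have hEc : Continuous E := hE.isSolution.continuous
  obtain ⟨B₁, h₁⟩ := hK.exists_bound_of_continuousOn (f := fun s => ((E s)⁻¹).det) (by
    simp only [Matrix.det_nonsing_inv, Ring.inverse_eq_inv']
    exact hEc.matrix_det.continuousOn.inv₀ fun s hs => hreg s hs)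
  obtain ⟨B₂, h₂⟩ := exists_entries_bound hK (M := E) fun i j =>
    (hEc.matrix_elem i j).continuousOn
  obtain ⟨B₃, h₃⟩ := exists_entries_bound hK (M := fun s => k₀⁻¹ • F s) fun i j s hs =>
    ((hF.hasDeriv s (hreg s hs) i j).continuousAt.const_mul k₀⁻¹).continuousWithinAt
  obtain ⟨C, hC⟩ := hf.decay_sliceFiber (max B₁ (max B₂ B₃)) m
  refine ⟨C, fun s hs x => ?_⟩
  rw [modeFiber_eq]
  refine hC _ _ _ _ _ ?_ ((h₁ s hs).trans (le_max_left _ _)) (fun i j => ?_)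
    fun i j => (h₃ s hs i j).trans ((le_max_right _ _).trans (le_max_right _ _))
  · rw [Matrix.det_nonsing_inv, Ring.inverse_eq_inv']
    exact inv_ne_zero (hreg s hs)
  · rw [Matrix.nonsing_inv_nonsing_inv _ (hreg s hs).isUnit]
    exact (h₂ s hs i j).trans ((le_max_left _ _).trans (le_max_right _ _))

theorem continuous_modeFiber (hf : IsBump f) (s : ℝ) : Continuous (modeFiber E F k₀ f s) := by
  have h := (hf.continuous_sliceFiber (shear E s) (E s)⁻¹ (k₀⁻¹ • F s)).comp
    (Continuous.prodMk_right k₀)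
  exact h.congr fun x => (modeFiber_eq E F k₀ f s x).symm

theorem continuous_gradFiber (hf : IsBump f) (a : Fin n) (s : ℝ) :
    Continuous (gradFiber E F k₀ a f s) := by
  have h1 := continuous_modeFiber (E := E) (F := F) (k₀ := k₀) hf s
  have h2 := fun i => continuous_modeFiber (E := E) (F := F) (k₀ := k₀) (hf.mul_coord i) s
  unfold gradFiber
  fun_prop

theorem continuous_hessFiber (hf : IsBump f) (a : Fin n) (s : ℝ) :
    Continuous (hessFiber E F k₀ a f s) := by
  have h1 := continuous_modeFiber (E := E) (F := F) (k₀ := k₀) hf s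
  have h2 := continuous_gradFiber (E := E) (F := F) (k₀ := k₀) hf a s
  have h3 := fun i => continuous_gradFiber (E := E) (F := F) (k₀ := k₀) (hf.mul_coord i) a s
  have h4 : Continuous fun x : Fin n → ℝ => ((k₀ * ∑ b, shear E s a b * x b : ℝ) : ℂ) := by
    fun_prop
  exact continuous_const.mul (((continuous_finsetSum _ fun i _ =>
    continuous_const.mul (h3 i)).add (h4.mul h2)).add (continuous_const.mul h1))

theorem continuous_timeFiber (hf : IsBump f) (s : ℝ) : Continuous (timeFiber H E F k₀ f s) := by
  have h1 := continuous_modeFiber (E := E) (F := F) (k₀ := k₀) hf s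
  have h2 := fun a => continuous_hessFiber (E := E) (F := F) (k₀ := k₀) hf a s
  have h3 : Continuous fun x : Fin n → ℝ => H s *ᵥ x :=
    Continuous.matrix_mulVec continuous_const continuous_id
  exact (continuous_const.mul (continuous_finsetSum _ fun a _ => h2 a)).add
    (continuous_const.mul (continuous_finsetSum _ fun a _ =>
      (Complex.continuous_ofReal.comp (continuous_apply a)).mul
      ((Complex.continuous_ofReal.comp ((continuous_apply a).comp h3)).mul h1)))

theorem Decays.const_mul {Ψ : ℝ → (Fin n → ℝ) → ℂ} (h : Decays K Ψ) {c : ℝ → ℝ} {B : ℝ}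
    (hc : ∀ s ∈ K, |c s| ≤ B) : Decays K fun s x => (c s : ℂ) * Ψ s x :=
  h.mul_left (c := fun s _ => (c s : ℂ)) (B := |B|) fun s hs x => by
    rw [Complex.norm_real, Real.norm_eq_abs]
    have := norm_nonneg x
    nlinarith [hc s hs, le_abs_self B, abs_nonneg B]

theorem Decays.smul {Ψ : ℝ → (Fin n → ℝ) → ℂ} (h : Decays K Ψ) (c : ℂ) :
    Decays K fun s x => c * Ψ s x :=
  h.mul_left (c := fun _ _ => c) (B := ‖c‖) fun s _ x => by
    nlinarith [norm_nonneg x, norm_nonneg c]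

theorem Decays.mul_mulVec {Ψ : ℝ → (Fin n → ℝ) → ℂ} (h : Decays K Ψ)
    {M : ℝ → Matrix (Fin n) (Fin n) ℝ} {B : ℝ} (hM : ∀ s ∈ K, ∀ i j, |M s i j| ≤ B) (a : Fin n) :
    Decays K fun s x => (((M s *ᵥ x) a : ℝ) : ℂ) * Ψ s x :=
  h.mul_left (c := fun s x => (((M s *ᵥ x) a : ℝ) : ℂ)) (B := n * |B|) fun s hs x => by
    rw [Complex.norm_real]
    refine (norm_le_pi_norm _ a).trans ((norm_mulVec_le (hM s hs) x).trans ?_)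
    gcongr
    linarith

theorem exists_bound_inv_shear (hE : IsVielbein H E) (hK : IsCompact K)
    (hreg : ∀ s ∈ K, Regular E s) :
    ∃ B, ∀ s ∈ K, ∀ i j, |(E s)⁻¹ i j| ≤ B ∧ |shear E s i j| ≤ B := by
  obtain ⟨B₁, h₁⟩ := exists_entries_bound hK (M := fun s => (E s)⁻¹) fun i j s hs =>
    (hE.hasDerivAt_inv (hreg s hs) i j).continuousAt.continuousWithinAt
  obtain ⟨B₂, h₂⟩ := exists_entries_bound hK (M := shear E) fun i j s hs =>
    (hE.hasDerivAt_shear (hreg s hs) i j).continuousAt.continuousWithinAt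
  exact ⟨max B₁ B₂, fun s hs i j => ⟨(h₁ s hs i j).trans (le_max_left _ _),
    (h₂ s hs i j).trans (le_max_right _ _)⟩⟩

theorem decays_linear {Ψ : Fin n → ℝ → (Fin n → ℝ) → ℂ} {Ψ₀ : ℝ → (Fin n → ℝ) → ℂ}
    (hE : IsVielbein H E) (hK : IsCompact K) (hreg : ∀ s ∈ K, Regular E s)
    (h : ∀ i, Decays K (Ψ i)) (h₀ : Decays K Ψ₀) (k₀ : ℝ) (a : Fin n) :
    Decays K fun s x => (∑ i, ((E s)⁻¹ i a : ℂ) * Ψ i s x)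
      + ((k₀ * ∑ b, shear E s a b * x b : ℝ) : ℂ) * Ψ₀ s x := by
  obtain ⟨B, hB⟩ := exists_bound_inv_shear hE hK hreg
  refine (Decays.sum fun i _ => (h i).const_mul fun s hs => (hB s hs i a).1).add ?_
  have h2 := (h₀.mul_mulVec (M := shear E) (fun s hs i j => (hB s hs i j).2) a).smul (k₀ : ℂ)
  convert h2 using 3 with s x
  rw [← mul_assoc]
  congr 1
  push_cast [Matrix.mulVec, dotProduct]
  rfl

theorem decays_gradFiber (hE : IsVielbein H E) (hF : IsRosenIntegral E F R) (hK : IsCompact K)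
    (hreg : ∀ s ∈ K, Regular E s) (hf : IsBump f) (a : Fin n) :
    Decays K (gradFiber E F k₀ a f) :=
  (decays_linear hE hK hreg (fun i => decays_modeFiber hE hF hK hreg (hf.mul_coord i))
    (decays_modeFiber hE hF hK hreg hf) k₀ a).smul Complex.I

theorem decays_hessFiber (hE : IsVielbein H E) (hF : IsRosenIntegral E F R) (hK : IsCompact K)
    (hreg : ∀ s ∈ K, Regular E s) (hf : IsBump f) (a : Fin n) :
    Decays K (hessFiber E F k₀ a f) := by
  obtain ⟨B, hB⟩ := exists_bound_inv_shear hE hK hreg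
  refine ((decays_linear hE hK hreg (fun i => decays_gradFiber hE hF hK hreg (hf.mul_coord i) a)
    (decays_gradFiber hE hF hK hreg hf a) k₀ a).add
    ((decays_modeFiber hE hF hK hreg hf).const_mul (c := fun s => k₀ * shear E s a a)
      (B := |k₀| * B) fun s hs => ?_)).smul Complex.I
  rw [abs_mul]
  exact mul_le_mul_of_nonneg_left (hB s hs a a).2 (abs_nonneg _)

theorem decays_timeFiber (hE : IsVielbein H E) (hF : IsRosenIntegral E F R)
    (hH : ∀ a b, Continuous fun s => H s a b) (hK : IsCompact K)
    (hreg : ∀ s ∈ K, Regular E s) (hf : IsBump f) : Decays K (timeFiber H E F k₀ f) := by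
  obtain ⟨B, hB⟩ := exists_entries_bound hK (M := H) fun i j => (hH i j).continuousOn
  refine ((Decays.sum fun a _ => decays_hessFiber hE hF hK hreg hf a).smul _).add
    ((Decays.sum fun a _ => ((decays_modeFiber hE hF hK hreg hf).mul_mulVec hB a).mul_left
      (c := fun _ x => (x a : ℂ)) (B := 1) fun s _ x => ?_).smul _)
  rw [Complex.norm_real]
  linarith [norm_le_pi_norm x a]

end Schrodinger

section Conservation

variable {H E₁ F₁ E₂ F₂ : ℝ → Matrix (Fin n) (Fin n) ℝ} {R₁ R₂ : Set ℝ} {k₀ : ℝ} {f g : Mom n → ℂ}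

/-- Integration by parts in a transverse direction. -/
theorem integral_mul_conj_lineDeriv {A A' B B' : (Fin n → ℝ) → ℂ} {v : Fin n → ℝ}
    (hA : ∀ x, HasLineDerivAt ℝ A (A' x) x v) (hB : ∀ x, HasLineDerivAt ℝ B (B' x) x v)
    (h1 : Integrable fun x => A' x * conj (B x)) (h2 : Integrable fun x => A x * conj (B' x))
    (h3 : Integrable fun x => A x * conj (B x)) :
    ∫ x, A x * conj (B' x) = -∫ x, A' x * conj (B x) :=
  integral_bilinear_hasLineDerivAt_right_eq_neg_left_of_integrable
    (B := ContinuousLinearMap.mul ℝ ℂ) (g := fun x => conj (B x)) (g' := fun x => conj (B' x))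
    h1 h2 h3 (fun x _ => hA x) fun x _ => HasDerivAt.star (hB x)

/-- Green's identity for the flat Laplacian. -/
theorem integral_hessFiber_mul_conj (hE₁ : IsVielbein H E₁) (hF₁ : IsRosenIntegral E₁ F₁ R₁)
    (hE₂ : IsVielbein H E₂) (hF₂ : IsRosenIntegral E₂ F₂ R₂) (hk : k₀ ≠ 0) (hf : IsBump f)
    (hg : IsBump g) {s : ℝ} (h₁ : Regular E₁ s) (h₂ : Regular E₂ s) (a : Fin n) :
    ∫ x, hessFiber E₁ F₁ k₀ a f s x * conj (modeFiber E₂ F₂ k₀ g s x)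
      = ∫ x, modeFiber E₁ F₁ k₀ f s x * conj (hessFiber E₂ F₂ k₀ a g s x) := by
  have hK : IsCompact ({s} : Set ℝ) := isCompact_singleton
  have r₁ : ∀ t ∈ ({s} : Set ℝ), Regular E₁ t := fun t ht => by rwa [Set.mem_singleton_iff.1 ht]
  have r₂ : ∀ t ∈ ({s} : Set ℝ), Regular E₂ t := fun t ht => by rwa [Set.mem_singleton_iff.1 ht]
  have dm₁ := decays_modeFiber (k₀ := k₀) hE₁ hF₁ hK r₁ hf
  have dg₁ := decays_gradFiber (k₀ := k₀) hE₁ hF₁ hK r₁ hf a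
  have dh₁ := decays_hessFiber (k₀ := k₀) hE₁ hF₁ hK r₁ hf a
  have dm₂ := decays_modeFiber (k₀ := k₀) hE₂ hF₂ hK r₂ hg
  have dg₂ := decays_gradFiber (k₀ := k₀) hE₂ hF₂ hK r₂ hg a
  have dh₂ := decays_hessFiber (k₀ := k₀) hE₂ hF₂ hK r₂ hg a
  have cm₁ := continuous_modeFiber (E := E₁) (F := F₁) (k₀ := k₀) hf s
  have cg₁ := continuous_gradFiber (E := E₁) (F := F₁) (k₀ := k₀) hf a s
  have ch₁ := continuous_hessFiber (E := E₁) (F := F₁) (k₀ := k₀) hf a s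
  have cm₂ := Complex.continuous_conj.comp
    (continuous_modeFiber (E := E₂) (F := F₂) (k₀ := k₀) hg s)
  have cg₂ := Complex.continuous_conj.comp
    (continuous_gradFiber (E := E₂) (F := F₂) (k₀ := k₀) hg a s)
  have ch₂ := Complex.continuous_conj.comp
    (continuous_hessFiber (E := E₂) (F := F₂) (k₀ := k₀) hg a s)
  have hs := Set.mem_singleton s
  have e1 := integral_mul_conj_lineDeriv
    (hasLineDerivAt_gradFiber (F := F₁) hE₁ hk h₁ hf a)
    (hasLineDerivAt_modeFiber (F := F₂) hE₂ hk h₂ hg a)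
    ((dh₁.mul_conj dm₂).integrable hs (ch₁.mul cm₂))
      ((dg₁.mul_conj dg₂).integrable hs (cg₁.mul cg₂))
    ((dg₁.mul_conj dm₂).integrable hs (cg₁.mul cm₂))
  have e2 := integral_mul_conj_lineDeriv
    (hasLineDerivAt_modeFiber (F := F₁) hE₁ hk h₁ hf a)
    (hasLineDerivAt_gradFiber (F := F₂) hE₂ hk h₂ hg a)
    ((dg₁.mul_conj dg₂).integrable hs (cg₁.mul cg₂))
      ((dm₁.mul_conj dh₂).integrable hs (cm₁.mul ch₂))
    ((dm₁.mul_conj dg₂).integrable hs (cm₁.mul cg₂))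
  rw [e2, e1, neg_neg]

/-- The Schrödinger flow at fixed frequency is unitary: the contributions of the potential cancel,
and those of the Laplacian cancel by Green's identity. -/
theorem integral_timeFiber_eq_zero (hE₁ : IsVielbein H E₁) (hF₁ : IsRosenIntegral E₁ F₁ R₁)
    (hE₂ : IsVielbein H E₂) (hF₂ : IsRosenIntegral E₂ F₂ R₂) (hk : k₀ ≠ 0) (hf : IsBump f)
    (hg : IsBump g) {s : ℝ} (h₁ : Regular E₁ s) (h₂ : Regular E₂ s) :
    ∫ x, (timeFiber H E₁ F₁ k₀ f s x * conj (modeFiber E₂ F₂ k₀ g s x)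
      + modeFiber E₁ F₁ k₀ f s x * conj (timeFiber H E₂ F₂ k₀ g s x)) = 0 := by
  have hK : IsCompact ({s} : Set ℝ) := isCompact_singleton
  have r₁ : ∀ t ∈ ({s} : Set ℝ), Regular E₁ t := fun t ht => by rwa [Set.mem_singleton_iff.1 ht]
  have r₂ : ∀ t ∈ ({s} : Set ℝ), Regular E₂ t := fun t ht => by rwa [Set.mem_singleton_iff.1 ht]
  have hs := Set.mem_singleton s
  have i1 : ∀ a, Integrable fun x =>
      hessFiber E₁ F₁ k₀ a f s x * conj (modeFiber E₂ F₂ k₀ g s x) := fun a =>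
    ((decays_hessFiber hE₁ hF₁ hK r₁ hf a).mul_conj (decays_modeFiber hE₂ hF₂ hK r₂ hg)).integrable
      hs
      ((continuous_hessFiber hf a s).mul (Complex.continuous_conj.comp (continuous_modeFiber hg s)))
  have i2 : ∀ a, Integrable fun x =>
      modeFiber E₁ F₁ k₀ f s x * conj (hessFiber E₂ F₂ k₀ a g s x) := fun a =>
    ((decays_modeFiber hE₁ hF₁ hK r₁ hf).mul_conj (decays_hessFiber hE₂ hF₂ hK r₂ hg a)).integrable
      hs
      ((continuous_modeFiber hf s).mul (Complex.continuous_conj.comp (continuous_hessFiber hg a s)))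
  have e : ∀ x, timeFiber H E₁ F₁ k₀ f s x * conj (modeFiber E₂ F₂ k₀ g s x)
      + modeFiber E₁ F₁ k₀ f s x * conj (timeFiber H E₂ F₂ k₀ g s x)
      = (-(Complex.I / (2 * k₀))) *
        ∑ a, (hessFiber E₁ F₁ k₀ a f s x * conj (modeFiber E₂ F₂ k₀ g s x)
          - modeFiber E₁ F₁ k₀ f s x * conj (hessFiber E₂ F₂ k₀ a g s x)) := by
    intro x
    simp only [timeFiber, map_add, map_mul, map_neg, map_div₀, map_sum, Complex.conj_I,
      Complex.conj_ofReal, map_ofNat, Finset.sum_sub_distrib, ← Finset.sum_mul, ← Finset.mul_sum,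
      ← mul_assoc]
    ring
  have e' : ∀ a, Integrable fun x => hessFiber E₁ F₁ k₀ a f s x * conj (modeFiber E₂ F₂ k₀ g s x)
      - modeFiber E₁ F₁ k₀ f s x * conj (hessFiber E₂ F₂ k₀ a g s x) := fun a => (i1 a).sub (i2 a)
  simp only [e]
  rw [integral_const_mul, integral_finsetSum _ fun a _ => e' a,
    Finset.sum_eq_zero fun a _ => ?_, mul_zero]
  rw [integral_sub (i1 a) (i2 a), integral_hessFiber_mul_conj hE₁ hF₁ hE₂ hF₂ hk hf hg h₁ h₂,
    sub_self]

/-- Differentiation under the integral, dominated by the rapid decay on a compact neighbourhood of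
regular slices. -/
theorem hasDerivAt_integral_modeFiber (hE₁ : IsVielbein H E₁) (hF₁ : IsRosenIntegral E₁ F₁ R₁)
    (hE₂ : IsVielbein H E₂) (hF₂ : IsRosenIntegral E₂ F₂ R₂)
      (hH : ∀ a b, Continuous fun s => H s a b)
    (hk : k₀ ≠ 0) (hf : IsBump f) (hg : IsBump g) {s : ℝ} (h₁ : Regular E₁ s) (h₂ : Regular E₂ s) :
    HasDerivAt (fun s => ∫ x, modeFiber E₁ F₁ k₀ f s x * conj (modeFiber E₂ F₂ k₀ g s x)) 0 s := by
  obtain ⟨ε, hε, hεU⟩ := Metric.nhds_basis_closedBall.mem_iff.1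
    ((hE₁.eventually_regular h₁).and (hE₂.eventually_regular h₂))
  have hK : IsCompact (Metric.closedBall s ε) := isCompact_closedBall s ε
  have r₁ : ∀ t ∈ Metric.closedBall s ε, Regular E₁ t := fun t ht => (hεU ht).1
  have r₂ : ∀ t ∈ Metric.closedBall s ε, Regular E₂ t := fun t ht => (hεU ht).2
  have hs := Metric.mem_closedBall_self (x := s) hε.le
  have dm₁ := decays_modeFiber (k₀ := k₀) hE₁ hF₁ hK r₁ hf
  have dt₁ := decays_timeFiber (k₀ := k₀) hE₁ hF₁ hH hK r₁ hf
  have dm₂ := decays_modeFiber (k₀ := k₀) hE₂ hF₂ hK r₂ hg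
  have dt₂ := decays_timeFiber (k₀ := k₀) hE₂ hF₂ hH hK r₂ hg
  have cm₁ := fun t => continuous_modeFiber (E := E₁) (F := F₁) (k₀ := k₀) hf t
  have cm₂ := fun t => Complex.continuous_conj.comp
    (continuous_modeFiber (E := E₂) (F := F₂) (k₀ := k₀) hg t)
  have ct₁ := continuous_timeFiber (H := H) (E := E₁) (F := F₁) (k₀ := k₀) hf s
  have ct₂ := Complex.continuous_conj.comp
    (continuous_timeFiber (H := H) (E := E₂) (F := F₂) (k₀ := k₀) hg s)
  obtain ⟨C, hC⟩ := ((dt₁.mul_conj dm₂).add (dm₁.mul_conj dt₂)).exists_le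
  have h := (hasDerivAt_integral_of_dominated_loc_of_deriv_le (μ := volume)
    (F := fun s x => modeFiber E₁ F₁ k₀ f s x * conj (modeFiber E₂ F₂ k₀ g s x))
    (F' := fun s x => timeFiber H E₁ F₁ k₀ f s x * conj (modeFiber E₂ F₂ k₀ g s x)
      + modeFiber E₁ F₁ k₀ f s x * conj (timeFiber H E₂ F₂ k₀ g s x))
    (Metric.closedBall_mem_nhds s hε)
    (Filter.Eventually.of_forall fun t => ((cm₁ t).mul (cm₂ t)).aestronglyMeasurable)
    ((dm₁.mul_conj dm₂).integrable hs ((cm₁ s).mul (cm₂ s)))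
    ((ct₁.mul (cm₂ s)).add ((cm₁ s).mul ct₂)).aestronglyMeasurable
    (ae_of_all _ fun x t ht => hC t ht x) (integrable_decayWeight.const_mul C)
    (ae_of_all _ fun x t ht => (hasDerivAt_modeFiber_u hE₁ hF₁ hH hk (r₁ t ht) hf x).mul
      (HasDerivAt.star (hasDerivAt_modeFiber_u hE₂ hF₂ hH hk (r₂ t ht) hg x)))).2
  rwa [integral_timeFiber_eq_zero hE₁ hF₁ hE₂ hF₂ hk hf hg h₁ h₂] at h

/-- Conservation of overlaps at fixed frequency on intervals of regular slices. -/
theorem integral_modeFiber_conserved (hE₁ : IsVielbein H E₁) (hF₁ : IsRosenIntegral E₁ F₁ R₁)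
    (hE₂ : IsVielbein H E₂) (hF₂ : IsRosenIntegral E₂ F₂ R₂)
      (hH : ∀ a b, Continuous fun s => H s a b)
    (hk : k₀ ≠ 0) (hf : IsBump f) (hg : IsBump g) {u u' : ℝ}
    (h : ∀ s ∈ Set.uIcc u u', Regular E₁ s ∧ Regular E₂ s) :
    ∫ x, modeFiber E₁ F₁ k₀ f u x * conj (modeFiber E₂ F₂ k₀ g u x)
      = ∫ x, modeFiber E₁ F₁ k₀ f u' x * conj (modeFiber E₂ F₂ k₀ g u' x) := by
  have h1 := (convex_uIcc u u').norm_image_sub_le_of_norm_hasDerivWithin_le (C := 0)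
    (fun s hs => (hasDerivAt_integral_modeFiber hE₁ hF₁ hE₂ hF₂ hH hk hf hg (h s hs).1
      (h s hs).2).hasDerivWithinAt) (fun s _ => by simp) Set.right_mem_uIcc Set.left_mem_uIcc
  rw [zero_mul] at h1
  exact sub_eq_zero.1 (norm_le_zero_iff.1 h1)

end Conservation

/-! ### Slice relations on the gravitational background -/

section Relations

variable {H E₁ F₁ E₂ F₂ : ℝ → Matrix (Fin n) (Fin n) ℝ} {R₁ R₂ : Set ℝ} {f g : Mom n → ℂ}

theorem Regular.det_inv_ne_zero {E : ℝ → Matrix (Fin n) (Fin n) ℝ} {u : ℝ} (h : Regular E u) :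
    ((E u)⁻¹).det ≠ 0 := by
  rw [Matrix.det_nonsing_inv, Ring.inverse_eq_inv']
  exact inv_ne_zero h

theorem IsTest.phased_quad (hf : IsTest f) (M : Matrix (Fin n) (Fin n) ℝ) :
    IsTest (PlaneWave.phased (quad M) f) := hf.phased (contDiff_quad M)

theorem integrable_scalarIP (hf : IsTest f) (hg : IsTest g) {u : ℝ} (h₁ : Regular E₁ u)
    (h₂ : Regular E₂ u) : Integrable (scalarIP E₁ F₁ E₂ F₂ f g u) :=
  integrable_scalarDensity (isSlicePacket_scalarMode E₁ F₁ f u) (isSlicePacket_scalarMode E₂ F₂ g u)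
    (hf.phased_quad _).isBump (hg.phased_quad _).isBump h₁.det_inv_ne_zero h₂.det_inv_ne_zero

theorem integral_scalarIP_self (hf : IsTest f) (hg : IsTest g) {u : ℝ} (h₁ : Regular E₁ u) :
    ∫ p, scalarIP E₁ F₁ E₁ F₁ f g u p = deltaPairing f g := by
  rw [show (∫ p, scalarIP E₁ F₁ E₁ F₁ f g u p) = _ from integral_scalarDensity_same
    (isSlicePacket_scalarMode E₁ F₁ f u) (isSlicePacket_scalarMode E₁ F₁ g u)
    (hf.phased_quad _).isBump (hg.phased_quad _).isBump h₁.det_inv_ne_zero, deltaPairing]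
  congr 1
  refine integral_congr_ae (ae_of_all _ fun k => ?_)
  simp only [phased, map_mul, ← Complex.exp_conj, Complex.conj_I, Complex.conj_ofReal]
  have e : ∀ θ : ℂ, Complex.exp (Complex.I * θ) * Complex.exp (-Complex.I * θ) = 1 := fun θ => by
    rw [← Complex.exp_add]; simp
  linear_combination (2 * (k.1 : ℂ) * f k * conj (g k)) * e ((quad (F₁ u) k.2 / (2 * k.1) : ℝ) : ℂ)

theorem integral_scalarIP_fiber (hf : IsTest f) (hg : IsTest g) {u : ℝ} (h₁ : Regular E₁ u)
    (h₂ : Regular E₂ u) : ∫ p, scalarIP E₁ F₁ E₂ F₂ f g u p = 2 * Real.pi * ∫ k₀ : ℝ, 2 * (k₀ : ℂ) *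
      ∫ x, modeFiber E₁ F₁ k₀ f u x * conj (modeFiber E₂ F₂ k₀ g u x) := by
  simp only [modeFiber_eq, ← sliceFiber_phased]
  exact integral_scalarDensity_fiber (isSlicePacket_scalarMode E₁ F₁ f u)
    (isSlicePacket_scalarMode E₂ F₂ g u) (hf.phased_quad _).isBump (hg.phased_quad _).isBump
    h₁.det_inv_ne_zero h₂.det_inv_ne_zero

/-- Normalisation is Plancherel's theorem on a slice, the absence of particle creation is the
disjointness of frequencies, and conservation holds at each frequency separately. -/
theorem scalarRelations (hE₁ : IsVielbein H E₁) (hF₁ : IsRosenIntegral E₁ F₁ R₁)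
    (hE₂ : IsVielbein H E₂) (hF₂ : IsRosenIntegral E₂ F₂ R₂)
    (hH : ∀ a b, Continuous fun s => H s a b) :
    SliceRelations 1 (Regular E₂) (Regular E₁) (scalarIP E₂ F₂ E₂ F₂) (scalarIP E₁ F₁ E₁ F₁)
      (scalarIP E₁ F₁ E₂ F₂) (scalarBarIP E₁ F₁ E₂ F₂) := by
  refine ⟨fun f g hf hg u hu => ⟨integrable_scalarIP hf hg hu hu, ?_⟩,
    fun f g hf hg u hu => ⟨integrable_scalarIP hf hg hu hu, ?_⟩,
    fun f g hf hg u hu hu' => ⟨?_, ?_⟩,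
    fun f g hf hg u hu hu' => integrable_scalarIP hf hg hu' hu,
    fun f g hf hg u u' h => ?_⟩
  · rw [integral_scalarIP_self hf hg hu, one_mul]
  · rw [integral_scalarIP_self hf hg hu, one_mul]
  · exact integrable_scalarDensity (isSlicePacket_scalarMode E₁ F₁ f u)
      (isSlicePacket_scalarMode E₂ F₂ g u).conj0
      (hf.phased_quad _).isBump (hg.phased_quad _).isBump.conj_neg hu'.det_inv_ne_zero
      hu.det_inv_ne_zero
  · exact integral_scalarDensity_eq_zero (isSlicePacket_scalarMode E₁ F₁ f u)
      (isSlicePacket_scalarMode E₂ F₂ g u).conj0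
      (hf.phased_quad _).isBump (hg.phased_quad _).isBump.conj_neg hu'.det_inv_ne_zero
      hu.det_inv_ne_zero (tests_apart (hf.phased_quad _) (hg.phased_quad _))
  · have h0 := h u Set.left_mem_uIcc
    have h0' := h u' Set.right_mem_uIcc
    rw [integral_scalarIP_fiber hf hg h0.2 h0.1, integral_scalarIP_fiber hf hg h0'.2 h0'.1]
    congr 1
    refine integral_congr_ae (ae_of_all _ fun k₀ => ?_)
    rcases eq_or_ne k₀ 0 with rfl | hk
    · simp
    · beta_reduce
      rw [integral_modeFiber_conserved hE₁ hF₁ hE₂ hF₂ hH hk hf.isBump hg.isBump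
        fun s hs => ⟨(h s hs).2, (h s hs).1⟩]

end Relations

/-! ### Oscillatory Gaussian integrals -/

section Fresnel

variable {σ U : Matrix (Fin n) (Fin n) ℝ} {d : Fin n → ℝ}

theorem exists_orthogonal_diagonal (h : σᵀ = σ) : ∃ (U : Matrix (Fin n) (Fin n) ℝ) (d : Fin n → ℝ),
    Uᵀ * U = 1 ∧ U * Uᵀ = 1 ∧ σ = U * Matrix.diagonal d * Uᵀ := by
  have hσ : σ.IsHermitian := by rwa
    [Matrix.IsHermitian, Matrix.conjTranspose_eq_transpose_of_trivial]
  refine ⟨hσ.eigenvectorUnitary, hσ.eigenvalues, ?_, ?_, ?_⟩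
  · have := Unitary.coe_star_mul_self hσ.eigenvectorUnitary
    rwa [Matrix.star_eq_conjTranspose, Matrix.conjTranspose_eq_transpose_of_trivial] at this
  · have := Unitary.coe_mul_star_self hσ.eigenvectorUnitary
    rwa [Unitary.coe_star, Matrix.star_eq_conjTranspose,
      Matrix.conjTranspose_eq_transpose_of_trivial] at this
  · have := hσ.spectral_theorem
    rwa [Unitary.conjStarAlgAut_apply, Matrix.star_eq_conjTranspose,
      Matrix.conjTranspose_eq_transpose_of_trivial] at this

theorem quad_eq_dotProduct (M : Matrix (Fin n) (Fin n) ℝ) (x : Fin n → ℝ) :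
    quad M x = x ⬝ᵥ (M *ᵥ x) := quad_eq_sum_mulVec M x

theorem quad_conj (U M : Matrix (Fin n) (Fin n) ℝ) (x : Fin n → ℝ) :
    quad (U * M * Uᵀ) x = quad M (Uᵀ *ᵥ x) := by
  rw [quad_eq_dotProduct, quad_eq_dotProduct, ← Matrix.mulVec_mulVec, ← Matrix.mulVec_mulVec,
    Matrix.dotProduct_mulVec, ← Matrix.mulVec_transpose]

theorem quad_diagonal (d x : Fin n → ℝ) : quad (Matrix.diagonal d) x = ∑ i, d i * x i ^ 2 := by
  rw [quad_eq_sum_mulVec]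
  refine Finset.sum_congr rfl fun i _ => ?_
  rw [Matrix.mulVec_diagonal]; ring

theorem det_diagonalized (hU : Uᵀ * U = 1) :
    (U * Matrix.diagonal d * Uᵀ).det = ∏ i, d i := by
  have h := congrArg Matrix.det hU
  rw [Matrix.det_mul, Matrix.det_one] at h
  rw [Matrix.det_mul, Matrix.det_mul, Matrix.det_diagonal]
  linear_combination (∏ i, d i) * h

theorem inv_diagonalized (hU : Uᵀ * U = 1) (hU' : U * Uᵀ = 1) (hd : ∀ i, d i ≠ 0) :
    (U * Matrix.diagonal d * Uᵀ)⁻¹ = U * Matrix.diagonal (fun i => (d i)⁻¹) * Uᵀ := by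
  refine Matrix.inv_eq_right_inv ?_
  calc _ = U * Matrix.diagonal d * (Uᵀ * U) * Matrix.diagonal (fun i => (d i)⁻¹) * Uᵀ := by
        simp only [Matrix.mul_assoc]
    _ = U * (Matrix.diagonal d * Matrix.diagonal (fun i => (d i)⁻¹)) * Uᵀ := by
        rw [hU, Matrix.mul_one, Matrix.mul_assoc U]
    _ = 1 := by
        rw [Matrix.diagonal_mul_diagonal]
        simp only [mul_inv_cancel₀ (hd _), Matrix.diagonal_one, Matrix.mul_one, hU']

theorem integral_comp_orthogonal (hU : Uᵀ * U = 1) {g : (Fin n → ℝ) → ℂ} (hg : Continuous g) :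
    ∫ x, g x = ∫ y, g (U *ᵥ y) := by
  have h := congrArg Matrix.det hU
  rw [Matrix.det_mul, Matrix.det_one, Matrix.det_transpose] at h
  have h0 : U.det ≠ 0 := fun h0 => by simp [h0] at h
  have h1 : |U.det| = 1 := by
    have : |U.det| * |U.det| = 1 := by rw [abs_mul_abs_self, h]
    nlinarith [abs_nonneg U.det]
  have h2 := Real.map_matrix_volume_pi_eq_smul_volume_pi h0
  rw [abs_inv, h1, inv_one, ENNReal.ofReal_one, one_smul] at h2
  conv_lhs => rw [← h2]
  rw [integral_map (LinearMap.continuous_of_finiteDimensional _).aemeasurable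
    hg.aestronglyMeasurable]
  rfl

/-- The Fourier transform of `exp (-(i k / 2) d y²)`, regularised by `exp (-δ y²)`. -/
def fresnelFactor (k δ d q : ℝ) : ℂ :=
  (Real.pi / ((δ : ℂ) + Complex.I * (k * d / 2 : ℝ))) ^ (1 / 2 : ℂ) *
    Complex.exp ((Complex.I * q) ^ 2 / (4 * ((δ : ℂ) + Complex.I * (k * d / 2 : ℝ))))

theorem sum_sq_mulVec (hU : Uᵀ * U = 1) (y : Fin n → ℝ) :
    ∑ i, (U *ᵥ y) i ^ 2 = ∑ i, y i ^ 2 := by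
  have h : ∀ z : Fin n → ℝ, ∑ i, z i ^ 2 = z ⬝ᵥ z := fun z =>
    Finset.sum_congr rfl fun i _ => sq (z i)
  rw [h, h, Matrix.dotProduct_mulVec, ← Matrix.mulVec_transpose, Matrix.mulVec_mulVec, hU,
    Matrix.one_mulVec]

/-- With a Gaussian regulator the integral factorises in an orthogonal eigenbasis of the quadratic
form. -/
theorem integral_regularised (hU : Uᵀ * U = 1) {δ : ℝ} (hδ : 0 < δ) (k : ℝ)
    (p : Fin n → ℝ) :
    ∫ x : Fin n → ℝ, Complex.exp (Complex.I * ((∑ a, p a * x a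
        - k / 2 * quad (U * Matrix.diagonal d * Uᵀ) x : ℝ) : ℂ)) *
        Complex.exp ((-δ * ∑ a, x a ^ 2 : ℝ) : ℂ)
      = ∏ i, fresnelFactor k δ (d i) ((Uᵀ *ᵥ p) i) := by
  have hq := continuous_quad (U * Matrix.diagonal d * Uᵀ)
  rw [integral_comp_orthogonal hU (by fun_prop)]
  have e : ∀ y : Fin n → ℝ, Complex.exp (Complex.I * ((∑ a, p a * (U *ᵥ y) a
        - k / 2 * quad (U * Matrix.diagonal d * Uᵀ) (U *ᵥ y) : ℝ) : ℂ)) *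
        Complex.exp ((-δ * ∑ a, (U *ᵥ y) a ^ 2 : ℝ) : ℂ)
      = Complex.exp (-∑ i, ((δ : ℂ) + Complex.I * (k * d i / 2 : ℝ)) * (y i : ℂ) ^ 2
        + ∑ i, (Complex.I * ((Uᵀ *ᵥ p) i : ℝ)) * y i) := by
    intro y
    have h1 : ∑ a, p a * (U *ᵥ y) a = ∑ i, (Uᵀ *ᵥ p) i * y i := by
      change p ⬝ᵥ (U *ᵥ y) = (Uᵀ *ᵥ p) ⬝ᵥ y
      rw [Matrix.dotProduct_mulVec, ← Matrix.mulVec_transpose]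
    rw [← Complex.exp_add, h1, sum_sq_mulVec hU, quad_conj, Matrix.mulVec_mulVec, hU,
      Matrix.one_mulVec, quad_diagonal]
    congr 1
    push_cast
    simp only [add_mul, Finset.sum_add_distrib, mul_sub, Finset.mul_sum, neg_mul,
      Finset.sum_neg_distrib]
    have h2 : ∀ i, Complex.I * (k * d i / 2) * (y i : ℂ) ^ 2
        = Complex.I * (k / 2 * (d i * (y i : ℂ) ^ 2)) := fun i => by ring
    simp only [h2, mul_assoc]
    ring
  simp only [e]
  rw [GaussianFourier.integral_cexp_neg_sum_mul_add (fun i => by simpa using hδ)]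
  rfl

theorem denom_ne_zero {δ c : ℝ} (hc : c ≠ 0) : (δ : ℂ) + Complex.I * (c : ℝ) ≠ 0 := fun h => by
  have := congrArg Complex.im h
  simp at this
  exact hc this

/-- A bound uniform in the regulator, which dominates the limit `δ → 0`. -/
theorem norm_fresnelFactor_le {k δ d : ℝ} (hk : 0 < k) (hδ : 0 < δ) (hd : d ≠ 0) (q : ℝ) :
    ‖fresnelFactor k δ d q‖ ≤ (Real.pi / (k * |d| / 2)) ^ (1 / 2 : ℝ) := by
  have hc : k * d / 2 ≠ 0 := by positivity
  have h1 : k * |d| / 2 ≤ ‖(δ : ℂ) + Complex.I * (k * d / 2 : ℝ)‖ := by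
    refine le_trans (le_of_eq ?_) (Complex.abs_im_le_norm _)
    simp [abs_mul, abs_div, abs_of_pos hk]
  have h2 : ‖Complex.exp ((Complex.I * q) ^ 2 / (4 * ((δ : ℂ) + Complex.I * (k * d / 2 : ℝ))))‖
      ≤ 1 := by
    rw [Complex.norm_exp, Real.exp_le_one_iff]
    have e : (Complex.I * q) ^ 2 / (4 * ((δ : ℂ) + Complex.I * (k * d / 2 : ℝ)))
        = ((-(q ^ 2 / 4) : ℝ) : ℂ) * ((δ : ℂ) + Complex.I * (k * d / 2 : ℝ))⁻¹ := by
      rw [mul_pow, Complex.I_sq]; push_cast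
      rw [div_eq_mul_inv, mul_inv]; ring
    rw [e, Complex.re_ofReal_mul, Complex.inv_re]
    have : ((δ : ℂ) + Complex.I * (k * d / 2 : ℝ)).re = δ := by simp
    rw [this]
    have h3 := Complex.normSq_nonneg ((δ : ℂ) + Complex.I * (k * d / 2 : ℝ))
    rw [neg_mul]
    exact neg_nonpos.2 (by positivity)
  have h3 : ((1 / 2 : ℂ)) = ((1 / 2 : ℝ) : ℂ) := by push_cast; rfl
  rw [fresnelFactor, norm_mul, h3, Complex.norm_cpow_real, norm_div, Complex.norm_real,
    Real.norm_of_nonneg Real.pi_pos.le]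
  have hk' : 0 < k * |d| / 2 := by positivity
  calc _ ≤ (Real.pi / ‖(δ : ℂ) + Complex.I * (k * d / 2 : ℝ)‖) ^ (1 / 2 : ℝ) * 1 := by gcongr
    _ ≤ _ := by
      rw [mul_one]
      exact Real.rpow_le_rpow (by positivity)
        (div_le_div_of_nonneg_left Real.pi_pos.le hk' h1) (by norm_num)

/-- The principal branch of the square root is continuous here, as `π / (δ + i k d / 2)` tends to a
point off the real axis. -/
theorem tendsto_fresnelFactor {k d : ℝ} (hk : 0 < k) (hd : d ≠ 0) (q : ℝ) :
    Tendsto (fun δ => fresnelFactor k δ d q) (𝓝[>] 0) (𝓝 (fresnelFactor k 0 d q)) := by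
  have hc : k * d / 2 ≠ 0 := by positivity
  have h0 := denom_ne_zero (δ := 0) hc
  refine Tendsto.mono_left (ContinuousAt.tendsto ?_) nhdsWithin_le_nhds
  have h1 : ContinuousAt (fun δ : ℝ => (δ : ℂ) + Complex.I * (k * d / 2 : ℝ)) 0 := by fun_prop
  refine ContinuousAt.mul ?_ ?_
  · refine (continuousAt_const.div h1 h0).cpow continuousAt_const (Or.inr ?_)
    have : (Real.pi : ℂ) / (((0 : ℝ) : ℂ) + Complex.I * (k * d / 2 : ℝ))
        = -(Complex.I * (Real.pi / (k * d / 2) : ℝ)) := by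
      have h2 : ((k * d / 2 : ℝ) : ℂ) ≠ 0 := Complex.ofReal_ne_zero.2 hc
      generalize k * d / 2 = c at h2
      rw [Complex.ofReal_zero, zero_add, Complex.ofReal_div]
      field_simp
      norm_num [Complex.I_sq]
    change ((Real.pi : ℂ) / (((0 : ℝ) : ℂ) + Complex.I * (k * d / 2 : ℝ))).im ≠ 0
    rw [this]
    simp only [Complex.neg_im, Complex.mul_im, Complex.I_re, Complex.I_im, Complex.ofReal_re,
      Complex.ofReal_im]
    have : Real.pi / (k * d / 2) ≠ 0 := div_ne_zero Real.pi_pos.ne' hc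
    simpa using this
  · exact (continuousAt_const.div (continuousAt_const.mul h1)
      (mul_ne_zero (by norm_num) h0)).cexp

/-- The branch of the square root is that of the limit from the right half plane. -/
theorem fresnelFactor_zero {k d : ℝ} (hk : 0 < k) (hd : d ≠ 0) (q : ℝ) :
    fresnelFactor k 0 d q = ((Real.sqrt (2 * Real.pi / k) / Real.sqrt |d| : ℝ) : ℂ) *
      Complex.exp (-Complex.I * ((Real.pi / 4 * SignType.sign d : ℝ) : ℂ)) *
      Complex.exp (Complex.I * ((d⁻¹ * q ^ 2 / (2 * k) : ℝ) : ℂ)) := by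
  have hk' : (k : ℂ) ≠ 0 := Complex.ofReal_ne_zero.2 hk.ne'
  have hd' : (d : ℂ) ≠ 0 := Complex.ofReal_ne_zero.2 hd
  have hr : 0 < 2 * Real.pi / k / |d| := by positivity
  have e1 : (Real.pi : ℂ) / (((0 : ℝ) : ℂ) + Complex.I * (k * d / 2 : ℝ))
      = ((2 * Real.pi / k / |d| : ℝ) : ℂ) * (-Complex.I * (SignType.sign d : ℝ)) := by
    have h1 : (d : ℂ) = ((SignType.sign d : ℝ) : ℂ) * (|d| : ℝ) := by
      rw [← Complex.ofReal_mul]; exact_mod_cast (sign_mul_abs d).symm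
    have h2 : ((SignType.sign d : ℝ) : ℂ) * ((SignType.sign d : ℝ) : ℂ) = 1 := by
      rcases lt_or_gt_of_ne hd with h | h <;> simp [h]
    have h3 : ((|d| : ℝ) : ℂ) ≠ 0 := Complex.ofReal_ne_zero.2 (abs_ne_zero.2 hd)
    rw [Complex.ofReal_zero, zero_add, div_eq_iff (mul_ne_zero Complex.I_ne_zero
      (Complex.ofReal_ne_zero.2 (by positivity)))]
    push_cast
    rw [h1]
    field_simp
    linear_combination ((SignType.sign d : ℝ) : ℂ) ^ 2 * Complex.I_sq - h2
  -- the branch of the square root: `(-i sgn d)^{1/2} = e^{-iπ sgn(d)/4}`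
  have e2 : Complex.log (-Complex.I * ((SignType.sign d : ℝ) : ℂ))
      = -Complex.I * ((Real.pi / 2 * SignType.sign d : ℝ) : ℂ) := by
    rcases lt_or_gt_of_ne hd with h | h
    · simp [h, Complex.log_I]; ring
    · simp [h, Complex.log_neg_I]; ring
  have hne : -Complex.I * ((SignType.sign d : ℝ) : ℂ) ≠ 0 := by
    rcases lt_or_gt_of_ne hd with h | h <;> simp [h]
  have e3 : Real.sqrt (2 * Real.pi / k) / Real.sqrt |d|
      = Real.exp (Real.log (2 * Real.pi / k / |d|) * (1 / 2)) := by
    rw [← Real.sqrt_div (by positivity), Real.sqrt_eq_rpow, Real.rpow_def_of_pos hr]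
  have e4 : (Complex.I * q) ^ 2 / (4 * (((0 : ℝ) : ℂ) + Complex.I * (k * d / 2 : ℝ)))
      = Complex.I * ((d⁻¹ * q ^ 2 / (2 * k) : ℝ) : ℂ) := by
    push_cast
    rw [zero_add, mul_pow]
    field_simp
    norm_num [Complex.I_sq]
  rw [fresnelFactor, e4, e1, Complex.cpow_def_of_ne_zero
    (mul_ne_zero (Complex.ofReal_ne_zero.2 hr.ne') hne), Complex.log_ofReal_mul hr hne, e2, e3,
    Complex.ofReal_exp, ← Complex.exp_add, ← Complex.exp_add, ← Complex.exp_add]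
  congr 1
  push_cast
  ring

theorem signature_diagonalized (hU : Uᵀ * U = 1) (hU' : U * Uᵀ = 1) :
    signature (U * Matrix.diagonal d * Uᵀ) = ∑ i, ((SignType.sign (d i) : ℤ) : ℝ) := by
  have happ : ∀ (M : Matrix (Fin n) (Fin n) ℝ) x, M.toQuadraticForm' x = quad M x := fun M x => by
    rw [quad_eq_dotProduct]
    simp [Matrix.toQuadraticForm', Matrix.toLinearMap₂'_apply']
  have he : QuadraticMap.Equivalent (U * Matrix.diagonal d * Uᵀ).toQuadraticForm'
      (QuadraticMap.weightedSumSquares ℝ d) :=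
    ⟨⟨Matrix.toLin'OfInv hU' hU, fun x => by
      rw [happ, quad_conj, quad_diagonal, QuadraticMap.weightedSumSquares_apply]
      exact Finset.sum_congr rfl fun i _ => by
        simp [Matrix.toLin'OfInv, sq]⟩⟩
  rw [signature, QuadraticForm.sigPos_of_equiv_weightedSumSquares he,
    QuadraticForm.sigNeg_of_equiv_weightedSumSquares he]
  have hs : ∀ i, ((SignType.sign (d i) : ℤ) : ℝ)
      = (if 0 < d i then 1 else 0) - (if d i < 0 then 1 else 0) := fun i => by
    rcases lt_trichotomy (d i) 0 with h | h | h
    · simp [h, h.not_gt]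
    · simp [h]
    · simp [h, h.not_gt]
  simp only [hs, Finset.sum_sub_distrib, Finset.sum_boole, Set.ncard_eq_toFinset_card',
    Set.toFinset_ofPred]

/-- The Fourier transform of `exp (-(i k / 2) σ_ab x^a x^b)`. -/
def fresnelKernel (σ : Matrix (Fin n) (Fin n) ℝ) (k : ℝ) (p : Fin n → ℝ) : ℂ :=
  (((2 * Real.pi / k) ^ ((n : ℝ) / 2) / Real.sqrt |σ.det| : ℝ) : ℂ) *
    Complex.exp (-Complex.I * ((Real.pi / 4 * signature σ : ℝ) : ℂ)) *
    Complex.exp (Complex.I * ((quad σ⁻¹ p / (2 * k) : ℝ) : ℂ))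

theorem prod_fresnelFactor_zero (hU : Uᵀ * U = 1) (hU' : U * Uᵀ = 1) {k : ℝ} (hk : 0 < k)
    (hd : ∀ i, d i ≠ 0) (p : Fin n → ℝ) :
    ∏ i, fresnelFactor k 0 (d i) ((Uᵀ *ᵥ p) i)
      = fresnelKernel (U * Matrix.diagonal d * Uᵀ) k p := by
  simp only [fresnelFactor_zero hk (hd _), Finset.prod_mul_distrib, ← Complex.exp_sum,
    ← Finset.mul_sum, ← Complex.ofReal_sum, ← Complex.ofReal_prod]
  rw [fresnelKernel, det_diagonalized hU, signature_diagonalized hU hU', inv_diagonalized hU hU' hd,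
    quad_conj, quad_diagonal, Finset.prod_div_distrib, Finset.prod_const, Finset.card_univ,
    Fintype.card_fin, ← Finset.sum_div, Finset.abs_prod, Real.sqrt_prod _ fun i _ => abs_nonneg
      (d i)]
  have h1 : √(2 * Real.pi / k) ^ n = (2 * Real.pi / k) ^ ((n : ℝ) / 2) := by
    rw [Real.sqrt_eq_rpow, ← Real.rpow_natCast, ← Real.rpow_mul (by positivity)]
    congr 1; ring
  have h2 : ∀ i, ((SignType.sign (d i) : ℤ) : ℝ) = SignType.sign (d i) := fun i => by simp
  simp only [h1, h2]

/-- Fresnel integrals smeared with an integrable function of the dual variable: the Gaussian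
integral is regularised by `exp (-δ x²)`, which makes Fubini's theorem applicable, and `δ` is sent
to `0`. -/
theorem integral_fresnel {Z : Type*} [MeasureSpace Z] [SFinite (volume : Measure Z)] {W : Z → ℂ}
    (hW : Integrable W) {p : Z → Fin n → ℝ} (hp : Measurable p) (hσ : σᵀ = σ) (hdet : σ.det ≠ 0)
    {k : ℝ} (hk : 0 < k)
    (hI : Integrable fun x : Fin n → ℝ => ∫ z, W z *
      Complex.exp (Complex.I * ((∑ a, p z a * x a - k / 2 * quad σ x : ℝ) : ℂ))) :
    ∫ x : Fin n → ℝ, ∫ z, W z *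
      Complex.exp (Complex.I * ((∑ a, p z a * x a - k / 2 * quad σ x : ℝ) : ℂ))
      = ∫ z, W z * fresnelKernel σ k (p z) := by
  obtain ⟨U, d, hU, hU', rfl⟩ := exists_orthogonal_diagonal hσ
  rw [det_diagonalized hU, Finset.prod_ne_zero_iff] at hdet
  have hd : ∀ i, d i ≠ 0 := fun i => hdet i (Finset.mem_univ i)
  set σ := U * Matrix.diagonal d * Uᵀ with hσd
  have hreg : ∀ x : Fin n → ℝ, ∀ δ : ℝ, 0 < δ →
      ‖Complex.exp ((-δ * ∑ a, x a ^ 2 : ℝ) : ℂ)‖ ≤ 1 := fun x δ hδ => by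
    rw [← Complex.ofReal_exp, Complex.norm_real, Real.norm_of_nonneg (Real.exp_nonneg _),
      Real.exp_le_one_iff, neg_mul]
    exact neg_nonpos.2 (mul_nonneg hδ.le (Finset.sum_nonneg fun a _ => sq_nonneg _))
  have hcont : ∀ δ : ℝ, Continuous fun x : Fin n → ℝ =>
      Complex.exp ((-δ * ∑ a, x a ^ 2 : ℝ) : ℂ) := fun δ => by fun_prop
  -- the regularised identity
  have hA : ∀ δ : ℝ, 0 < δ → ∫ x : Fin n → ℝ, (∫ z, W z *
      Complex.exp (Complex.I * ((∑ a, p z a * x a - k / 2 * quad σ x : ℝ) : ℂ))) *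
        Complex.exp ((-δ * ∑ a, x a ^ 2 : ℝ) : ℂ)
      = ∫ z, W z * ∏ i, fresnelFactor k δ (d i) ((Uᵀ *ᵥ p z) i) := fun δ hδ => by
    have hg : Integrable fun x : Fin n → ℝ => Complex.exp ((-δ * ∑ a, x a ^ 2 : ℝ) : ℂ) := by
      have h := GaussianFourier.integrable_cexp_neg_mul_sum_add (ι := Fin n) (b := (δ : ℂ))
        (by simpa using hδ) 0
      refine h.congr (ae_of_all _ fun x => ?_)
      simp
    have hint : Integrable (Function.uncurry fun (x : Fin n → ℝ) (z : Z) => W z *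
        Complex.exp (Complex.I * ((∑ a, p z a * x a - k / 2 * quad σ x : ℝ) : ℂ)) *
        Complex.exp ((-δ * ∑ a, x a ^ 2 : ℝ) : ℂ)) (volume.prod volume) := by
      refine ((hg.mul_prod hW).bdd_mul (c := 1) (f := fun q : (Fin n → ℝ) × Z =>
        Complex.exp (Complex.I * ((∑ a, p q.2 a * q.1 a - k / 2 * quad σ q.1 : ℝ) : ℂ))) ?_
        (ae_of_all _ fun q => ?_)).congr (ae_of_all _ fun q => ?_)
      · refine Measurable.aestronglyMeasurable ?_
        have h1 := (continuous_quad σ).measurable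
        fun_prop
      · rw [norm_expI]
      · simp only [Function.uncurry]; ring
    simp only [← integral_mul_const]
    rw [integral_integral_swap hint]
    refine integral_congr_ae (ae_of_all _ fun z => ?_)
    simp only [mul_assoc]
    rw [integral_const_mul, ← integral_regularised hU hδ]
  -- removal of the regulator on either side
  have hL : Tendsto (fun δ : ℝ => ∫ x : Fin n → ℝ, (∫ z, W z *
      Complex.exp (Complex.I * ((∑ a, p z a * x a - k / 2 * quad σ x : ℝ) : ℂ))) *
        Complex.exp ((-δ * ∑ a, x a ^ 2 : ℝ) : ℂ)) (𝓝[>] 0)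
      (𝓝 (∫ x : Fin n → ℝ, (∫ z, W z *
      Complex.exp (Complex.I * ((∑ a, p z a * x a - k / 2 * quad σ x : ℝ) : ℂ))) *
        Complex.exp ((-0 * ∑ a, x a ^ 2 : ℝ) : ℂ))) := by
    refine tendsto_integral_filter_of_dominated_convergence _
      (Eventually.of_forall fun δ => hI.aestronglyMeasurable.mul (hcont δ).aestronglyMeasurable)
      (eventually_nhdsWithin_of_forall fun δ hδ => ae_of_all _ fun x => ?_) hI.norm
      (ae_of_all _ fun x => ?_)
    · rw [norm_mul]
      exact mul_le_of_le_one_right (norm_nonneg _) (hreg x δ hδ)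
    · refine Tendsto.const_mul _ (Tendsto.mono_left (ContinuousAt.tendsto ?_) nhdsWithin_le_nhds)
      fun_prop
  have hR : Tendsto (fun δ : ℝ => ∫ z, W z * ∏ i, fresnelFactor k δ (d i) ((Uᵀ *ᵥ p z) i)) (𝓝[>] 0)
      (𝓝 (∫ z, W z * ∏ i, fresnelFactor k 0 (d i) ((Uᵀ *ᵥ p z) i))) := by
    refine tendsto_integral_filter_of_dominated_convergence
      (fun z => ‖W z‖ * ∏ i, (Real.pi / (k * |d i| / 2)) ^ (1 / 2 : ℝ))
      (Eventually.of_forall fun δ => hW.aestronglyMeasurable.mul ?_)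
      (eventually_nhdsWithin_of_forall fun δ hδ => ae_of_all _ fun z => ?_) (hW.norm.mul_const _)
      (ae_of_all _ fun z => Tendsto.const_mul _ (tendsto_finsetProd _ fun i _ =>
        tendsto_fresnelFactor hk (hd i) _))
    · refine Measurable.aestronglyMeasurable ?_
      have h1 : ∀ i, Measurable fun z => (Uᵀ *ᵥ p z) i := fun i => by
        have h2 : Continuous fun y : Fin n → ℝ => (Uᵀ *ᵥ y) i :=
          (continuous_apply i).comp (Continuous.matrix_mulVec continuous_const continuous_id)
        exact h2.measurable.comp hp
      unfold fresnelFactor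
      fun_prop
    · rw [norm_mul, norm_prod]
      gcongr with i
      exact norm_fresnelFactor_le hk hδ (hd i) _
  have h := tendsto_nhds_unique hL (hR.congr'
    (eventually_nhdsWithin_of_forall fun δ hδ => (hA δ hδ).symm))
  simp only [prod_fresnelFactor_zero hU hU' hk hd] at h
  simpa using h

end Fresnel

/-! ### The in–out overlaps on the slice `u = 0` -/

section Overlap

variable {H Em Fm Ep Fp : ℝ → Matrix (Fin n) (Fin n) ℝ} {R R' : Set ℝ} {f g : Mom n → ℂ}

/-- The out data on a slice where the out modes are exactly flat, up to the factor `v`. -/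
structure IsTrivialAtZero (E F : ℝ → Matrix (Fin n) (Fin n) ℝ) : Prop where
  vielbein : E 0 = 1
  shear : shear E 0 = 0
  rosen : F 0 = 0

/-- The slice `u = 0` lies in the out-region, or on its boundary. -/
theorem IsOutVielbein.isTrivialAtZero (hE : IsOutVielbein H Ep) (hH : Continuous H) {a b : ℝ}
    (hsupp : ∀ u, u ∉ Set.Icc a b → H u = 0) (hb : b ≤ 0)
    (hF : IsRosenIntegral Ep Fp (Set.Ioi b)) : IsTrivialAtZero Ep Fp := by
  obtain ⟨h1, h2⟩ := hE.eq_one hH hsupp 0 hb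
  have hreg : Regular Ep 0 := by rw [Regular, h1, Matrix.det_one]; exact one_ne_zero
  refine ⟨h1, by rw [hE.1.shear_eq hreg, h2, Matrix.zero_mul, neg_zero], ?_⟩
  -- `F` is continuous at `0` and equal to `u` on `u > 0`
  ext i j
  have hc : Tendsto (fun s => Fp s i j) (𝓝[>] 0) (𝓝 (Fp 0 i j)) :=
    (hF.hasDeriv 0 hreg i j).continuousAt.tendsto.mono_left nhdsWithin_le_nhds
  have hl : Tendsto (fun s : ℝ => (s • (1 : Matrix (Fin n) (Fin n) ℝ)) i j) (𝓝[>] 0) (𝓝 0) := by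
    have : ContinuousAt (fun s : ℝ => (s • (1 : Matrix (Fin n) (Fin n) ℝ)) i j) 0 := by
      simp only [Matrix.smul_apply, smul_eq_mul]; fun_prop
    have h := this.tendsto.mono_left (nhdsWithin_le_nhds (s := Set.Ioi 0))
    simpa using h
  refine tendsto_nhds_unique hc (hl.congr' ?_)
  filter_upwards [self_mem_nhdsWithin] with s hs
  rw [hF.asymptotic s (lt_of_le_of_lt hb hs)]

theorem IsTrivialAtZero.regular (h : IsTrivialAtZero Ep Fp) : Regular Ep 0 := by
  rw [Regular, h.vielbein, Matrix.det_one]; exact one_ne_zero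

theorem IsBump.conj {V : Type*} [NormedAddCommGroup V] [NormedSpace ℝ V] {f : V → ℂ}
    (hf : IsBump f) : IsBump fun k => conj (f k) :=
  ⟨Complex.conjCLE.contDiff.comp hf.smooth, hf.compact.comp_left (map_zero _)⟩

theorem quad_zero_matrix (x : Fin n → ℝ) : quad (0 : Matrix (Fin n) (Fin n) ℝ) x = 0 := by
  simp [quad]

theorem modeFiber_trivial (h : IsTrivialAtZero Ep Fp) (k₀ : ℝ) (f : Mom n → ℂ) (x : Fin n → ℝ) :
    modeFiber Ep Fp k₀ f 0 x
      = ∫ κ : Fin n → ℝ, f (k₀, κ) * Complex.exp (Complex.I * ((∑ a, κ a * x a : ℝ) : ℂ)) := by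
  have hΩ : Omega Ep 0 = 1 := by rw [Omega_eq_sqrt, h.vielbein]; simp
  have hm : ∀ κ, scalarMode Ep Fp (k₀, κ) (pt 0 0 x)
      = (Omega Ep 0 : ℂ) * Complex.exp (Complex.I * (phase Ep Fp (k₀, κ) (pt 0 0 x) : ℂ)) :=
    fun κ => rfl
  simp only [modeFiber, hm, phase_pt, h.vielbein, h.shear, h.rosen, hΩ, quad_zero_matrix, inv_one,
    Matrix.one_mulVec, mul_zero, zero_div, zero_add, add_zero, Complex.ofReal_one, one_mul]

/-- The integrand of the smeared overlap as a function of the pair of transverse momenta, without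
the oscillating factor. -/
def overlapWeight (Em Fm : ℝ → Matrix (Fin n) (Fin n) ℝ) (f g : Mom n → ℂ) (k₀ : ℝ)
    (z : (Fin n → ℝ) × (Fin n → ℝ)) : ℂ :=
  f (k₀, z.1) * (conj (g (k₀, z.2)) *
    (Complex.exp (-Complex.I * (sPhase Fm k₀ z.2 : ℂ)) * (Omega Em 0 : ℂ)))

theorem integrable_overlapWeight (hf : IsBump f) (hg : IsBump g) (k₀ : ℝ) :
    Integrable (overlapWeight Em Fm f g k₀) (volume.prod volume) := by
  have hs : Continuous fun l : Fin n → ℝ =>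
      Complex.exp (-Complex.I * (sPhase Fm k₀ l : ℂ)) * (Omega Em 0 : ℂ) := by
    have := continuous_quad (Fm 0)
    unfold sPhase
    fun_prop
  exact (hf.slice k₀).integrable.mul_prod ((hg.slice k₀).conj.integrable_mul hs)

theorem overlapWeight_mul (Em Fm : ℝ → Matrix (Fin n) (Fin n) ℝ) (f g : Mom n → ℂ) (k₀ : ℝ)
    (x k l : Fin n → ℝ) :
    overlapWeight Em Fm f g k₀ (k, l) * Complex.exp (Complex.I *
        ((∑ a, momShift Em k l a * x a - k₀ / 2 * quad (shear Em 0) x : ℝ) : ℂ))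
      = f (k₀, k) * conj (g (k₀, l)) * gaussDensity Em Fm k₀ k l x := by
  rw [overlapWeight, gaussDensity]; ring

theorem measurable_momShift (Em : ℝ → Matrix (Fin n) (Fin n) ℝ) :
    Measurable fun z : (Fin n → ℝ) × (Fin n → ℝ) => momShift Em z.1 z.2 := by
  have : Continuous fun z : (Fin n → ℝ) × (Fin n → ℝ) => momShift Em z.1 z.2 := by
    refine continuous_pi fun a => ?_
    unfold momShift
    fun_prop
  exact this.measurable

theorem integrable_overlapWeight_mul (hf : IsBump f) (hg : IsBump g) (k₀ : ℝ) (x : Fin n → ℝ) :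
    Integrable (fun z : (Fin n → ℝ) × (Fin n → ℝ) => overlapWeight Em Fm f g k₀ z *
      Complex.exp (Complex.I * ((∑ a, momShift Em z.1 z.2 a * x a
        - k₀ / 2 * quad (shear Em 0) x : ℝ) : ℂ))) (volume.prod volume) := by
  refine (integrable_overlapWeight hf hg k₀).mul_bdd (c := 1) ?_
    (ae_of_all _ fun z => (norm_expI _).le)
  have h := measurable_momShift Em
  refine Measurable.aestronglyMeasurable ?_
  fun_prop

theorem modeFiber_mul_conj (h : IsTrivialAtZero Ep Fp) (f g : Mom n → ℂ)
    (k₀ : ℝ) (x : Fin n → ℝ) :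
    modeFiber Ep Fp k₀ f 0 x * conj (modeFiber Em Fm k₀ g 0 x)
      = ∫ z : (Fin n → ℝ) × (Fin n → ℝ), overlapWeight Em Fm f g k₀ z *
        Complex.exp (Complex.I * ((∑ a, momShift Em z.1 z.2 a * x a
          - k₀ / 2 * quad (shear Em 0) x : ℝ) : ℂ)) := by
  rw [modeFiber_trivial h, modeFiber, ← integral_conj, ← integral_prod_mul]
  refine integral_congr_ae (ae_of_all _ fun z => ?_)
  have hm : scalarMode Em Fm (k₀, z.2) (pt 0 0 x)
      = (Omega Em 0 : ℂ) * Complex.exp (Complex.I * (phase Em Fm (k₀, z.2) (pt 0 0 x) : ℂ)) := rfl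
  simp only [overlapWeight, hm, phase_pt, map_mul, ← Complex.exp_conj, Complex.conj_I,
    Complex.conj_ofReal, mul_zero, add_zero]
  have e1 : ∑ a, momShift Em z.1 z.2 a * x a
      = ∑ a, z.1 a * x a - ∑ i, z.2 i * ((Em 0)⁻¹ *ᵥ x) i := by
    rw [sum_mulVec_mul, Finset.sum_comm, ← Finset.sum_sub_distrib]
    refine Finset.sum_congr rfl fun a _ => ?_
    rw [momShift, sub_mul, Finset.sum_mul]
  have e2 : Complex.exp (Complex.I * ((∑ a, z.1 a * x a : ℝ) : ℂ)) *
      Complex.exp (-Complex.I * ((k₀ / 2 * quad (shear Em 0) x + ∑ i, z.2 i * ((Em 0)⁻¹ *ᵥ x) i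
        + quad (Fm 0) z.2 / (2 * k₀) : ℝ) : ℂ))
      = Complex.exp (-Complex.I * (sPhase Fm k₀ z.2 : ℂ)) * Complex.exp (Complex.I *
        ((∑ a, momShift Em z.1 z.2 a * x a - k₀ / 2 * quad (shear Em 0) x : ℝ) : ℂ)) := by
    rw [← Complex.exp_add, ← Complex.exp_add, e1, sPhase]
    congr 1
    push_cast
    ring
  linear_combination (f (k₀, z.1) * conj (g (k₀, z.2)) * (Omega Em 0 : ℂ)) * e2

theorem shear_det_eq (hEm : IsVielbein H Em) (hreg : Regular Em 0) :
    |(shear Em 0).det| = |(matDeriv Em 0).det| * |(Em 0)⁻¹.det| := by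
  rw [hEm.shear_eq hreg, Matrix.det_neg, Matrix.det_mul, abs_mul, abs_pow, abs_neg, abs_one,
    one_pow,
    one_mul, abs_mul]

theorem shear_inv_eq (hEm : IsVielbein H Em) (hreg : Regular Em 0) (hb : (matDeriv Em 0).det ≠ 0) :
    (shear Em 0)⁻¹ = -(Em 0 * (matDeriv Em 0)⁻¹) := by
  refine Matrix.inv_eq_right_inv ?_
  rw [hEm.shear_eq hreg, Matrix.neg_mul, Matrix.mul_neg, neg_neg]
  calc _ = matDeriv Em 0 * ((Em 0)⁻¹ * Em 0) * (matDeriv Em 0)⁻¹ := by simp only [Matrix.mul_assoc]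
    _ = 1 := by
      rw [Matrix.nonsing_inv_mul _ hreg.isUnit, Matrix.mul_one,
        Matrix.mul_nonsing_inv _ (isUnit_iff_ne_zero.2 hb)]

theorem quad_neg (M : Matrix (Fin n) (Fin n) ℝ) (x : Fin n → ℝ) : quad (-M) x = -quad M x := by
  simp [quad]

theorem overlapWeight_mul_fresnelKernel (hEm : IsVielbein H Em) (hreg : Regular Em 0)
    (hb : (matDeriv Em 0).det ≠ 0) (f g : Mom n → ℂ) (k₀ : ℝ) (k l : Fin n → ℝ) :
    overlapWeight Em Fm f g k₀ (k, l) * fresnelKernel (shear Em 0) k₀ (momShift Em k l)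
      = f (k₀, k) * conj (g (k₀, l)) * gaussKernel Em Fm k₀ k l := by
  have hΩ : (Omega Em 0) * ((2 * Real.pi / k₀) ^ ((n : ℝ) / 2) / √|(shear Em 0).det|)
      = (2 * Real.pi / k₀) ^ ((n : ℝ) / 2) / √|(matDeriv Em 0).det| := by
    have h0 : √|(Em 0)⁻¹.det| ≠ 0 := (Real.sqrt_pos.2 (abs_pos.2 hreg.det_inv_ne_zero)).ne'
    have h1 : √|(matDeriv Em 0).det| ≠ 0 := (Real.sqrt_pos.2 (abs_pos.2 hb)).ne'
    rw [Omega_eq_sqrt, shear_det_eq hEm hreg, Real.sqrt_mul (abs_nonneg _)]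
    field_simp
  have he : Complex.exp (-Complex.I * (sPhase Fm k₀ l : ℂ)) *
      Complex.exp (Complex.I * ((quad (shear Em 0)⁻¹ (momShift Em k l) / (2 * k₀) : ℝ) : ℂ))
      = Complex.exp (-Complex.I * ((sPhase Fm k₀ l + rPhase Em k₀ k l : ℝ) : ℂ)) := by
    rw [← Complex.exp_add, shear_inv_eq hEm hreg hb, quad_neg, rPhase]
    congr 1
    push_cast
    ring
  rw [overlapWeight, fresnelKernel, gaussKernel, ← hΩ, ← he, Complex.ofReal_mul (Omega Em 0)]
  ring

theorem norm_fresnelKernel (σ : Matrix (Fin n) (Fin n) ℝ) (k : ℝ) (p : Fin n → ℝ) :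
    ‖fresnelKernel σ k p‖ = ‖(2 * Real.pi / k) ^ ((n : ℝ) / 2) / √|σ.det|‖ := by
  have h : ∀ r : ℝ, ‖Complex.exp (-Complex.I * (r : ℂ))‖ = 1 := fun r => by
    rw [neg_mul, ← mul_neg, ← Complex.ofReal_neg, norm_expI]
  rw [fresnelKernel, norm_mul, norm_mul, norm_expI, h, mul_one, mul_one, Complex.norm_real]

theorem continuous_fresnelKernel (σ : Matrix (Fin n) (Fin n) ℝ) (k : ℝ) :
    Continuous (fresnelKernel σ k) := by
  have := continuous_quad σ⁻¹
  unfold fresnelKernel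
  fun_prop

/-- The Gaussian integral over the slice, evaluated by `integral_fresnel`: the order of integration
can only be exchanged after regularisation. -/
theorem integral_modeFiber_mul_conj (h : IsTrivialAtZero Ep Fp) (hEp : IsVielbein H Ep)
    (hFp : IsRosenIntegral Ep Fp R) (hEm : IsVielbein H Em) (hFm : IsRosenIntegral Em Fm R')
    (hreg : Regular Em 0) (hb : (matDeriv Em 0).det ≠ 0) (hf : IsBump f) (hg : IsBump g) {k₀ : ℝ}
    (hk : 0 < k₀) :
    ∫ x, modeFiber Ep Fp k₀ f 0 x * conj (modeFiber Em Fm k₀ g 0 x)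
      = ∫ k : Fin n → ℝ, ∫ l : Fin n → ℝ,
        f (k₀, k) * conj (g (k₀, l)) * gaussKernel Em Fm k₀ k l := by
  have hK : IsCompact ({0} : Set ℝ) := isCompact_singleton
  have r₁ : ∀ t ∈ ({0} : Set ℝ), Regular Ep t := fun t ht => by
    rw [Set.mem_singleton_iff.1 ht]; exact h.regular
  have r₂ : ∀ t ∈ ({0} : Set ℝ), Regular Em t := fun t ht => by rwa [Set.mem_singleton_iff.1 ht]
  have hI := ((decays_modeFiber (k₀ := k₀) hEp hFp hK r₁ hf).mul_conj
    (decays_modeFiber (k₀ := k₀) hEm hFm hK r₂ hg)).integrable (Set.mem_singleton 0)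
    ((continuous_modeFiber hf 0).mul (Complex.continuous_conj.comp (continuous_modeFiber hg 0)))
  have hdet : (shear Em 0).det ≠ 0 := by
    rw [← abs_pos, shear_det_eq hEm hreg]
    exact mul_pos (abs_pos.2 hb) (abs_pos.2 hreg.det_inv_ne_zero)
  simp only [modeFiber_mul_conj h] at hI ⊢
  rw [integral_fresnel (integrable_overlapWeight hf hg k₀) (measurable_momShift Em)
    (hEm.shear_symm hreg) hdet hk hI]
  have hW : Integrable (fun z : (Fin n → ℝ) × (Fin n → ℝ) => overlapWeight Em Fm f g k₀ z *
      fresnelKernel (shear Em 0) k₀ (momShift Em z.1 z.2)) (volume.prod volume) :=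
    (integrable_overlapWeight hf hg k₀).mul_bdd
      (((continuous_fresnelKernel _ _).measurable.comp
        (measurable_momShift Em)).aestronglyMeasurable)
      (ae_of_all _ fun z => (norm_fresnelKernel _ _ _).le)
  refine (integral_prod _ hW).trans ?_
  simp only [overlapWeight_mul_fresnelKernel hEm hreg hb]

theorem scalarOverlap (h : IsTrivialAtZero Ep Fp) (hEp : IsVielbein H Ep)
    (hFp : IsRosenIntegral Ep Fp R) (hEm : IsVielbein H Em) (hFm : IsRosenIntegral Em Fm R')
    (hreg : Regular Em 0) : GravOverlap Em Fm 1 (scalarIP Ep Fp Em Fm) := by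
  refine ⟨fun f g hf hg => ?_, fun hb f g hf hg => ?_⟩
  · rw [integral_scalarIP_fiber hf hg h.regular hreg, one_mul]
    congr 1
    refine integral_congr_ae (ae_of_all _ fun k₀ => ?_)
    beta_reduce
    congr 1
    refine integral_congr_ae (ae_of_all _ fun x => ?_)
    beta_reduce
    rw [modeFiber_mul_conj h]
    refine (integral_prod _ (integrable_overlapWeight_mul hf.isBump hg.isBump k₀ x)).trans ?_
    simp only [overlapWeight_mul]
  · rw [integral_scalarIP_fiber hf hg h.regular hreg, one_mul]
    congr 1
    refine integral_congr_ae (ae_of_all _ fun k₀ => ?_)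
    beta_reduce
    rcases lt_or_ge 0 k₀ with hk | hk
    · rw [integral_modeFiber_mul_conj h hEp hFp hEm hFm hreg hb hf.isBump hg.isBump hk]
    · have h0 : ∀ κ : Fin n → ℝ, f (k₀, κ) = 0 := fun κ => hf.eq_zero hk
      simp [modeFiber, h0]

end Overlap

/-! ### Unitarity of the gravitational scattering -/

section MulIsometry

variable {α : Type*} [MeasurableSpace α] {μ ν : Measure α} {ρ : α → ℂ}

theorem eLpNorm_mul_density (hρ : Measurable ρ)
    (hν : ν = μ.withDensity fun x => ENNReal.ofReal (‖ρ x‖ ^ 2)) {f : α → ℂ}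
    (hf : StronglyMeasurable f) : eLpNorm (fun x => ρ x * f x) 2 μ = eLpNorm f 2 ν := by
  have h2 : (2 : ENNReal) ≠ 0 := by simp
  have h2' : (2 : ENNReal) ≠ ⊤ := by simp
  rw [eLpNorm_eq_lintegral_rpow_enorm_toReal h2 h2', eLpNorm_eq_lintegral_rpow_enorm_toReal h2 h2',
    hν,
    lintegral_withDensity_eq_lintegral_mul _ (by fun_prop)
      (hf.measurable.enorm.pow_const _)]
  congr 1
  refine lintegral_congr fun x => ?_
  simp only [enorm_mul, Pi.mul_apply, ENNReal.toReal_ofNat, ENNReal.rpow_ofNat, mul_pow]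
  rw [ENNReal.ofReal_pow (norm_nonneg _), ofReal_norm]

theorem ae_mul_density {μ ν : Measure α} {ρ : α → ℂ} (hρ : Measurable ρ)
    (hν : ν = μ.withDensity fun x => ENNReal.ofReal (‖ρ x‖ ^ 2)) {f g : α → ℂ} (h : f =ᵐ[ν] g) :
    (fun x => ρ x * f x) =ᵐ[μ] fun x => ρ x * g x := by
  rw [Filter.EventuallyEq, hν, ae_withDensity_iff (by fun_prop)] at h
  filter_upwards [h] with x hx
  by_cases h0 : ρ x = 0
  · rw [h0, zero_mul, zero_mul]
  · rw [hx (by simpa using h0)]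

/-- Multiplication by a density of `ν` with respect to `μ` is an isometry of the `L²` spaces. -/
theorem exists_isometry_mul (hρ : Measurable ρ)
    (hν : ν = μ.withDensity fun x => ENNReal.ofReal (‖ρ x‖ ^ 2)) :
    ∃ W : Lp ℂ 2 ν →ₗᵢ[ℂ] Lp ℂ 2 μ, (∀ f : Lp ℂ 2 ν, W f =ᵐ[μ] fun x => ρ x * f x) ∧
      ∀ g : Lp ℂ 2 μ, (∀ᵐ x ∂μ, ρ x = 0 → g x = 0) → ∃ f, W f = g := by
  have hn := fun f : Lp ℂ 2 ν => eLpNorm_mul_density hρ hν (Lp.stronglyMeasurable f)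
  have hm : ∀ f : Lp ℂ 2 ν, MemLp (fun x => ρ x * f x) 2 μ := fun f =>
    ⟨(hρ.stronglyMeasurable.mul (Lp.stronglyMeasurable f)).aestronglyMeasurable,
      (hn f) ▸ (Lp.memLp f).2⟩
  have hW : ∃ W : Lp ℂ 2 ν →ₗᵢ[ℂ] Lp ℂ 2 μ, ∀ f : Lp ℂ 2 ν, W f =ᵐ[μ] fun x => ρ x * f x := by
    refine ⟨{ toFun := fun f => (hm f).toLp _, map_add' := ?_, map_smul' := ?_, norm_map' := ?_ },
      fun f => (hm f).coeFn_toLp⟩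
    · intro f g
      rw [← MemLp.toLp_add (hm f) (hm g)]
      refine MemLp.toLp_congr _ _ ?_
      filter_upwards [ae_mul_density hρ hν (Lp.coeFn_add f g)] with x hx
      rw [hx, Pi.add_apply, Pi.add_apply, mul_add]
    · intro c f
      rw [RingHom.id_apply, ← MemLp.toLp_const_smul c (hm f)]
      refine MemLp.toLp_congr _ _ ?_
      filter_upwards [ae_mul_density hρ hν (Lp.coeFn_smul c f)] with x hx
      rw [hx, Pi.smul_apply, Pi.smul_apply, smul_eq_mul, smul_eq_mul]
      ring
    · intro f
      simp only [LinearMap.coe_mk, AddHom.coe_mk]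
      rw [Lp.norm_toLp, hn f, Lp.norm_def]
  obtain ⟨W, hW⟩ := hW
  refine ⟨W, hW, fun g hg => ?_⟩
  have hgm : StronglyMeasurable fun x => (ρ x)⁻¹ * g x :=
    hρ.inv.stronglyMeasurable.mul (Lp.stronglyMeasurable g)
  have hcancel : (fun x => ρ x * ((ρ x)⁻¹ * g x)) =ᵐ[μ] g := by
    filter_upwards [hg] with x hx
    by_cases h0 : ρ x = 0
    · rw [h0, zero_mul, hx h0]
    · rw [mul_inv_cancel_left₀ h0]
  have hmem : MemLp (fun x => (ρ x)⁻¹ * g x) 2 ν := by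
    refine ⟨hgm.aestronglyMeasurable, ?_⟩
    rw [← eLpNorm_mul_density hρ hν hgm, eLpNorm_congr_ae hcancel]
    exact (Lp.memLp g).2
  refine ⟨hmem.toLp _, Lp.ext ?_⟩
  exact (hW _).trans ((ae_mul_density hρ hν hmem.coeFn_toLp).trans hcancel)

end MulIsometry

/-- A unitary operator that preserves the range of an isometry `J`, together with its inverse,
induces a unitary operator on the source of `J`. -/
theorem exists_unitary_of_range {X Y : Type*} [NormedAddCommGroup X] [InnerProductSpace ℂ X]
    [NormedAddCommGroup Y] [InnerProductSpace ℂ Y] (J : X →ₗᵢ[ℂ] Y) (V : Y ≃ₗᵢ[ℂ] Y)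
    (h₁ : ∀ x, ∃ y, J y = V (J x)) (h₂ : ∀ x, ∃ y, J y = V.symm (J x)) :
    ∃ S : X ≃ₗᵢ[ℂ] X, ∀ x, J (S x) = V (J x) := by
  choose s hs using h₁
  let S₀ : X →ₗᵢ[ℂ] X :=
    { toFun := s
      map_add' := fun x y => J.injective (by simp only [hs, map_add])
      map_smul' := fun c x => J.injective (by simp only [hs, map_smul, RingHom.id_apply])
      norm_map' := fun x => by
        change ‖s x‖ = ‖x‖
        rw [← J.norm_map, hs, V.norm_map, J.norm_map] }
  refine ⟨LinearIsometryEquiv.ofSurjective S₀ fun x => ?_, hs⟩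
  obtain ⟨y, hy⟩ := h₂ x
  exact ⟨y, J.injective ((hs y).trans (by rw [hy, V.apply_symm_apply]))⟩

section Frequency

/-- An `L²` function orthogonal to all test functions supported in an open set vanishes there. -/
theorem ae_eq_zero_of_inner_bump {U : Set (Mom n)} (hU : IsOpen U)
    {G : Lp ℂ 2 (volume : Measure (Mom n))}
    (h : ∀ g : Mom n → ℂ, IsBump g → tsupport g ⊆ U →
      ∀ g' : Lp ℂ 2 (volume : Measure (Mom n)), g' =ᵐ[volume] g → inner ℂ g' G = 0) :
    ∀ᵐ k, k ∈ U → G k = 0 := by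
  refine hU.ae_eq_zero_of_integral_contDiff_smul_eq_zero
    (((Lp.memLp G).locallyIntegrable (by norm_num)).locallyIntegrableOn U) fun g hg hc hs => ?_
  have hb : IsBump fun k => (g k : ℂ) :=
    ⟨Complex.ofRealCLM.contDiff.comp hg, hc.comp_left Complex.ofReal_zero⟩
  have hs' : tsupport (fun k => (g k : ℂ)) ⊆ U :=
    (closure_mono (Function.support_comp_subset Complex.ofReal_zero g)).trans hs
  have h1 := h _ hb hs' _ hb.memLp_two.coeFn_toLp
  rw [inner_eq_integral (EventuallyEq.refl _ _) hb.memLp_two.coeFn_toLp] at h1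
  rw [← h1]
  refine integral_congr_ae (ae_of_all _ fun k => ?_)
  simp only [Complex.conj_ofReal, Complex.real_smul, mul_comm]

theorem ae_fst_ne_zero : ∀ᵐ k : Mom n, k.1 ≠ 0 :=
  Measure.quasiMeasurePreserving_fst.ae (p := fun t : ℝ => t ≠ 0) (Measure.ae_ne volume 0)

/-- A unitary operator without matrix elements between positive and negative frequencies preserves
the functions of positive frequency. -/
theorem positive_of_orthogonal
    (V : Lp ℂ 2 (volume : Measure (Mom n)) ≃ₗᵢ[ℂ] Lp ℂ 2 (volume : Measure (Mom n)))
    (hV : ∀ h g : Mom n → ℂ, IsBump h → IsBump g → (∀ k ∈ tsupport h, k.1 < 0) →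
      (∀ k ∈ tsupport g, 0 < k.1) → ∀ h' g' : Lp ℂ 2 (volume : Measure (Mom n)),
        h' =ᵐ[volume] h → g' =ᵐ[volume] g → inner ℂ h' (V g') = 0)
    {F : Lp ℂ 2 (volume : Measure (Mom n))} (hF : ∀ᵐ k : Mom n, k.1 ≤ 0 → F k = 0) :
    ∀ᵐ k : Mom n, k.1 ≤ 0 → V F k = 0 := by
  have hneg : ∀ᵐ k : Mom n, k ∈ {k : Mom n | k.1 < 0} → V F k = 0 := by
    refine ae_eq_zero_of_inner_bump (isOpen_lt continuous_fst continuous_const)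
      fun h hh hs h' hh' => ?_
    have hG : ∀ᵐ k : Mom n, k ∈ {k : Mom n | 0 < k.1} → V.symm h' k = 0 := by
      refine ae_eq_zero_of_inner_bump (isOpen_lt continuous_const continuous_fst)
        fun g hg hgs g' hg' => ?_
      rw [← V.inner_map_map, V.apply_symm_apply, ← inner_conj_symm,
        hV h g hh hg hs hgs h' g' hh' hg', map_zero]
    rw [← V.symm.inner_map_map, V.symm_apply_apply,
      inner_eq_integral (EventuallyEq.refl _ _) (EventuallyEq.refl _ _)]
    refine integral_eq_zero_of_ae ?_
    filter_upwards [hF, hG] with k h1 h2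
    rcases le_or_gt k.1 0 with h0 | h0
    · rw [h1 h0, zero_mul]; rfl
    · rw [h2 h0, map_zero, mul_zero]; rfl
  filter_upwards [hneg, ae_fst_ne_zero] with k h1 h2 h3
  exact h1 (lt_of_le_of_ne h3 h2)

end Frequency

/-- The square root of the density of the one-particle measure. -/
def oneParticleRoot (n : ℕ) (k₀ : ℝ) : ℂ := (√((2 * Real.pi) ^ (n + 1) * (2 * k₀)) : ℝ)

theorem measurable_oneParticleRoot : Measurable fun k : Mom n => oneParticleRoot n k.1 := by
  unfold oneParticleRoot
  fun_prop

theorem oneParticleRoot_eq_zero {k₀ : ℝ} (h : k₀ ≤ 0) : oneParticleRoot n k₀ = 0 := by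
  rw [oneParticleRoot, Real.sqrt_eq_zero_of_nonpos, Complex.ofReal_zero]
  exact mul_nonpos_of_nonneg_of_nonpos (by positivity) (by linarith)

theorem oneParticleRoot_ne_zero {k₀ : ℝ} (h : 0 < k₀) : oneParticleRoot n k₀ ≠ 0 :=
  Complex.ofReal_ne_zero.2 (Real.sqrt_pos.2 (by positivity)).ne'

theorem oneParticle_eq_withDensity : oneParticle n
    = (volume : Measure (Mom n)).withDensity fun k =>
      ENNReal.ofReal (‖oneParticleRoot n k.1‖ ^ 2) := by
  rw [oneParticle, ← withDensity_indicator measurableSet_positive]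
  congr 1
  funext k
  by_cases hk : 0 < k.1
  · rw [Set.indicator_of_mem (show k ∈ {k : Mom n | 0 < k.1} from hk), oneParticleRoot,
      Complex.norm_real, Real.norm_of_nonneg (Real.sqrt_nonneg _), Real.sq_sqrt (by positivity)]
  · rw [Set.indicator_of_notMem (show k ∉ {k : Mom n | 0 < k.1} from hk),
      oneParticleRoot_eq_zero (not_lt.1 hk)]
    simp

theorem IsTest.root_mul {f : Mom n → ℂ} (hf : IsTest f) :
    IsTest fun k => oneParticleRoot n k.1 * f k :=
  hf.smoothOn_mul fun k hk => by
    have h1 : ContDiffAt ℝ ∞ (fun k : Mom n => (2 * Real.pi) ^ (n + 1) * (2 * k.1)) k := by fun_prop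
    exact Complex.ofRealCLM.contDiff.contDiffAt.comp k
      (h1.sqrt (by positivity : (2 * Real.pi) ^ (n + 1) * (2 * k.1) ≠ 0))

section Scattering

variable {E F : ℝ → Matrix (Fin n) (Fin n) ℝ}

theorem IsBump.phased {f : Mom n → ℂ} (hf : IsBump f) (h0 : ∀ k ∈ tsupport f, k.1 ≠ 0)
    (M : Matrix (Fin n) (Fin n) ℝ) : IsBump (PlaneWave.phased (quad M) f) := by
  refine hf.smoothOn_mul fun k hk => ?_
  have h1 : ContDiffAt ℝ ∞ (fun k : Mom n => quad M k.2 / (2 * k.1)) k := by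
    refine ContDiffAt.div ((contDiff_quad M).comp contDiff_snd).contDiffAt ?_
      (mul_ne_zero two_ne_zero (h0 k hk))
    exact (contDiff_const.mul contDiff_fst).contDiffAt
  exact (contDiffAt_const.mul (Complex.ofRealCLM.contDiff.contDiffAt.comp k h1)).cexp

/-- The map from momentum profiles to packets on a slice is unitary, up to normalisation. -/
theorem exists_unitary_modePacket (E F : ℝ → Matrix (Fin n) (Fin n) ℝ) {u : ℝ} (hu : Regular E u) :
    ∃ W : Lp ℂ 2 (volume : Measure (Mom n)) ≃ₗᵢ[ℂ] Lp ℂ 2 (volume : Measure (Mom n)),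
      ∀ f : Mom n → ℂ, IsBump f → (∀ k ∈ tsupport f, k.1 ≠ 0) →
        ∀ f' : Lp ℂ 2 (volume : Measure (Mom n)), f' =ᵐ[volume] f →
        W f' =ᵐ[volume] fun p => ((√((2 * Real.pi) ^ (n + 1)))⁻¹ : ℂ) *
          slicePacket (shear E u) (E u)⁻¹ (phased (quad (F u)) f) p := by
  have hm : Measurable fun k : Mom n =>
      Complex.exp (Complex.I * ((quad (F u) k.2 / (2 * k.1) : ℝ) : ℂ)) := by
    have := (continuous_quad (F u)).measurable
    fun_prop
  obtain ⟨M, hM⟩ := exists_unitary_weightedComp (T := MeasurableEquiv.refl (Mom n)) (μ := volume)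
    (ν := volume) one_pos (by
      rw [inv_one, ENNReal.ofReal_one, one_smul]; exact Measure.map_id) hm
        (fun k => by rw [norm_expI, Real.sqrt_one])
  obtain ⟨W, hW⟩ := exists_unitary_slicePacket (shear E u) (E u)⁻¹ hu.det_inv_ne_zero
  refine ⟨M.trans W, fun f hf h0 f' hf' => hW _ (hf.phased h0 _) _ ?_⟩
  filter_upwards [hM f', hf'] with k h1 h2
  refine h1.trans ?_
  rw [MeasurableEquiv.refl_apply, h2]
  rfl

variable {Ep Fp Em Fm : ℝ → Matrix (Fin n) (Fin n) ℝ} {u : ℝ}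

/-- The overlap of normalised packets is that of the profiles rescaled by the one-particle density.
-/
theorem integral_scalarIP_eq_root {f g : Mom n → ℂ} (hf : IsTest f) (hg : IsTest g)
    (h₁ : Regular Ep u) (h₂ : Regular Em u) :
    ∫ p, scalarIP Ep Fp Em Fm f g u p = ((2 * Real.pi : ℂ) ^ (n + 1))⁻¹ *
      ∫ p, slicePacket (shear Ep u) (Ep u)⁻¹
          (phased (quad (Fp u)) fun k => oneParticleRoot n k.1 * f k) p *
        conj (slicePacket (shear Em u) (Em u)⁻¹
          (phased (quad (Fm u)) fun k => oneParticleRoot n k.1 * g k) p) := by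
  have hpi : (2 * Real.pi : ℂ) ^ (n + 1) ≠ 0 :=
    pow_ne_zero _ (mul_ne_zero two_ne_zero (Complex.ofReal_ne_zero.2 Real.pi_ne_zero))
  have hc : ∀ (q : (Fin n → ℝ) → ℝ) (f : Mom n → ℂ),
      phased q (fun k => oneParticleRoot n k.1 * f k)
        = fun k => oneParticleRoot n k.1 * phased q f k := fun q f => funext fun k => by
    simp only [phased]; ring
  have h := integral_scalarDensity_fiber
    (isSlicePacket_scalarMode Ep Fp f u) (isSlicePacket_scalarMode Em Fm g u)
    (hf.phased_quad _).isBump (hg.phased_quad _).isBump h₁.det_inv_ne_zero h₂.det_inv_ne_zero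
  rw [integral_slicePacket_mul_conj_eq_fiber (hf.root_mul.phased_quad (Fp u)).isBump
    (hg.root_mul.phased_quad (Fm u)).isBump h₁.det_inv_ne_zero h₂.det_inv_ne_zero]
  refine (show (∫ p, scalarIP Ep Fp Em Fm f g u p) = _ from h).trans ?_
  rw [mul_left_comm, ← integral_const_mul (((2 * Real.pi : ℂ) ^ (n + 1))⁻¹)]
  congr 1
  refine integral_congr_ae (ae_of_all _ fun k₀ => ?_)
  simp only [hc, sliceFiber_freq_mul (oneParticleRoot n), map_mul]
  -- both sides vanish at non-positive frequency
  rcases le_or_gt k₀ 0 with hk | hk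
  · have h0 : k₀ ∉ Prod.fst '' tsupport (phased (quad (Fp u)) f) := by
      rintro ⟨k, hk', rfl⟩
      exact ((hf.phased_quad (Fp u)).positive k hk').not_ge hk
    simp [sliceFiber_eq_zero h0]
  · have hr : oneParticleRoot n k₀ * conj (oneParticleRoot n k₀)
        = (2 * Real.pi : ℂ) ^ (n + 1) * (2 * k₀) := by
      rw [oneParticleRoot, Complex.conj_ofReal, ← Complex.ofReal_mul,
        Real.mul_self_sqrt (by positivity)]
      push_cast
      ring
    have hx : ∀ a b : ℂ, oneParticleRoot n k₀ * a * (conj (oneParticleRoot n k₀) * b)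
        = (2 * Real.pi : ℂ) ^ (n + 1) * (2 * k₀) * (a * b) := fun a b => by
      rw [mul_mul_mul_comm, hr]
    simp only [hx, integral_const_mul]
    rw [← mul_assoc, inv_mul_cancel_left₀ hpi]

/-- The operator `V` relating in to out profiles on the slice is unitary on all of `L²`. It has no
matrix elements between frequencies of opposite sign, so it restricts to the positive frequencies,
that is, to the range of the isometry `J` of the one-particle space. -/
theorem exists_scalar_scattering (h₁ : Regular Ep u) (h₂ : Regular Em u) :
    ∃ S : Lp ℂ 2 (oneParticle n) ≃ₗᵢ[ℂ] Lp ℂ 2 (oneParticle n),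
      ScattersBy S 1 u (scalarIP Ep Fp Em Fm) := by
  obtain ⟨Wp, hWp⟩ := exists_unitary_modePacket Ep Fp h₁
  obtain ⟨Wm, hWm⟩ := exists_unitary_modePacket Em Fm h₂
  obtain ⟨J, hJ, hJr⟩ := exists_isometry_mul (measurable_oneParticleRoot (n := n))
    oneParticle_eq_withDensity
  set V := Wm.trans Wp.symm with hVdef
  -- in and out packets of opposite frequencies are orthogonal
  have horth : ∀ h g : Mom n → ℂ, IsBump h → IsBump g → (∀ k ∈ tsupport h, k.1 < 0) →
      (∀ k ∈ tsupport g, 0 < k.1) → ∀ h' g' : Lp ℂ 2 (volume : Measure (Mom n)),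
        h' =ᵐ[volume] h → g' =ᵐ[volume] g →
        inner ℂ (Wp h') (Wm g') = 0 ∧ inner ℂ (Wm h') (Wp g') = 0 := by
    intro h g hh hg hhs hgs h' g' hh' hg'
    have nh : ∀ k ∈ tsupport h, k.1 ≠ 0 := fun k hk => (hhs k hk).ne
    have ng : ∀ k ∈ tsupport g, k.1 ≠ 0 := fun k hk => (hgs k hk).ne'
    have hd : ∀ M N : Matrix (Fin n) (Fin n) ℝ, ∀ k ∈ tsupport (phased (quad M) g),
        ∀ l ∈ tsupport (phased (quad N) h), k.1 ≠ l.1 := fun M N k hk l hl =>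
      ((hhs l (tsupport_mul_subset_right hl)).trans (hgs k (tsupport_mul_subset_right hk))).ne'
    have key : ∀ a b : Mom n → ℂ, ∫ p, a p * conj (b p) = 0 → ∀ c : ℂ,
        ∫ p, (c * a p) * conj (c * b p) = 0 := fun a b hab c => by
      have hp : ∀ p, (c * a p) * conj (c * b p) = (c * conj c) * (a p * conj (b p)) := fun p => by
        rw [map_mul]; ring
      simp only [hp, integral_const_mul, hab, mul_zero]
    constructor
    · rw [inner_eq_integral (hWm g hg ng g' hg') (hWp h hh nh h' hh')]
      exact key _ _ (integral_slicePacket_mul_conj_eq_zero (hg.phased ng _) (hh.phased nh _)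
        h₂.det_inv_ne_zero h₁.det_inv_ne_zero (hd _ _)) _
    · rw [inner_eq_integral (hWp g hg ng g' hg') (hWm h hh nh h' hh')]
      exact key _ _ (integral_slicePacket_mul_conj_eq_zero (hg.phased ng _) (hh.phased nh _)
        h₁.det_inv_ne_zero h₂.det_inv_ne_zero (hd _ _)) _
  -- the range of `J` consists of the functions supported in positive frequency
  have hpos : ∀ G : Lp ℂ 2 (oneParticle n), ∀ᵐ k : Mom n, k.1 ≤ 0 → J G k = 0 := fun G => by
    filter_upwards [hJ G] with k h1 h2
    rw [h1, oneParticleRoot_eq_zero h2, zero_mul]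
  have hrange : ∀ F : Lp ℂ 2 (volume : Measure (Mom n)), (∀ᵐ k : Mom n, k.1 ≤ 0 → F k = 0) →
      ∃ G, J G = F := fun F hF => hJr F (by
    filter_upwards [hF] with k h1 h2
    exact h1 (not_lt.1 fun h => oneParticleRoot_ne_zero h h2))
  obtain ⟨S, hS⟩ := exists_unitary_of_range J V
    (fun G => hrange _ (positive_of_orthogonal V (fun h g hh hg hhs hgs h' g' hh' hg' => by
      rw [← Wp.inner_map_map, hVdef, LinearIsometryEquiv.trans_apply, Wp.apply_symm_apply]
      exact (horth h g hh hg hhs hgs h' g' hh' hg').1) (hpos G)))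
    (fun G => hrange _ (positive_of_orthogonal V.symm (fun h g hh hg hhs hgs h' g' hh' hg' => by
      rw [← Wm.inner_map_map, hVdef, LinearIsometryEquiv.symm_trans, LinearIsometryEquiv.symm_symm,
        LinearIsometryEquiv.trans_apply, Wm.apply_symm_apply]
      exact (horth h g hh hg hhs hgs h' g' hh' hg').2) (hpos G)))
  refine ⟨S, fun f g hf hg F G hF hG => ?_⟩
  have hmul : ∀ (φ : Mom n → ℂ) (Φ : Lp ℂ 2 (oneParticle n)),
      Φ =ᵐ[oneParticle n] φ → J Φ =ᵐ[volume] fun k => oneParticleRoot n k.1 * φ k :=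
    fun φ Φ hΦ => (hJ Φ).trans (ae_mul_density measurable_oneParticleRoot
      oneParticle_eq_withDensity hΦ)
  have hp := hWp _ hf.root_mul.isBump (fun k hk => (hf.root_mul.positive k hk).ne') _ (hmul f F hF)
  have hm := hWm _ hg.root_mul.isBump (fun k hk => (hg.root_mul.positive k hk).ne') _ (hmul g G hG)
  have hin : inner ℂ (S G) F = inner ℂ (Wm (J G)) (Wp (J F)) := by
    rw [← J.inner_map_map, hS, ← Wp.inner_map_map, hVdef, LinearIsometryEquiv.trans_apply,
      Wp.apply_symm_apply]
  rw [one_mul, hin, inner_eq_integral hp hm, integral_scalarIP_eq_root hf hg h₁ h₂,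
    ← integral_const_mul]
  refine integral_congr_ae (ae_of_all _ fun p => ?_)
  have hc : ((√((2 * Real.pi) ^ (n + 1)))⁻¹ : ℂ) * ((√((2 * Real.pi) ^ (n + 1)))⁻¹ : ℂ)
      = ((2 * Real.pi : ℂ) ^ (n + 1))⁻¹ := by
    rw [← mul_inv, ← Complex.ofReal_mul, Real.mul_self_sqrt (by positivity)]
    push_cast
    rfl
  simp only [map_mul, map_inv₀, Complex.conj_ofReal]
  rw [mul_mul_mul_comm, hc]

end Scattering

/-! ### Inner products of spinning packets -/

section SpinPackets

variable (ε₁ ε₂ : Fin n → ℂ)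

theorem gaugeIP_eq (H : ℝ → Matrix (Fin n) (Fin n) ℝ) (E₁ F₁ E₂ F₂ : ℝ → Matrix (Fin n) (Fin n) ℝ)
    (f g : Mom n → ℂ) (hf : IsTest f) (hg : IsTest g) (u : ℝ) :
    gaugeIP H ε₁ ε₂ E₁ F₁ E₂ F₂ f g u = fun p => polDot ε₁ ε₂ * scalarIP E₁ F₁ E₂ F₂ f g u p :=
  funext fun p => gaugeDensity_eq H (isTransverse_gaugeMode E₁ F₁ ε₁ hf)
    (isTransverse_gaugeMode E₂ F₂ ε₂ hg) u p

theorem gaugeBarIP_eq (H : ℝ → Matrix (Fin n) (Fin n) ℝ)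
    (E₁ F₁ E₂ F₂ : ℝ → Matrix (Fin n) (Fin n) ℝ)
    (f g : Mom n → ℂ) (hf : IsTest f) (hg : IsTest g) (u : ℝ) :
    gaugeBarIP H ε₁ ε₂ E₁ F₁ E₂ F₂ f g u
      = fun p => polDot ε₁ (fun a => conj (ε₂ a)) * scalarBarIP E₁ F₁ E₂ F₂ f g u p :=
  funext fun p => gaugeDensity_eq H (isTransverse_gaugeMode E₁ F₁ ε₁ hf)
    (isTransverse_gaugeMode E₂ F₂ ε₂ hg).conj1 u p

theorem gravitonIP_eq {H : ℝ → Matrix (Fin n) (Fin n) ℝ} (hH : ∀ u, (H u).IsSymm)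
    (E₁ F₁ E₂ F₂ : ℝ → Matrix (Fin n) (Fin n) ℝ)
    (f g : Mom n → ℂ) (hf : IsTest f) (hg : IsTest g) (u : ℝ) :
    gravitonIP H ε₁ ε₂ E₁ F₁ E₂ F₂ f g u
      = fun p => polDot ε₁ ε₂ ^ 2 * scalarIP E₁ F₁ E₂ F₂ f g u p :=
  funext fun p => gravitonDensity_eq H (isTransverse2_gravitonMode hH E₁ F₁ ε₁ hf)
    (isTransverse2_gravitonMode hH E₂ F₂ ε₂ hg) u p

theorem gravitonBarIP_eq {H : ℝ → Matrix (Fin n) (Fin n) ℝ} (hH : ∀ u, (H u).IsSymm)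
    (E₁ F₁ E₂ F₂ : ℝ → Matrix (Fin n) (Fin n) ℝ)
    (f g : Mom n → ℂ) (hf : IsTest f) (hg : IsTest g) (u : ℝ) :
    gravitonBarIP H ε₁ ε₂ E₁ F₁ E₂ F₂ f g u
      = fun p => polDot ε₁ (fun a => conj (ε₂ a)) ^ 2 * scalarBarIP E₁ F₁ E₂ F₂ f g u p :=
  funext fun p => gravitonDensity_eq H (isTransverse2_gravitonMode hH E₁ F₁ ε₁ hf)
    (isTransverse2_gravitonMode hH E₂ F₂ ε₂ hg).conj2 u p

variable {𝔥 : Type*} [NormedAddCommGroup 𝔥] [NormedSpace ℝ 𝔥] {e : 𝔥 →ₗ[ℝ] ℝ} {Fs : ℝ → Fin n → 𝔥}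

theorem gluonIP_eq (A₁ : ℝ → Fin n → ℝ) (φ₁ : (Fin n → ℝ) → ℝ → ℝ) (A₂ : ℝ → Fin n → ℝ)
    (φ₂ : (Fin n → ℝ) → ℝ → ℝ) (f g : Mom n → ℂ) (hf : IsTest f) (hg : IsTest g) (u : ℝ) :
    gluonIP (background e Fs) ε₁ ε₂ A₁ φ₁ A₂ φ₂ f g u
      = fun p => polDot ε₁ ε₂ * chargedIP A₁ φ₁ A₂ φ₂ f g u p :=
  funext fun p => gluonDensity_eq (funext background_iv) (isTransverse_gluonMode A₁ φ₁ ε₁ hf)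
    (isTransverse_gluonMode A₂ φ₂ ε₂ hg) u p

theorem gluonBarIP_eq (A₁ : ℝ → Fin n → ℝ) (φ₁ : (Fin n → ℝ) → ℝ → ℝ) (A₂ : ℝ → Fin n → ℝ)
    (φ₂ : (Fin n → ℝ) → ℝ → ℝ) (f g : Mom n → ℂ) (hf : IsTest f) (hg : IsTest g) (u : ℝ) :
    gluonBarIP (background e Fs) ε₁ ε₂ A₁ φ₁ A₂ φ₂ f g u
      = fun p => polDot ε₁ (fun a => conj (ε₂ a)) * chargedBarIP A₁ φ₁ A₂ φ₂ f g u p :=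
  funext fun p => gluonBarDensity_eq (funext background_iv) (isTransverse_gluonMode A₁ φ₁ ε₁ hf)
    (isTransverse_gluonMode A₂ φ₂ ε₂ hg) u p

end SpinPackets

end PlaneWave

end

theorem mainTheorem7 {n : ℕ} (u₁ u₂ : ℝ) (hu : u₁ ≤ u₂) (hu₂ : u₂ ≤ 0)
    -- the gravitational sandwich plane wave
    (H : ℝ → Matrix (Fin n) (Fin n) ℝ) (hHsymm : ∀ u, (H u).IsSymm)
    (hHsmooth : ∀ a b, ContDiff ℝ 2 (fun u => H u a b))
    (hHsupp : ∀ u, u ∉ Set.Icc u₁ u₂ → H u = 0)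
    -- the gauge theory sandwich plane wave, valued in a Cartan subalgebra, and a charge
    {𝔥 : Type*} [NormedAddCommGroup 𝔥] [NormedSpace ℝ 𝔥] [FiniteDimensional ℝ 𝔥]
    (e : 𝔥 →ₗ[ℝ] ℝ) (Fs : ℝ → Fin n → 𝔥) (hFsmooth : ContDiff ℝ 1 Fs)
    (hFsupp : ∀ u, u ∉ Set.Icc u₁ u₂ → Fs u = 0) :
    -- I. Gravitational background: the vielbeins exist and are unique ...
    ((∃! Em, IsInVielbein H Em) ∧ (∃! Ep, IsOutVielbein H Ep) ∧
      ∀ Em Ep, IsInVielbein H Em → IsOutVielbein H Ep →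
        -- ... with memory `E^-(u) = u b + c` in the out-region, and so do the functions `F^{ij}`
        (∀ u, u₂ < u → Em u = u • matDeriv Em 0 + Em 0) ∧
        (∃ Fm, IsRosenIntegral Em Fm (Set.Iio u₁)) ∧ (∃ Fp, IsRosenIntegral Ep Fp (Set.Ioi u₂)) ∧
        ∀ Fm Fp, IsRosenIntegral Em Fm (Set.Iio u₁) → IsRosenIntegral Ep Fp (Set.Ioi u₂) →
          -- the in and out modes of spin 0, 1, 2 are solutions
          GravModesSolve H Em Fm ∧ GravModesSolve H Ep Fp ∧
          GravModesFlat H Em Fm (Set.Iio u₁) ∧ GravModesFlat H Ep Fp (Set.Ioi u₂) ∧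
          -- conserved, δ-normalised inner products, no particle creation
          SliceRelations 1 (Regular Em) (Regular Ep)
            (scalarIP Em Fm Em Fm) (scalarIP Ep Fp Ep Fp)
            (scalarIP Ep Fp Em Fm) (scalarBarIP Ep Fp Em Fm) ∧
          (∀ ε₁ ε₂ : Fin n → ℂ, SliceRelations (polDot ε₁ ε₂) (Regular Em) (Regular Ep)
            (gaugeIP H ε₁ ε₂ Em Fm Em Fm) (gaugeIP H ε₁ ε₂ Ep Fp Ep Fp)
            (gaugeIP H ε₁ ε₂ Ep Fp Em Fm) (gaugeBarIP H ε₁ ε₂ Ep Fp Em Fm)) ∧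
          ((∀ u, (H u).trace = 0) → ∀ ε₁ ε₂ : Fin n → ℂ,
            ∑ a, ε₁ a * ε₁ a = 0 → ∑ a, ε₂ a * ε₂ a = 0 →
            SliceRelations (polDot ε₁ ε₂ ^ 2) (Regular Em) (Regular Ep)
              (gravitonIP H ε₁ ε₂ Em Fm Em Fm) (gravitonIP H ε₁ ε₂ Ep Fp Ep Fp)
              (gravitonIP H ε₁ ε₂ Ep Fp Em Fm) (gravitonBarIP H ε₁ ε₂ Ep Fp Em Fm)) ∧
          -- unitarity and Gaussian in–out overlaps, when `c = E^-(0)` is invertible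
          (Regular Em 0 →
            (∃ S : Lp ℂ 2 (oneParticle n) ≃ₗᵢ[ℂ] Lp ℂ 2 (oneParticle n),
              ScattersBy S 1 0 (scalarIP Ep Fp Em Fm) ∧
              (∀ ε₁ ε₂ : Fin n → ℂ,
                ScattersBy S (polDot ε₁ ε₂) 0 (gaugeIP H ε₁ ε₂ Ep Fp Em Fm)) ∧
              ((∀ u, (H u).trace = 0) → ∀ ε₁ ε₂ : Fin n → ℂ,
                ∑ a, ε₁ a * ε₁ a = 0 → ∑ a, ε₂ a * ε₂ a = 0 →
                ScattersBy S (polDot ε₁ ε₂ ^ 2) 0 (gravitonIP H ε₁ ε₂ Ep Fp Em Fm))) ∧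
            GravOverlap Em Fm 1 (scalarIP Ep Fp Em Fm) ∧
            (∀ ε₁ ε₂ : Fin n → ℂ,
              GravOverlap Em Fm (polDot ε₁ ε₂) (gaugeIP H ε₁ ε₂ Ep Fp Em Fm)) ∧
            ((∀ u, (H u).trace = 0) → ∀ ε₁ ε₂ : Fin n → ℂ,
              ∑ a, ε₁ a * ε₁ a = 0 → ∑ a, ε₂ a * ε₂ a = 0 →
              GravOverlap Em Fm (polDot ε₁ ε₂ ^ 2) (gravitonIP H ε₁ ε₂ Ep Fp Em Fm)))) ∧
    -- II. Gauge theory background: the modes are solutions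
    (ChargedModesSolve (background e Fs) (potIn e Fs) (fIn (potIn e Fs)) ∧
     ChargedModesSolve (background e Fs) (potOut e Fs) (fOut (potOut e Fs)) ∧
     ChargedModesFlat (potIn e Fs) (fIn (potIn e Fs)) (Set.Iio u₁) ∧
     ChargedModesFlat (potOut e Fs) (fOut (potOut e Fs)) (Set.Ioi u₂) ∧
     -- conserved, δ-normalised inner products, no particle creation
     SliceRelations 1 (fun _ => True) (fun _ => True)
       (chargedIP (potIn e Fs) (fIn (potIn e Fs)) (potIn e Fs) (fIn (potIn e Fs)))
       (chargedIP (potOut e Fs) (fOut (potOut e Fs)) (potOut e Fs) (fOut (potOut e Fs)))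
       (chargedIP (potOut e Fs) (fOut (potOut e Fs)) (potIn e Fs) (fIn (potIn e Fs)))
       (chargedBarIP (potOut e Fs) (fOut (potOut e Fs)) (potIn e Fs) (fIn (potIn e Fs))) ∧
     (∀ ε₁ ε₂ : Fin n → ℂ, SliceRelations (polDot ε₁ ε₂) (fun _ => True) (fun _ => True)
       (gluonIP (background e Fs) ε₁ ε₂
         (potIn e Fs) (fIn (potIn e Fs)) (potIn e Fs) (fIn (potIn e Fs)))
       (gluonIP (background e Fs) ε₁ ε₂
         (potOut e Fs) (fOut (potOut e Fs)) (potOut e Fs) (fOut (potOut e Fs)))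
       (gluonIP (background e Fs) ε₁ ε₂
         (potOut e Fs) (fOut (potOut e Fs)) (potIn e Fs) (fIn (potIn e Fs)))
       (gluonBarIP (background e Fs) ε₁ ε₂
         (potOut e Fs) (fOut (potOut e Fs)) (potIn e Fs) (fIn (potIn e Fs)))) ∧
     -- in–out overlaps with the memory kick, on every slice
     (∀ f g, IsTest f → IsTest g → ∀ u,
       ∫ p, chargedIP (potOut e Fs) (fOut (potOut e Fs)) (potIn e Fs) (fIn (potIn e Fs)) f g u p
         = kickPairing (potIn e Fs) 1 f g) ∧
     (∀ ε₁ ε₂ : Fin n → ℂ, ∀ f g, IsTest f → IsTest g → ∀ u,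
       ∫ p, gluonIP (background e Fs) ε₁ ε₂
           (potOut e Fs) (fOut (potOut e Fs)) (potIn e Fs) (fIn (potIn e Fs)) f g u p
         = kickPairing (potIn e Fs) (polDot ε₁ ε₂) f g) ∧
     -- unitarity
     (∃ S : Lp ℂ 2 (oneParticle n) ≃ₗᵢ[ℂ] Lp ℂ 2 (oneParticle n), ∀ u,
       ScattersBy S 1 u
         (chargedIP (potOut e Fs) (fOut (potOut e Fs)) (potIn e Fs) (fIn (potIn e Fs))) ∧
       ∀ ε₁ ε₂ : Fin n → ℂ, ScattersBy S (polDot ε₁ ε₂) u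
         (gluonIP (background e Fs) ε₁ ε₂
           (potOut e Fs) (fOut (potOut e Fs)) (potIn e Fs) (fIn (potIn e Fs))))) := by
  have hH : Continuous H := continuous_pi fun a => continuous_pi fun b => (hHsmooth a b).continuous
  have hFs : Continuous Fs := hFsmooth.continuous
  have hF₁ : ∀ s < u₁, Fs s = 0 := fun s hs => hFsupp s fun h => hs.not_ge h.1
  have hF₂ : ∀ s, u₂ < s → Fs s = 0 := fun s hs => hFsupp s fun h => hs.not_ge h.2
  refine ⟨⟨existsUnique_inVielbein hH hHsymm hu hHsupp,
    existsUnique_outVielbein hH hHsymm hu hHsupp,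
    fun Em Ep hEm hEp => ⟨fun u h => hEm.memory hH hHsupp hu₂ h,
      hEm.exists_rosenIntegral hH hHsymm hu hHsupp, hEp.exists_rosenIntegral hH hHsymm hu hHsupp,
      fun Fm Fp hFm hFp => ?_⟩⟩, ?_⟩
  · have hrel := scalarRelations hEp.1 hFp hEm.1 hFm fun a b => (hHsmooth a b).continuous
    refine ⟨gravModesSolve hHsymm hEm.1 hFm, gravModesSolve hHsymm hEp.1 hFp,
      gravModesFlat hHsymm hEm.1 hFm fun u h => hEm.eq_one hH hHsupp u (Set.mem_Iio.1 h).le,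
      gravModesFlat hHsymm hEp.1 hFp fun u h => hEp.eq_one hH hHsupp u (Set.mem_Ioi.1 h).le,
      hrel, fun ε₁ ε₂ => ?_, fun _ ε₁ ε₂ _ _ => ?_, fun hreg => ?_⟩
    · exact hrel.smul (gaugeIP_eq ε₁ ε₂ H Em Fm Em Fm) (gaugeIP_eq ε₁ ε₂ H Ep Fp Ep Fp)
        (gaugeIP_eq ε₁ ε₂ H Ep Fp Em Fm) (gaugeBarIP_eq ε₁ ε₂ H Ep Fp Em Fm)
    · exact hrel.smul (gravitonIP_eq ε₁ ε₂ hHsymm Em Fm Em Fm)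
        (gravitonIP_eq ε₁ ε₂ hHsymm Ep Fp Ep Fp)
        (gravitonIP_eq ε₁ ε₂ hHsymm Ep Fp Em Fm) (gravitonBarIP_eq ε₁ ε₂ hHsymm Ep Fp Em Fm)
    · have h0 := hEp.isTrivialAtZero hH hHsupp hu₂ hFp
      have hov := scalarOverlap h0 hEp.1 hFp hEm.1 hFm hreg
      obtain ⟨S, hS⟩ := exists_scalar_scattering (Fp := Fp) (Fm := Fm) h0.regular hreg
      exact ⟨⟨S, hS, fun ε₁ ε₂ => hS.smul (gaugeIP_eq ε₁ ε₂ H Ep Fp Em Fm),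
          fun _ ε₁ ε₂ _ _ => hS.smul (gravitonIP_eq ε₁ ε₂ hHsymm Ep Fp Em Fm)⟩,
        hov, fun ε₁ ε₂ => hov.smul (gaugeIP_eq ε₁ ε₂ H Ep Fp Em Fm),
        fun _ ε₁ ε₂ _ _ => hov.smul (gravitonIP_eq ε₁ ε₂ hHsymm Ep Fp Em Fm)⟩
  · have hrel := chargedRelations (e := e) hFs hF₁ hF₂ hu₂
    obtain ⟨S, hS⟩ := exists_charged_scattering (e := e) hFs hF₁ hF₂ hu₂
    refine ⟨chargedModesSolve (isChargedData_in hFs hF₁),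
      chargedModesSolve (isChargedData_out hFs hF₂),
      chargedModesFlat (fun u h => potIn_eq_zero hF₁ (Set.mem_Iio.1 h).le)
        fun u h => fIn_eq hF₁ (Set.mem_Iio.1 h).le,
      chargedModesFlat (fun u h => potOut_eq_zero hF₂ (Set.mem_Ioi.1 h).le)
        fun u h => fOut_eq hF₂ (Set.mem_Ioi.1 h).le,
      hrel, fun ε₁ ε₂ => hrel.smul (gluonIP_eq ε₁ ε₂ _ _ _ _) (gluonIP_eq ε₁ ε₂ _ _ _ _)
        (gluonIP_eq ε₁ ε₂ _ _ _ _) (gluonBarIP_eq ε₁ ε₂ _ _ _ _),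
      fun f g hf hg u => integral_chargedIP_out_in hFs hF₁ hF₂ hu₂ hf hg u,
      fun ε₁ ε₂ f g hf hg u => ?_,
      S, fun u => ⟨hS u, fun ε₁ ε₂ => (hS u).smul (gluonIP_eq ε₁ ε₂ _ _ _ _)⟩⟩
    rw [gluonIP_eq ε₁ ε₂ _ _ _ _ f g hf hg, integral_const_mul,
      integral_chargedIP_out_in hFs hF₁ hF₂ hu₂ hf hg u, kickPairing, kickPairing, one_mul,
      mul_assoc]
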